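/- **Setting.** Let $d\in\{1,2\}$ and let $\Omega\subset\mathbb R^d$ be a bounded open interval ($d=1$) or an axis-parallel open rectangle ($d=2$), partitioned into finitely many non-overlapping open intervals, respectively axis-parallel rectangles, $\Omega_1,\dots,\Omega_I$ (that is, $\bigcup_i\overline{\Omega_i}=\overline\Omega$). Let $\Gamma=\bigcup_{i\ne j}\partial\Omega_i\cap\partial\Omega_j$ be the set of interfaces, with its $(d-1)$-dimensional measure. Fix $\Theta>0$ and $0<p_{\min}\le p_{\max}$. Let $\mathbb P$ be a measurable set of parameters $p=(p_1,\dots,p_I)\in[p_{\min},p_{\max}]^I$, identified with the coefficients $p(x)=p_i$ for $x\in\Omega_i$, and let $\mu$ be a measure on $\mathbb P$. For $p\in\mathbb P$ let $\ell^p\in L^2(\Omega)$, and let $\mathfrak u^p\in H^1_0(\Omega)$ be the weak solution of $-\operatorname{div}(p\nabla\mathfrak u^p)=\ell^p$, i.e. $\int_\Omega p\nabla\mathfrak u^p\cdot\nabla v\,dx=\int_\Omega \ell^p v\,dx$ for all $v\in H^1_0(\Omega)$. Write $\|u\|_{H^1_0(\Omega)}=\|\nabla u\|_{L^2(\Omega)}$,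 and let $[p\nabla u\cdot\mathbf n]$ be the jump of the normal flux across $\Gamma$, defined by Green's formula $\int_\Gamma[p\nabla u\cdot\mathbf n]\varphi\,dS=\int_{\Omega}p\nabla u\cdot\nabla\varphi\,dx+\int_{\Omega\setminus\Gamma}p\,\Delta u\,\varphi\,dx$ for $\varphi\in C_c^\infty(\Omega)$ (its $L^2(\Gamma)$-norm is $\infty$ if it is not in $L^2(\Gamma)$). **Singular functions ($d=2$).** Let $x_1,\dots,x_{N_s}\in\Omega$ be the singular points, $0<\delta_1<\delta_2$, and let $\eta$ be smooth with $\eta(r)=1$ for $r<\delta_1$ and $\eta(r)=0$ for $r>\delta_2$, where the closed discs of radius $\delta_2$ about the $x_i$ are pairwise disjoint, lie in $\Omega$, and meet only subdomains whose closure contains $x_i$. Let $p_{(i)}(\theta)$ be the angular trace of $p$ around $x_i$, and let $\{\varphi_k\}$ be a fixed finite family of $2\pi$-periodic continuous piecewise polynomial trial functions. For each $p\in\mathbb P$ and each $i$ let there be given finitely many pairs of * exact eigenpairs $(\Lambda^p_{ij},\vartheta^p_{ij})$: $\Lambda^p_{ij}\in(0,1)$, $\vartheta^p_{ij}\in H^1_{\rm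 per}(0,2\pi)$, $\|\vartheta^p_{ij}\|_{L^2(0,2\pi)}=1$, and $\int_0^{2\pi}p_{(i)}\big((\vartheta^p_{ij})'v'-(\Lambda^p_{ij})^2\vartheta^p_{ij}v\big)\,d\theta=0$ for all $v\in H^1_{\rm per}(0,2\pi)$; * finite element (FE) eigenpairs $(\lambda^p_{ij},\mu^p_{ij})$: $\lambda^p_{ij}\in(0,1)$, $\mu^p_{ij}=\sum_k\rho_k\varphi_k$, $\|\mu^p_{ij}\|_{L^2(0,2\pi)}=1$, and $G\rho=(\lambda^p_{ij})^2B\rho$ with $G_{kl}=\int_0^{2\pi}p_{(i)}\varphi_k'\varphi_l'\,d\theta$, $B_{kl}=\int_0^{2\pi}p_{(i)}\varphi_k\varphi_l\,d\theta$. In polar coordinates about $x_i$ put $s^p_{ij}=r^{\lambda^p_{ij}}\mu^p_{ij}(\theta)\eta(r)$ and $$\mathbf S^p_{ij}=2\,\partial_r\big(r^{\lambda^p_{ij}}\mu^p_{ij}(\theta)\big)\,\eta'(r)+r^{\lambda^p_{ij}}\mu^p_{ij}(\theta)\Big(\eta''(r)+\tfrac1r\eta'(r)\Big)\quad\text{for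 }\delta_1<r<\delta_2,$$ and $\mathbf S^p_{ij}=0$ elsewhere. **LS-ReCoNN solution and loss.** Let $w_1,\dots,w_{N_1}\in H^2(\Omega)\cap H^1_0(\Omega)$ and $v_1,\dots,v_{N_2}\in H^2(\Omega\setminus\Gamma)\cap H^1_0(\Omega)$ (the outputs of the neural network with parameters $\alpha$). For $p\in\mathbb P$ and coefficient vectors $a,b,c$ let $$\mathcal J^p(a,b,c)=\Big\|p\Big(\Delta(a\cdot w+b\cdot v)+\sum_{i,j}c_{ij}\mathbf S^p_{ij}\Big)+\ell^p\Big\|^2_{L^2(\Omega)}+\Theta\,\big\|[p\nabla(a\cdot w+b\cdot v)\cdot\mathbf n]\big\|^2_{L^2(\Gamma)},$$ where $\Delta$ is taken on $\Omega\setminus\Gamma$. Let $(a^p,b^p,c^p)$ be a minimizer of $\mathcal J^p$, let $u^{p,\alpha}=a^p\cdot w+b^p\cdot v+\sum_{i,j}c^p_{ij}s^p_{ij}$, and let $\mathcal J_\mu=\int_{\mathbb P}\min_{a,b,c}\mathcal J^p(a,b,c)\,d\mu(p)$. If $d=1$ there are no singular functions and all terms with $c$ are absent. **Theorem.** There is a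 constant $C>0$ such that $$\int_{\mathbb P}\|u^{p,\alpha}-\mathfrak u^p\|^2_{H^1_0(\Omega)}\,d\mu(p)\le C\left(\mathcal J_\mu+\int_{\mathbb P}\|c^{p}\|_{\ell^2}^2\Big(\|\mu^p-\vartheta^p\|^2_{L^2(0,2\pi)}+\|\lambda^p-\Lambda^p\|^2_{\ell^2}\Big)d\mu(p)\right),$$ where $\|\mu^p-\vartheta^p\|^2_{L^2(0,2\pi)}=\sum_{i,j}\|\mu^p_{ij}-\vartheta^p_{ij}\|^2_{L^2(0,2\pi)}$ and $\|\lambda^p-\Lambda^p\|^2_{\ell^2}=\sum_{i,j}(\lambda^p_{ij}-\Lambda^p_{ij})^2$ (for $d=1$ the second term is absent). The constant $C$ depends only on $\Theta,p_{\min},p_{\max}$, the partition of $\Omega$ and, if $d=2$, on the points $x_i$, on $\delta_1,\delta_2,\eta$ and on the trial functions $\{\varphi_k\}$ of the FE eigenvalue solver. It does not depend on $\mathbb P$, $\mu$, $\ell^p$, the functions $w_n,v_m$ and their number, the eigenpairs, the coefficients, or the LS-ReCoNN solution. -/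

import Mathlib

open MeasureTheory Set
open scoped ENNReal ContDiff

noncomputable section

namespace LSReCoNN

/-- Euclidean space of dimension `d`. -/
abbrev E (d : ℕ) : Type := EuclideanSpace ℝ (Fin d)

/-! ### Sobolev spaces -/

/-- The `k`-th partial derivative of a differentiable function. -/
def partialDeriv {d : ℕ} (k : Fin d) (φ : E d → ℝ) (x : E d) : ℝ :=
  fderiv ℝ φ x (EuclideanSpace.single k 1)

/-- Smooth functions with compact support contained in `U`. -/
def IsTestFunction {d : ℕ} (U : Set (E d)) (φ : E d → ℝ) : Prop :=
  ContDiff ℝ ∞ φ ∧ HasCompactSupport φ ∧ tsupport φ ⊆ U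

/-- `u` belongs to `L²(U)`. -/
def MemL2 {d : ℕ} (U : Set (E d)) (u : E d → ℝ) : Prop :=
  MemLp u 2 (volume.restrict U)

/-- The squared norm of `L²(U)`. -/
def l2NormSq {d : ℕ} (U : Set (E d)) (u : E d → ℝ) : ℝ≥0∞ :=
  (eLpNorm u 2 (volume.restrict U)) ^ 2

/-- `g ∈ L²(U)` is the `k`-th weak partial derivative of `u` in the open set `U`. -/
def IsWeakDeriv {d : ℕ} (U : Set (E d)) (k : Fin d) (u g : E d → ℝ) : Prop :=
  MemL2 U g ∧ ∀ φ : E d → ℝ, IsTestFunction U φ →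
    ∫ x in U, u x * partialDeriv k φ x = - ∫ x in U, g x * φ x

open Classical in
/-- The (almost everywhere unique) `k`-th weak partial derivative in `L²(U)`; `0` if there is
none. -/
def weakDeriv {d : ℕ} (U : Set (E d)) (k : Fin d) (u : E d → ℝ) : E d → ℝ :=
  if h : ∃ g, IsWeakDeriv U k u g then h.choose else 0

/-- `u ∈ H¹(U)`. -/
def MemH1 {d : ℕ} (U : Set (E d)) (u : E d → ℝ) : Prop :=
  MemL2 U u ∧ ∀ k, ∃ g, IsWeakDeriv U k u g

/-- `u ∈ H²(U)`. -/
def MemH2 {d : ℕ} (U : Set (E d)) (u : E d → ℝ) : Prop :=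
  MemH1 U u ∧ ∀ k, MemH1 U (weakDeriv U k u)

/-- `u ∈ H¹₀(U)`: the closure of the test functions in `H¹(U)`. -/
def MemH10 {d : ℕ} (U : Set (E d)) (u : E d → ℝ) : Prop :=
  MemH1 U u ∧ ∀ ε : ℝ≥0∞, 0 < ε → ∃ φ : E d → ℝ, IsTestFunction U φ ∧
    l2NormSq U (fun x => u x - φ x) < ε ∧
    ∀ k, l2NormSq U (fun x => weakDeriv U k u x - partialDeriv k φ x) < ε

/-- The squared norm `‖u‖²_{H¹₀(U)} = ‖∇u‖²_{L²(U)}`. -/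
def h10NormSq {d : ℕ} (U : Set (E d)) (u : E d → ℝ) : ℝ≥0∞ :=
  ∑ k, l2NormSq U (weakDeriv U k u)

/-- The weak Laplacian of `u ∈ H²(U)`. -/
def weakLaplacian {d : ℕ} (U : Set (E d)) (u : E d → ℝ) (x : E d) : ℝ :=
  ∑ k, weakDeriv U k (weakDeriv U k u) x

/-! ### The transmission problem -/

/-- The open box with the given lower and upper corners. -/
def openBox {d : ℕ} (lo hi : Fin d → ℝ) : Set (E d) :=
  {x | ∀ k, lo k < x k ∧ x k < hi k}

/-- A partition of a bounded open box `Ω` into finitely many non-overlapping open boxes `Ω_i`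
(intervals if `d = 1`, axis-parallel rectangles if `d = 2`). -/
structure BoxPartition (d I : ℕ) where
  lo : Fin d → ℝ
  hi : Fin d → ℝ
  lo_lt_hi : ∀ k, lo k < hi k
  subLo : Fin I → Fin d → ℝ
  subHi : Fin I → Fin d → ℝ
  subLo_lt_subHi : ∀ i k, subLo i k < subHi i k
  disjoint : ∀ i j, i ≠ j → Disjoint (openBox (subLo i) (subHi i)) (openBox (subLo j) (subHi j))
  cover : ⋃ i, closure (openBox (subLo i) (subHi i)) = closure (openBox lo hi)

namespace BoxPartition

variable {d I : ℕ}

/-- The domain `Ω`. -/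
def dom (D : BoxPartition d I) : Set (E d) := openBox D.lo D.hi

/-- The subdomain `Ω_i`. -/
def sub (D : BoxPartition d I) (i : Fin I) : Set (E d) := openBox (D.subLo i) (D.subHi i)

/-- The set `Γ` of interfaces, the union of the common boundaries of distinct subdomains. -/
def interfaces (D : BoxPartition d I) : Set (E d) :=
  ⋃ (i : Fin I) (j : Fin I) (_ : i ≠ j), frontier (D.sub i) ∩ frontier (D.sub j)

/-- The surface measure on `Γ` (`(d - 1)`-dimensional Hausdorff measure). -/
def surfaceMeasure (D : BoxPartition d I) : Measure (E d) :=
  (Measure.hausdorffMeasure ((d : ℝ) - 1)).restrict D.interfaces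

/-- The piecewise constant coefficient with the value `p i` on `Ω_i`. -/
def coeff (D : BoxPartition d I) (p : Fin I → ℝ) (x : E d) : ℝ :=
  ∑ i, (D.sub i).indicator (fun _ => p i) x

/-- `u ∈ H¹₀(Ω)` is the weak solution of `-div (p ∇u) = ℓ`. -/
def IsWeakSolution (D : BoxPartition d I) (p : Fin I → ℝ) (l u : E d → ℝ) : Prop :=
  MemH10 D.dom u ∧ ∀ v : E d → ℝ, MemH10 D.dom v →
    ∫ x in D.dom, D.coeff p x * ∑ k, weakDeriv D.dom k u x * weakDeriv D.dom k v x
      = ∫ x in D.dom, l x * v x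

/-- The space `𝕌₁ = H²(Ω) ∩ H¹₀(Ω)`. -/
def MemSmooth (D : BoxPartition d I) (u : E d → ℝ) : Prop :=
  MemH2 D.dom u ∧ MemH10 D.dom u

/-- The space `𝕌₂ = H²(Ω \ Γ) ∩ H¹₀(Ω)`. -/
def MemJump (D : BoxPartition d I) (u : E d → ℝ) : Prop :=
  MemH2 (D.dom \ D.interfaces) u ∧ MemH10 D.dom u

/-- `j ∈ L²(Γ)` is the jump `[p ∇u · n]`, that is, the sum over the subdomains of the normal traces
of `p ∇u` with respect to the outer normals. As usual for fields in the broken space `H(div)`, the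
normal traces are defined by Green's formula:
`∑_i ∫_{∂Ω_i} (p ∇u · n_i) φ = ∑_i ∫_{Ω_i} (p ∇u · ∇φ + div (p ∇u) φ)`. -/
def IsFluxJump (D : BoxPartition d I) (p : Fin I → ℝ) (u j : E d → ℝ) : Prop :=
  MemLp j 2 D.surfaceMeasure ∧ ∀ φ : E d → ℝ, IsTestFunction D.dom φ →
    ∫ x, j x * φ x ∂D.surfaceMeasure
      = (∫ x in D.dom, D.coeff p x * ∑ k, weakDeriv D.dom k u x * partialDeriv k φ x)
        + ∫ x in D.dom \ D.interfaces,
            D.coeff p x * weakLaplacian (D.dom \ D.interfaces) u x * φ x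

/-- `‖[p ∇u · n]‖²_{L²(Γ)}`; it is `∞` if the jump is not in `L²(Γ)`. -/
def fluxJumpNormSq (D : BoxPartition d I) (p : Fin I → ℝ) (u : E d → ℝ) : ℝ≥0∞ :=
  ⨅ (j : E d → ℝ) (_ : D.IsFluxJump p u j), (eLpNorm j 2 D.surfaceMeasure) ^ 2

/-- The residual `‖p (Δ u + S) + ℓ‖²_{L²(Ω)} + Θ ‖[p ∇u · n]‖²_{L²(Γ)}` for the principal
component `u` and the source `S` of the singular component. -/
def residual (D : BoxPartition d I) (Θ : ℝ) (p : Fin I → ℝ) (l u S : E d → ℝ) : ℝ≥0∞ :=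
  l2NormSq D.dom
      (fun x => D.coeff p x * (weakLaplacian (D.dom \ D.interfaces) u x + S x) + l x)
    + ENNReal.ofReal Θ * D.fluxJumpNormSq p u

end BoxPartition

/-- The principal component `a · w + b · v`. -/
def principal {d N₁ N₂ : ℕ} (w : Fin N₁ → E d → ℝ) (v : Fin N₂ → E d → ℝ)
    (a : Fin N₁ → ℝ) (b : Fin N₂ → ℝ) (x : E d) : ℝ :=
  ∑ n, a n * w n x + ∑ m, b m * v m x

/-! ### The Sturm–Liouville problem on the circle and its finite element discretization -/

/-- Lebesgue measure on `(0, 2π)`. -/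
def angularMeasure : Measure ℝ := volume.restrict (Ioo 0 (2 * Real.pi))

/-- `f ∈ H¹_per(0, 2π)`, extended periodically to the line. -/
def MemH1Per (f : ℝ → ℝ) : Prop :=
  Function.Periodic f (2 * Real.pi) ∧ AbsolutelyContinuousOnInterval f 0 (2 * Real.pi) ∧
    MemLp (deriv f) 2 angularMeasure

/-- `ϑ`, normalized in `L²(0, 2π)`, is an eigenfunction of the periodic Sturm–Liouville problem
`-(q ϑ')' = Λ² q ϑ` with `Λ ∈ (0, 1)`. -/
def IsSLEigenpair (q : ℝ → ℝ) (Lam : ℝ) (vth : ℝ → ℝ) : Prop :=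
  Lam ∈ Ioo (0 : ℝ) 1 ∧ MemH1Per vth ∧ eLpNorm vth 2 angularMeasure = 1 ∧
    ∀ f : ℝ → ℝ, MemH1Per f →
      ∫ θ in (0 : ℝ)..(2 * Real.pi),
        q θ * (deriv vth θ * deriv f θ - Lam ^ 2 * (vth θ * f θ)) = 0

/-- `2π`-periodic continuous functions that are polynomial on each element of a mesh of
`[0, 2π]`. -/
def IsPeriodicPiecewisePolynomial (f : ℝ → ℝ) : Prop :=
  Function.Periodic f (2 * Real.pi) ∧
    ∃ (m : ℕ) (t : Fin (m + 1) → ℝ), StrictMono t ∧ t 0 = 0 ∧ t (Fin.last m) = 2 * Real.pi ∧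
      ∀ e : Fin m, ∃ P : Polynomial ℝ, ∀ θ ∈ Icc (t e.castSucc) (t e.succ), f θ = P.eval θ

/-- The stiffness matrix of the trial functions `φ`. -/
def stiffness {M : ℕ} (φ : Fin M → ℝ → ℝ) (q : ℝ → ℝ) : Matrix (Fin M) (Fin M) ℝ :=
  Matrix.of fun k l => ∫ θ in (0 : ℝ)..(2 * Real.pi), q θ * deriv (φ k) θ * deriv (φ l) θ

/-- The mass matrix of the trial functions `φ`. -/
def mass {M : ℕ} (φ : Fin M → ℝ → ℝ) (q : ℝ → ℝ) : Matrix (Fin M) (Fin M) ℝ :=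
  Matrix.of fun k l => ∫ θ in (0 : ℝ)..(2 * Real.pi), q θ * φ k θ * φ l θ

/-- `(lam, mu)` is computed by the finite element eigenvalue solver: `mu = ∑ ρ_k φ_k`, normalized
in `L²(0, 2π)`, where `G ρ = lam² B ρ` and `lam ∈ (0, 1)`. -/
def IsFEEigenpair {M : ℕ} (φ : Fin M → ℝ → ℝ) (q : ℝ → ℝ) (lam : ℝ) (mu : ℝ → ℝ) : Prop :=
  lam ∈ Ioo (0 : ℝ) 1 ∧ eLpNorm mu 2 angularMeasure = 1 ∧
    ∃ ρ : Fin M → ℝ, (stiffness φ q).mulVec ρ = lam ^ 2 • (mass φ q).mulVec ρ ∧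
      mu = fun θ => ∑ k, ρ k * φ k θ

/-! ### Singular functions -/

/-- The polar angle of `x` with respect to the centre `x₀`. -/
def polarAngle (x₀ x : E 2) : ℝ := Complex.arg ⟨x 0 - x₀ 0, x 1 - x₀ 1⟩

/-- The point with polar coordinates `(r, θ)` with respect to the centre `x₀`. -/
def polarPoint (x₀ : E 2) (r θ : ℝ) : E 2 :=
  !₂[x₀ 0 + r * Real.cos θ, x₀ 1 + r * Real.sin θ]

/-- The singular points `x_i` of a planar partition, with a smooth radial cutoff `η` which is `1`
for `r < δ₁` and `0` for `r > δ₂`. The closed discs of radius `δ₂` about the singular points are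
pairwise disjoint, lie in `Ω`, and meet only the subdomains incident to their centre. -/
structure SingularPoints {I : ℕ} (D : BoxPartition 2 I) (Ns : ℕ) where
  pt : Fin Ns → E 2
  δ₁ : ℝ
  δ₂ : ℝ
  η : ℝ → ℝ
  δ₁_pos : 0 < δ₁
  δ₁_lt_δ₂ : δ₁ < δ₂
  η_smooth : ContDiff ℝ ∞ η
  η_one : ∀ r, r < δ₁ → η r = 1
  η_zero : ∀ r, δ₂ < r → η r = 0
  ball_subset : ∀ i, Metric.closedBall (pt i) δ₂ ⊆ D.dom
  ball_incident : ∀ i k, (Metric.closedBall (pt i) δ₂ ∩ D.sub k).Nonempty →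
    pt i ∈ closure (D.sub k)
  ball_disjoint : ∀ i j, i ≠ j →
    Disjoint (Metric.closedBall (pt i) δ₂) (Metric.closedBall (pt j) δ₂)

namespace SingularPoints

variable {I Ns : ℕ} {D : BoxPartition 2 I}

/-- The angular trace `p(θ)` of the coefficient around the point `x_i`. In the disc of radius `δ₂`
the coefficient depends on the angle only; it is read off at the radius `δ₁`. -/
def angularCoeff (V : SingularPoints D Ns) (p : Fin I → ℝ) (i : Fin Ns) (θ : ℝ) : ℝ :=
  D.coeff p (polarPoint (V.pt i) V.δ₁ θ)

/-- The singular function `r ^ lam * mu θ * η r` in polar coordinates about `x_i`. -/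
def singularFun (V : SingularPoints D Ns) (i : Fin Ns) (lam : ℝ) (mu : ℝ → ℝ) (x : E 2) : ℝ :=
  dist x (V.pt i) ^ lam * mu (polarAngle (V.pt i) x) * V.η (dist x (V.pt i))

open Classical in
/-- The radial source `2 ∂_r s η' + s (η'' + η' / r)` on `δ₁ < r < δ₂` and `0` elsewhere, where
`s = r ^ lam * mu θ`. -/
def singularSource (V : SingularPoints D Ns) (i : Fin Ns) (lam : ℝ) (mu : ℝ → ℝ) (x : E 2) : ℝ :=
  let r := dist x (V.pt i)
  let θ := polarAngle (V.pt i) x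
  if r ∈ Ioo V.δ₁ V.δ₂ then
    2 * deriv (fun s : ℝ => s ^ lam * mu θ) r * deriv V.η r
      + r ^ lam * mu θ * (deriv (deriv V.η) r + 1 / r * deriv V.η r)
  else 0

/-- The singular component `∑_i ∑_j c_ij s_ij`. -/
def singularPart (V : SingularPoints D Ns) {K : Fin Ns → ℕ} (lam : ∀ i, Fin (K i) → ℝ)
    (mu : ∀ i, Fin (K i) → ℝ → ℝ) (c : ∀ i, Fin (K i) → ℝ) (x : E 2) : ℝ :=
  ∑ i, ∑ j, c i j * V.singularFun i (lam i j) (mu i j) x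

/-- The combined source `∑_i ∑_j c_ij S_ij`. -/
def sourcePart (V : SingularPoints D Ns) {K : Fin Ns → ℕ} (lam : ∀ i, Fin (K i) → ℝ)
    (mu : ∀ i, Fin (K i) → ℝ → ℝ) (c : ∀ i, Fin (K i) → ℝ) (x : E 2) : ℝ :=
  ∑ i, ∑ j, c i j * V.singularSource i (lam i j) (mu i j) x

end SingularPoints

/-- `‖c‖² (‖mu - ϑ‖²_{L²(0, 2π)} + ‖lam - Λ‖²)`. -/
def eigenError {Ns : ℕ} {K : Fin Ns → ℕ} (c lam Lam : ∀ i, Fin (K i) → ℝ)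
    (mu vth : ∀ i, Fin (K i) → ℝ → ℝ) : ℝ≥0∞ :=
  ENNReal.ofReal (∑ i, ∑ j, c i j ^ 2) *
    ((∑ i, ∑ j, (eLpNorm (fun θ => mu i j θ - vth i j θ) 2 angularMeasure) ^ 2)
      + ENNReal.ofReal (∑ i, ∑ j, (lam i j - Lam i j) ^ 2))

end LSReCoNN

end

open LSReCoNN

/-! Fix a parameter `p` and let `e = ur + s - u` be the error, where `ur = a·w + b·v` is piecewise
`H²` and `s` is the singular component with gradient `Gs` and source `S`. Let `j` be a flux jump of
`ur` and `R = p (Δ ur + S) + ℓ` the interior residual. Green's formula, which defines the jump, and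
the weak equation give, for every test function `φ`, ∫ p ∇e·∇φ = ∫_Γ j φ - ∫ R φ + (∫ p Gs·∇φ + ∫ p
S φ). A trace inequality on the faces and Poincaré's inequality bound the first two terms by the
square root of the loss times ‖∇φ‖. Coercivity, together with the density of test functions, turns a
bound of this functional into a bound of ‖∇e‖ (`energy_bound`, `residual_estimate`). In one
dimension `s = 0` and nothing else is needed.

In two dimensions the bracket measures how far `s` is from solving its equation. For `s = r^λ μ(θ)
η(r)` in polar coordinates the radial terms add up to a total derivative and drop out. What remains
is ∫ η r^(λ-1) a(μ, φ(r,·)) dr, where a is the Sturm–Liouville form `circleForm` with parameter `λ`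
(`residual_polarSing_eq`). An exact eigenpair would make it vanish. Two difficulties remain for a
discrete eigenpair.

The form a contains `μ'`, while only the `L²` error of `μ` may appear in the bound. An inverse
estimate resolves this (`exists_slForm_sub_le`): on a mesh element the coefficient is constant, `ϑ''
= -Λ² ϑ`, and `μ` is a polynomial of bounded degree. Testing with the strong residual `μ'' + Λ² μ`
times a bubble and moving all derivatives to the test function leaves only ‖μ - ϑ‖, and equivalence
of norms on polynomials of bounded degree does the rest. This is where the constant depends on the
trial functions.

Radial integration costs factors 1/λ and 1/λ² (Cauchy–Schwarz and Hardy), which blow up as λ → 0.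
However, the exact `Λ` is bounded below in terms of `pmin` and `pmax`. A small `λ` therefore comes
with a large eigenvalue error, and the Rayleigh quotient of the discrete eigenfunction then makes
‖μ'‖ of order λ. So the angular residual carries compensating weights λ and λ²
(`exists_circleForm_residual_le`).

Cauchy–Schwarz over the singular pairs yields ‖c‖² times the eigenpair errors. All bounds hold for
each `p` with one constant, so integration over the parameters finishes the proof. -/

noncomputable section

namespace LSReCoNN

/-! ### Square integrable functions -/

section SquareIntegrable

variable {α : Type*} [MeasurableSpace α] {μ : Measure α} {f g : α → ℝ}

/-- The norm of a square integrable function as a real number. -/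
def nrm (μ : Measure α) (f : α → ℝ) : ℝ := √(∫ x, f x ^ 2 ∂μ)

lemma nrm_nonneg : 0 ≤ nrm μ f := Real.sqrt_nonneg _

lemma nrm_sq : nrm μ f ^ 2 = ∫ x, f x ^ 2 ∂μ :=
  Real.sq_sqrt (integral_nonneg fun _ => sq_nonneg _)

lemma eLpNorm_sq_eq_lintegral : eLpNorm f 2 μ ^ 2 = ∫⁻ x, ENNReal.ofReal (f x ^ 2) ∂μ := by
  rw [eLpNorm_eq_lintegral_rpow_enorm_toReal two_ne_zero ENNReal.ofNat_ne_top, ← ENNReal.rpow_two,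
    ← ENNReal.rpow_mul]
  simp only [ENNReal.toReal_ofNat, one_div, isUnit_iff_ne_zero, ne_eq, OfNat.ofNat_ne_zero,
    not_false_eq_true, IsUnit.inv_mul_cancel, ENNReal.rpow_one]
  refine lintegral_congr fun x => ?_
  rw [← sq_abs, ENNReal.ofReal_pow (abs_nonneg _), Real.enorm_eq_ofReal_abs, ENNReal.rpow_two]

lemma eLpNorm_sq_eq (hf : MemLp f 2 μ) : eLpNorm f 2 μ ^ 2 = ENNReal.ofReal (nrm μ f ^ 2) := by
  rw [eLpNorm_sq_eq_lintegral, nrm_sq,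
    ofReal_integral_eq_lintegral_ofReal hf.integrable_sq (ae_of_all _ fun _ => sq_nonneg _)]

lemma eLpNorm_eq_nrm (hf : MemLp f 2 μ) : eLpNorm f 2 μ = ENNReal.ofReal (nrm μ f) := by
  have h := eLpNorm_sq_eq hf
  rw [ENNReal.ofReal_pow nrm_nonneg] at h
  exact (ENNReal.pow_right_strictMono two_ne_zero).injective h

lemma nrm_congr (h : f =ᵐ[μ] g) : nrm μ f = nrm μ g := by
  rw [nrm, nrm, integral_congr_ae]
  filter_upwards [h] with x hx using by simp [hx]

lemma integrable_mul_of_memLp (hf : MemLp f 2 μ) (hg : MemLp g 2 μ) :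
    Integrable (fun x => f x * g x) μ := hf.integrable_mul hg

/-- The quadratic `t ↦ ∫ (t f + g)²` is nonnegative, so its discriminant is not positive. -/
lemma abs_integral_mul_le (hf : MemLp f 2 μ) (hg : MemLp g 2 μ) :
    |∫ x, f x * g x ∂μ| ≤ nrm μ f * nrm μ g := by
  have h1 := hf.integrable_sq
  have h2 := hg.integrable_sq
  have h3 := integrable_mul_of_memLp hf hg
  have key : ∀ t : ℝ, 0 ≤ (∫ x, f x ^ 2 ∂μ) * (t * t) + (2 * ∫ x, f x * g x ∂μ) * t
      + ∫ x, g x ^ 2 ∂μ := by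
    intro t
    have : ∫ x, (t * f x + g x) ^ 2 ∂μ = (∫ x, f x ^ 2 ∂μ) * (t * t)
        + (2 * ∫ x, f x * g x ∂μ) * t + ∫ x, g x ^ 2 ∂μ := by
      rw [← integral_mul_const, ← integral_const_mul, ← integral_mul_const, ← integral_add
        (h1.mul_const _) ((h3.const_mul _).mul_const _), ← integral_add _ h2]
      · exact integral_congr_ae (ae_of_all _ fun x => by ring)
      · exact (h1.mul_const _).add ((h3.const_mul _).mul_const _)
    rw [← this]
    exact integral_nonneg fun _ => sq_nonneg _
  have h4 := discrim_le_zero key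
  rw [discrim] at h4
  rw [nrm, nrm, ← Real.sqrt_mul (integral_nonneg fun _ => sq_nonneg _)]
  exact Real.abs_le_sqrt (by linarith)

lemma nrm_add_le (hf : MemLp f 2 μ) (hg : MemLp g 2 μ) :
    nrm μ (fun x => f x + g x) ≤ nrm μ f + nrm μ g := by
  have h1 := hf.integrable_sq
  have h2 := hg.integrable_sq
  have h3 := integrable_mul_of_memLp hf hg
  refine (sq_le_sq₀ nrm_nonneg (add_nonneg nrm_nonneg nrm_nonneg)).1 ?_
  have : ∫ x, (f x + g x) ^ 2 ∂μ = (∫ x, f x ^ 2 ∂μ) + 2 * (∫ x, f x * g x ∂μ)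
      + ∫ x, g x ^ 2 ∂μ := by
    rw [← integral_const_mul, ← integral_add h1 (h3.const_mul _), ← integral_add _ h2]
    · exact integral_congr_ae (ae_of_all _ fun x => by ring)
    · exact h1.add (h3.const_mul _)
  rw [nrm_sq, this]
  have := (abs_le.1 (abs_integral_mul_le hf hg)).2
  nlinarith [nrm_sq (μ := μ) (f := f), nrm_sq (μ := μ) (f := g)]

lemma nrm_const_mul (c : ℝ) : nrm μ (fun x => c * f x) = |c| * nrm μ f := by
  simp only [nrm, mul_pow, integral_const_mul]
  rw [Real.sqrt_mul (sq_nonneg c), Real.sqrt_sq_eq_abs]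

lemma memLp_sub (hf : MemLp f 2 μ) (hg : MemLp g 2 μ) : MemLp (fun x => f x - g x) 2 μ :=
  hf.sub hg

lemma nrm_sub_le (hf : MemLp f 2 μ) (hg : MemLp g 2 μ) :
    nrm μ (fun x => f x - g x) ≤ nrm μ f + nrm μ g := by
  have := nrm_add_le hf hg.neg
  simpa [sub_eq_add_neg, nrm] using this

/-- Integrability is needed for the majorant only: a nonintegrable `f²` would have integral `0`. -/
lemma nrm_mono (hg : MemLp g 2 μ) (h : ∀ᵐ x ∂μ, |f x| ≤ |g x|) : nrm μ f ≤ nrm μ g := by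
  refine Real.sqrt_le_sqrt (integral_mono_of_nonneg (ae_of_all _ fun _ => sq_nonneg _)
    hg.integrable_sq ?_)
  filter_upwards [h] with x hx using sq_le_sq.2 hx

lemma memLp_of_eLpNorm_ne_top (hf : AEStronglyMeasurable f μ) (h : eLpNorm f 2 μ ^ 2 ≠ ⊤) :
    MemLp f 2 μ := ⟨hf, lt_top_iff_ne_top.2 fun h' => h (by simp [h'])⟩

end SquareIntegrable

/-! ### Test functions and weak derivatives -/

section Weak

variable {d : ℕ} {U : Set (E d)} {φ u v g h : E d → ℝ} {k : Fin d}

/-- The real `L²(U)` norm. -/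
abbrev nrmOn (U : Set (E d)) (u : E d → ℝ) : ℝ := nrm (volume.restrict U) u

lemma IsTestFunction.continuous (hφ : IsTestFunction U φ) : Continuous φ := hφ.1.continuous

lemma IsTestFunction.differentiable (hφ : IsTestFunction U φ) : Differentiable ℝ φ :=
  hφ.1.differentiable (by simp)

lemma IsTestFunction.continuous_partialDeriv (hφ : IsTestFunction U φ) (k : Fin d) :
    Continuous (partialDeriv k φ) :=
  (hφ.1.continuous_fderiv (by simp)).clm_apply continuous_const

lemma IsTestFunction.hasCompactSupport_partialDeriv (hφ : IsTestFunction U φ) (k : Fin d) :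
    HasCompactSupport (partialDeriv k φ) :=
  hφ.2.1.fderiv_apply (𝕜 := ℝ) _

lemma IsTestFunction.memLp {μ : Measure (E d)} [IsFiniteMeasureOnCompacts μ]
    (hφ : IsTestFunction U φ) (p : ℝ≥0∞) : MemLp φ p μ :=
  hφ.continuous.memLp_of_hasCompactSupport hφ.2.1

lemma IsTestFunction.memLp_partialDeriv {μ : Measure (E d)} [IsFiniteMeasureOnCompacts μ]
    (hφ : IsTestFunction U φ) (k : Fin d) (p : ℝ≥0∞) : MemLp (partialDeriv k φ) p μ :=
  (hφ.continuous_partialDeriv k).memLp_of_hasCompactSupport (hφ.hasCompactSupport_partialDeriv k)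

lemma IsTestFunction.mono {V : Set (E d)} (hφ : IsTestFunction U φ) (h : U ⊆ V) :
    IsTestFunction V φ := ⟨hφ.1, hφ.2.1, hφ.2.2.trans h⟩

lemma IsTestFunction.eq_zero_of_notMem (hφ : IsTestFunction U φ) {x : E d} (hx : x ∉ U) :
    φ x = 0 := image_eq_zero_of_notMem_tsupport fun h => hx (hφ.2.2 h)

lemma tsupport_partialDeriv_subset (k : Fin d) : tsupport (partialDeriv k φ) ⊆ tsupport φ :=
  tsupport_fderiv_apply_subset ℝ _

lemma IsTestFunction.partialDeriv_eq_zero_of_notMem (hφ : IsTestFunction U φ) (k : Fin d)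
    {x : E d} (hx : x ∉ U) : partialDeriv k φ x = 0 :=
  image_eq_zero_of_notMem_tsupport fun h => hx (hφ.2.2 (tsupport_partialDeriv_subset k h))

lemma IsTestFunction.add (hu : IsTestFunction U u) (hv : IsTestFunction U v) :
    IsTestFunction U (fun x => u x + v x) :=
  ⟨hu.1.add hv.1, hu.2.1.add hv.2.1,
    (tsupport_add u v).trans (union_subset hu.2.2 hv.2.2)⟩

lemma IsTestFunction.const_mul (c : ℝ) (hu : IsTestFunction U u) :
    IsTestFunction U (fun x => c * u x) :=
  ⟨contDiff_const.mul hu.1, hu.2.1.mul_left, (tsupport_mul_subset_right).trans hu.2.2⟩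

lemma IsTestFunction.partialDeriv_add (hu : IsTestFunction U u) (hv : IsTestFunction U v)
    (k : Fin d) (x : E d) :
    partialDeriv k (fun x => u x + v x) x = partialDeriv k u x + partialDeriv k v x := by
  simp only [partialDeriv]
  rw [fderiv_fun_add (hu.differentiable x) (hv.differentiable x)]
  rfl

lemma IsTestFunction.partialDeriv_const_mul (c : ℝ) (hu : IsTestFunction U u)
    (k : Fin d) (x : E d) :
    partialDeriv k (fun x => c * u x) x = c * partialDeriv k u x := by
  simp only [partialDeriv]
  rw [fderiv_const_mul (hu.differentiable x)]
  rfl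

/-- Integration by parts for two smooth functions, one of them with compact support. -/
lemma integral_mul_partialDeriv_eq_neg (hu : ContDiff ℝ ∞ u) (hφ : ContDiff ℝ ∞ φ)
    (hc : HasCompactSupport φ) (k : Fin d) :
    ∫ x, u x * partialDeriv k φ x = - ∫ x, partialDeriv k u x * φ x := by
  have h1 : IsTestFunction univ φ := ⟨hφ, hc, subset_univ _⟩
  have hu' : Continuous (partialDeriv k u) :=
    (hu.continuous_fderiv (by simp)).clm_apply continuous_const
  refine integral_mul_fderiv_eq_neg_fderiv_mul_of_integrable ?_ ?_ ?_ ?_ ?_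
  · exact (hu'.mul h1.continuous).integrable_of_hasCompactSupport hc.mul_left
  · exact (hu.continuous.mul (h1.continuous_partialDeriv k)).integrable_of_hasCompactSupport
      (h1.hasCompactSupport_partialDeriv k).mul_left
  · exact (hu.continuous.mul h1.continuous).integrable_of_hasCompactSupport hc.mul_left
  · exact fun x _ => hu.differentiable (by simp) x
  · exact fun x _ => hφ.differentiable (by simp) x

lemma IsTestFunction.isWeakDeriv (hu : IsTestFunction U u) (k : Fin d) :
    IsWeakDeriv U k u (partialDeriv k u) := by
  refine ⟨hu.memLp_partialDeriv k 2, fun φ hφ => ?_⟩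
  rw [setIntegral_eq_integral_of_forall_compl_eq_zero, setIntegral_eq_integral_of_forall_compl_eq_zero]
  · exact integral_mul_partialDeriv_eq_neg hu.1 hφ.1 hφ.2.1 k
  · intro x hx; simp [hφ.eq_zero_of_notMem hx]
  · intro x hx; simp [hu.eq_zero_of_notMem hx]

lemma IsWeakDeriv.congr (hg : IsWeakDeriv U k u g) (hu : u =ᵐ[volume.restrict U] v)
    (hh : g =ᵐ[volume.restrict U] h) : IsWeakDeriv U k v h := by
  refine ⟨hg.1.ae_eq hh, fun φ hφ => ?_⟩
  have := hg.2 φ hφ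
  rw [integral_congr_ae (g := fun x => v x * partialDeriv k φ x),
    integral_congr_ae (f := fun x => g x * φ x) (g := fun x => h x * φ x)] at this
  · exact this
  · filter_upwards [hh] with x hx using by simp [hx]
  · filter_upwards [hu] with x hx using by simp [hx]

lemma IsWeakDeriv.add (hg : IsWeakDeriv U k u g) (hh : IsWeakDeriv U k v h) (hu : MemL2 U u)
    (hv : MemL2 U v) : IsWeakDeriv U k (fun x => u x + v x) (fun x => g x + h x) := by
  refine ⟨hg.1.add hh.1, fun φ hφ => ?_⟩
  simp only [add_mul]
  rw [integral_add, integral_add, hg.2 φ hφ, hh.2 φ hφ]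
  · ring
  · exact integrable_mul_of_memLp hg.1 (hφ.memLp 2)
  · exact integrable_mul_of_memLp hh.1 (hφ.memLp 2)
  · exact integrable_mul_of_memLp hu (hφ.memLp_partialDeriv k 2)
  · exact integrable_mul_of_memLp hv (hφ.memLp_partialDeriv k 2)

lemma IsWeakDeriv.const_mul (c : ℝ) (hg : IsWeakDeriv U k u g) :
    IsWeakDeriv U k (fun x => c * u x) (fun x => c * g x) := by
  refine ⟨hg.1.const_mul c, fun φ hφ => ?_⟩
  simp only [mul_assoc, integral_const_mul]
  rw [hg.2 φ hφ]
  ring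

/-- The fundamental lemma of the calculus of variations, applied to `g - h`. It makes the choice
inside `weakDeriv` harmless. -/
lemma IsWeakDeriv.ae_eq (hU : IsOpen U) (hg : IsWeakDeriv U k u g) (hh : IsWeakDeriv U k u h) :
    g =ᵐ[volume.restrict U] h := by
  have h0 : ∀ᵐ x, x ∈ U → (g x - h x) = 0 := by
    refine hU.ae_eq_zero_of_integral_contDiff_smul_eq_zero ?_ fun φ h1 h2 h3 => ?_
    · have : LocallyIntegrable (fun x => g x - h x) (volume.restrict U) :=
        (hg.1.sub hh.1).locallyIntegrable (by norm_num)
      exact locallyIntegrableOn_of_locallyIntegrable_restrict this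
    · have hφ : IsTestFunction U φ := ⟨h1, h2, h3⟩
      have e1 := hg.2 φ hφ
      have e2 := hh.2 φ hφ
      rw [← setIntegral_eq_integral_of_forall_compl_eq_zero (s := U)]
      · have : ∫ x in U, φ x • (g x - h x) = (∫ x in U, g x * φ x) - ∫ x in U, h x * φ x := by
          rw [← integral_sub (integrable_mul_of_memLp hg.1 (hφ.memLp 2))
            (integrable_mul_of_memLp hh.1 (hφ.memLp 2))]
          exact integral_congr_ae (ae_of_all _ fun x => by simp only [smul_eq_mul]; ring)
        rw [this]; linarith
      · intro x hx; simp [hφ.eq_zero_of_notMem hx]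
  rw [Filter.EventuallyEq, ae_restrict_iff' hU.measurableSet]
  filter_upwards [h0] with x hx hxU using sub_eq_zero.1 (hx hxU)

lemma IsWeakDeriv.weakDeriv (hg : IsWeakDeriv U k u g) :
    IsWeakDeriv U k u (weakDeriv U k u) := by
  have h : ∃ g, IsWeakDeriv U k u g := ⟨g, hg⟩
  rw [LSReCoNN.weakDeriv, dif_pos h]
  exact h.choose_spec

lemma IsWeakDeriv.weakDeriv_ae_eq (hU : IsOpen U) (hg : IsWeakDeriv U k u g) :
    LSReCoNN.weakDeriv U k u =ᵐ[volume.restrict U] g := hg.weakDeriv.ae_eq hU hg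

lemma MemH1.isWeakDeriv (hu : MemH1 U u) (k : Fin d) : IsWeakDeriv U k u (weakDeriv U k u) :=
  (hu.2 k).choose_spec.weakDeriv

/-- Meant for the passage from `Ω` to `Ω \ Γ`: the smaller set has fewer test functions, and the
integrals do not see the removed null set. -/
lemma IsWeakDeriv.mono_of_null {V : Set (E d)} (hVU : V ⊆ U)
    (hV : U =ᵐ[volume] V) (hg : IsWeakDeriv U k u g) : IsWeakDeriv V k u g := by
  have hr : volume.restrict U = volume.restrict V := Measure.restrict_congr_set hV
  refine ⟨?_, fun φ hφ => ?_⟩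
  · have := hg.1
    rwa [MemL2, hr] at this
  · have := hg.2 φ (hφ.mono hVU)
    rwa [hr] at this

lemma MemH1.congr (hu : MemH1 U u) (h : u =ᵐ[volume.restrict U] v) : MemH1 U v :=
  ⟨hu.1.ae_eq h, fun k => ⟨_, (hu.isWeakDeriv k).congr h Filter.EventuallyEq.rfl⟩⟩

lemma MemH1.mono_of_null {V : Set (E d)} (hVU : V ⊆ U)
    (hV : U =ᵐ[volume] V) (hu : MemH1 U u) : MemH1 V u := by
  refine ⟨?_, fun k => ⟨_, (hu.isWeakDeriv k).mono_of_null hVU hV⟩⟩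
  have := hu.1
  rwa [MemL2, Measure.restrict_congr_set hV] at this

lemma MemH2.mono_of_null {V : Set (E d)} (hVo : IsOpen V) (hVU : V ⊆ U)
    (hV : U =ᵐ[volume] V) (hu : MemH2 U u) : MemH2 V u := by
  refine ⟨hu.1.mono_of_null hVU hV, fun k => ((hu.2 k).mono_of_null hVU hV).congr ?_⟩
  exact (((hu.1.isWeakDeriv k).mono_of_null hVU hV).weakDeriv_ae_eq hVo).symm

lemma MemH1.add (hu : MemH1 U u) (hv : MemH1 U v) : MemH1 U (fun x => u x + v x) :=
  ⟨hu.1.add hv.1, fun k => ⟨_, (hu.isWeakDeriv k).add (hv.isWeakDeriv k) hu.1 hv.1⟩⟩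

lemma MemH1.const_mul (c : ℝ) (hu : MemH1 U u) : MemH1 U (fun x => c * u x) :=
  ⟨hu.1.const_mul c, fun k => ⟨_, (hu.isWeakDeriv k).const_mul c⟩⟩

/-- The chosen `weakDeriv` is additive only almost everywhere, so second derivatives are transferred
along this a.e. equality. -/
lemma MemH2.add (hU : IsOpen U) (hu : MemH2 U u) (hv : MemH2 U v) :
    MemH2 U (fun x => u x + v x) :=
  ⟨hu.1.add hv.1, fun k => ((hu.2 k).add (hv.2 k)).congr
    (((hu.1.isWeakDeriv k).add (hv.1.isWeakDeriv k) hu.1.1 hv.1.1).weakDeriv_ae_eq hU).symm⟩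

lemma MemH2.const_mul (hU : IsOpen U) (c : ℝ) (hu : MemH2 U u) :
    MemH2 U (fun x => c * u x) :=
  ⟨hu.1.const_mul c, fun k => ((hu.2 k).const_mul c).congr
    (((hu.1.isWeakDeriv k).const_mul c).weakDeriv_ae_eq hU).symm⟩

lemma MemH2.memLp_weakLaplacian (hu : MemH2 U u) : MemL2 U (weakLaplacian U u) := by
  have : weakLaplacian U u = fun x => ∑ k, weakDeriv U k (weakDeriv U k u) x := rfl
  rw [MemL2, this]
  exact memLp_finsetSum _ fun k _ => ((hu.2 k).isWeakDeriv k).1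

/-! ### The space `H¹₀` -/

/-- `u ∈ H¹₀(U)` with gradient `G`. -/
def InH10 (U : Set (E d)) (u : E d → ℝ) (G : Fin d → E d → ℝ) : Prop :=
  MemL2 U u ∧ (∀ k, MemL2 U (G k)) ∧ ∀ ε : ℝ, 0 < ε → ∃ φ, IsTestFunction U φ ∧
    nrmOn U (fun x => u x - φ x) < ε ∧ ∀ k, nrmOn U (fun x => G k x - partialDeriv k φ x) < ε

variable {G F : Fin d → E d → ℝ}

/-- `InH10` carries a gradient explicitly, which makes sums and limits painless. That `G` is indeed
the weak gradient follows since integration by parts holds for the approximating test functions and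
both sides are continuous in `L²`. -/
lemma InH10.isWeakDeriv (h : InH10 U u G) (k : Fin d) : IsWeakDeriv U k u (G k) := by
  refine ⟨h.2.1 k, fun ψ hψ => ?_⟩
  set A := nrmOn U (partialDeriv k ψ) + nrmOn U ψ with hA
  have hA0 : 0 ≤ A := add_nonneg nrm_nonneg nrm_nonneg
  have key : ∀ ε : ℝ, 0 < ε →
      |(∫ x in U, u x * partialDeriv k ψ x) + ∫ x in U, G k x * ψ x| ≤ ε * A := by
    intro ε hε
    obtain ⟨φ, hφ, h1, h2⟩ := h.2.2 ε hε
    have h3 := (hφ.isWeakDeriv k).2 ψ hψ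
    have e1 : (∫ x in U, u x * partialDeriv k ψ x) + ∫ x in U, G k x * ψ x
        = (∫ x in U, (u x - φ x) * partialDeriv k ψ x)
          + ∫ x in U, (G k x - partialDeriv k φ x) * ψ x := by
      simp only [sub_mul]
      rw [integral_sub, integral_sub, h3]
      · ring
      · exact integrable_mul_of_memLp (h.2.1 k) (hψ.memLp 2)
      · exact integrable_mul_of_memLp (hφ.memLp_partialDeriv k 2) (hψ.memLp 2)
      · exact integrable_mul_of_memLp h.1 (hψ.memLp_partialDeriv k 2)
      · exact integrable_mul_of_memLp (hφ.memLp 2) (hψ.memLp_partialDeriv k 2)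
    rw [e1]
    have a1 := abs_integral_mul_le (h.1.sub (hφ.memLp 2)) (hψ.memLp_partialDeriv
      (μ := volume.restrict U) k 2)
    have a2 := abs_integral_mul_le ((h.2.1 k).sub (hφ.memLp_partialDeriv k 2)) (hψ.memLp
      (μ := volume.restrict U) 2)
    calc _ ≤ _ := abs_add_le _ _
      _ ≤ _ := add_le_add a1 a2
      _ ≤ ε * nrmOn U (partialDeriv k ψ) + ε * nrmOn U ψ :=
        add_le_add (mul_le_mul_of_nonneg_right h1.le nrm_nonneg)
          (mul_le_mul_of_nonneg_right (h2 k).le nrm_nonneg)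
      _ = ε * A := by rw [hA]; ring
  have h0 : |(∫ x in U, u x * partialDeriv k ψ x) + ∫ x in U, G k x * ψ x| ≤ 0 := by
    refine le_of_forall_pos_le_add fun δ hδ => ?_
    -- The `+ 1` covers the case `A = 0`.
    have := key (δ / (A + 1)) (by positivity)
    refine this.trans ?_
    rw [zero_add, div_mul_eq_mul_div, div_le_iff₀ (by positivity)]
    nlinarith
  have := abs_eq_zero.1 (le_antisymm h0 (abs_nonneg _))
  linarith

lemma InH10.memH1 (h : InH10 U u G) : MemH1 U u := ⟨h.1, fun k => ⟨_, h.isWeakDeriv k⟩⟩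

lemma InH10.memH10 (hU : IsOpen U) (h : InH10 U u G) : MemH10 U u := by
  refine ⟨h.memH1, fun ε hε => ?_⟩
  -- The tolerance `ε` may be `∞`, so a finite positive number below it is taken first.
  obtain ⟨δ, hδ, hδε⟩ : ∃ δ : ℝ, 0 < δ ∧ ENNReal.ofReal (δ ^ 2) < ε := by
    obtain ⟨r, hr, hrε⟩ := ENNReal.lt_iff_exists_nnreal_btwn.1 hε
    refine ⟨√r, Real.sqrt_pos.2 (by exact_mod_cast hr), ?_⟩
    rw [Real.sq_sqrt r.coe_nonneg]
    simpa using hrε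
  obtain ⟨φ, hφ, h1, h2⟩ := h.2.2 δ hδ
  refine ⟨φ, hφ, ?_, fun k => ?_⟩
  · rw [l2NormSq, eLpNorm_sq_eq (memLp_sub h.1 (hφ.memLp 2))]
    refine lt_of_le_of_lt (ENNReal.ofReal_le_ofReal ?_) hδε
    exact pow_le_pow_left₀ nrm_nonneg h1.le 2
  · have hae := (h.isWeakDeriv k).weakDeriv_ae_eq hU
    rw [l2NormSq, eLpNorm_sq_eq (memLp_sub ((h.isWeakDeriv k).weakDeriv).1
      (hφ.memLp_partialDeriv k 2))]
    refine lt_of_le_of_lt (ENNReal.ofReal_le_ofReal ?_) hδε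
    refine pow_le_pow_left₀ nrm_nonneg ?_ 2
    refine le_trans (le_of_eq (nrm_congr ?_)) (h2 k).le
    filter_upwards [hae] with x hx using by simp [hx]

lemma MemH10.inH10 (h : MemH10 U u) : InH10 U u (fun k => weakDeriv U k u) := by
  refine ⟨h.1.1, fun k => (h.1.isWeakDeriv k).1, fun ε hε => ?_⟩
  obtain ⟨φ, hφ, h1, h2⟩ := h.2 (ENNReal.ofReal (ε ^ 2)) (by simpa using by positivity)
  refine ⟨φ, hφ, ?_, fun k => ?_⟩
  · rw [l2NormSq, eLpNorm_sq_eq (memLp_sub h.1.1 (hφ.memLp 2)),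
      ENNReal.ofReal_lt_ofReal_iff (by positivity)] at h1
    exact lt_of_pow_lt_pow_left₀ 2 hε.le h1
  · have := h2 k
    rw [l2NormSq, eLpNorm_sq_eq (memLp_sub (h.1.isWeakDeriv k).1 (hφ.memLp_partialDeriv k 2)),
      ENNReal.ofReal_lt_ofReal_iff (by positivity)] at this
    exact lt_of_pow_lt_pow_left₀ 2 hε.le this

lemma IsTestFunction.inH10 (hφ : IsTestFunction U φ) :
    InH10 U φ (fun k => partialDeriv k φ) :=
  ⟨hφ.memLp 2, fun k => hφ.memLp_partialDeriv k 2, fun ε hε => ⟨φ, hφ, by simpa [nrm] using hε,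
    fun k => by simpa [nrm] using hε⟩⟩

lemma InH10.add (hu : InH10 U u G) (hv : InH10 U v F) :
    InH10 U (fun x => u x + v x) (fun k x => G k x + F k x) := by
  refine ⟨hu.1.add hv.1, fun k => (hu.2.1 k).add (hv.2.1 k), fun ε hε => ?_⟩
  obtain ⟨φ, hφ, h1, h2⟩ := hu.2.2 (ε / 2) (by positivity)
  obtain ⟨ψ, hψ, h3, h4⟩ := hv.2.2 (ε / 2) (by positivity)
  refine ⟨_, hφ.add hψ, ?_, fun k => ?_⟩
  · have := nrm_add_le (hu.1.sub (hφ.memLp 2)) (hv.1.sub (hψ.memLp 2))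
    simp only [Pi.sub_apply] at this
    calc _ = _ := by congr 1; ext x; ring
      _ ≤ _ := this
      _ < ε := by
        have : nrmOn U (u - φ) < ε / 2 := h1
        have : nrmOn U (v - ψ) < ε / 2 := h3
        linarith
  · have := nrm_add_le ((hu.2.1 k).sub (hφ.memLp_partialDeriv k 2))
      ((hv.2.1 k).sub (hψ.memLp_partialDeriv k 2))
    simp only [Pi.sub_apply] at this
    calc _ = _ := by congr 1; ext x; rw [hφ.partialDeriv_add hψ]; ring
      _ ≤ _ := this
      _ < ε := by
        have : nrmOn U (G k - partialDeriv k φ) < ε / 2 := h2 k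
        have : nrmOn U (F k - partialDeriv k ψ) < ε / 2 := h4 k
        linarith

lemma InH10.const_mul (c : ℝ) (hu : InH10 U u G) :
    InH10 U (fun x => c * u x) (fun k x => c * G k x) := by
  refine ⟨hu.1.const_mul c, fun k => (hu.2.1 k).const_mul c, fun ε hε => ?_⟩
  obtain ⟨φ, hφ, h1, h2⟩ := hu.2.2 (ε / (|c| + 1)) (by positivity)
  have key : ∀ f : E d → ℝ, nrmOn U f < ε / (|c| + 1) → nrmOn U (fun x => c * f x) < ε := by
    intro f hf
    rw [nrmOn, nrm_const_mul]
    rw [lt_div_iff₀ (by positivity)] at hf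
    nlinarith [nrm_nonneg (μ := volume.restrict U) (f := f)]
  refine ⟨_, hφ.const_mul c, ?_, fun k => ?_⟩
  · have := key _ h1
    simpa only [mul_sub] using this
  · have := key _ (h2 k)
    simp only [hφ.partialDeriv_const_mul]
    simpa only [mul_sub] using this

lemma InH10.sub (hu : InH10 U u G) (hv : InH10 U v F) :
    InH10 U (fun x => u x - v x) (fun k x => G k x - F k x) := by
  simpa only [neg_one_mul, ← sub_eq_add_neg] using hu.add (hv.const_mul (-1))

lemma inH10_zero : InH10 U (fun _ => 0) (fun (_ : Fin d) _ => 0) := by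
  have : IsTestFunction U (fun _ => 0) :=
    ⟨contDiff_const, HasCompactSupport.zero, by simp [tsupport]⟩
  have h0 : (fun (k : Fin d) => partialDeriv k (fun _ : E d => (0 : ℝ))) = fun _ _ => 0 := by
    ext k x
    simp [partialDeriv]
  rw [← h0]
  exact this.inH10

lemma InH10.sum {ι : Type*} (s : Finset ι) {u : ι → E d → ℝ} {G : ι → Fin d → E d → ℝ}
    (h : ∀ i ∈ s, InH10 U (u i) (G i)) :
    InH10 U (fun x => ∑ i ∈ s, u i x) (fun k x => ∑ i ∈ s, G i k x) := by
  classical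
  induction s using Finset.induction_on with
  | empty => simpa using inH10_zero
  | insert a s ha ih =>
    simp only [Finset.sum_insert ha]
    exact (h a (by simp)).add (ih fun i hi => h i (by simp [hi]))

/-- `H¹₀` is closed. -/
lemma inH10_of_approx (hu : MemL2 U u) (hG : ∀ k, MemL2 U (G k))
    (h : ∀ ε : ℝ, 0 < ε → ∃ v F, InH10 U v F ∧ nrmOn U (fun x => u x - v x) < ε ∧
      ∀ k, nrmOn U (fun x => G k x - F k x) < ε) : InH10 U u G := by
  refine ⟨hu, hG, fun ε hε => ?_⟩
  obtain ⟨v, F, hv, h1, h2⟩ := h (ε / 2) (by positivity)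
  obtain ⟨φ, hφ, h3, h4⟩ := hv.2.2 (ε / 2) (by positivity)
  refine ⟨φ, hφ, ?_, fun k => ?_⟩
  · have := nrm_add_le (hu.sub hv.1) (hv.1.sub (hφ.memLp 2))
    simp only [Pi.sub_apply, sub_add_sub_cancel] at this
    have e : nrmOn U (u - v) < ε / 2 := h1
    have e' : nrmOn U (v - φ) < ε / 2 := h3
    linarith
  · have := nrm_add_le ((hG k).sub (hv.2.1 k)) ((hv.2.1 k).sub (hφ.memLp_partialDeriv k 2))
    simp only [Pi.sub_apply, sub_add_sub_cancel] at this
    have e : nrmOn U (G k - F k) < ε / 2 := h2 k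
    have e' : nrmOn U (F k - partialDeriv k φ) < ε / 2 := h4 k
    linarith

lemma InH10.h10NormSq_eq (hU : IsOpen U) (h : InH10 U u G) :
    h10NormSq U u = ENNReal.ofReal (∑ k, nrmOn U (G k) ^ 2) := by
  rw [h10NormSq, ENNReal.ofReal_sum_of_nonneg fun k _ => sq_nonneg _]
  refine Finset.sum_congr rfl fun k _ => ?_
  have hae := (h.isWeakDeriv k).weakDeriv_ae_eq hU
  rw [l2NormSq, eLpNorm_congr_ae hae, eLpNorm_sq_eq (h.2.1 k)]

end Weak


/-! ### Boxes and hyperplanes -/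

section Boxes

variable {d : ℕ}

/-- The hyperplane `x_k = c`. -/
def hyperplane (k : Fin d) (c : ℝ) : Set (E d) := {x | x k = c}

lemma continuous_coord (k : Fin d) : Continuous fun x : E d => x k := by fun_prop

lemma volume_hyperplane (k : Fin d) (c : ℝ) : volume (hyperplane k c) = 0 := by
  have h := (PiLp.volume_preserving_ofLp (Fin d)).measure_preimage
    (s := {f : Fin d → ℝ | f k = c})
    (measurableSet_eq_fun (measurable_pi_apply k) measurable_const).nullMeasurableSet
  rw [show hyperplane k c = WithLp.ofLp ⁻¹' {f : Fin d → ℝ | f k = c} from rfl, h]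
  exact Measure.pi_hyperplane (fun _ : Fin d => (volume : Measure ℝ)) k c

variable {lo hi : Fin d → ℝ}

lemma isOpen_openBox : IsOpen (openBox lo hi) := by
  simp only [openBox, ofPred_forall]
  exact isOpen_iInter_of_finite fun k =>
    (isOpen_lt continuous_const (continuous_coord k)).inter
      (isOpen_lt (continuous_coord k) continuous_const)

lemma closure_openBox_subset : closure (openBox lo hi) ⊆ {x | ∀ k, lo k ≤ x k ∧ x k ≤ hi k} := by
  refine closure_minimal (fun x hx k => ⟨(hx k).1.le, (hx k).2.le⟩) ?_
  simp only [ofPred_forall]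
  exact isClosed_iInter fun k =>
    (isClosed_le continuous_const (continuous_coord k)).inter
      (isClosed_le (continuous_coord k) continuous_const)

lemma frontier_openBox_subset :
    frontier (openBox lo hi) ⊆ ⋃ k, (hyperplane k (lo k) ∪ hyperplane k (hi k)) := by
  intro x hx
  rw [isOpen_openBox.frontier_eq] at hx
  have h1 := closure_openBox_subset hx.1
  by_contra h
  simp only [mem_iUnion, mem_union, not_exists, not_or] at h
  exact hx.2 fun k => ⟨lt_of_le_of_ne (h1 k).1 fun e => (h k).1 e.symm,
    lt_of_le_of_ne (h1 k).2 fun e => (h k).2 e⟩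

end Boxes

/-! ### Faces, interfaces and the piecewise constant coefficient -/

namespace BoxPartition

variable {d I : ℕ} (D : BoxPartition d I)

lemma isOpen_dom : IsOpen D.dom := isOpen_openBox

lemma isOpen_sub (i : Fin I) : IsOpen (D.sub i) := isOpen_openBox

/-- The union of the hyperplanes spanned by the faces of the subdomains. -/
def facePlanes : Set (E d) :=
  ⋃ i, ⋃ k, (hyperplane k (D.subLo i k) ∪ hyperplane k (D.subHi i k))

lemma frontier_sub_subset (i : Fin I) : frontier (D.sub i) ⊆ D.facePlanes :=
  frontier_openBox_subset.trans (subset_iUnion_of_subset i Subset.rfl)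

lemma volume_facePlanes : volume D.facePlanes = 0 := by
  refine measure_iUnion_null fun i => measure_iUnion_null fun k => ?_
  exact measure_union_null (volume_hyperplane _ _) (volume_hyperplane _ _)

lemma interfaces_subset : D.interfaces ⊆ D.facePlanes := by
  refine iUnion_subset fun i => iUnion_subset fun _ => iUnion_subset fun _ => ?_
  exact inter_subset_left.trans (D.frontier_sub_subset i)

lemma isClosed_interfaces : IsClosed D.interfaces :=
  isClosed_iUnion_of_finite fun _ => isClosed_iUnion_of_finite fun _ =>
    isClosed_iUnion_of_finite fun _ => isClosed_frontier.inter isClosed_frontier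

lemma volume_interfaces : volume D.interfaces = 0 :=
  measure_mono_null D.interfaces_subset D.volume_facePlanes

lemma isOpen_dom_diff : IsOpen (D.dom \ D.interfaces) := D.isOpen_dom.sdiff D.isClosed_interfaces

lemma dom_ae_eq_diff : D.dom =ᵐ[volume] (D.dom \ D.interfaces : Set (E d)) :=
  (sdiff_null_ae_eq_self D.volume_interfaces).symm

lemma restrict_dom_diff : volume.restrict (D.dom \ D.interfaces) = volume.restrict D.dom :=
  (Measure.restrict_congr_set D.dom_ae_eq_diff).symm

lemma coeff_eq (p : Fin I → ℝ) {i : Fin I} {x : E d} (hx : x ∈ D.sub i) : D.coeff p x = p i := by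
  rw [coeff, Finset.sum_eq_single i]
  · simp [hx]
  · intro j _ hj
    exact indicator_of_notMem (fun h => (disjoint_left.1 (D.disjoint j i hj)) h hx) _
  · simp

lemma exists_mem_sub {x : E d} (hx : x ∈ D.dom) (hx' : x ∉ D.facePlanes) : ∃ i, x ∈ D.sub i := by
  have h : x ∈ ⋃ i, closure (openBox (D.subLo i) (D.subHi i)) := by
    rw [D.cover]; exact subset_closure hx
  obtain ⟨i, hi⟩ := mem_iUnion.1 h
  refine ⟨i, by_contra fun hni => hx' (D.frontier_sub_subset i ?_)⟩
  rw [(D.isOpen_sub i).frontier_eq]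
  exact ⟨hi, hni⟩

lemma measurable_coeff (p : Fin I → ℝ) : Measurable (D.coeff p) := by
  have : D.coeff p = fun x => ∑ i, (D.sub i).indicator (fun _ => p i) x := rfl
  rw [this]
  exact Finset.measurable_sum _ fun i _ =>
    measurable_const.indicator (D.isOpen_sub i).measurableSet

lemma ae_coeff_mem {p : Fin I → ℝ} {pmin pmax : ℝ} (hp : ∀ i, pmin ≤ p i ∧ p i ≤ pmax) :
    ∀ᵐ x ∂volume.restrict D.dom, pmin ≤ D.coeff p x ∧ D.coeff p x ≤ pmax := by
  rw [ae_restrict_iff' D.isOpen_dom.measurableSet]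
  have : ∀ᵐ x : E d, x ∉ D.facePlanes := measure_eq_zero_iff_ae_notMem.1 D.volume_facePlanes
  filter_upwards [this] with x hx hxd
  obtain ⟨i, hi⟩ := D.exists_mem_sub hxd hx
  rw [D.coeff_eq p hi]
  exact hp i

/-- This holds at every point, because off the open subdomains the coefficient is `0`. For the same
reason the lower bound `pmin` is available only almost everywhere. -/
lemma abs_coeff_le {p : Fin I → ℝ} {pmin pmax : ℝ} (hpmin : 0 < pmin) (hpm : pmin ≤ pmax)
    (hp : ∀ i, pmin ≤ p i ∧ p i ≤ pmax) (x : E d) : |D.coeff p x| ≤ pmax := by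
  by_cases h : ∃ i, x ∈ D.sub i
  · obtain ⟨i, hi⟩ := h
    rw [D.coeff_eq p hi, abs_of_pos (hpmin.trans_le (hp i).1)]
    exact (hp i).2
  · push Not at h
    have : D.coeff p x = 0 := Finset.sum_eq_zero fun i _ => indicator_of_notMem (h i) _
    rw [this, abs_zero]
    linarith

lemma memLp_coeff_mul {p : Fin I → ℝ} {pmin pmax : ℝ} (hpmin : 0 < pmin) (hpm : pmin ≤ pmax)
    (hp : ∀ i, pmin ≤ p i ∧ p i ≤ pmax) {μ : Measure (E d)} {f : E d → ℝ} (hf : MemLp f 2 μ) :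
    MemLp (fun x => D.coeff p x * f x) 2 μ := by
  refine hf.of_le_mul (c := pmax) ((D.measurable_coeff p).aestronglyMeasurable.mul hf.1)
    (ae_of_all _ fun x => ?_)
  rw [norm_mul]
  exact mul_le_mul_of_nonneg_right (D.abs_coeff_le hpmin hpm hp x) (norm_nonneg _)

end BoxPartition

/-! ### Poincaré and trace inequalities for test functions -/

section Inequalities

variable {d : ℕ} {U : Set (E d)} {φ : E d → ℝ}

/-- The `L²` norm of the gradient. -/
def gradNorm (φ : E d → ℝ) : ℝ := √(∑ k, nrm volume (partialDeriv k φ) ^ 2)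

lemma gradNorm_nonneg : 0 ≤ gradNorm φ := Real.sqrt_nonneg _

lemma gradNorm_sq : gradNorm φ ^ 2 = ∑ k, nrm volume (partialDeriv k φ) ^ 2 :=
  Real.sq_sqrt (Finset.sum_nonneg fun _ _ => sq_nonneg _)

lemma nrm_partialDeriv_le_gradNorm (k : Fin d) : nrm volume (partialDeriv k φ) ≤ gradNorm φ := by
  refine Real.le_sqrt_of_sq_le ?_
  exact Finset.single_le_sum (f := fun k => nrm volume (partialDeriv k φ) ^ 2)
    (fun _ _ => sq_nonneg _) (Finset.mem_univ k)

lemma IsTestFunction.nrmOn_eq (hφ : IsTestFunction U φ) : nrmOn U φ = nrm volume φ := by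
  rw [nrmOn, nrm, nrm, setIntegral_eq_integral_of_forall_compl_eq_zero]
  intro x hx; simp [hφ.eq_zero_of_notMem hx]

lemma IsTestFunction.nrmOn_partialDeriv_eq (hφ : IsTestFunction U φ) (k : Fin d) :
    nrmOn U (partialDeriv k φ) = nrm volume (partialDeriv k φ) := by
  rw [nrmOn, nrm, nrm, setIntegral_eq_integral_of_forall_compl_eq_zero]
  intro x hx; simp [hφ.partialDeriv_eq_zero_of_notMem k hx]

lemma partialDeriv_sq (hφ : Differentiable ℝ φ) (k : Fin d) (x : E d) :
    partialDeriv k (fun x => φ x ^ 2) x = 2 * (φ x * partialDeriv k φ x) := by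
  have h : HasFDerivAt (fun x => φ x ^ 2) _ x := (hφ x).hasFDerivAt.pow 2
  simp only [partialDeriv, h.fderiv]
  simp
  ring

lemma IsTestFunction.sq (hφ : IsTestFunction U φ) : IsTestFunction U (fun x => φ x ^ 2) := by
  refine ⟨hφ.1.pow 2, ?_, ?_⟩
  · have := hφ.2.1.mul_left (f := φ)
    simp only [pow_two]
    exact this
  · simp only [pow_two]
    exact (tsupport_mul_subset_left).trans hφ.2.2

/-- Poincaré's inequality for test functions on a set which is bounded in one direction. -/
lemma IsTestFunction.poincare (hφ : IsTestFunction U φ) (k : Fin d) {lo hi : ℝ}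
    (hU : ∀ x ∈ U, lo < x k ∧ x k < hi) :
    nrm volume φ ≤ 2 * (hi - lo) * nrm volume (partialDeriv k φ) := by
  have hd : ∀ x, partialDeriv k (fun y : E d => y k - lo) x = 1 := by
    intro x
    have h : HasFDerivAt (fun y : E d => y k - lo) (EuclideanSpace.proj k : E d →L[ℝ] ℝ) x :=
      ((EuclideanSpace.proj k : E d →L[ℝ] ℝ).hasFDerivAt).sub_const lo
    simp [partialDeriv, h.fderiv]
  -- Write `φ² = φ² ∂ₖ(xₖ - lo)` and integrate by parts. Since `|xₖ - lo| ≤ hi - lo` on `U`,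
  -- Cauchy–Schwarz then gives the factor `2 (hi - lo)`.
  have h1 := integral_mul_partialDeriv_eq_neg (u := fun y : E d => y k - lo) (by fun_prop)
    hφ.sq.1 hφ.sq.2.1 k
  simp only [hd, one_mul, partialDeriv_sq hφ.differentiable] at h1
  have hm := hφ.memLp (μ := volume) 2
  have hm' := hφ.memLp_partialDeriv (μ := volume) k 2
  have hm2 : MemLp (fun x => |φ x|) 2 volume := hm.abs
  have hm2' : MemLp (fun x => |partialDeriv k φ x|) 2 volume := hm'.abs
  -- If `U` is empty, `hi - lo` may be negative, but then `φ = 0`.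
  rcases eq_empty_or_nonempty U with hUe | ⟨x₀, hx₀⟩
  · have : φ = fun _ => 0 := by
      ext x; exact hφ.eq_zero_of_notMem (by simp [hUe])
    have h0 : nrm volume φ = 0 := by rw [this]; simp [nrm]
    have h0' : nrm volume (partialDeriv k φ) = 0 := by rw [this]; simp [nrm, partialDeriv]
    rw [h0, h0', mul_zero]
  have hlh : lo < hi := (hU x₀ hx₀).1.trans (hU x₀ hx₀).2
  have h2 : ∫ x, φ x ^ 2 ≤ 2 * (hi - lo) * (nrm volume φ * nrm volume (partialDeriv k φ)) := by
    have e : ∫ x, φ x ^ 2 = ∫ x, -((x k - lo) * (2 * (φ x * partialDeriv k φ x))) := by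
      rw [integral_neg, h1, neg_neg]
    have e2 : nrm volume (fun x => |φ x|) = nrm volume φ := by simp [nrm]
    have e3 : nrm volume (fun x => |partialDeriv k φ x|) = nrm volume (partialDeriv k φ) := by
      simp [nrm]
    rw [e]
    have hi1 := integrable_mul_of_memLp hm2 hm2'
    calc _ ≤ ∫ x, 2 * (hi - lo) * (|φ x| * |partialDeriv k φ x|) := by
          refine integral_mono ?_ (hi1.const_mul _) fun x => ?_
          · refine Continuous.integrable_of_hasCompactSupport ?_ ?_
            · exact (((continuous_coord k).sub continuous_const).mul (continuous_const.mul
                (hφ.continuous.mul (hφ.continuous_partialDeriv k)))).neg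
            · exact (((hφ.2.1.mul_right (f' := partialDeriv k φ)).mul_left
                (f := fun _ => (2 : ℝ))).mul_left (f := fun x : E d => x k - lo)).neg
          · by_cases hx : x ∈ U
            · have h3 : |x k - lo| ≤ hi - lo := by
                rw [abs_of_pos (by linarith [(hU x hx).1])]
                linarith [(hU x hx).2]
              calc -((x k - lo) * (2 * (φ x * partialDeriv k φ x)))
                  ≤ |-((x k - lo) * (2 * (φ x * partialDeriv k φ x)))| := le_abs_self _
                _ = |x k - lo| * (2 * (|φ x| * |partialDeriv k φ x|)) := by
                  rw [abs_neg, abs_mul, abs_mul, abs_mul, abs_two]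
                _ ≤ (hi - lo) * (2 * (|φ x| * |partialDeriv k φ x|)) := by gcongr
                _ = _ := by ring
            · simp [hφ.eq_zero_of_notMem hx]
      _ ≤ _ := by
          rw [integral_const_mul]
          refine mul_le_mul_of_nonneg_left ?_ (by linarith)
          have := abs_integral_mul_le hm2 hm2'
          rw [e2, e3] at this
          exact (le_abs_self _).trans this
  rw [← nrm_sq] at h2
  have hn : 0 ≤ nrm volume φ := nrm_nonneg
  rcases hn.eq_or_lt with h | h
  · rw [← h]
    have : 0 ≤ nrm volume (partialDeriv k φ) := nrm_nonneg
    have : 0 ≤ hi - lo := by linarith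
    positivity
  · nlinarith

end Inequalities

/-! ### Traces on hyperplanes -/

section Trace

variable {n : ℕ} {φ : E (n + 1) → ℝ}

/-- The point with `k`-th coordinate `s` and the other coordinates `y`. -/
def insertCoord (k : Fin (n + 1)) (s : ℝ) (y : Fin n → ℝ) : E (n + 1) :=
  WithLp.toLp 2 (k.insertNth s y)

lemma insertCoord_eq (k : Fin (n + 1)) (s : ℝ) (y : Fin n → ℝ) :
    insertCoord k s y = insertCoord k 0 y + s • EuclideanSpace.single k (1 : ℝ) := by
  ext j
  rcases Fin.eq_self_or_eq_succAbove k j with rfl | ⟨i, rfl⟩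
  · simp [insertCoord]
  · simp [insertCoord, Fin.succAbove_ne]

lemma range_insertCoord (k : Fin (n + 1)) (c : ℝ) : range (insertCoord k c) = hyperplane k c := by
  ext x
  constructor
  · rintro ⟨y, rfl⟩
    simp [hyperplane, insertCoord]
  · intro hx
    refine ⟨fun j => x (k.succAbove j), ?_⟩
    ext j
    rcases Fin.eq_self_or_eq_succAbove k j with rfl | ⟨i, rfl⟩
    · simpa [insertCoord] using hx.symm
    · simp [insertCoord]

/-- `Fin n → ℝ` carries the sup metric, which agrees with the Euclidean metric of the hyperplane
only for `n ≤ 1`. This covers ambient dimensions one and two. -/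
lemma isometry_insertCoord (hn : n ≤ 1) (k : Fin (n + 1)) (c : ℝ) :
    Isometry (insertCoord k c) := by
  refine Isometry.of_dist_eq fun x y => ?_
  rw [EuclideanSpace.dist_eq, Fin.sum_univ_succAbove _ k]
  simp only [insertCoord, Fin.insertNth_apply_same, dist_self, Fin.insertNth_apply_succAbove]
  interval_cases n
  · simp [Subsingleton.elim x y]
  · simp only [Finset.univ_unique, Finset.sum_singleton]
    rw [zero_pow two_ne_zero, zero_add, Real.sqrt_sq dist_nonneg, dist_pi_def]
    simp

lemma lintegral_insertCoord (k : Fin (n + 1)) {f : E (n + 1) → ℝ≥0∞} (hf : Measurable f) :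
    ∫⁻ x, f x = ∫⁻ y : Fin n → ℝ, ∫⁻ s : ℝ, f (insertCoord k s y) := by
  have hf' : Measurable fun z : Fin (n + 1) → ℝ => f (WithLp.toLp 2 z) := hf.comp (by fun_prop)
  have h := ((volume_preserving_piFinSuccAbove (fun _ => ℝ) k).symm).lintegral_comp hf'
  rw [← (PiLp.volume_preserving_toLp (Fin (n + 1))).lintegral_comp hf, ← h,
    Measure.volume_eq_prod, lintegral_prod_symm']
  · rfl
  · exact hf'.comp (MeasurableEquiv.measurable _)

lemma continuous_insertCoord (k : Fin (n + 1)) (c : ℝ) : Continuous (insertCoord k c) := by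
  unfold insertCoord
  refine (PiLp.continuous_toLp 2 _).comp (continuous_pi fun j => ?_)
  rcases Fin.eq_self_or_eq_succAbove k j with rfl | ⟨i, rfl⟩
  · simpa using continuous_const
  · simpa using continuous_apply i

/-- Along each line in direction `k` the compactly supported function `φ²` is bounded by the
integral of `|∂ₖ φ²| = 2 |φ ∂ₖφ|`. Integrating over the remaining coordinates and applying
Cauchy–Schwarz gives a trace bound of product form. -/
lemma IsTestFunction.lintegral_insertCoord_le {U : Set (E (n + 1))} (hφ : IsTestFunction U φ)
    (k : Fin (n + 1)) (c : ℝ) :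
    ∫⁻ y : Fin n → ℝ, ENNReal.ofReal (φ (insertCoord k c y) ^ 2)
      ≤ ENNReal.ofReal (2 * (nrm volume φ * nrm volume (partialDeriv k φ))) := by
  have hm := (hφ.memLp (μ := volume) 2).abs
  have hm' := (hφ.memLp_partialDeriv (μ := volume) k 2).abs
  have e2 : nrm volume |φ| = nrm volume φ := by simp [nrm]
  have e3 : nrm volume |partialDeriv k φ| = nrm volume (partialDeriv k φ) := by simp [nrm]
  have hint := integrable_mul_of_memLp hm hm'
  have h1 : ∀ y : Fin n → ℝ, ENNReal.ofReal (φ (insertCoord k c y) ^ 2)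
      ≤ ∫⁻ s : ℝ, ENNReal.ofReal (2 * (|φ (insertCoord k s y)| *
        |partialDeriv k φ (insertCoord k s y)|)) := by
    intro y
    have hd : ∀ s, HasDerivAt (fun s => insertCoord k s y)
        (EuclideanSpace.single k (1 : ℝ)) s := by
      intro s
      rw [show (fun s => insertCoord k s y) = fun s => insertCoord k 0 y +
        s • EuclideanSpace.single k (1 : ℝ) from funext fun s => insertCoord_eq k s y]
      simpa using ((hasDerivAt_id s).smul_const (EuclideanSpace.single k (1 : ℝ))).const_add
        (insertCoord k 0 y)
    have hc : ContDiff ℝ ∞ fun s => insertCoord k s y := by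
      rw [show (fun s => insertCoord k s y) = fun s => insertCoord k 0 y +
        s • EuclideanSpace.single k (1 : ℝ) from funext fun s => insertCoord_eq k s y]
      fun_prop
    have hiso : Isometry fun s => insertCoord k s y := by
      refine Isometry.of_dist_eq fun s t => ?_
      rw [insertCoord_eq k s, insertCoord_eq k t, dist_add_left, dist_eq_norm, ← sub_smul,
        norm_smul]
      simp [dist_eq_norm]
    have hf : ContDiff ℝ 1 fun s => φ (insertCoord k s y) ^ 2 :=
      ((hφ.1.comp hc).pow 2).of_le (by simp)
    have hs : HasCompactSupport fun s => φ (insertCoord k s y) ^ 2 :=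
      hφ.sq.2.1.comp_isClosedEmbedding hiso.isClosedEmbedding
    have := hs.enorm_le_lintegral_Ici_deriv hf c
    rw [Real.enorm_eq_ofReal_abs, abs_of_nonneg (sq_nonneg _)] at this
    refine this.trans ((lintegral_mono' Measure.restrict_le_self le_rfl).trans
      (lintegral_mono fun s => ?_))
    have hds : HasDerivAt (fun s => φ (insertCoord k s y) ^ 2)
        (2 * (φ (insertCoord k s y) * partialDeriv k φ (insertCoord k s y))) s := by
      have := ((hφ.sq.differentiable (insertCoord k s y)).hasFDerivAt).comp_hasDerivAt s (hd s)
      rw [← partialDeriv_sq hφ.differentiable]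
      exact this
    rw [hds.deriv, Real.enorm_eq_ofReal_abs, abs_mul, abs_mul, abs_two]
  calc _ ≤ _ := lintegral_mono h1
    _ = ∫⁻ x, ENNReal.ofReal (2 * (|φ x| * |partialDeriv k φ x|)) := by
      rw [lintegral_insertCoord k]
      exact (ENNReal.continuous_ofReal.comp (continuous_const.mul
        (hφ.continuous.abs.mul (hφ.continuous_partialDeriv k).abs))).measurable
    _ = ENNReal.ofReal (∫ x, 2 * (|φ x| * |partialDeriv k φ x|)) :=
      (ofReal_integral_eq_lintegral_ofReal (hint.const_mul 2)
        (ae_of_all _ fun _ => mul_nonneg two_pos.le (mul_nonneg (abs_nonneg _) (abs_nonneg _)))).symm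
    _ ≤ _ := by
      refine ENNReal.ofReal_le_ofReal ?_
      rw [integral_const_mul]
      have := (le_abs_self _).trans (abs_integral_mul_le hm hm')
      rw [e2, e3] at this
      exact mul_le_mul_of_nonneg_left this (by norm_num)

/-- An isometric parametrization carries Hausdorff measure to Hausdorff measure, and on `Fin n → ℝ`
the `n`-dimensional one is Lebesgue measure. -/
lemma lintegral_hyperplane (hn : n ≤ 1) (k : Fin (n + 1)) (c : ℝ) {f : E (n + 1) → ℝ≥0∞}
    (hf : Measurable f) :
    ∫⁻ x in hyperplane k c, f x ∂(Measure.hausdorffMeasure (((n + 1 : ℕ) : ℝ) - 1))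
      = ∫⁻ y : Fin n → ℝ, f (insertCoord k c y) := by
  have h := (isometry_insertCoord hn k c).map_hausdorffMeasure (d := (n : ℝ)) (Or.inl (by simp))
  have h2 : (Measure.hausdorffMeasure (n : ℝ) : Measure (Fin n → ℝ)) = volume := by
    simpa using hausdorffMeasure_pi_real (ι := Fin n)
  rw [h2, range_insertCoord] at h
  have h3 : (((n + 1 : ℕ) : ℝ) - 1) = n := by push_cast; ring
  rw [h3, ← h, lintegral_map hf (continuous_insertCoord k c).measurable]

/-- The trace inequality on the interfaces, for test functions. -/
lemma BoxPartition.exists_trace_bound {I : ℕ} (hn : n ≤ 1) (D : BoxPartition (n + 1) I) :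
    ∃ C : ℝ, 0 < C ∧ ∀ φ, IsTestFunction D.dom φ → MemLp φ 2 D.surfaceMeasure ∧
      nrm D.surfaceMeasure φ ≤ C * gradNorm φ := by
  set L := ∑ k, (D.hi k - D.lo k) with hL
  have hk : ∀ k, D.hi k - D.lo k ≤ L := fun k =>
    Finset.single_le_sum (f := fun k => D.hi k - D.lo k)
      (fun j _ => sub_nonneg.2 (D.lo_lt_hi j).le) (Finset.mem_univ k)
  have hL0 : 0 < L := (sub_pos.2 (D.lo_lt_hi 0)).trans_le (hk 0)
  -- `N` counts the face planes: two for every subdomain and coordinate direction. The trace is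
  -- estimated on whole planes, which contain the interfaces.
  set N : ℝ := ∑ i : Fin I, ∑ k : Fin (n + 1), (2 : ℝ) with hN
  have hN0 : 0 ≤ N := by positivity
  refine ⟨√(N * (4 * L)) + 1, by positivity, fun φ hφ => ?_⟩
  have hb : ∀ k c, ∫⁻ x in hyperplane k c, ENNReal.ofReal (φ x ^ 2)
      ∂(Measure.hausdorffMeasure (((n + 1 : ℕ) : ℝ) - 1))
      ≤ ENNReal.ofReal (4 * L * gradNorm φ ^ 2) := by
    intro k c
    have hmeas : Measurable fun x => ENNReal.ofReal (φ x ^ 2) :=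
      (ENNReal.continuous_ofReal.comp (hφ.continuous.pow 2)).measurable
    rw [lintegral_hyperplane hn k c hmeas]
    refine (hφ.lintegral_insertCoord_le k c).trans (ENNReal.ofReal_le_ofReal ?_)
    have h1 := hφ.poincare k (fun x hx => hx k)
    have h2 := nrm_partialDeriv_le_gradNorm (φ := φ) k
    have h3 : 0 ≤ nrm volume (partialDeriv k φ) := nrm_nonneg
    have h4 : nrm volume φ ≤ 2 * L * gradNorm φ := by
      refine h1.trans (mul_le_mul (by linarith [hk k]) h2 h3 (by linarith))
    nlinarith [mul_le_mul h4 h2 h3 (mul_nonneg (by linarith : 0 ≤ 2 * L) (gradNorm_nonneg (φ := φ)))]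
  have htot : ∫⁻ x, ENNReal.ofReal (φ x ^ 2) ∂D.surfaceMeasure
      ≤ ENNReal.ofReal (N * (4 * L) * gradNorm φ ^ 2) := by
    calc _ ≤ ∫⁻ x in D.facePlanes, ENNReal.ofReal (φ x ^ 2)
          ∂(Measure.hausdorffMeasure (((n + 1 : ℕ) : ℝ) - 1)) :=
          lintegral_mono_set D.interfaces_subset
      _ ≤ ∑ i : Fin I, ∑ k : Fin (n + 1), 2 * ENNReal.ofReal (4 * L * gradNorm φ ^ 2) := by
          refine (lintegral_iUnion_le _ _).trans ?_
          rw [tsum_fintype]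
          refine Finset.sum_le_sum fun i _ => (lintegral_iUnion_le _ _).trans ?_
          rw [tsum_fintype]
          refine Finset.sum_le_sum fun k _ => (lintegral_union_le _ _ _).trans ?_
          rw [two_mul]
          exact add_le_add (hb _ _) (hb _ _)
      _ = _ := by
          rw [mul_assoc N, ENNReal.ofReal_mul hN0, hN]
          generalize ENNReal.ofReal (4 * L * gradNorm φ ^ 2) = X
          simp only [Finset.sum_const, Finset.card_univ, Fintype.card_fin, nsmul_eq_mul]
          rw [ENNReal.ofReal_mul (by positivity), ENNReal.ofReal_mul (by positivity),
            ENNReal.ofReal_natCast, ENNReal.ofReal_natCast, ENNReal.ofReal_ofNat]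
          ring
  have hmem : MemLp φ 2 D.surfaceMeasure := by
    refine memLp_of_eLpNorm_ne_top hφ.continuous.aestronglyMeasurable ?_
    rw [eLpNorm_sq_eq_lintegral]
    exact ne_top_of_le_ne_top ENNReal.ofReal_ne_top htot
  refine ⟨hmem, ?_⟩
  rw [← eLpNorm_sq_eq_lintegral, eLpNorm_sq_eq hmem,
    ENNReal.ofReal_le_ofReal_iff (by positivity)] at htot
  have hg := gradNorm_nonneg (φ := φ)
  calc nrm D.surfaceMeasure φ ≤ √(N * (4 * L)) * gradNorm φ := by
        refine (sq_le_sq₀ nrm_nonneg (by positivity)).1 ?_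
        rw [mul_pow, Real.sq_sqrt (by positivity)]
        exact htot
    _ ≤ _ := by nlinarith

end Trace


/-! ### The energy estimate -/

namespace BoxPartition

variable {d I : ℕ} (D : BoxPartition d I) {p : Fin I → ℝ} {pmin pmax : ℝ}

lemma integrable_coeff_mul_sum (hpmin : 0 < pmin) (hpm : pmin ≤ pmax)
    (hp : ∀ i, pmin ≤ p i ∧ p i ≤ pmax) {G F : Fin d → E d → ℝ} (hG : ∀ k, MemL2 D.dom (G k))
    (hF : ∀ k, MemL2 D.dom (F k)) :
    Integrable (fun x => D.coeff p x * ∑ k, G k x * F k x) (volume.restrict D.dom) := by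
  simp only [Finset.mul_sum, ← mul_assoc]
  exact integrable_finsetSum _ fun k _ =>
    integrable_mul_of_memLp (D.memLp_coeff_mul hpmin hpm hp (hG k)) (hF k)

lemma integral_coeff_mul_sum (hpmin : 0 < pmin) (hpm : pmin ≤ pmax)
    (hp : ∀ i, pmin ≤ p i ∧ p i ≤ pmax) {G F : Fin d → E d → ℝ} (hG : ∀ k, MemL2 D.dom (G k))
    (hF : ∀ k, MemL2 D.dom (F k)) :
    ∫ x in D.dom, D.coeff p x * ∑ k, G k x * F k x
      = ∑ k, ∫ x in D.dom, (D.coeff p x * G k x) * F k x := by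
  simp only [Finset.mul_sum, ← mul_assoc]
  exact integral_finsetSum _ fun k _ =>
    integrable_mul_of_memLp (D.memLp_coeff_mul hpmin hpm hp (hG k)) (hF k)

/-- A bound of the energy functional on test functions controls the `H¹₀` norm. -/
lemma energy_bound (hpmin : 0 < pmin) (hpm : pmin ≤ pmax) (hp : ∀ i, pmin ≤ p i ∧ p i ≤ pmax)
    {e : E d → ℝ} {G : Fin d → E d → ℝ} (he : InH10 D.dom e G) {B : ℝ} (hB : 0 ≤ B)
    (h : ∀ φ, IsTestFunction D.dom φ →
      |∫ x in D.dom, D.coeff p x * ∑ k, G k x * partialDeriv k φ x| ≤ B * gradNorm φ) :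
    pmin * √(∑ k, nrmOn D.dom (G k) ^ 2) ≤ B := by
  set a : Fin d → ℝ := fun k => nrmOn D.dom (G k) with ha
  have ha0 : ∀ k, 0 ≤ a k := fun k => nrm_nonneg
  set g := √(∑ k, a k ^ 2) with hg
  have hg2 : g ^ 2 = ∑ k, a k ^ 2 := Real.sq_sqrt (Finset.sum_nonneg fun _ _ => sq_nonneg _)
  -- The error itself is not an admissible test function. The hypothesis is used for an `ε`-close
  -- test function, the difference is paid for by the last term, and `ε → 0` afterwards.
  have key : ∀ ε : ℝ, 0 < ε → pmin * g ^ 2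
      ≤ B * √(∑ k, (a k + ε) ^ 2) + pmax * ε * ∑ k, a k := by
    intro ε hε
    obtain ⟨φ, hφ, -, h2⟩ := he.2.2 ε hε
    have hm : ∀ k, MemL2 D.dom (partialDeriv k φ) := fun k => hφ.memLp_partialDeriv k 2
    have hδ : ∀ k, MemL2 D.dom (fun x => G k x - partialDeriv k φ x) := fun k =>
      memLp_sub (he.2.1 k) (hm k)
    have e1 : ∫ x in D.dom, D.coeff p x * ∑ k, G k x * G k x
        = (∫ x in D.dom, D.coeff p x * ∑ k, G k x * partialDeriv k φ x)
          + ∫ x in D.dom, D.coeff p x * ∑ k, G k x * (G k x - partialDeriv k φ x) := by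
      rw [← integral_add (D.integrable_coeff_mul_sum hpmin hpm hp he.2.1 hm)
        (D.integrable_coeff_mul_sum hpmin hpm hp he.2.1 hδ)]
      refine integral_congr_ae (ae_of_all _ fun x => ?_)
      simp only [← mul_add, ← Finset.sum_add_distrib]
      congr 1
      exact Finset.sum_congr rfl fun k _ => by ring
    have e2 : pmin * g ^ 2 ≤ ∫ x in D.dom, D.coeff p x * ∑ k, G k x * G k x := by
      have : pmin * g ^ 2 = ∫ x in D.dom, pmin * ∑ k, G k x * G k x := by
        rw [hg2, integral_const_mul, integral_finsetSum _ fun k _ =>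
          integrable_mul_of_memLp (he.2.1 k) (he.2.1 k)]
        congr 1
        refine Finset.sum_congr rfl fun k _ => ?_
        rw [ha, nrm_sq]
        simp only [pow_two]
      rw [this]
      refine integral_mono_ae ?_ (D.integrable_coeff_mul_sum hpmin hpm hp he.2.1 he.2.1) ?_
      · exact (integrable_finsetSum _ fun k _ =>
          integrable_mul_of_memLp (he.2.1 k) (he.2.1 k)).const_mul _
      · filter_upwards [D.ae_coeff_mem hp] with x hx
        exact mul_le_mul_of_nonneg_right hx.1 (Finset.sum_nonneg fun k _ => mul_self_nonneg _)
    have e3 : ∫ x in D.dom, D.coeff p x * ∑ k, G k x * (G k x - partialDeriv k φ x)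
        ≤ pmax * ε * ∑ k, a k := by
      rw [D.integral_coeff_mul_sum hpmin hpm hp he.2.1 hδ, Finset.mul_sum]
      refine Finset.sum_le_sum fun k _ => ?_
      have h3 := (le_abs_self _).trans (abs_integral_mul_le
        (D.memLp_coeff_mul hpmin hpm hp (he.2.1 k)) (hδ k))
      have h4 : nrmOn D.dom (fun x => D.coeff p x * G k x) ≤ pmax * a k := by
        have : pmax * a k = nrmOn D.dom (fun x => pmax * G k x) := by
          rw [nrmOn, nrm_const_mul, abs_of_pos (hpmin.trans_le hpm)]
        rw [this]
        refine nrm_mono ((he.2.1 k).const_mul _) (ae_of_all _ fun x => ?_)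
        rw [abs_mul, abs_mul, abs_of_pos (hpmin.trans_le hpm)]
        exact mul_le_mul_of_nonneg_right (D.abs_coeff_le hpmin hpm hp x) (abs_nonneg _)
      calc _ ≤ _ := h3
        _ ≤ (pmax * a k) * ε := mul_le_mul h4 (h2 k).le nrm_nonneg
          (mul_nonneg (hpmin.le.trans hpm) (ha0 k))
        _ = _ := by ring
    have e4 : gradNorm φ ≤ √(∑ k, (a k + ε) ^ 2) := by
      refine Real.sqrt_le_sqrt (Finset.sum_le_sum fun k _ => ?_)
      refine pow_le_pow_left₀ nrm_nonneg ?_ 2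
      rw [← hφ.nrmOn_partialDeriv_eq]
      have := nrm_sub_le (he.2.1 k) (hδ k)
      simp only [sub_sub_cancel] at this
      exact this.trans (add_le_add le_rfl (h2 k).le)
    have e5 := (le_abs_self _).trans (h φ hφ)
    have e6 := mul_le_mul_of_nonneg_left e4 hB
    linarith
  have hlim : pmin * g ^ 2 ≤ B * g := by
    have hc : Continuous fun ε : ℝ => B * √(∑ k, (a k + ε) ^ 2) + pmax * ε * ∑ k, a k := by
      fun_prop
    have := (hc.tendsto 0).mono_left (nhdsWithin_le_nhds (s := Ioi 0))
    simp only [add_zero, mul_zero, zero_mul] at this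
    refine ge_of_tendsto this ?_
    filter_upwards [self_mem_nhdsWithin] with ε hε using key ε hε
  have hg0 : 0 ≤ g := Real.sqrt_nonneg _
  rcases hg0.eq_or_lt with h0 | h0
  · rw [← h0, mul_zero]; exact hB
  · nlinarith

/-- The a posteriori estimate for the sum of a function `ur`, which is smooth on the subdomains, and
a function `s` with gradient `Gs` such that `-div (p Gs) = p S` up to an error of size `Es`. -/
lemma residual_estimate (hpmin : 0 < pmin) (hpm : pmin ≤ pmax) {Θ : ℝ} (hΘ : 0 < Θ) (k₀ : Fin d)
    {Ct : ℝ} (hCt : 0 < Ct)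
    (htr : ∀ φ, IsTestFunction D.dom φ → MemLp φ 2 D.surfaceMeasure ∧
      nrm D.surfaceMeasure φ ≤ Ct * gradNorm φ) :
    ∃ C : ℝ, 0 < C ∧ ∀ p : Fin I → ℝ, (∀ i, pmin ≤ p i ∧ p i ≤ pmax) →
      ∀ l u ur S s : E d → ℝ, ∀ Gs : Fin d → E d → ℝ, ∀ Es : ℝ, MemL2 D.dom l →
      D.IsWeakSolution p l u → MemH10 D.dom ur → MemH2 (D.dom \ D.interfaces) ur →
      MemL2 D.dom S → InH10 D.dom s Gs → 0 ≤ Es →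
      (∀ φ, IsTestFunction D.dom φ →
        |(∫ x in D.dom, D.coeff p x * ∑ k, Gs k x * partialDeriv k φ x)
          + ∫ x in D.dom, D.coeff p x * S x * φ x| ≤ Es * gradNorm φ) →
      h10NormSq D.dom (fun x => ur x + s x - u x)
        ≤ ENNReal.ofReal C * (D.residual Θ p l ur S + ENNReal.ofReal (Es ^ 2)) := by
  set Cp := 2 * (D.hi k₀ - D.lo k₀) with hCp
  have hCp0 : 0 < Cp := by
    have := D.lo_lt_hi k₀
    simp only [hCp]; linarith
  -- The `3` comes from squaring a sum of three terms and `pmin²` from coercivity. Division by `Θ`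
  -- undoes the weight of the jump term in the loss.
  set C := 3 / pmin ^ 2 * (Ct ^ 2 / Θ + Cp ^ 2 + 1) with hC
  have hC0 : 0 < C := by positivity
  refine ⟨C, hC0, fun p hp l u ur S s Gs Es hl hu hur hur2 hS hs hEs herr => ?_⟩
  have hlap : MemL2 D.dom (weakLaplacian (D.dom \ D.interfaces) ur) := by
    have := hur2.memLp_weakLaplacian
    rwa [MemL2, D.restrict_dom_diff] at this
  set R : E d → ℝ := fun x =>
    D.coeff p x * (weakLaplacian (D.dom \ D.interfaces) ur x + S x) + l x with hR
  have hRm : MemL2 D.dom R := (D.memLp_coeff_mul hpmin hpm hp (hlap.add hS)).add hl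
  have he := (hur.inH10.add hs).sub hu.1.inH10
  rw [he.h10NormSq_eq D.isOpen_dom, residual, l2NormSq, eLpNorm_sq_eq hRm, fluxJumpNormSq]
  have hΘ0 : ENNReal.ofReal Θ ≠ 0 := by simpa using hΘ
  have hC0' : ENNReal.ofReal C ≠ 0 := by simpa using hC0
  -- The infimum over all jumps is pulled to the front, so that one jump `j` can be fixed. If no
  -- jump exists, the right side is `∞`.
  simp only [ENNReal.mul_iInf_of_ne hΘ0 ENNReal.ofReal_ne_top, ENNReal.add_iInf,
    ENNReal.iInf_add, ENNReal.mul_iInf_of_ne hC0' ENNReal.ofReal_ne_top]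
  refine le_iInf₂ fun j hj => ?_
  rw [eLpNorm_sq_eq hj.1, ← ENNReal.ofReal_mul hΘ.le, ← ENNReal.ofReal_add (sq_nonneg _)
    (by positivity), ← ENNReal.ofReal_add (by positivity) (by positivity),
    ← ENNReal.ofReal_mul hC0.le]
  refine ENNReal.ofReal_le_ofReal ?_
  set nj := nrm D.surfaceMeasure j with hnj
  have hnj0 : 0 ≤ nj := nrm_nonneg
  set nR := nrm (volume.restrict D.dom) R with hnR
  have hnR0 : 0 ≤ nR := nrm_nonneg
  have hen := D.energy_bound hpmin hpm hp he (B := Ct * nj + Cp * nR + Es) (by positivity) ?_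
  · set g := √(∑ k, nrmOn D.dom (fun x => weakDeriv D.dom k ur x + Gs k x
      - weakDeriv D.dom k u x) ^ 2) with hg
    have hg2 : g ^ 2 = ∑ k, nrmOn D.dom (fun x => weakDeriv D.dom k ur x + Gs k x
      - weakDeriv D.dom k u x) ^ 2 := Real.sq_sqrt (Finset.sum_nonneg fun _ _ => sq_nonneg _)
    rw [← hg2]
    have hg0 : 0 ≤ g := Real.sqrt_nonneg _
    have h1 : (pmin * g) ^ 2 ≤ (Ct * nj + Cp * nR + Es) ^ 2 :=
      pow_le_pow_left₀ (by positivity) hen 2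
    have h2 : (Ct * nj + Cp * nR + Es) ^ 2
        ≤ 3 * (Ct ^ 2 * nj ^ 2 + Cp ^ 2 * nR ^ 2 + Es ^ 2) := by
      nlinarith [sq_nonneg (Ct * nj - Cp * nR), sq_nonneg (Ct * nj - Es),
        sq_nonneg (Cp * nR - Es)]
    have h3 : Ct ^ 2 * nj ^ 2 + Cp ^ 2 * nR ^ 2 + Es ^ 2
        ≤ (Ct ^ 2 / Θ + Cp ^ 2 + 1) * (nR ^ 2 + Θ * nj ^ 2 + Es ^ 2) := by
      have e : Ct ^ 2 * nj ^ 2 = Ct ^ 2 / Θ * (Θ * nj ^ 2) := by field_simp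
      rw [e]
      have a1 : 0 ≤ Ct ^ 2 / Θ := by positivity
      have a2 : 0 ≤ Cp ^ 2 := by positivity
      have a3 : 0 ≤ Θ * nj ^ 2 := by positivity
      have a4 : 0 ≤ nR ^ 2 := by positivity
      have a5 : 0 ≤ Es ^ 2 := by positivity
      nlinarith [mul_nonneg a1 a4, mul_nonneg a1 a5, mul_nonneg a2 a3, mul_nonneg a2 a5]
    have h4 : pmin ^ 2 * g ^ 2 ≤ 3 * ((Ct ^ 2 / Θ + Cp ^ 2 + 1) *
        (nR ^ 2 + Θ * nj ^ 2 + Es ^ 2)) := by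
      rw [← mul_pow]; linarith
    rw [hC, div_mul_eq_mul_div, div_mul_eq_mul_div, le_div_iff₀ (by positivity)]
    linarith
  · intro φ hφ
    have hm : ∀ k, MemL2 D.dom (partialDeriv k φ) := fun k => hφ.memLp_partialDeriv k 2
    have hφ2 : MemL2 D.dom φ := hφ.memLp 2
    obtain ⟨ht1, ht2⟩ := htr φ hφ
    have i1 := D.integrable_coeff_mul_sum hpmin hpm hp hur.inH10.2.1 hm
    have i2 := D.integrable_coeff_mul_sum hpmin hpm hp hs.2.1 hm
    have i3 := D.integrable_coeff_mul_sum hpmin hpm hp hu.1.inH10.2.1 hm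
    have e1 : ∫ x in D.dom, D.coeff p x * ∑ k, (weakDeriv D.dom k ur x + Gs k x
          - weakDeriv D.dom k u x) * partialDeriv k φ x
        = (∫ x in D.dom, D.coeff p x * ∑ k, weakDeriv D.dom k ur x * partialDeriv k φ x)
          + (∫ x in D.dom, D.coeff p x * ∑ k, Gs k x * partialDeriv k φ x)
          - ∫ x in D.dom, D.coeff p x * ∑ k, weakDeriv D.dom k u x * partialDeriv k φ x := by
      rw [← integral_add i1 i2, ← integral_sub _ i3]
      · refine integral_congr_ae (ae_of_all _ fun x => ?_)
        simp only [add_mul, sub_mul, Finset.sum_add_distrib, Finset.sum_sub_distrib, mul_add,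
          mul_sub]
      · exact i1.add i2
    have e2 := hj.2 φ hφ
    rw [D.restrict_dom_diff] at e2
    have e3 : ∫ x in D.dom, D.coeff p x * ∑ k, weakDeriv D.dom k u x * partialDeriv k φ x
        = ∫ x in D.dom, l x * φ x := by
      rw [← hu.2 φ (hφ.inH10.memH10 D.isOpen_dom)]
      refine integral_congr_ae ?_
      have : ∀ᵐ x ∂volume.restrict D.dom, ∀ k, weakDeriv D.dom k φ x = partialDeriv k φ x :=
        ae_all_iff.2 fun k => (hφ.isWeakDeriv k).weakDeriv_ae_eq D.isOpen_dom
      filter_upwards [this] with x hx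
      simp only [hx]
    have e4 : ∫ x in D.dom, R x * φ x
        = (∫ x in D.dom, D.coeff p x * weakLaplacian (D.dom \ D.interfaces) ur x * φ x)
          + (∫ x in D.dom, D.coeff p x * S x * φ x) + ∫ x in D.dom, l x * φ x := by
      have j1 := integrable_mul_of_memLp (D.memLp_coeff_mul hpmin hpm hp hlap) hφ2
      have j2 := integrable_mul_of_memLp (D.memLp_coeff_mul hpmin hpm hp hS) hφ2
      have j3 := integrable_mul_of_memLp hl hφ2
      rw [← integral_add j1 j2, ← integral_add _ j3]
      · refine integral_congr_ae (ae_of_all _ fun x => ?_)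
        simp only [hR]
        ring
      · exact j1.add j2
    -- The error equation: Green's formula trades `∫ p ∇ur·∇φ` for the jump term minus `∫ p Δur φ`.
    -- The term `∫ p S φ` is added and subtracted to complete the residual `R`.
    have e5 : ∫ x in D.dom, D.coeff p x * ∑ k, (weakDeriv D.dom k ur x + Gs k x
          - weakDeriv D.dom k u x) * partialDeriv k φ x
        = (∫ x, j x * φ x ∂D.surfaceMeasure) - (∫ x in D.dom, R x * φ x)
          + ((∫ x in D.dom, D.coeff p x * ∑ k, Gs k x * partialDeriv k φ x)
            + ∫ x in D.dom, D.coeff p x * S x * φ x) := by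
      rw [e1, e3, e4, e2]; ring
    rw [e5]
    have b1 : |∫ x, j x * φ x ∂D.surfaceMeasure| ≤ Ct * nj * gradNorm φ := by
      refine (abs_integral_mul_le hj.1 ht1).trans ?_
      calc _ ≤ nj * (Ct * gradNorm φ) := mul_le_mul_of_nonneg_left ht2 hnj0
        _ = _ := by ring
    have b2 : |∫ x in D.dom, R x * φ x| ≤ Cp * nR * gradNorm φ := by
      refine (abs_integral_mul_le hRm hφ2).trans ?_
      have h1 : nrm (volume.restrict D.dom) φ ≤ Cp * gradNorm φ := by
        rw [show nrm (volume.restrict D.dom) φ = nrm volume φ from hφ.nrmOn_eq]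
        refine (hφ.poincare k₀ (fun x hx => hx k₀)).trans ?_
        exact mul_le_mul_of_nonneg_left (nrm_partialDeriv_le_gradNorm k₀) hCp0.le
      calc _ ≤ nR * (Cp * gradNorm φ) := mul_le_mul_of_nonneg_left h1 hnR0
        _ = _ := by ring
    have b3 := herr φ hφ
    calc _ ≤ |∫ x, j x * φ x ∂D.surfaceMeasure| + |∫ x in D.dom, R x * φ x| + _ :=
          (abs_add_le _ _).trans (add_le_add (abs_sub _ _) le_rfl)
      _ ≤ Ct * nj * gradNorm φ + Cp * nR * gradNorm φ + Es * gradNorm φ :=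
          add_le_add (add_le_add b1 b2) b3
      _ = _ := by ring

lemma memH10_principal {N₁ N₂ : ℕ} {w : Fin N₁ → E d → ℝ} {v : Fin N₂ → E d → ℝ}
    (hw : ∀ n, D.MemSmooth (w n)) (hv : ∀ m, D.MemJump (v m)) (a : Fin N₁ → ℝ)
    (b : Fin N₂ → ℝ) : MemH10 D.dom (principal w v a b) := by
  have h1 := InH10.sum Finset.univ fun n _ => ((hw n).2.inH10).const_mul (a n)
  have h2 := InH10.sum Finset.univ fun m _ => ((hv m).2.inH10).const_mul (b m)
  exact (h1.add h2).memH10 D.isOpen_dom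

lemma memH2_sum {U : Set (E d)} (hU : IsOpen U) {ι : Type*} (s : Finset ι) {u : ι → E d → ℝ}
    (h : ∀ i ∈ s, MemH2 U (u i)) : MemH2 U (fun x => ∑ i ∈ s, u i x) := by
  classical
  induction s using Finset.induction_on with
  | empty =>
    have h0 : MemH1 U (fun _ => 0) := inH10_zero.memH1
    refine ⟨by simpa using h0, fun k => ?_⟩
    refine h0.congr ?_
    simpa using ((inH10_zero (U := U)).isWeakDeriv k |>.weakDeriv_ae_eq hU).symm
  | insert a s ha ih =>
    simp only [Finset.sum_insert ha]
    exact (h a (by simp)).add hU (ih fun i hi => h i (by simp [hi]))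

/-- The `w n` are `H²` across the interfaces and the `v m` only off them. Both belong to `H²(Ω \ Γ)`
because `Γ` is closed and null. -/
lemma memH2_principal {N₁ N₂ : ℕ} {w : Fin N₁ → E d → ℝ} {v : Fin N₂ → E d → ℝ}
    (hw : ∀ n, D.MemSmooth (w n)) (hv : ∀ m, D.MemJump (v m)) (a : Fin N₁ → ℝ)
    (b : Fin N₂ → ℝ) : MemH2 (D.dom \ D.interfaces) (principal w v a b) := by
  have h1 := memH2_sum D.isOpen_dom_diff Finset.univ fun n _ =>
    ((hw n).1.mono_of_null D.isOpen_dom_diff sdiff_subset D.dom_ae_eq_diff).const_mul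
      D.isOpen_dom_diff (a n)
  have h2 := memH2_sum D.isOpen_dom_diff Finset.univ fun m _ =>
    (hv m).1.const_mul D.isOpen_dom_diff (b m)
  exact h1.add D.isOpen_dom_diff h2

end BoxPartition

/-- The a posteriori estimate in one dimension. -/
theorem estimate_dim_one {I : ℕ} (D : BoxPartition 1 I) {Θ pmin pmax : ℝ} (hΘ : 0 < Θ)
    (hpmin : 0 < pmin) :
      ∃ C : ℝ, 0 < C ∧
      ∀ (N₁ N₂ : ℕ) (w : Fin N₁ → E 1 → ℝ) (v : Fin N₂ → E 1 → ℝ),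
        (∀ n, D.MemSmooth (w n)) → (∀ m, D.MemJump (v m)) →
      ∀ (P : Set (Fin I → ℝ)) (μ : Measure (Fin I → ℝ)),
        MeasurableSet P → (∀ p ∈ P, ∀ i, pmin ≤ p i ∧ p i ≤ pmax) →
      ∀ (l u : (Fin I → ℝ) → E 1 → ℝ),
        (∀ p ∈ P, MemL2 D.dom (l p)) → (∀ p ∈ P, D.IsWeakSolution p (l p) (u p)) →
      ∀ (a : (Fin I → ℝ) → Fin N₁ → ℝ) (b : (Fin I → ℝ) → Fin N₂ → ℝ),
        (∀ p ∈ P, ∀ a' b', D.residual Θ p (l p) (principal w v (a p) (b p)) 0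
          ≤ D.residual Θ p (l p) (principal w v a' b') 0) →
        ∫⁻ p in P, h10NormSq D.dom (fun x => principal w v (a p) (b p) x - u p x) ∂μ
          ≤ ENNReal.ofReal C *
            ∫⁻ p in P, (⨅ (a') (b'), D.residual Θ p (l p) (principal w v a' b') 0) ∂μ := by
  obtain ⟨Ct, hCt, htr⟩ := D.exists_trace_bound (n := 0) (by norm_num)
  -- Replacing `pmax` by `max pmin pmax` keeps the bounds on the coefficients and supplies an
  -- ordered pair without further assumption.
  obtain ⟨C, hC, hest⟩ := D.residual_estimate hpmin (le_max_left pmin pmax) hΘ 0 hCt htr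
  refine ⟨C, hC, fun N₁ N₂ w v hw hv P μ hP hPp l u hl hu a b hmin => ?_⟩
  rw [← lintegral_const_mul' _ _ ENNReal.ofReal_ne_top]
  refine setLIntegral_mono' hP fun p hp => ?_
  -- In one dimension the singular component, its source and its consistency error `Es` are all
  -- zero.
  have h := hest p (fun i => ⟨(hPp p hp i).1, (hPp p hp i).2.trans (le_max_right _ _)⟩) (l p) (u p)
    (principal w v (a p) (b p)) 0 (fun _ => 0) (fun _ _ => 0) 0 (hl p hp) (hu p hp)
    (D.memH10_principal hw hv _ _) (D.memH2_principal hw hv _ _) MemLp.zero inH10_zero le_rfl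
    (fun φ _ => by simp)
  simp only [add_zero, ne_eq, OfNat.ofNat_ne_zero, not_false_eq_true, zero_pow,
    ENNReal.ofReal_zero] at h
  refine h.trans ?_
  gcongr
  exact le_iInf₂ fun a' b' => hmin p hp a' b'


/-! ### Lipschitz functions with compact support belong to `H¹₀` -/

section Mollification

open Filter Topology ContinuousLinearMap

variable {d : ℕ} {h f : E d → ℝ}

/-- The convolution of `h` with a normalized bump function. -/
def mollify (φ : ContDiffBump (0 : E d)) (h : E d → ℝ) (x : E d) : ℝ :=
  ∫ t, φ.normed volume t * h (x - t)

lemma mollify_eq_convolution (φ : ContDiffBump (0 : E d)) (h : E d → ℝ) :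
    mollify φ h = convolution (φ.normed volume) h (lsmul ℝ ℝ) volume := rfl

lemma abs_mollify_le (φ : ContDiffBump (0 : E d)) {M : ℝ} (hM : ∀ x, |h x| ≤ M) (x : E d) :
    |mollify φ h x| ≤ M := by
  have h1 : ‖mollify φ h x‖ ≤ ∫ t, φ.normed volume t * M := by
    refine norm_integral_le_of_norm_le (φ.integrable_normed.mul_const M) (ae_of_all _ fun t => ?_)
    rw [norm_mul, Real.norm_of_nonneg (φ.nonneg_normed t)]
    exact mul_le_mul_of_nonneg_left (hM _) (φ.nonneg_normed t)
  rwa [integral_mul_const, φ.integral_normed, one_mul] at h1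

lemma mollify_eq_zero (φ : ContDiffBump (0 : E d)) {K : Set (E d)} (hK : ∀ x ∉ K, h x = 0)
    {x : E d} (hx : x ∉ Metric.cthickening φ.rOut K) : mollify φ h x = 0 := by
  refine integral_eq_zero_of_ae (ae_of_all _ fun t => ?_)
  by_cases ht : t ∈ Metric.ball (0 : E d) φ.rOut
  · have : x - t ∉ K := by
      intro hxt
      refine hx (Metric.mem_cthickening_of_dist_le x (x - t) _ _ hxt ?_)
      simpa using (mem_ball_zero_iff.1 ht).le
    simp [hK _ this]
  · rw [← φ.support_normed_eq (μ := volume), Function.notMem_support] at ht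
    simp [ht]

lemma integrable_of_bounded_compact (hm : Measurable h) {M : ℝ} (hM : ∀ x, |h x| ≤ M)
    {K : Set (E d)} (hKc : IsCompact K) (hK : ∀ x ∉ K, h x = 0) : Integrable h := by
  have h1 : IntegrableOn h K :=
    Measure.integrableOn_of_bounded (M := M) hKc.measure_lt_top.ne hm.aestronglyMeasurable
      (ae_of_all _ hM)
  rwa [integrableOn_iff_integrable_of_support_subset] at h1
  exact fun x hx => by_contra fun hxK => hx (hK x hxK)

lemma memLp_of_bounded_compact (hm : Measurable h) {M : ℝ} (hM : ∀ x, |h x| ≤ M)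
    {K : Set (E d)} (hKc : IsCompact K) (hK : ∀ x ∉ K, h x = 0) : MemLp h 2 volume := by
  refine (memLp_two_iff_integrable_sq hm.aestronglyMeasurable).2 ?_
  refine integrable_of_bounded_compact (hm.pow_const 2) (M := M ^ 2) (fun x => ?_) hKc
    (fun x hx => by simp [hK x hx])
  rw [abs_pow]
  exact pow_le_pow_left₀ (abs_nonneg _) (hM x) 2

/-- Mollifications converge almost everywhere if inner and outer radii stay comparable (`h2`). Since
the radii are at most `1`, everything lives in the compact `1`-neighbourhood of `K`, where `(2M)²`
dominates the squared difference. -/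
lemma tendsto_nrm_mollify (hm : Measurable h) {M : ℝ} (hM : ∀ x, |h x| ≤ M)
    {K : Set (E d)} (hKc : IsCompact K) (hK : ∀ x ∉ K, h x = 0)
    {φ : ℕ → ContDiffBump (0 : E d)} (h1 : Tendsto (fun n => (φ n).rOut) atTop (𝓝 0))
    (h2 : ∀ n, (φ n).rOut ≤ 2 * (φ n).rIn) (h3 : ∀ n, (φ n).rOut ≤ 1) :
    Tendsto (fun n => nrm volume fun x => h x - mollify (φ n) h x) atTop (𝓝 0) := by
  have hi := integrable_of_bounded_compact hm hM hKc hK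
  have hae := ContDiffBump.ae_convolution_tendsto_right_of_locallyIntegrable (μ := volume) h1
    (Eventually.of_forall h2) hi.locallyIntegrable
  have hM0 : 0 ≤ M := (abs_nonneg _).trans (hM 0)
  have key : Tendsto (fun n => ∫ x, (h x - mollify (φ n) h x) ^ 2) atTop
      (𝓝 (∫ _ : E d, (0 : ℝ))) := by
    refine tendsto_integral_of_dominated_convergence
      ((Metric.cthickening 1 K).indicator fun _ => (2 * M) ^ 2) (fun n => ?_) ?_ (fun n => ?_) ?_
    · have : Continuous (mollify (φ n) h) := by
        rw [mollify_eq_convolution]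
        exact (φ n).hasCompactSupport_normed.continuous_convolution_left _ (φ n).continuous_normed
          hi.locallyIntegrable
      exact ((hm.sub this.measurable).pow_const 2).aestronglyMeasurable
    · rw [integrable_indicator_iff Metric.isClosed_cthickening.measurableSet]
      exact integrableOn_const hKc.cthickening.measure_lt_top.ne
    · refine ae_of_all _ fun x => ?_
      by_cases hx : x ∈ Metric.cthickening 1 K
      · rw [indicator_of_mem hx, norm_pow, Real.norm_eq_abs]
        refine pow_le_pow_left₀ (abs_nonneg _) ?_ 2
        calc _ ≤ |h x| + |mollify (φ n) h x| := abs_sub _ _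
          _ ≤ M + M := add_le_add (hM x) (abs_mollify_le _ hM x)
          _ = _ := by ring
      · have e1 : h x = 0 := hK x fun hxK => hx (Metric.self_subset_cthickening K hxK)
        have e2 : mollify (φ n) h x = 0 :=
          mollify_eq_zero _ hK fun h' => hx (Metric.cthickening_mono (h3 n) _ h')
        simp [e1, e2, hx]
    · filter_upwards [hae] with x hx
      have := (tendsto_const_nhds (x := h x)).sub hx
      simpa [mollify_eq_convolution] using this.pow 2
  have := (Real.continuous_sqrt.tendsto _).comp key
  simpa [nrm, Function.comp_def] using this

/-- The derivative first falls on the smooth kernel. Integration by parts for Lipschitz functions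
then moves it to `f`, in the form of the line derivative. -/
lemma partialDeriv_mollify {C : NNReal} (hf : LipschitzWith C f) (hi : Integrable f)
    (φ : ContDiffBump (0 : E d)) (k : Fin d) (x : E d) :
    partialDeriv k (mollify φ f) x
      = mollify φ (fun y => lineDeriv ℝ f y (EuclideanSpace.single k 1)) x := by
  set v : E d := EuclideanSpace.single k 1
  have hc : HasCompactSupport (φ.normed volume) := φ.hasCompactSupport_normed
  have hs : ContDiff ℝ 1 (φ.normed volume) := φ.contDiff_normed
  have h1 := hc.hasFDerivAt_convolution_left (lsmul ℝ ℝ) hs hi.locallyIntegrable x (μ := volume)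
  have h2 : partialDeriv k (mollify φ f) x = ∫ t, fderiv ℝ (φ.normed volume) t v * f (x - t) := by
    rw [partialDeriv, mollify_eq_convolution, h1.fderiv, convolution]
    rw [ContinuousLinearMap.integral_apply]
    · rfl
    · have := ((hc.fderiv ℝ).convolutionExists_left ((lsmul ℝ ℝ).precompL (E d))
        (hs.continuous_fderiv (by simp)) hi.locallyIntegrable (μ := volume) x)
      exact this
  obtain ⟨D, hD⟩ := hs.lipschitzWith_of_hasCompactSupport hc (by simp)
  have hg : LipschitzWith C fun t => f (x - t) := by
    refine LipschitzWith.of_dist_le_mul fun s t => ?_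
    refine (hf.dist_le_mul _ _).trans (le_of_eq ?_)
    rw [dist_sub_left]
  -- The direction is `-v` because `t ↦ f (x - t)` reverses orientation. The sign cancels against
  -- that of the integration by parts.
  have h3 := hg.integral_lineDeriv_mul_eq (μ := volume) hD hc (-v)
  rw [neg_neg] at h3
  rw [h2, mollify]
  calc _ = ∫ t, lineDeriv ℝ (φ.normed volume) t v * f (x - t) := by
        refine integral_congr_ae (ae_of_all _ fun t => ?_)
        simp only
        rw [((hs.differentiable (by simp)) t).lineDeriv_eq_fderiv]
    _ = _ := by
        rw [← h3]
        refine integral_congr_ae (ae_of_all _ fun t => ?_)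
        simp only
        rw [mul_comm]
        congr 1
        simp only [lineDeriv]
        congr 1
        ext s
        congr 1
        simp only [smul_neg]
        abel

/-- A Lipschitz function with compact support in `U` belongs to `H¹₀(U)`. -/
lemma inH10_of_lipschitz {U : Set (E d)} (hU : IsOpen U) {C : NNReal} (hf : LipschitzWith C f)
    (hc : HasCompactSupport f) (hs : tsupport f ⊆ U) :
    InH10 U f (fun k x => lineDeriv ℝ f x (EuclideanSpace.single k 1)) := by
  obtain ⟨M, hM⟩ := hc.exists_bound_of_continuous hf.continuous
  have hK : ∀ x ∉ tsupport f, f x = 0 := fun x hx => image_eq_zero_of_notMem_tsupport hx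
  have hgm : ∀ k : Fin d, Measurable fun x => lineDeriv ℝ f x (EuclideanSpace.single k 1) :=
    fun k => measurable_lineDeriv hf.continuous
  have hgM : ∀ (k : Fin d) x, |lineDeriv ℝ f x (EuclideanSpace.single k 1)| ≤ C := fun k x => by
    simpa using norm_lineDeriv_le_of_lipschitz ℝ hf (x₀ := x) (v := EuclideanSpace.single k 1)
  have hgK : ∀ (k : Fin d), ∀ x ∉ tsupport f, lineDeriv ℝ f x (EuclideanSpace.single k 1) = 0 := by
    intro k x hx
    have h0 : f =ᶠ[𝓝 x] fun _ => 0 := notMem_tsupport_iff_eventuallyEq.1 hx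
    rw [h0.lineDeriv_eq]
    simp [lineDeriv]
  have hmem : MemLp f 2 volume :=
    memLp_of_bounded_compact hf.continuous.measurable hM hc hK
  have hgmem : ∀ k : Fin d,
      MemLp (fun x => lineDeriv ℝ f x (EuclideanSpace.single k 1)) 2 volume :=
    fun k => memLp_of_bounded_compact (hgm k) (hgM k) hc (hgK k)
  have hi : Integrable f := integrable_of_bounded_compact hf.continuous.measurable hM hc hK
  obtain ⟨δ, hδ, hδU⟩ := hc.isCompact.exists_cthickening_subset_open hU hs
  -- The outer radii tend to zero with the ratio of radii fixed at `2`. The bound by `δ` keeps the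
  -- supports in `U`, the bound by `1` keeps them in one compact set.
  let φ : ℕ → ContDiffBump (0 : E d) := fun n =>
    ⟨min δ 1 / (n + 1) / 2, min δ 1 / (n + 1), by positivity, half_lt_self (by positivity)⟩
  have h1 : Tendsto (fun n => (φ n).rOut) atTop (𝓝 0) := by
    have := (tendsto_one_div_add_atTop_nhds_zero_nat (𝕜 := ℝ)).const_mul (min δ 1)
    simpa [φ, div_eq_mul_inv] using this
  have h2 : ∀ n, (φ n).rOut ≤ 2 * (φ n).rIn := fun n => by simp only [φ]; linarith
  have h3' : ∀ n, (φ n).rOut ≤ min δ 1 := fun n =>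
    div_le_self (by positivity) (by simp)
  have h3 : ∀ n, (φ n).rOut ≤ 1 := fun n => (h3' n).trans (min_le_right _ _)
  have t1 := tendsto_nrm_mollify hf.continuous.measurable hM hc hK h1 h2 h3
  have t2 := fun k => tendsto_nrm_mollify (hgm k) (hgM k) hc (hgK k) h1 h2 h3
  have htest : ∀ n, IsTestFunction U (mollify (φ n) f) := by
    intro n
    have hz : ∀ x ∉ Metric.cthickening δ (tsupport f), mollify (φ n) f x = 0 := fun x hx =>
      mollify_eq_zero _ hK fun h' =>
        hx (Metric.cthickening_mono ((h3' n).trans (min_le_left _ _)) _ h')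
    have hcc : IsCompact (Metric.cthickening δ (tsupport f)) := hc.isCompact.cthickening
    have hcd : ContDiff ℝ ∞ (mollify (φ n) f) := by
      rw [mollify_eq_convolution]
      exact (φ n).hasCompactSupport_normed.contDiff_convolution_left _ (φ n).contDiff_normed
        hi.locallyIntegrable
    refine ⟨hcd, HasCompactSupport.intro hcc hz, ?_⟩
    refine (closure_minimal (fun x hx => ?_) hcc.isClosed).trans hδU
    exact by_contra fun hx' => hx (hz x hx')
  refine ⟨hmem.restrict U, fun k => (hgmem k).restrict U, fun ε hε => ?_⟩
  have e1 := t1.eventually (gt_mem_nhds hε)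
  have e2 := eventually_all.2 fun k => (t2 k).eventually (gt_mem_nhds hε)
  obtain ⟨n, hn1, hn2⟩ := (e1.and e2).exists
  have hr : ∀ g : E d → ℝ, MemLp g 2 volume → nrmOn U g ≤ nrm volume g := fun g hg =>
    Real.sqrt_le_sqrt (setIntegral_le_integral hg.integrable_sq (ae_of_all _ fun _ => sq_nonneg _))
  refine ⟨_, htest n, (hr _ (memLp_sub hmem ((htest n).memLp 2))).trans_lt hn1, fun k => ?_⟩
  refine (hr _ (memLp_sub (hgmem k) ((htest n).memLp_partialDeriv k 2))).trans_lt ?_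
  have : (fun x => lineDeriv ℝ f x (EuclideanSpace.single k 1)
      - partialDeriv k (mollify (φ n) f) x) = fun x => lineDeriv ℝ f x (EuclideanSpace.single k 1)
      - mollify (φ n) (fun y => lineDeriv ℝ f y (EuclideanSpace.single k 1)) x := by
    ext x
    rw [partialDeriv_mollify hf hi]
  rw [this]
  exact hn2 k

end Mollification


/-! ### The periodic Sturm–Liouville problem on one element -/

section Element

open Polynomial

variable {a c : ℝ}

/-- The `L²(a, c)` norm. -/
abbrev nrmI (a c : ℝ) (f : ℝ → ℝ) : ℝ := nrm (volume.restrict (Ioc a c)) f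

lemma memLp_Ioc_of_continuousOn {f : ℝ → ℝ} (hf : ContinuousOn f (Icc a c)) :
    MemLp f 2 (volume.restrict (Ioc a c)) := by
  have h1 : AEStronglyMeasurable f (volume.restrict (Ioc a c)) :=
    (hf.mono Ioc_subset_Icc_self).aestronglyMeasurable measurableSet_Ioc
  refine (memLp_two_iff_integrable_sq h1).2 ?_
  exact ((hf.pow 2).integrableOn_compact isCompact_Icc).mono_set Ioc_subset_Icc_self

lemma memLp_Ioc_of_continuous {f : ℝ → ℝ} (hf : Continuous f) :
    MemLp f 2 (volume.restrict (Ioc a c)) := memLp_Ioc_of_continuousOn hf.continuousOn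

lemma abs_intervalIntegral_mul_le (hac : a ≤ c) {f g : ℝ → ℝ}
    (hf : MemLp f 2 (volume.restrict (Ioc a c))) (hg : MemLp g 2 (volume.restrict (Ioc a c))) :
    |∫ x in a..c, f x * g x| ≤ nrmI a c f * nrmI a c g := by
  rw [intervalIntegral.integral_of_le hac]
  exact abs_integral_mul_le hf hg

/-- Equivalence of norms on polynomials of bounded degree. -/
lemma exists_polynomial_nrm_le (hac : a < c) (N : ℕ) (T S : ℝ[X] →ₗ[ℝ] ℝ[X])
    (hS : Function.Injective S) :
    ∃ K : ℝ, 0 ≤ K ∧ ∀ g : ℝ[X], g.natDegree ≤ N →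
      nrmI a c (fun x => (T g).eval x) ≤ K * nrmI a c (fun x => (S g).eval x) := by
  let μ : Measure ℝ := volume.restrict (Ioc a c)
  have hmem : ∀ P : ℝ[X], MemLp (fun x => P.eval x) 2 μ := fun P =>
    memLp_Ioc_of_continuous P.continuous
  let ev : ℝ[X] →ₗ[ℝ] Lp ℝ 2 μ :=
    { toFun := fun P => (hmem P).toLp _
      map_add' := fun P Q => by
        rw [← MemLp.toLp_add]
        congr 1
        ext x
        simp
      map_smul' := fun r P => by
        rw [RingHom.id_apply, ← MemLp.toLp_const_smul]
        congr 1
        ext x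
        simp }
  have hev : ∀ P, ‖ev P‖ = nrm μ (fun x => P.eval x) := fun P => by
    rw [show ev P = (hmem P).toLp _ from rfl, Lp.norm_toLp, eLpNorm_eq_nrm (hmem P),
      ENNReal.toReal_ofReal nrm_nonneg]
  -- A polynomial vanishing almost everywhere on an interval vanishes on its interior by continuity,
  -- hence has infinitely many roots.
  have hinj : ∀ P, ev P = 0 → P = 0 := by
    intro P hP
    have h0 : (fun x => P.eval x) =ᵐ[μ] 0 := by
      have := (hmem P).coeFn_toLp
      rw [show (hmem P).toLp _ = 0 from hP] at this
      exact this.symm.trans (Lp.coeFn_zero _ _ _)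
    have h1 : EqOn (fun x => P.eval x) 0 (Ioo a c) := by
      refine Measure.eqOn_Ioo_of_ae_eq volume ?_ P.continuous.continuousOn continuousOn_const
      exact ae_restrict_of_ae_restrict_of_subset Ioo_subset_Ioc_self h0
    refine P.eq_zero_of_infinite_isRoot ((Ioo_infinite hac).mono fun x hx => ?_)
    exact h1 hx
  let co : (Fin (N + 1) → ℝ) →ₗ[ℝ] ℝ[X] :=
    ((degreeLT ℝ (N + 1)).subtype).comp (degreeLTEquiv ℝ (N + 1)).symm.toLinearMap
  have hco : Function.Injective co :=
    (Submodule.subtype_injective _).comp (degreeLTEquiv ℝ (N + 1)).symm.injective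
  have hSk : LinearMap.ker ((ev.comp S).comp co) = ⊥ := by
    rw [LinearMap.ker_eq_bot']
    intro y hy
    have : S (co y) = S 0 := by rw [map_zero]; exact hinj _ hy
    exact hco ((hS this).trans (map_zero co).symm)
  -- On the finite-dimensional space of coefficients the injective map through `S` is bounded below
  -- and the map through `T` is bounded above. Composing the two bounds eliminates the coefficients.
  obtain ⟨K, hK, hanti⟩ := LinearMap.exists_antilipschitzWith ((ev.comp S).comp co) hSk
  let Tc := LinearMap.toContinuousLinearMap ((ev.comp T).comp co)
  refine ⟨‖Tc‖ * K, by positivity, fun g hg => ?_⟩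
  obtain ⟨y, hy⟩ : ∃ y, co y = g := by
    have hmemg : g ∈ degreeLT ℝ (N + 1) := by
      rw [mem_degreeLT]
      exact lt_of_le_of_lt degree_le_natDegree (by exact_mod_cast Nat.lt_succ_of_le hg)
    exact ⟨degreeLTEquiv ℝ (N + 1) ⟨g, hmemg⟩, by simp [co]⟩
  have h1 : ‖ev (T (co y))‖ ≤ ‖Tc‖ * ‖y‖ := Tc.le_opNorm y
  have h2 : ‖y‖ ≤ K * ‖ev (S (co y))‖ := by
    have := hanti.le_mul_dist y 0
    simpa using this
  rw [hy, hev] at h1 h2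
  calc _ ≤ _ := h1
    _ ≤ ‖Tc‖ * (K * nrm μ (fun x => (S g).eval x)) := by gcongr
    _ = _ := by ring

lemma contDiff_polynomial_eval (P : ℝ[X]) : ContDiff ℝ ∞ fun x => P.eval x := by
  simpa [coe_aeval_eq_eval] using P.contDiff_aeval (𝕜 := ℝ) ∞

lemma _root_.ContDiff.absolutelyContinuousOnInterval {f : ℝ → ℝ} (hf : ContDiff ℝ 1 f) (a c : ℝ) :
    AbsolutelyContinuousOnInterval f a c :=
  hf.contDiffOn.absolutelyContinuousOnInterval

/-- The end point values of a function on an interval are bounded by its `H¹` norm. -/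
lemma exists_abs_endpoints_le (hac : a < c) :
    ∃ K : ℝ, 0 ≤ K ∧ ∀ ψ : ℝ → ℝ, ContDiff ℝ 1 ψ →
      |ψ a| ≤ K * (nrmI a c ψ + nrmI a c (deriv ψ)) ∧
      |ψ c| ≤ K * (nrmI a c ψ + nrmI a c (deriv ψ)) := by
  set K₀ := nrmI a c (fun _ => 1) + nrmI a c (fun x => x - a) + nrmI a c (fun x => x - c) with hK₀
  have n1 : 0 ≤ nrmI a c (fun _ => 1) := nrm_nonneg
  have n2 : 0 ≤ nrmI a c (fun x => x - a) := nrm_nonneg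
  have n3 : 0 ≤ nrmI a c (fun x => x - c) := nrm_nonneg
  have hca : 0 < c - a := sub_pos.2 hac
  refine ⟨K₀ / (c - a), by positivity, fun ψ hψ => ?_⟩
  have hψ' : Continuous (deriv ψ) := hψ.continuous_deriv le_rfl
  have m1 : 0 ≤ nrmI a c ψ := nrm_nonneg
  have m2 : 0 ≤ nrmI a c (deriv ψ) := nrm_nonneg
  -- The fundamental theorem of calculus for `(x - s) ψ`. The choice `s = c` isolates `ψ a`, and `s
  -- = a` isolates `ψ c`.
  have key : ∀ s : ℝ, (c - s) * ψ c - (a - s) * ψ a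
      = (∫ x in a..c, 1 * ψ x) + ∫ x in a..c, (x - s) * deriv ψ x := by
    intro s
    have hd : ∀ x, HasDerivAt (fun x => (x - s) * ψ x) (1 * ψ x + (x - s) * deriv ψ x) x :=
      fun x => ((hasDerivAt_id x).sub_const s).mul
        (hψ.differentiable (by simp) x).hasDerivAt
    rw [← intervalIntegral.integral_add]
    · rw [intervalIntegral.integral_eq_sub_of_hasDerivAt (fun x _ => hd x)]
      exact Continuous.intervalIntegrable (by fun_prop) _ _
    · exact Continuous.intervalIntegrable (by fun_prop) _ _
    · exact Continuous.intervalIntegrable (by fun_prop) _ _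
  have b1 := abs_intervalIntegral_mul_le hac.le (memLp_Ioc_of_continuous (a := a) (c := c)
    (continuous_const (y := (1 : ℝ)))) (memLp_Ioc_of_continuous hψ.continuous)
  have b2 : ∀ s : ℝ, |∫ x in a..c, (x - s) * deriv ψ x|
      ≤ nrmI a c (fun x => x - s) * nrmI a c (deriv ψ) := fun s =>
    abs_intervalIntegral_mul_le hac.le
      (memLp_Ioc_of_continuous (a := a) (c := c) (f := fun x => x - s) (by fun_prop))
      (memLp_Ioc_of_continuous hψ')
  rw [div_mul_eq_mul_div, le_div_iff₀ hca, le_div_iff₀ hca]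
  constructor
  · have h1 := key c
    rw [sub_self, zero_mul] at h1
    have h2 : |ψ a| * (c - a) = |(∫ x in a..c, 1 * ψ x) + ∫ x in a..c, (x - c) * deriv ψ x| := by
      rw [← h1, show (0 : ℝ) - (a - c) * ψ a = ψ a * (c - a) by ring, abs_mul, abs_of_pos hca]
    rw [h2]
    refine (abs_add_le _ _).trans ((add_le_add b1 (b2 c)).trans ?_)
    rw [hK₀]
    nlinarith [mul_nonneg n1 m2, mul_nonneg n2 m1, mul_nonneg n2 m2, mul_nonneg n3 m1]
  · have h1 := key a
    rw [sub_self, zero_mul, sub_zero] at h1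
    have h2 : |ψ c| * (c - a) = |(∫ x in a..c, 1 * ψ x) + ∫ x in a..c, (x - a) * deriv ψ x| := by
      rw [← h1, abs_mul, abs_of_pos hca, mul_comm]
    rw [h2]
    refine (abs_add_le _ _).trans ((add_le_add b1 (b2 a)).trans ?_)
    rw [hK₀]
    nlinarith [mul_nonneg n1 m2, mul_nonneg n2 m1, mul_nonneg n3 m2, mul_nonneg n3 m1]

/-- The bilinear form `∫ (u' f' - Λ² u f)` on one element. -/
def slForm (a c Lam : ℝ) (u f : ℝ → ℝ) : ℝ :=
  ∫ x in a..c, (deriv u x * deriv f x - Lam ^ 2 * (u x * f x))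

lemma intervalIntegrable_slForm {Lam : ℝ} {u f : ℝ → ℝ}
    (hu : AbsolutelyContinuousOnInterval u a c) (hf : ContDiff ℝ 1 f) :
    IntervalIntegrable (fun x => deriv u x * deriv f x - Lam ^ 2 * (u x * f x)) volume a c := by
  refine (hu.intervalIntegrable_deriv.mul_continuousOn
    (hf.continuous_deriv le_rfl).continuousOn).sub ?_
  exact ((hu.continuousOn.mul hf.continuous.continuousOn).intervalIntegrable).const_mul _

/-- An absolutely continuous function is differentiable almost everywhere, which suffices to split
the derivative of the difference under the integral. -/
lemma slForm_sub_left {Lam : ℝ} {u v f : ℝ → ℝ} (hu : AbsolutelyContinuousOnInterval u a c)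
    (hv : AbsolutelyContinuousOnInterval v a c) (hf : ContDiff ℝ 1 f) :
    slForm a c Lam (fun x => u x - v x) f = slForm a c Lam u f - slForm a c Lam v f := by
  rw [slForm, slForm, slForm, ← intervalIntegral.integral_sub (intervalIntegrable_slForm hu hf)
    (intervalIntegrable_slForm hv hf)]
  refine intervalIntegral.integral_congr_ae ?_
  filter_upwards [hu.ae_differentiableAt, hv.ae_differentiableAt] with x h1 h2 hx
  have hx' := uIoc_subset_uIcc hx
  rw [deriv_fun_sub (h1 hx') (h2 hx')]
  ring

lemma slForm_add_right {Lam : ℝ} {u f g : ℝ → ℝ} (hu : AbsolutelyContinuousOnInterval u a c)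
    (hf : ContDiff ℝ 1 f) (hg : ContDiff ℝ 1 g) :
    slForm a c Lam u (fun x => f x + g x) = slForm a c Lam u f + slForm a c Lam u g := by
  rw [slForm, slForm, slForm, ← intervalIntegral.integral_add (intervalIntegrable_slForm hu hf)
    (intervalIntegrable_slForm hu hg)]
  refine intervalIntegral.integral_congr fun x _ => ?_
  rw [deriv_fun_add (hf.differentiable (by simp) x) (hg.differentiable (by simp) x)]
  ring

/-- Integration by parts towards the second argument. -/
lemma slForm_eq_of_deriv_eq_zero {Lam : ℝ} {u f : ℝ → ℝ}
    (hu : AbsolutelyContinuousOnInterval u a c) (hf : ContDiff ℝ 2 f) (ha : deriv f a = 0)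
    (hc : deriv f c = 0) :
    slForm a c Lam u f = -∫ x in a..c, u x * (deriv (deriv f) x + Lam ^ 2 * f x) := by
  have hf' : ContDiff ℝ 1 (deriv f) := hf.deriv'
  have h1 := hu.integral_mul_deriv_eq_deriv_mul (hf'.absolutelyContinuousOnInterval a c)
  rw [ha, hc] at h1
  have i1 : IntervalIntegrable (fun x => u x * deriv (deriv f) x) volume a c :=
    (hu.continuousOn.mul (hf'.continuous_deriv le_rfl).continuousOn).intervalIntegrable
  have i2 : IntervalIntegrable (fun x => Lam ^ 2 * (u x * f x)) volume a c :=
    ((hu.continuousOn.mul hf.continuous.continuousOn).intervalIntegrable).const_mul _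
  have i3 : IntervalIntegrable (fun x => deriv u x * deriv f x) volume a c :=
    hu.intervalIntegrable_deriv.mul_continuousOn hf'.continuous.continuousOn
  rw [slForm, intervalIntegral.integral_sub i3 i2,
    show (∫ x in a..c, u x * (deriv (deriv f) x + Lam ^ 2 * f x))
      = (∫ x in a..c, u x * deriv (deriv f) x) + ∫ x in a..c, Lam ^ 2 * (u x * f x) by
      rw [← intervalIntegral.integral_add i1 i2]
      exact intervalIntegral.integral_congr fun x _ => by ring]
  linarith

/-- Integration by parts towards the first argument. -/
lemma slForm_polynomial_eq {Lam : ℝ} (P : ℝ[X]) {f : ℝ → ℝ} (hf : ContDiff ℝ 1 f) (ha : f a = 0)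
    (hc : f c = 0) :
    slForm a c Lam (fun x => P.eval x) f
      = -∫ x in a..c, (derivative (derivative P) + C (Lam ^ 2) * P).eval x * f x := by
  have hPac := fun Q : ℝ[X] => ((contDiff_polynomial_eval Q).of_le
    (n := ∞) (m := 1) (by simp)).absolutelyContinuousOnInterval a c
  have h1 := (hPac (derivative P)).integral_mul_deriv_eq_deriv_mul
    (hf.absolutelyContinuousOnInterval a c)
  rw [ha, hc] at h1
  have hd : ∀ Q : ℝ[X], deriv (fun x => Q.eval x) = fun x => (derivative Q).eval x := fun Q =>
    funext fun x => Q.deriv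
  rw [hd] at h1
  have hcQ : ∀ Q : ℝ[X], Continuous fun x => Q.eval x := fun Q => Q.continuous
  have hf' := hf.continuous_deriv le_rfl
  have i1 : IntervalIntegrable (fun x => (derivative P).eval x * deriv f x) volume a c :=
    ((hcQ _).mul hf').intervalIntegrable _ _
  have i2 : IntervalIntegrable (fun x => Lam ^ 2 * (P.eval x * f x)) volume a c :=
    (continuous_const.mul ((hcQ _).mul hf.continuous)).intervalIntegrable _ _
  have i3 : IntervalIntegrable (fun x => (derivative (derivative P)).eval x * f x) volume a c :=
    ((hcQ _).mul hf.continuous).intervalIntegrable _ _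
  rw [slForm, hd, intervalIntegral.integral_sub i1 i2,
    show (∫ x in a..c, (derivative (derivative P) + C (Lam ^ 2) * P).eval x * f x)
      = (∫ x in a..c, (derivative (derivative P)).eval x * f x)
        + ∫ x in a..c, Lam ^ 2 * (P.eval x * f x) by
      rw [← intervalIntegral.integral_add i3 i2]
      refine intervalIntegral.integral_congr fun x _ => ?_
      simp only [eval_add, eval_mul, eval_C]
      ring]
  linarith

/-- The inverse estimate: on one element, the difference of a polynomial and a solution of
`-ϑ'' = Λ² ϑ` is controlled in a dual norm by its `L²` norm. -/
lemma exists_slForm_sub_le (hac : a < c) (N : ℕ) :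
    ∃ K : ℝ, 0 ≤ K ∧ ∀ (P : ℝ[X]) (vth : ℝ → ℝ) (Lam : ℝ), P.natDegree ≤ N → Lam ∈ Icc (0 : ℝ) 1 →
      AbsolutelyContinuousOnInterval vth a c →
      (∀ f, ContDiff ℝ 1 f → f a = 0 → f c = 0 → slForm a c Lam vth f = 0) →
      ∀ ψ, ContDiff ℝ 1 ψ →
        |slForm a c Lam (fun x => P.eval x) ψ - slForm a c Lam vth ψ|
          ≤ K * nrmI a c (fun x => P.eval x - vth x) * (nrmI a c ψ + nrmI a c (deriv ψ)) := by
  -- A bubble vanishing at both end points. Its square vanishes there together with its first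
  -- derivative, so tests with multiples of `β²` produce no boundary terms in either direction of
  -- integration by parts.
  set β : ℝ[X] := (X - C a) * (C c - X) with hβ
  have hβ0 : β ≠ 0 := by
    refine mul_ne_zero (X_sub_C_ne_zero a) ?_
    rw [← neg_sub]
    exact neg_ne_zero.2 (X_sub_C_ne_zero c)
  have hβa : β.eval a = 0 := by simp [hβ]
  have hβc : β.eval c = 0 := by simp [hβ]
  let S : ℝ[X] →ₗ[ℝ] ℝ[X] := LinearMap.mulLeft ℝ β
  have hS : Function.Injective S := fun P Q h => mul_left_cancel₀ hβ0 h
  let T₁ : ℝ[X] →ₗ[ℝ] ℝ[X] := LinearMap.mulLeft ℝ (β ^ 2)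
  let T₂ : ℝ[X] →ₗ[ℝ] ℝ[X] := (derivative.comp derivative).comp (LinearMap.mulLeft ℝ (β ^ 2))
  -- For polynomials `g` of degree at most `N`, the norms of `g`, `β² g` and `(β² g)''` are all
  -- controlled by that of `β g`.
  obtain ⟨K₀, hK₀, e0⟩ := exists_polynomial_nrm_le hac N LinearMap.id S hS
  obtain ⟨K₁, hK₁, e1⟩ := exists_polynomial_nrm_le hac N T₁ S hS
  obtain ⟨K₂, hK₂, e2⟩ := exists_polynomial_nrm_le hac N T₂ S hS
  obtain ⟨K₃, hK₃, e3⟩ := exists_abs_endpoints_le hac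
  -- cubic Hermite polynomials
  set σ : ℝ[X] := C (c - a)⁻¹ * (X - C a) with hσ
  set h₁ : ℝ[X] := 3 * σ ^ 2 - 2 * σ ^ 3 with hh₁
  set h₀ : ℝ[X] := 1 - h₁ with hh₀
  have hca : c - a ≠ 0 := sub_ne_zero.2 hac.ne'
  have hσa : σ.eval a = 0 := by simp [hσ]
  have hσc : σ.eval c = 1 := by simp [hσ, hca]
  have hh₁' : derivative h₁ = 6 * (σ - σ ^ 2) * derivative σ := by
    rw [hh₁, derivative_sub, derivative_mul, derivative_mul, derivative_pow, derivative_pow]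
    have c2 : C (2 : ℝ) = 2 := map_ofNat C 2
    have c3 : C (3 : ℝ) = 3 := map_ofNat C 3
    simp [c2, c3]
    ring
  have v1 : h₁.eval a = 0 := by simp [hh₁, hσa]
  have v2 : h₁.eval c = 1 := by simp [hh₁, hσc]; norm_num
  have v3 : (derivative h₁).eval a = 0 := by simp [hh₁', hσa]
  have v4 : (derivative h₁).eval c = 0 := by simp [hh₁', hσc]
  set L₀ := nrmI a c (fun x => h₀.eval x) + nrmI a c (fun x => h₁.eval x) with hL₀
  set L₂ := nrmI a c (fun x => (derivative (derivative h₁)).eval x) with hL₂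
  have nn : ∀ f, 0 ≤ nrmI a c f := fun f => nrm_nonneg
  have hL₀0 : 0 ≤ L₀ := add_nonneg (nn _) (nn _)
  have hL₂0 : 0 ≤ L₂ := nn _
  set Kg := K₀ * (K₂ + K₁) with hKg
  refine ⟨Kg * (1 + K₃ * L₀) + K₃ * (2 * L₂ + L₀), by positivity,
    fun P vth Lam hP hLam hvth hweak ψ hψ => ?_⟩
  have hLam2 : Lam ^ 2 ≤ 1 := pow_le_one₀ hLam.1 hLam.2
  have hLam0 : 0 ≤ Lam ^ 2 := sq_nonneg _
  have hd : ∀ Q : ℝ[X], deriv (fun x => Q.eval x) = fun x => (derivative Q).eval x := fun Q =>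
    funext fun x => Q.deriv
  have hcQ : ∀ Q : ℝ[X], Continuous fun x => Q.eval x := fun Q => Q.continuous
  have hPc : ∀ (Q : ℝ[X]) (n : ℕ), ContDiff ℝ n fun x => Q.eval x := fun Q n =>
    (contDiff_polynomial_eval Q).of_le (by exact_mod_cast le_top)
  have mQ : ∀ Q : ℝ[X], MemLp (fun x => Q.eval x) 2 (volume.restrict (Ioc a c)) := fun Q =>
    memLp_Ioc_of_continuous (hcQ Q)
  set e : ℝ → ℝ := fun x => P.eval x - vth x with he
  have hPac : AbsolutelyContinuousOnInterval (fun x => P.eval x) a c :=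
    (hPc P 1).absolutelyContinuousOnInterval a c
  have heac : AbsolutelyContinuousOnInterval e a c := hPac.sub hvth
  have hem : MemLp e 2 (volume.restrict (Ioc a c)) := by
    refine memLp_Ioc_of_continuousOn ?_
    have := heac.continuousOn
    rwa [uIcc_of_le hac.le] at this
  have hsub : ∀ f, ContDiff ℝ 1 f → slForm a c Lam (fun x => P.eval x) f - slForm a c Lam vth f
      = slForm a c Lam e f := fun f hf => (slForm_sub_left hPac hvth hf).symm
  have hne : 0 ≤ nrmI a c e := nn _
  -- tests with polynomials whose derivative vanishes at the end points
  have step1 : ∀ Q : ℝ[X], (derivative Q).eval a = 0 → (derivative Q).eval c = 0 →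
      |slForm a c Lam e (fun x => Q.eval x)| ≤ nrmI a c e *
        (nrmI a c (fun x => (derivative (derivative Q)).eval x) + nrmI a c (fun x => Q.eval x)) := by
    intro Q h1 h2
    rw [slForm_eq_of_deriv_eq_zero heac (hPc Q 2) (by rw [hd]; exact h1) (by rw [hd]; exact h2),
      abs_neg, hd, hd]
    have m := (mQ (derivative (derivative Q))).add ((mQ Q).const_mul (Lam ^ 2))
    refine (abs_intervalIntegral_mul_le hac.le hem m).trans ?_
    refine mul_le_mul_of_nonneg_left ?_ hne
    refine (nrm_add_le (mQ (derivative (derivative Q))) ((mQ Q).const_mul (Lam ^ 2))).trans ?_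
    refine add_le_add le_rfl ?_
    rw [nrm_const_mul, abs_of_nonneg hLam0]
    exact mul_le_of_le_one_left nrm_nonneg hLam2
  set g : ℝ[X] := derivative (derivative P) + C (Lam ^ 2) * P with hg
  have hgN : g.natDegree ≤ N := by
    refine (natDegree_add_le _ _).trans (max_le ?_ ?_)
    · exact (natDegree_derivative_le _).trans ((Nat.sub_le _ _).trans
        ((natDegree_derivative_le _).trans ((Nat.sub_le _ _).trans hP)))
    · exact (natDegree_C_mul_le _ _).trans hP
  -- tests with functions vanishing at the end points
  have step2 : ∀ f, ContDiff ℝ 1 f → f a = 0 → f c = 0 →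
      slForm a c Lam e f = -∫ x in a..c, g.eval x * f x := by
    intro f hf h1 h2
    rw [← hsub f hf, hweak f hf h1 h2, slForm_polynomial_eq P hf h1 h2, sub_zero]
  -- `g` is the strong residual `P'' + Λ² P`. Testing with `Q = β² g` gives `‖β g‖²` by `step2`,
  -- while `step1` bounds the same quantity by `‖e‖ (‖Q''‖ + ‖Q‖)`, hence by `‖e‖ (K₂ + K₁) ‖β g‖`.
  -- After division by `‖β g‖` no derivative of `e` is left.
  have step3 : nrmI a c (fun x => g.eval x) ≤ Kg * nrmI a c e := by
    set Q : ℝ[X] := β ^ 2 * g with hQ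
    have q1 := step2 (fun x => Q.eval x) (hPc Q 1) (by simp [hQ, hβa]) (by simp [hQ, hβc])
    have q2 := step1 Q (by simp [hQ, hβa, derivative_pow]) (by simp [hQ, hβc, derivative_pow])
    have q3 : ∫ x in a..c, g.eval x * Q.eval x = nrmI a c (fun x => (S g).eval x) ^ 2 := by
      rw [nrm_sq, intervalIntegral.integral_of_le hac.le]
      refine integral_congr_ae (ae_of_all _ fun x => ?_)
      simp only [hQ, S, LinearMap.mulLeft_apply, eval_mul, eval_pow]
      ring
    set z := nrmI a c (fun x => (S g).eval x) with hz
    have hz0 : 0 ≤ z := nn _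
    rw [q1, abs_neg, q3, abs_of_nonneg (sq_nonneg _)] at q2
    have q4 : nrmI a c (fun x => (derivative (derivative Q)).eval x) ≤ K₂ * z := e2 g hgN
    have q5 : nrmI a c (fun x => Q.eval x) ≤ K₁ * z := e1 g hgN
    have q6 : nrmI a c (fun x => g.eval x) ≤ K₀ * z := e0 g hgN
    have q7 : z ≤ nrmI a c e * (K₂ + K₁) := by
      rcases hz0.eq_or_lt with h | h
      · rw [← h]; positivity
      · have : z ^ 2 ≤ nrmI a c e * (K₂ * z + K₁ * z) :=
          q2.trans (mul_le_mul_of_nonneg_left (add_le_add q4 q5) hne)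
        nlinarith
    calc _ ≤ K₀ * z := q6
      _ ≤ K₀ * (nrmI a c e * (K₂ + K₁)) := mul_le_mul_of_nonneg_left q7 hK₀
      _ = _ := by rw [hKg]; ring
  obtain ⟨p1, p2⟩ := e3 ψ hψ
  set w := nrmI a c ψ + nrmI a c (deriv ψ) with hw
  have hw0 : 0 ≤ w := add_nonneg (nn _) (nn _)
  -- `H` takes the end point values of `ψ` and has zero slope there. Thus `ψ = H + (ψ - H)`, where
  -- `step1` applies to the first part and `step2` with the bound on `g` to the second.
  set H : ℝ[X] := C (ψ a) * h₀ + C (ψ c) * h₁ with hH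
  have hHa : H.eval a = ψ a := by simp [hH, hh₀, v1]
  have hHc : H.eval c = ψ c := by simp [hH, hh₀, v2]
  have hH' : derivative H = C (ψ c - ψ a) * derivative h₁ := by
    simp only [hH, hh₀, derivative_add, derivative_mul, derivative_C, derivative_sub,
      derivative_one, C_sub]
    ring
  have hHn : nrmI a c (fun x => H.eval x) ≤ K₃ * w * L₀ := by
    have := nrm_add_le ((mQ h₀).const_mul (ψ a)) ((mQ h₁).const_mul (ψ c))
    rw [nrm_const_mul, nrm_const_mul] at this
    simp only [hH, eval_add, eval_mul, eval_C]
    refine this.trans ?_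
    rw [hL₀, mul_add]
    exact add_le_add (mul_le_mul_of_nonneg_right p1 nrm_nonneg)
      (mul_le_mul_of_nonneg_right p2 nrm_nonneg)
  have hHn2 : nrmI a c (fun x => (derivative (derivative H)).eval x) ≤ 2 * (K₃ * w) * L₂ := by
    simp only [hH', derivative_mul, derivative_C, zero_mul, zero_add, eval_mul, eval_C]
    rw [nrmI, nrm_const_mul]
    refine mul_le_mul_of_nonneg_right ?_ nrm_nonneg
    exact (abs_sub _ _).trans (by linarith)
  have hψ0 : ContDiff ℝ 1 fun x => ψ x - H.eval x := hψ.sub (hPc H 1)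
  have r1 := step1 H (by simp [hH', v3]) (by simp [hH', v4])
  have r2 := step2 _ hψ0 (by simp [hHa]) (by simp [hHc])
  have r3 : |slForm a c Lam e fun x => ψ x - H.eval x|
      ≤ Kg * nrmI a c e * (w + K₃ * w * L₀) := by
    have mψ : MemLp ψ 2 (volume.restrict (Ioc a c)) := memLp_Ioc_of_continuous hψ.continuous
    rw [r2, abs_neg]
    refine (abs_intervalIntegral_mul_le hac.le (mQ g) (memLp_sub mψ (mQ H))).trans ?_
    refine mul_le_mul step3 ((nrm_sub_le mψ (mQ H)).trans (add_le_add ?_ hHn)) (nn _)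
      (by positivity)
    linarith [nn (deriv ψ)]
  have r4 : slForm a c Lam e ψ = slForm a c Lam e (fun x => H.eval x)
      + slForm a c Lam e (fun x => ψ x - H.eval x) := by
    rw [← slForm_add_right heac (hPc H 1) hψ0]
    congr 1
    ext x
    ring
  rw [hsub ψ hψ, r4]
  refine (abs_add_le _ _).trans ((add_le_add (r1.trans
    (mul_le_mul_of_nonneg_left (add_le_add hHn2 hHn) hne)) r3).trans (le_of_eq ?_))
  ring

end Element


/-! ### Meshes of the circle -/

section Mesh

open Polynomial

/-- A mesh of `[0, 2π]` such that all trial functions are polynomials of degree at most `deg` on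
each element, and each element lies in one quadrant. -/
structure TrialMesh {M : ℕ} (φ : Fin M → ℝ → ℝ) where
  size : ℕ
  node : ℕ → ℝ
  deg : ℕ
  node_zero : node 0 = 0
  node_size : node size = 2 * Real.pi
  node_lt : ∀ i < size, node i < node (i + 1)
  exists_polynomial : ∀ i < size, ∀ k, ∃ P : ℝ[X], P.natDegree ≤ deg ∧
    ∀ θ ∈ Icc (node i) (node (i + 1)), φ k θ = P.eval θ
  exists_quadrant : ∀ i < size, ∃ j : Fin 4,
    Icc (node i) (node (i + 1)) ⊆ Icc (j * (Real.pi / 2)) ((j + 1) * (Real.pi / 2))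

/-- The increasing enumeration of a finite set. The last clause says that no point of `S` lies
strictly between consecutive nodes, so the resulting mesh refines every mesh with nodes in `S`. -/
lemma exists_sorted_nodes {S : Finset ℝ} {L : ℝ} (h0 : (0 : ℝ) ∈ S) (hL : L ∈ S)
    (hS : ∀ s ∈ S, 0 ≤ s ∧ s ≤ L) :
    ∃ (m : ℕ) (t : ℕ → ℝ), t 0 = 0 ∧ t m = L ∧ (∀ i < m, t i < t (i + 1)) ∧
      (∀ i ≤ m, t i ∈ S) ∧ ∀ i < m, ∀ s ∈ S, s ≤ t i ∨ t (i + 1) ≤ s := by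
  obtain ⟨m, hm⟩ : ∃ m, S.card = m + 1 :=
    Nat.exists_eq_succ_of_ne_zero (Finset.card_ne_zero_of_mem h0)
  set f := S.orderEmbOfFin hm with hf
  have hmem : ∀ i, f i ∈ S := fun i => S.orderEmbOfFin_mem hm i
  have hsurj : ∀ s ∈ S, ∃ j, f j = s := fun s hs => by
    have : s ∈ range f := by rw [hf, Finset.range_orderEmbOfFin]; exact hs
    exact this
  -- Truncation at `m` makes the enumeration a total function on `ℕ`; only indices up to `m` matter.
  let t : ℕ → ℝ := fun i => f ⟨min i m, by omega⟩
  refine ⟨m, t, ?_, ?_, fun i hi => ?_, fun i _ => hmem _, fun i hi s hs => ?_⟩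
  · obtain ⟨j, hj⟩ := hsurj 0 h0
    refine le_antisymm ?_ (hS _ (hmem _)).1
    rw [← hj]
    exact f.monotone (Fin.mk_le_of_le_val (by simp))
  · obtain ⟨j, hj⟩ := hsurj L hL
    refine le_antisymm (hS _ (hmem _)).2 ?_
    rw [← hj]
    refine f.monotone ?_
    rw [Fin.le_def]
    simp only [min_self]
    omega
  · refine f.strictMono ?_
    rw [Fin.lt_def]
    simp only
    omega
  · obtain ⟨j, rfl⟩ := hsurj s hs
    rcases le_or_gt (j : ℕ) i with h | h
    · left
      refine f.monotone ?_
      rw [Fin.le_def]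
      simp only
      omega
    · right
      refine f.monotone ?_
      rw [Fin.le_def]
      simp only
      omega

lemma exists_element {n : ℕ} {s : Fin (n + 1) → ℝ} {x : ℝ} (h0 : s 0 ≤ x)
    (h1 : x < s (Fin.last n)) : ∃ e : Fin n, s e.castSucc ≤ x ∧ x < s e.succ := by
  by_contra! h
  have : ∀ i, s i ≤ x := fun i => Fin.induction h0 (fun e he => h e he) i
  exact absurd (this (Fin.last n)) (not_le.2 h1)

/-- The common refinement of the finitely many trial meshes and the multiples of `π/2`. The latter
are included because the angular coefficient around a singular point of an axis-parallel partition
is constant in each open quadrant. -/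
lemma exists_trialMesh {M : ℕ} {φ : Fin M → ℝ → ℝ}
    (hφ : ∀ k, IsPeriodicPiecewisePolynomial (φ k)) : Nonempty (TrialMesh φ) := by
  choose hper n s hs hs0 hs1 hP using hφ
  have hpi := Real.pi_pos
  let quad : Fin 5 → ℝ := fun j => j * (Real.pi / 2)
  let S : Finset ℝ := (Finset.univ.image quad) ∪
    Finset.univ.biUnion fun k => Finset.univ.image (s k)
  have hquad : ∀ j, quad j ∈ S := fun j =>
    Finset.mem_union_left _ (Finset.mem_image_of_mem _ (Finset.mem_univ j))
  have hsS : ∀ k i, s k i ∈ S := fun k i => Finset.mem_union_right _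
    (Finset.mem_biUnion.2 ⟨k, Finset.mem_univ _, Finset.mem_image_of_mem _ (Finset.mem_univ i)⟩)
  have h0 : (0 : ℝ) ∈ S := by simpa [quad] using hquad 0
  have hL : 2 * Real.pi ∈ S := by
    have := hquad 4
    have e : quad 4 = 2 * Real.pi := by
      simp only [quad]
      norm_num
      ring
    rwa [e] at this
  have hS : ∀ x ∈ S, 0 ≤ x ∧ x ≤ 2 * Real.pi := by
    intro x hx
    rcases Finset.mem_union.1 hx with h | h
    · obtain ⟨j, -, rfl⟩ := Finset.mem_image.1 h
      have hj : ((j : ℕ) : ℝ) ≤ 4 := by exact_mod_cast Nat.lt_succ_iff.1 j.2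
      have hj0 : (0 : ℝ) ≤ ((j : ℕ) : ℝ) := by positivity
      simp only [quad]
      constructor
      · positivity
      · nlinarith
    · obtain ⟨k, -, h⟩ := Finset.mem_biUnion.1 h
      obtain ⟨i, -, rfl⟩ := Finset.mem_image.1 h
      rw [← hs0 k, ← hs1 k]
      exact ⟨(hs k).monotone (Fin.zero_le _), (hs k).monotone (Fin.le_last _)⟩
  obtain ⟨m, t, t0, tm, tlt, tS, tsep⟩ := exists_sorted_nodes h0 hL hS
  have hlt : ∀ i < m, t i < 2 * Real.pi := fun i hi =>
    (tlt i hi).trans_le (hS _ (tS (i + 1) hi)).2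
  -- The condition `i < m` stands inside the existential, so that `choose` returns a total family
  -- and one maximal degree can be taken.
  have hpoly : ∀ i k, ∃ P : ℝ[X], i < m → ∀ θ ∈ Icc (t i) (t (i + 1)), φ k θ = P.eval θ := by
    intro i k
    by_cases hi : i < m
    · obtain ⟨e, he1, he2⟩ := exists_element (s := s k) (x := t i)
        (by rw [hs0]; exact (hS _ (tS i hi.le)).1) (by rw [hs1]; exact hlt i hi)
      obtain ⟨P, hPe⟩ := hP k e
      refine ⟨P, fun _ θ hθ => hPe θ ⟨he1.trans hθ.1, hθ.2.trans ?_⟩⟩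
      exact (tsep i hi _ (hsS k e.succ)).resolve_left (not_le.2 he2)
    · exact ⟨0, fun h => absurd h hi⟩
  choose P hP' using hpoly
  refine ⟨⟨m, t, (Finset.range m).sup fun i => Finset.univ.sup fun k => (P i k).natDegree, t0, tm,
    tlt, fun i hi k => ⟨P i k, ?_, hP' i k hi⟩, fun i hi => ?_⟩⟩
  · refine le_trans ?_ (Finset.le_sup
      (f := fun i => Finset.univ.sup fun k => (P i k).natDegree) (Finset.mem_range.2 hi))
    exact Finset.le_sup (f := fun k => (P i k).natDegree) (Finset.mem_univ k)
  · obtain ⟨e, he1, he2⟩ := exists_element (n := 4) (s := quad) (x := t i)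
      (by simpa [quad] using (hS _ (tS i hi.le)).1) (by
        have := hlt i hi
        simp only [quad, Fin.val_last]
        push_cast
        linarith)
    refine ⟨e, fun θ hθ => ⟨le_trans (by simpa [quad] using he1) hθ.1, hθ.2.trans ?_⟩⟩
    have := (tsep i hi _ (hquad e.succ)).resolve_left (not_le.2 he2)
    simpa [quad] using this

/-! ### Nodes of the mesh and elementwise integration -/

namespace TrialMesh

variable {M : ℕ} {φ : Fin M → ℝ → ℝ} (T : TrialMesh φ)

lemma node_mono {i j : ℕ} (hij : i ≤ j) (hj : j ≤ T.size) : T.node i ≤ T.node j := by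
  induction j, hij using Nat.le_induction with
  | base => exact le_rfl
  | succ j _ ih => exact (ih (by omega)).trans (T.node_lt j (by omega)).le

lemma node_nonneg {i : ℕ} (hi : i ≤ T.size) : 0 ≤ T.node i := by
  rw [← T.node_zero]; exact T.node_mono (Nat.zero_le i) hi

lemma node_le {i : ℕ} (hi : i ≤ T.size) : T.node i ≤ 2 * Real.pi := by
  rw [← T.node_size]; exact T.node_mono hi le_rfl

/-- `f` agrees with a continuous function in the interior of each element. -/
def PwCont (f : ℝ → ℝ) : Prop :=
  ∀ i < T.size, ∃ g : ℝ → ℝ, Continuous g ∧ ∀ θ ∈ Ioo (T.node i) (T.node (i + 1)), f θ = g θ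

variable {T}

lemma PwCont.mul {f g : ℝ → ℝ} (hf : T.PwCont f) (hg : T.PwCont g) :
    T.PwCont fun θ => f θ * g θ := fun i hi => by
  obtain ⟨u, hu, h1⟩ := hf i hi
  obtain ⟨v, hv, h2⟩ := hg i hi
  exact ⟨fun θ => u θ * v θ, hu.mul hv, fun θ hθ => by simp only [h1 θ hθ, h2 θ hθ]⟩

lemma PwCont.intervalIntegrable_element {f : ℝ → ℝ} (hf : T.PwCont f) {i : ℕ} (hi : i < T.size) :
    IntervalIntegrable f volume (T.node i) (T.node (i + 1)) := by
  obtain ⟨g, hg, h⟩ := hf i hi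
  refine (hg.intervalIntegrable _ _).congr_ae ?_
  rw [uIoc_of_le (T.node_lt i hi).le, ← restrict_Ioo_eq_restrict_Ioc]
  exact (ae_restrict_iff' measurableSet_Ioo).2 (ae_of_all _ fun θ hθ => (h θ hθ).symm)

lemma PwCont.intervalIntegrable {f : ℝ → ℝ} (hf : T.PwCont f) :
    IntervalIntegrable f volume 0 (2 * Real.pi) := by
  rw [← T.node_zero, ← T.node_size]
  exact IntervalIntegrable.trans_iterate fun i hi => hf.intervalIntegrable_element hi

lemma PwCont.memLp {f : ℝ → ℝ} (hf : T.PwCont f) :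
    MemLp f 2 (volume.restrict (Ioc 0 (2 * Real.pi))) := by
  have h2 : (0 : ℝ) ≤ 2 * Real.pi := by positivity
  have h1 := hf.intervalIntegrable
  have h3 := (hf.mul hf).intervalIntegrable
  rw [intervalIntegrable_iff_integrableOn_Ioc_of_le h2] at h1 h3
  refine (memLp_two_iff_integrable_sq h1.aestronglyMeasurable).2 ?_
  have h4 : Integrable (fun x => f x * f x) (volume.restrict (Ioc 0 (2 * Real.pi))) := h3
  simpa only [pow_two] using h4

lemma sum_integral {f : ℝ → ℝ}
    (hf : ∀ i < T.size, IntervalIntegrable f volume (T.node i) (T.node (i + 1))) :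
    ∑ i ∈ Finset.range T.size, ∫ θ in (T.node i)..(T.node (i + 1)), f θ
      = ∫ θ in (0 : ℝ)..(2 * Real.pi), f θ := by
  rw [intervalIntegral.sum_integral_adjacent_intervals hf, T.node_zero, T.node_size]

variable (T)

/-- Apart from the finitely many nodes, every angle is interior to some element; otherwise all
nodes, including `2π`, would lie strictly to its left. -/
lemma ae_mem_element : ∀ᵐ θ ∂volume.restrict (Ioc 0 (2 * Real.pi)),
    ∃ i < T.size, θ ∈ Ioo (T.node i) (T.node (i + 1)) := by
  have h1 : ∀ᵐ θ : ℝ, θ ∉ T.node '' (Iio (T.size + 1)) :=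
    measure_eq_zero_iff_ae_notMem.1 (((finite_Iio _).image _).measure_zero _)
  refine (ae_restrict_iff' measurableSet_Ioc).2 ?_
  filter_upwards [h1] with θ h hθ
  by_contra! hno
  have hn : ∀ i ≤ T.size, T.node i < θ := by
    intro i
    induction i with
    | zero => intro _; rw [T.node_zero]; exact hθ.1
    | succ i ih =>
      intro hi
      have h2 := hno i (by omega)
      have h3 : T.node (i + 1) ≤ θ := by
        by_contra! h4
        exact h2 ⟨ih (by omega), h4⟩
      exact lt_of_le_of_ne h3 fun h5 => h ⟨i + 1, by simp; omega, h5⟩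
  have := hn T.size le_rfl
  rw [T.node_size] at this
  linarith [hθ.2]

/-- On each element, linear combinations of the trial functions are polynomials. -/
lemma exists_polynomial_combination (ρ : Fin M → ℝ) {i : ℕ} (hi : i < T.size) :
    ∃ P : ℝ[X], P.natDegree ≤ T.deg ∧
      ∀ θ ∈ Icc (T.node i) (T.node (i + 1)), ∑ k, ρ k * φ k θ = P.eval θ := by
  choose P hP1 hP2 using T.exists_polynomial i hi
  refine ⟨∑ k, C (ρ k) * P k, ?_, fun θ hθ => ?_⟩
  · exact natDegree_sum_le_of_forall_le _ _ fun k _ => (natDegree_C_mul_le _ _).trans (hP1 k)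
  · simp only [eval_finsetSum, eval_mul, eval_C]
    exact Finset.sum_congr rfl fun k _ => by rw [hP2 k θ hθ]

end TrialMesh

lemma deriv_eq_of_eqOn_Icc {f : ℝ → ℝ} {P : ℝ[X]} {a c θ : ℝ}
    (h : ∀ x ∈ Icc a c, f x = P.eval x) (hθ : θ ∈ Ioo a c) :
    HasDerivAt f (P.derivative.eval θ) θ := by
  refine (P.hasDerivAt θ).congr_of_eventuallyEq ?_
  filter_upwards [Icc_mem_nhds hθ.1 hθ.2] with x hx using h x hx

/-! ### Regularity of linear combinations of trial functions -/

namespace TrialMesh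

variable {M : ℕ} {φ : Fin M → ℝ → ℝ} (T : TrialMesh φ)

lemma pwCont_trial (k : Fin M) : T.PwCont (φ k) := fun i hi => by
  obtain ⟨P, -, hP⟩ := T.exists_polynomial i hi k
  exact ⟨_, P.continuous, fun θ hθ => hP θ (Ioo_subset_Icc_self hθ)⟩

lemma pwCont_deriv_trial (k : Fin M) : T.PwCont (deriv (φ k)) := fun i hi => by
  obtain ⟨P, -, hP⟩ := T.exists_polynomial i hi k
  exact ⟨_, P.derivative.continuous, fun θ hθ => (deriv_eq_of_eqOn_Icc hP hθ).deriv⟩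

lemma hasDerivAt_combination (ρ : Fin M → ℝ) {i : ℕ} (hi : i < T.size) {θ : ℝ}
    (hθ : θ ∈ Ioo (T.node i) (T.node (i + 1))) :
    HasDerivAt (fun θ => ∑ k, ρ k * φ k θ) (∑ k, ρ k * deriv (φ k) θ) θ := by
  refine HasDerivAt.fun_sum fun k _ => ?_
  obtain ⟨P, -, hP⟩ := T.exists_polynomial i hi k
  have := deriv_eq_of_eqOn_Icc hP hθ
  rw [this.deriv]
  exact this.const_mul _

/-- Linear combinations of the trial functions are Lipschitz continuous. -/
lemma exists_lipschitz_combination (T : TrialMesh φ) (hper : ∀ k, Function.Periodic (φ k) (2 * Real.pi))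
    (ρ : Fin M → ℝ) : ∃ K : NNReal, LipschitzWith K fun θ => ∑ k, ρ k * φ k θ := by
  set f : ℝ → ℝ := fun θ => ∑ k, ρ k * φ k θ with hf
  have hfp : Function.Periodic f (2 * Real.pi) := fun θ => by simp only [hf, hper _ θ]
  have h1 : ∀ i, ∃ K : NNReal, i < T.size →
      LipschitzOnWith K f (Icc (T.node i) (T.node (i + 1))) := by
    intro i
    by_cases hi : i < T.size
    · obtain ⟨P, -, hP⟩ := T.exists_polynomial_combination ρ hi
      obtain ⟨K, hK⟩ := ((contDiff_polynomial_eval P).contDiffOn (s := Icc (T.node i)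
        (T.node (i + 1)))).exists_lipschitzOnWith (by simp) (convex_Icc _ _) isCompact_Icc
      exact ⟨K, fun _ x hx y hy => by rw [hf]; simp only; rw [hP x hx, hP y hy]; exact hK hx hy⟩
    · exact ⟨0, fun h => absurd h hi⟩
  choose K hK using h1
  set L : NNReal := (Finset.range T.size).sup K with hL
  have hKL : ∀ i < T.size, ∀ x ∈ Icc (T.node i) (T.node (i + 1)),
      ∀ y ∈ Icc (T.node i) (T.node (i + 1)), |f x - f y| ≤ L * |x - y| := by
    intro i hi x hx y hy
    have := (hK i hi).dist_le_mul x hx y hy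
    rw [Real.dist_eq, Real.dist_eq] at this
    refine this.trans (mul_le_mul_of_nonneg_right ?_ (abs_nonneg _))
    exact_mod_cast Finset.le_sup (f := K) (Finset.mem_range.2 hi)
  -- The elementwise Lipschitz bounds are glued from left to right; splitting at a node loses
  -- nothing because the distances add up.
  have h2 : ∀ n ≤ T.size, ∀ x y, 0 ≤ x → x ≤ y → y ≤ T.node n →
      |f x - f y| ≤ L * (y - x) := by
    intro n
    induction n with
    | zero =>
      intro _ x y hx hxy hy
      rw [T.node_zero] at hy
      have e1 : x = 0 := by linarith
      have e2 : y = 0 := by linarith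
      simp [e1, e2]
    | succ n ih =>
      intro hn x y hx hxy hy
      rcases le_total y (T.node n) with h | h
      · exact ih (by omega) x y hx hxy h
      · rcases le_total x (T.node n) with h' | h'
        · have a1 := ih (by omega) x (T.node n) hx h' le_rfl
          have a2 := hKL n (by omega) (T.node n) ⟨le_rfl, (T.node_lt n (by omega)).le⟩ y ⟨h, hy⟩
          rw [abs_sub_comm (T.node n), abs_of_nonneg (sub_nonneg.2 h)] at a2
          have := abs_sub_le (f x) (f (T.node n)) (f y)
          linarith
        · have := hKL n (by omega) x ⟨h', hxy.trans hy⟩ y ⟨h, hy⟩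
          rwa [abs_sub_comm x y, abs_of_nonneg (sub_nonneg.2 hxy)] at this
  have h2pi : 0 < 2 * Real.pi := by positivity
  -- Pairs straddling `2π` are split there, and the part beyond it is moved back by one period.
  have h3 : ∀ x y, 0 ≤ x → x < 2 * Real.pi → x ≤ y → y < x + 2 * Real.pi →
      |f x - f y| ≤ L * (y - x) := by
    intro x y hx hx2 hxy hy
    rcases le_total y (2 * Real.pi) with h | h
    · exact h2 T.size le_rfl x y hx hxy (by rwa [T.node_size])
    · have a1 := h2 T.size le_rfl x (2 * Real.pi) hx hx2.le (by rw [T.node_size])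
      have a2 := h2 T.size le_rfl 0 (y - 2 * Real.pi) le_rfl (by linarith)
        (by rw [T.node_size]; linarith)
      rw [hfp.sub_eq, show f 0 = f (2 * Real.pi) by simpa using (hfp 0).symm] at a2
      have := abs_sub_le (f x) (f (2 * Real.pi)) (f y)
      linarith
  -- First `y` is reduced to `y'` in the period starting at `x`, which does not increase the
  -- distance. Then `x` and `y'` are translated by the same multiple of `2π`.
  have h4 : ∀ x y, x ≤ y → |f x - f y| ≤ L * (y - x) := by
    intro x y hxy
    set y' := toIcoMod h2pi x y with hy'
    have m1 : y' ∈ Ico x (x + 2 * Real.pi) := toIcoMod_mem_Ico h2pi x y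
    have m2 : y' ≤ y := by
      have := toIcoMod_add_toIcoDiv_zsmul h2pi x y
      have h0 : 0 ≤ toIcoDiv h2pi x y := by
        by_contra! hneg
        have hle : toIcoDiv h2pi x y ≤ -1 := by omega
        have hle' : ((toIcoDiv h2pi x y : ℤ) : ℝ) ≤ -1 := by exact_mod_cast hle
        rw [zsmul_eq_mul] at this
        have := m1.2
        nlinarith
      have h0' : (0 : ℝ) ≤ ((toIcoDiv h2pi x y : ℤ) : ℝ) := by exact_mod_cast h0
      rw [zsmul_eq_mul] at this
      nlinarith
    have m3 : f y' = f y := by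
      have := toIcoMod_add_toIcoDiv_zsmul h2pi x y
      rw [← this, zsmul_eq_mul]
      exact (hfp.int_mul _ _).symm
    set x' := toIcoMod h2pi 0 x with hx'
    have k1 : x' ∈ Ico 0 (0 + 2 * Real.pi) := toIcoMod_mem_Ico h2pi 0 x
    rw [zero_add] at k1
    have k2 := toIcoMod_add_toIcoDiv_zsmul h2pi 0 x
    rw [zsmul_eq_mul] at k2
    have k3 : f x' = f x := by
      rw [← k2]
      exact (hfp.int_mul _ _).symm
    have k4 : f (y' - (toIcoDiv h2pi 0 x : ℤ) * (2 * Real.pi)) = f y' := hfp.sub_int_mul_eq _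
    have := h3 x' (y' - (toIcoDiv h2pi 0 x : ℤ) * (2 * Real.pi)) k1.1 k1.2
      (by linarith [m1.1]) (by linarith [m1.2])
    rw [k3, k4, m3] at this
    refine this.trans (mul_le_mul_of_nonneg_left ?_ L.2)
    linarith
  refine ⟨L, LipschitzWith.of_dist_le_mul fun x y => ?_⟩
  rw [Real.dist_eq, Real.dist_eq]
  rcases le_total x y with h | h
  · rw [abs_sub_comm x y, abs_of_nonneg (sub_nonneg.2 h)]
    exact h4 x y h
  · rw [abs_sub_comm (f x), abs_of_nonneg (sub_nonneg.2 h)]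
    exact h4 y x h

end TrialMesh

end Mesh


/-! ### The eigenvalue problem on the circle -/

section Circle

open Polynomial

/-- `q` is constant in the interior of each quadrant, with values in `[pmin, pmax]`. -/
def IsSectorCoeff (pmin pmax : ℝ) (q : ℝ → ℝ) : Prop :=
  ∀ j : Fin 4, ∃ v ∈ Icc pmin pmax,
    ∀ θ ∈ Ioo (j * (Real.pi / 2)) ((j + 1) * (Real.pi / 2)), q θ = v

/-- The `L²` norm over one period. -/
abbrev nrmC (f : ℝ → ℝ) : ℝ := nrmI 0 (2 * Real.pi) f

lemma angularMeasure_eq : angularMeasure = volume.restrict (Ioc 0 (2 * Real.pi)) :=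
  restrict_Ioo_eq_restrict_Ioc

/-- The weighted bilinear form `∫ q (u' f' - Λ² u f)` over one period. -/
def circleForm (q : ℝ → ℝ) (Lam : ℝ) (u f : ℝ → ℝ) : ℝ :=
  ∫ θ in (0 : ℝ)..(2 * Real.pi), q θ * (deriv u θ * deriv f θ - Lam ^ 2 * (u θ * f θ))

lemma periodic_deriv {f : ℝ → ℝ} {c : ℝ} (hf : Function.Periodic f c) :
    Function.Periodic (deriv f) c := fun x => by
  rw [← deriv_comp_add_const]
  congr 1
  exact funext hf

lemma memH1Per_of_contDiff {f : ℝ → ℝ} (hf : ContDiff ℝ 1 f)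
    (hp : Function.Periodic f (2 * Real.pi)) : MemH1Per f := by
  refine ⟨hp, hf.absolutelyContinuousOnInterval _ _, ?_⟩
  rw [angularMeasure_eq]
  exact memLp_Ioc_of_continuous (hf.continuous_deriv le_rfl)

lemma MemH1Per.memLp_deriv {f : ℝ → ℝ} (hf : MemH1Per f) :
    MemLp (deriv f) 2 (volume.restrict (Ioc 0 (2 * Real.pi))) := by
  rw [← angularMeasure_eq]; exact hf.2.2

lemma MemH1Per.memLp {f : ℝ → ℝ} (hf : MemH1Per f) :
    MemLp f 2 (volume.restrict (Ioc 0 (2 * Real.pi))) := by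
  have := hf.2.1.continuousOn
  rw [uIcc_of_le (by positivity)] at this
  exact memLp_Ioc_of_continuousOn this

lemma memH1Per_of_lipschitzOn {f : ℝ → ℝ} (hp : Function.Periodic f (2 * Real.pi)) {K : NNReal}
    (hK : LipschitzOnWith K f (Icc 0 (2 * Real.pi))) : MemH1Per f := by
  have h2 : (0 : ℝ) ≤ 2 * Real.pi := by positivity
  refine ⟨hp, LipschitzOnWith.absolutelyContinuousOnInterval (K := K) (by rwa [uIcc_of_le h2]), ?_⟩
  rw [angularMeasure]
  refine MemLp.of_bound (measurable_deriv f).aestronglyMeasurable K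
    ((ae_restrict_iff' measurableSet_Ioo).2 (ae_of_all _ fun θ hθ => ?_))
  exact norm_deriv_le_of_lipschitzOn (Icc_mem_nhds hθ.1 hθ.2) hK

/-- A function on an element vanishing at the end points extends by zero to `H¹_per`. -/
lemma exists_memH1Per_extension {a c : ℝ} (ha : 0 ≤ a) (hac : a < c) (hc : c ≤ 2 * Real.pi)
    {f : ℝ → ℝ} (hf : ContDiff ℝ 1 f) (hfa : f a = 0) (hfc : f c = 0) :
    ∃ F : ℝ → ℝ, MemH1Per F ∧ (∀ θ ∈ Ioo a c, F θ = f θ) ∧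
      ∀ θ ∈ Icc 0 (2 * Real.pi), θ ∉ Ioo a c → F θ = 0 := by
  have h2 : (0 : ℝ) < 2 * Real.pi := by positivity
  -- Clamping the argument to `[a, c]` extends `f` by its end point values, which are zero, and
  -- preserves the Lipschitz constant.
  set g : ℝ → ℝ := fun θ => f (max a (min c θ)) with hg
  set F : ℝ → ℝ := fun θ => g (toIcoMod h2 0 θ) with hF
  have hclamp : ∀ θ, max a (min c θ) ∈ Icc a c := fun θ =>
    ⟨le_max_left _ _, max_le hac.le (min_le_left _ _)⟩
  have hg0 : ∀ θ, θ ∉ Ioo a c → g θ = 0 := by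
    intro θ hθ
    simp only [hg]
    rcases le_or_gt θ a with h | h
    · rw [max_eq_left ((min_le_right _ _).trans h), hfa]
    · have : c ≤ θ := by
        by_contra! h'
        exact hθ ⟨h, h'⟩
      rw [min_eq_left this, max_eq_right hac.le, hfc]
  have hFg : ∀ θ ∈ Icc 0 (2 * Real.pi), F θ = g θ := by
    intro θ hθ
    rcases hθ.2.lt_or_eq with h | h
    · simp only [hF]
      rw [(toIcoMod_eq_self h2).2 ⟨hθ.1, by simpa using h⟩]
    · simp only [hF]
      -- At `θ = 2π` the periodization reads the value at `0`; both values are zero because `(a, c)`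
      -- lies inside the period.
      have : toIcoMod h2 0 θ = 0 := by
        have := toIcoMod_apply_right h2 0
        rw [zero_add] at this
        rwa [h]
      rw [this, hg0 _ (fun h' => absurd h'.1 (not_lt.2 ha)),
        hg0 _ (fun h' => absurd h'.2 (not_lt.2 (by rw [h]; exact hc)))]
  obtain ⟨K, hK⟩ := (hf.contDiffOn (s := Icc a c)).exists_lipschitzOnWith (by simp)
    (convex_Icc _ _) isCompact_Icc
  have hgK : LipschitzWith K g := by
    refine LipschitzWith.of_dist_le_mul fun x y => ?_
    refine (hK.dist_le_mul _ (hclamp x) _ (hclamp y)).trans ?_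
    refine mul_le_mul_of_nonneg_left ?_ K.2
    have h1 : LipschitzWith 1 fun θ : ℝ => max a (min c θ) :=
      (LipschitzWith.id.const_min c).const_max a
    simpa using h1.dist_le_mul x y
  refine ⟨F, memH1Per_of_lipschitzOn (K := K) ?_ ?_, ?_, ?_⟩
  · intro θ
    simp only [hF]
    rw [toIcoMod_add_right]
  · intro x hx y hy
    rw [hFg x hx, hFg y hy]
    exact hgK x y
  · intro θ hθ
    rw [hFg θ ⟨ha.trans hθ.1.le, hθ.2.le.trans hc⟩]
    simp only [hg]
    rw [min_eq_right hθ.2.le, max_eq_right hθ.1.le]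
  · intro θ hθ h
    rw [hFg θ hθ, hg0 θ h]

/-! ### Localization of the eigenvalue equation to elements -/

namespace IsSectorCoeff

variable {pmin pmax : ℝ} {q : ℝ → ℝ} {M : ℕ} {φ : Fin M → ℝ → ℝ}

lemma exists_eq_on_element (hq : IsSectorCoeff pmin pmax q) (T : TrialMesh φ) {i : ℕ}
    (hi : i < T.size) :
    ∃ v ∈ Icc pmin pmax, ∀ θ ∈ Ioo (T.node i) (T.node (i + 1)), q θ = v := by
  obtain ⟨j, hj⟩ := T.exists_quadrant i hi
  obtain ⟨v, hv, h⟩ := hq j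
  have h1 := T.node_lt i hi
  refine ⟨v, hv, fun θ hθ => h θ ⟨?_, ?_⟩⟩
  · exact (hj ⟨le_rfl, h1.le⟩).1.trans_lt hθ.1
  · exact hθ.2.trans_le (hj ⟨h1.le, le_rfl⟩).2

lemma pwCont (hq : IsSectorCoeff pmin pmax q) (T : TrialMesh φ) : T.PwCont q := fun i hi => by
  obtain ⟨v, -, h⟩ := hq.exists_eq_on_element T hi
  exact ⟨fun _ => v, continuous_const, h⟩

lemma ae_mem (hq : IsSectorCoeff pmin pmax q) (T : TrialMesh φ) :
    ∀ᵐ θ ∂volume.restrict (Ioc 0 (2 * Real.pi)), q θ ∈ Icc pmin pmax := by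
  filter_upwards [T.ae_mem_element] with θ hθ
  obtain ⟨i, hi, h⟩ := hθ
  obtain ⟨v, hv, h'⟩ := hq.exists_eq_on_element T hi
  rw [h' θ h]
  exact hv

/-- An eigenfunction satisfies the eigenvalue equation on each element. -/
lemma slForm_eq_zero (hpmin : 0 < pmin) (hq : IsSectorCoeff pmin pmax q) (T : TrialMesh φ)
    {Lam : ℝ} {vth : ℝ → ℝ} (h : ∀ f, MemH1Per f → circleForm q Lam vth f = 0) {i : ℕ}
    (hi : i < T.size) {f : ℝ → ℝ} (hf : ContDiff ℝ 1 f) (hfa : f (T.node i) = 0)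
    (hfc : f (T.node (i + 1)) = 0) : slForm (T.node i) (T.node (i + 1)) Lam vth f = 0 := by
  set a := T.node i with ha
  set c := T.node (i + 1) with hc
  have hac : a < c := T.node_lt i hi
  have h2 : (0 : ℝ) ≤ 2 * Real.pi := by positivity
  have ha0 : 0 ≤ a := T.node_nonneg hi.le
  have hc2 : c ≤ 2 * Real.pi := T.node_le hi
  obtain ⟨F, hF, hF1, hF2⟩ := exists_memH1Per_extension ha0 hac hc2 hf hfa hfc
  obtain ⟨v, hv, hqv⟩ := hq.exists_eq_on_element T hi
  have key := h F hF
  rw [circleForm, intervalIntegral.integral_of_le h2, integral_Ioc_eq_integral_Ioo] at key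
  have e1 : ∫ θ in Ioo 0 (2 * Real.pi),
        q θ * (deriv vth θ * deriv F θ - Lam ^ 2 * (vth θ * F θ))
      = ∫ θ in Ioo 0 (2 * Real.pi), (Ioo a c).indicator
          (fun θ => v * (deriv vth θ * deriv f θ - Lam ^ 2 * (vth θ * f θ))) θ := by
    refine integral_congr_ae ((ae_restrict_iff' measurableSet_Ioo).2 ?_)
    -- The extension may have corners at `a` and `c`. Away from these points its derivative is that
    -- of `f` or of zero.
    have h1 : ∀ᵐ θ : ℝ, θ ≠ a := by simp [ae_iff]
    have h3 : ∀ᵐ θ : ℝ, θ ≠ c := by simp [ae_iff]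
    filter_upwards [h1, h3] with θ ha' hc' hθ
    by_cases hm : θ ∈ Ioo a c
    · rw [indicator_of_mem hm, hqv θ hm, hF1 θ hm, Filter.EventuallyEq.deriv_eq
        (Filter.eventually_of_mem (Ioo_mem_nhds hm.1 hm.2) hF1)]
    · rw [indicator_of_notMem hm]
      have : F =ᶠ[nhds θ] fun _ => 0 := by
        have h4 : θ ∉ Icc a c := fun h' =>
          hm ⟨lt_of_le_of_ne h'.1 (Ne.symm ha'), lt_of_le_of_ne h'.2 hc'⟩
        filter_upwards [isClosed_Icc.isOpen_compl.mem_nhds h4, Ioo_mem_nhds hθ.1 hθ.2] with x hx hx'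
        exact hF2 x (Ioo_subset_Icc_self hx') fun h' => hx (Ioo_subset_Icc_self h')
      rw [this.deriv_eq, this.eq_of_nhds]
      simp
  rw [e1, setIntegral_indicator measurableSet_Ioo,
    inter_eq_right.2 (Ioo_subset_Ioo ha0 hc2), integral_const_mul,
    ← integral_Ioc_eq_integral_Ioo, ← intervalIntegral.integral_of_le hac.le] at key
  exact (mul_eq_zero.1 key).resolve_left (hpmin.trans_le hv.1).ne'

lemma circleForm_eq_sum (T : TrialMesh φ) {v : ℕ → ℝ}
    (hv : ∀ i < T.size, ∀ θ ∈ Ioo (T.node i) (T.node (i + 1)), q θ = v i) {Lam : ℝ} {u ψ : ℝ → ℝ}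
    (hu : MemH1Per u) (hψ : ContDiff ℝ 1 ψ) :
    circleForm q Lam u ψ
      = ∑ i ∈ Finset.range T.size, v i * slForm (T.node i) (T.node (i + 1)) Lam u ψ := by
  have hle : ∀ i < T.size, T.node i ≤ T.node (i + 1) := fun i hi => (T.node_lt i hi).le
  have hae : ∀ i < T.size, ∀ᵐ θ : ℝ, θ ∈ uIoc (T.node i) (T.node (i + 1)) →
      q θ * (deriv u θ * deriv ψ θ - Lam ^ 2 * (u θ * ψ θ))
        = v i * (deriv u θ * deriv ψ θ - Lam ^ 2 * (u θ * ψ θ)) := by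
    intro i hi
    have h1 : ∀ᵐ θ : ℝ, θ ≠ T.node (i + 1) := by simp [ae_iff]
    filter_upwards [h1] with θ h1 h2
    rw [uIoc_of_le (hle i hi)] at h2
    rw [hv i hi θ ⟨h2.1, lt_of_le_of_ne h2.2 h1⟩]
  have hint : ∀ i < T.size, IntervalIntegrable
      (fun θ => v i * (deriv u θ * deriv ψ θ - Lam ^ 2 * (u θ * ψ θ))) volume
      (T.node i) (T.node (i + 1)) := by
    intro i hi
    have hac : AbsolutelyContinuousOnInterval u (T.node i) (T.node (i + 1)) := by
      refine hu.2.1.mono ?_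
      rw [uIcc_of_le (hle i hi), uIcc_of_le (by positivity)]
      exact Icc_subset_Icc (T.node_nonneg hi.le) (T.node_le hi)
    exact (intervalIntegrable_slForm hac hψ).const_mul _
  rw [circleForm, ← T.sum_integral]
  · refine Finset.sum_congr rfl fun i hi => ?_
    rw [slForm, ← intervalIntegral.integral_const_mul]
    exact intervalIntegral.integral_congr_ae (hae i (Finset.mem_range.1 hi))
  · intro i hi
    refine (hint i hi).congr_ae ?_
    refine (ae_restrict_iff' measurableSet_uIoc).2 ?_
    filter_upwards [hae i hi] with θ h h' using (h h').symm

end IsSectorCoeff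

lemma nrmI_le_nrmC {a c : ℝ} (ha : 0 ≤ a) (hc : c ≤ 2 * Real.pi) {f : ℝ → ℝ}
    (hf : MemLp f 2 (volume.restrict (Ioc 0 (2 * Real.pi)))) : nrmI a c f ≤ nrmC f :=
  Real.sqrt_le_sqrt (setIntegral_mono_set hf.integrable_sq (ae_of_all _ fun _ => sq_nonneg _)
    (ae_of_all _ (Ioc_subset_Ioc ha hc)))

/-! ### The inverse estimate for trial functions on the circle -/

namespace TrialMesh

variable {M : ℕ} {φ : Fin M → ℝ → ℝ}

lemma memH1Per_combination (T : TrialMesh φ) (hper : ∀ k, Function.Periodic (φ k) (2 * Real.pi))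
    (ρ : Fin M → ℝ) : MemH1Per fun θ => ∑ k, ρ k * φ k θ := by
  obtain ⟨K, hK⟩ := T.exists_lipschitz_combination hper ρ
  exact memH1Per_of_lipschitzOn (fun θ => by simp only [hper _ θ]) (K := K) hK.lipschitzOnWith

/-- The inverse estimate on the circle. -/
lemma exists_circleForm_le (T : TrialMesh φ)
    (hper : ∀ k, Function.Periodic (φ k) (2 * Real.pi)) {pmin : ℝ} (hpmin : 0 < pmin) (pmax : ℝ) :
    ∃ K : ℝ, 0 ≤ K ∧ ∀ q, IsSectorCoeff pmin pmax q → ∀ (Lam : ℝ) (vth : ℝ → ℝ),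
      Lam ∈ Icc (0 : ℝ) 1 → MemH1Per vth → (∀ f, MemH1Per f → circleForm q Lam vth f = 0) →
      ∀ (ρ : Fin M → ℝ) (ψ : ℝ → ℝ), ContDiff ℝ 1 ψ → Function.Periodic ψ (2 * Real.pi) →
        |circleForm q Lam (fun θ => ∑ k, ρ k * φ k θ) ψ|
          ≤ K * nrmC (fun θ => ∑ k, ρ k * φ k θ - vth θ) * (nrmC ψ + nrmC (deriv ψ)) := by
  -- The element constants are fixed before `q`, the eigenpairs and the test function, with the
  -- default `0` for indices beyond the mesh.
  have hK : ∀ i, ∃ K : ℝ, 0 ≤ K ∧ (i < T.size → ∀ (P : ℝ[X]) (vth : ℝ → ℝ) (Lam : ℝ),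
      P.natDegree ≤ T.deg → Lam ∈ Icc (0 : ℝ) 1 →
      AbsolutelyContinuousOnInterval vth (T.node i) (T.node (i + 1)) →
      (∀ f, ContDiff ℝ 1 f → f (T.node i) = 0 → f (T.node (i + 1)) = 0 →
        slForm (T.node i) (T.node (i + 1)) Lam vth f = 0) →
      ∀ ψ, ContDiff ℝ 1 ψ →
        |slForm (T.node i) (T.node (i + 1)) Lam (fun x => P.eval x) ψ
            - slForm (T.node i) (T.node (i + 1)) Lam vth ψ|
          ≤ K * nrmI (T.node i) (T.node (i + 1)) (fun x => P.eval x - vth x)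
            * (nrmI (T.node i) (T.node (i + 1)) ψ
              + nrmI (T.node i) (T.node (i + 1)) (deriv ψ))) := by
    intro i
    by_cases hi : i < T.size
    · obtain ⟨K, hK, h⟩ := exists_slForm_sub_le (T.node_lt i hi) T.deg
      exact ⟨K, hK, fun _ => h⟩
    · exact ⟨0, le_rfl, fun h => absurd h hi⟩
  choose K hK0 hK using hK
  have hpm : 0 ≤ max pmin pmax := hpmin.le.trans (le_max_left _ _)
  refine ⟨max pmin pmax * ∑ i ∈ Finset.range T.size, K i,
    mul_nonneg hpm (Finset.sum_nonneg fun i _ => hK0 i), ?_⟩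
  intro q hq Lam vth hLam hvth hsl ρ ψ hψ hψp
  set u : ℝ → ℝ := fun θ => ∑ k, ρ k * φ k θ with hu
  have huH := T.memH1Per_combination hper ρ
  have hv : ∀ i, ∃ v : ℝ, i < T.size → v ∈ Icc pmin pmax ∧
      ∀ θ ∈ Ioo (T.node i) (T.node (i + 1)), q θ = v := by
    intro i
    by_cases hi : i < T.size
    · obtain ⟨v, hv, h⟩ := hq.exists_eq_on_element T hi
      exact ⟨v, fun _ => ⟨hv, h⟩⟩
    · exact ⟨0, fun h => absurd h hi⟩
  choose v hv using hv
  have e1 := IsSectorCoeff.circleForm_eq_sum T (fun i hi => (hv i hi).2) (Lam := Lam) huH hψ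
  have e2 := IsSectorCoeff.circleForm_eq_sum T (fun i hi => (hv i hi).2) (Lam := Lam) hvth hψ
  rw [hsl ψ (memH1Per_of_contDiff hψ hψp)] at e2
  -- The form of the exact eigenfunction vanishes over the whole period but not element by element,
  -- because of fluxes at the nodes. Subtracting it turns each summand into the difference which the
  -- inverse estimate controls.
  have e3 : circleForm q Lam u ψ = ∑ i ∈ Finset.range T.size, v i *
      (slForm (T.node i) (T.node (i + 1)) Lam u ψ
        - slForm (T.node i) (T.node (i + 1)) Lam vth ψ) := by
    simp only [mul_sub, Finset.sum_sub_distrib]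
    rw [← e1, ← e2, sub_zero]
  rw [e3, Finset.mul_sum, Finset.sum_mul, Finset.sum_mul]
  refine (Finset.abs_sum_le_sum_abs _ _).trans (Finset.sum_le_sum fun i hi => ?_)
  have hi' := Finset.mem_range.1 hi
  obtain ⟨⟨hv1, hv2⟩, hv3⟩ := hv i hi'
  obtain ⟨P, hP1, hP2⟩ := T.exists_polynomial_combination ρ hi'
  have hle := (T.node_lt i hi').le
  have hac : AbsolutelyContinuousOnInterval vth (T.node i) (T.node (i + 1)) := by
    refine hvth.2.1.mono ?_
    rw [uIcc_of_le hle, uIcc_of_le (by positivity)]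
    exact Icc_subset_Icc (T.node_nonneg hi'.le) (T.node_le hi')
  have e4 : slForm (T.node i) (T.node (i + 1)) Lam u ψ
      = slForm (T.node i) (T.node (i + 1)) Lam (fun x => P.eval x) ψ := by
    rw [slForm, slForm]
    refine intervalIntegral.integral_congr_ae ?_
    have h1 : ∀ᵐ θ : ℝ, θ ≠ T.node (i + 1) := by simp [ae_iff]
    filter_upwards [h1] with θ h1 h2
    rw [uIoc_of_le hle] at h2
    rw [(deriv_eq_of_eqOn_Icc hP2 ⟨h2.1, lt_of_le_of_ne h2.2 h1⟩).deriv, P.deriv,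
      show u θ = P.eval θ from hP2 θ (Ioc_subset_Icc_self h2)]
  have key := hK i hi' P vth Lam hP1 hLam hac
    (fun f hf hfa hfc => hq.slForm_eq_zero hpmin T hsl hi' hf hfa hfc) ψ hψ
  have e5 : nrmI (T.node i) (T.node (i + 1)) (fun x => P.eval x - vth x)
      = nrmI (T.node i) (T.node (i + 1)) (fun x => u x - vth x) := by
    refine nrm_congr ((ae_restrict_iff' measurableSet_Ioc).2 (ae_of_all _ fun θ hθ => ?_))
    simp only
    rw [show u θ = P.eval θ from hP2 θ (Ioc_subset_Icc_self hθ)]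
  have b1 := nrmI_le_nrmC (T.node_nonneg hi'.le) (T.node_le hi') (memLp_sub huH.memLp hvth.memLp)
  have b2 := nrmI_le_nrmC (T.node_nonneg hi'.le) (T.node_le hi')
    (memLp_Ioc_of_continuous hψ.continuous)
  have b3 := nrmI_le_nrmC (T.node_nonneg hi'.le) (T.node_le hi')
    (memLp_Ioc_of_continuous (hψ.continuous_deriv le_rfl))
  rw [e4, abs_mul, mul_assoc, mul_assoc]
  rw [e5] at key
  refine mul_le_mul ?_ (key.trans ?_) (abs_nonneg _) hpm
  · rw [abs_of_pos (hpmin.trans_le hv1)]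
    exact hv2.trans (le_max_right _ _)
  · rw [mul_assoc]
    refine mul_le_mul_of_nonneg_left ?_ (hK0 i)
    exact mul_le_mul b1 (add_le_add b2 b3) (add_nonneg nrm_nonneg nrm_nonneg) nrm_nonneg

end TrialMesh

end Circle


/-! ### Bounds for exact and discrete eigenpairs, uniform in the coefficient -/

section Circle

variable {pmin pmax : ℝ} {q : ℝ → ℝ} {M : ℕ} {φ : Fin M → ℝ → ℝ}

lemma memLp_mul_of_ae_mem {μ : Measure ℝ} {f : ℝ → ℝ} (hpmin : 0 < pmin)
    (hqm : AEStronglyMeasurable q μ) (hq : ∀ᵐ θ ∂μ, q θ ∈ Icc pmin pmax) (hf : MemLp f 2 μ) :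
    MemLp (fun θ => q θ * f θ) 2 μ := by
  refine hf.of_le_mul (c := pmax) (hqm.mul hf.1) ?_
  filter_upwards [hq] with θ h
  rw [norm_mul, Real.norm_of_nonneg (hpmin.le.trans h.1)]
  exact mul_le_mul_of_nonneg_right h.2 (norm_nonneg _)

lemma nrm_mul_le_of_ae_mem {μ : Measure ℝ} {f : ℝ → ℝ} (hpmin : 0 < pmin)
    (hq : ∀ᵐ θ ∂μ, q θ ∈ Icc pmin pmax) (hf : MemLp f 2 μ) :
    nrm μ (fun θ => q θ * f θ) ≤ max pmin pmax * nrm μ f := by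
  have h0 : 0 ≤ max pmin pmax := hpmin.le.trans (le_max_left _ _)
  rw [← abs_of_nonneg h0, ← nrm_const_mul]
  refine nrm_mono (hf.const_mul _) ?_
  filter_upwards [hq] with θ h
  rw [abs_mul, abs_mul, abs_of_nonneg (hpmin.le.trans h.1), abs_of_nonneg h0]
  exact mul_le_mul_of_nonneg_right (h.2.trans (le_max_right _ _)) (abs_nonneg _)

lemma TrialMesh.PwCont.aestronglyMeasurable {T : TrialMesh φ} {f : ℝ → ℝ} (hf : T.PwCont f) :
    AEStronglyMeasurable f (volume.restrict (Ioc 0 (2 * Real.pi))) := hf.memLp.1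

/-- The weighted `L²` pairing. -/
lemma abs_integral_weight_le (hpmin : 0 < pmin) (T : TrialMesh φ) (hq : IsSectorCoeff pmin pmax q)
    {f g : ℝ → ℝ} (hf : MemLp f 2 (volume.restrict (Ioc 0 (2 * Real.pi))))
    (hg : MemLp g 2 (volume.restrict (Ioc 0 (2 * Real.pi)))) :
    IntervalIntegrable (fun θ => q θ * (f θ * g θ)) volume 0 (2 * Real.pi) ∧
      |∫ θ in (0 : ℝ)..(2 * Real.pi), q θ * (f θ * g θ)|
        ≤ max pmin pmax * nrmC f * nrmC g := by
  have h2 : (0 : ℝ) ≤ 2 * Real.pi := by positivity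
  have hqf := memLp_mul_of_ae_mem hpmin (hq.pwCont T).aestronglyMeasurable (hq.ae_mem T) hf
  simp only [← mul_assoc]
  constructor
  · rw [intervalIntegrable_iff_integrableOn_Ioc_of_le h2]
    exact integrable_mul_of_memLp hqf hg
  · refine (abs_intervalIntegral_mul_le h2 hqf hg).trans ?_
    exact mul_le_mul_of_nonneg_right (nrm_mul_le_of_ae_mem hpmin (hq.ae_mem T) hf) nrm_nonneg

lemma weighted_integral_sq_bounds (hpmin : 0 < pmin) (T : TrialMesh φ)
    (hq : IsSectorCoeff pmin pmax q) {f : ℝ → ℝ}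
    (hf : MemLp f 2 (volume.restrict (Ioc 0 (2 * Real.pi)))) :
    pmin * nrmC f ^ 2 ≤ ∫ θ in (0 : ℝ)..(2 * Real.pi), q θ * (f θ * f θ) := by
  have h2 : (0 : ℝ) ≤ 2 * Real.pi := by positivity
  have h1 := (abs_integral_weight_le hpmin T hq hf hf).1
  rw [nrmC, nrm_sq, ← integral_const_mul, intervalIntegral.integral_of_le h2]
  rw [intervalIntegrable_iff_integrableOn_Ioc_of_le h2] at h1
  refine integral_mono_ae (hf.integrable_sq.const_mul _) h1 ?_
  filter_upwards [hq.ae_mem T] with θ h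
  rw [pow_two]
  exact mul_le_mul_of_nonneg_right h.1 (mul_self_nonneg _)

lemma circleForm_eq_sub (hpmin : 0 < pmin) (T : TrialMesh φ) (hq : IsSectorCoeff pmin pmax q)
    {u f : ℝ → ℝ} (hu : MemH1Per u) (hf : MemH1Per f) (Lam : ℝ) :
    circleForm q Lam u f = (∫ θ in (0 : ℝ)..(2 * Real.pi), q θ * (deriv u θ * deriv f θ))
      - Lam ^ 2 * ∫ θ in (0 : ℝ)..(2 * Real.pi), q θ * (u θ * f θ) := by
  rw [circleForm, ← intervalIntegral.integral_const_mul, ← intervalIntegral.integral_sub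
    (abs_integral_weight_le hpmin T hq hu.memLp_deriv hf.memLp_deriv).1
    ((abs_integral_weight_le hpmin T hq hu.memLp hf.memLp).1.const_mul _)]
  exact intervalIntegral.integral_congr fun θ _ => by ring

/-- Discrete eigenfunctions have the Rayleigh quotient `λ²`. -/
lemma IsFEEigenpair.rayleigh (hpmin : 0 < pmin) (T : TrialMesh φ)
    (hper : ∀ k, Function.Periodic (φ k) (2 * Real.pi)) (hq : IsSectorCoeff pmin pmax q)
    {ρ : Fin M → ℝ} {lam : ℝ}
    (h : (stiffness φ q).mulVec ρ = lam ^ 2 • (mass φ q).mulVec ρ) :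
    circleForm q lam (fun θ => ∑ k, ρ k * φ k θ) (fun θ => ∑ k, ρ k * φ k θ) = 0 := by
  have hu := T.memH1Per_combination hper ρ
  have h2 : (0 : ℝ) ≤ 2 * Real.pi := by positivity
  have hG : ∑ k, ρ k * ∑ l, (stiffness φ q) k l * ρ l
      = ∫ θ in (0 : ℝ)..(2 * Real.pi), q θ * (deriv (fun θ => ∑ k, ρ k * φ k θ) θ
          * deriv (fun θ => ∑ k, ρ k * φ k θ) θ) := by
    have e1 : ∫ θ in (0 : ℝ)..(2 * Real.pi), q θ * (deriv (fun θ => ∑ k, ρ k * φ k θ) θ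
          * deriv (fun θ => ∑ k, ρ k * φ k θ) θ)
        = ∫ θ in (0 : ℝ)..(2 * Real.pi), ∑ k, ∑ l,
            ρ k * (q θ * deriv (φ k) θ * deriv (φ l) θ * ρ l) := by
      rw [intervalIntegral.integral_of_le h2, intervalIntegral.integral_of_le h2]
      refine integral_congr_ae ?_
      filter_upwards [T.ae_mem_element] with θ hθ
      obtain ⟨i, hi, hθ⟩ := hθ
      rw [(T.hasDerivAt_combination ρ hi hθ).deriv, Finset.sum_mul_sum, Finset.mul_sum]
      refine Finset.sum_congr rfl fun k _ => ?_
      rw [Finset.mul_sum]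
      exact Finset.sum_congr rfl fun l _ => by ring
    have hi : ∀ k l, IntervalIntegrable
        (fun θ => ρ k * (q θ * deriv (φ k) θ * deriv (φ l) θ * ρ l)) volume 0 (2 * Real.pi) :=
      fun k l => (((((hq.pwCont T).mul (T.pwCont_deriv_trial k)).mul
        (T.pwCont_deriv_trial l)).intervalIntegrable).mul_const _).const_mul _
    rw [e1, intervalIntegral.integral_finsetSum fun k _ =>
      (IntervalIntegrable.sum Finset.univ fun l _ => hi k l).congr_ae
        (ae_of_all _ fun θ => by simp)]
    refine Finset.sum_congr rfl fun k _ => ?_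
    rw [intervalIntegral.integral_finsetSum fun l _ => hi k l, Finset.mul_sum]
    refine Finset.sum_congr rfl fun l _ => ?_
    rw [intervalIntegral.integral_const_mul, intervalIntegral.integral_mul_const]
    rfl
  have hB : ∑ k, ρ k * ∑ l, (mass φ q) k l * ρ l
      = ∫ θ in (0 : ℝ)..(2 * Real.pi), q θ * ((∑ k, ρ k * φ k θ) * ∑ k, ρ k * φ k θ) := by
    have e1 : ∫ θ in (0 : ℝ)..(2 * Real.pi), q θ * ((∑ k, ρ k * φ k θ) * ∑ k, ρ k * φ k θ)
        = ∫ θ in (0 : ℝ)..(2 * Real.pi), ∑ k, ∑ l, ρ k * (q θ * φ k θ * φ l θ * ρ l) := by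
      refine intervalIntegral.integral_congr fun θ _ => ?_
      rw [Finset.sum_mul_sum, Finset.mul_sum]
      refine Finset.sum_congr rfl fun k _ => ?_
      rw [Finset.mul_sum]
      exact Finset.sum_congr rfl fun l _ => by ring
    have hi : ∀ k l, IntervalIntegrable
        (fun θ => ρ k * (q θ * φ k θ * φ l θ * ρ l)) volume 0 (2 * Real.pi) :=
      fun k l => (((((hq.pwCont T).mul (T.pwCont_trial k)).mul
        (T.pwCont_trial l)).intervalIntegrable).mul_const _).const_mul _
    rw [e1, intervalIntegral.integral_finsetSum fun k _ =>
      (IntervalIntegrable.sum Finset.univ fun l _ => hi k l).congr_ae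
        (ae_of_all _ fun θ => by simp)]
    refine Finset.sum_congr rfl fun k _ => ?_
    rw [intervalIntegral.integral_finsetSum fun l _ => hi k l, Finset.mul_sum]
    refine Finset.sum_congr rfl fun l _ => ?_
    rw [intervalIntegral.integral_const_mul, intervalIntegral.integral_mul_const]
    rfl
  rw [circleForm_eq_sub hpmin T hq hu hu, ← hG, ← hB, sub_eq_zero, Finset.mul_sum]
  refine Finset.sum_congr rfl fun k _ => ?_
  have := congrFun h k
  simp only [Matrix.mulVec, dotProduct, Pi.smul_apply, smul_eq_mul] at this
  rw [this]
  ring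

lemma nrmC_eq_one {f : ℝ → ℝ} (hf : MemLp f 2 (volume.restrict (Ioc 0 (2 * Real.pi))))
    (h : eLpNorm f 2 angularMeasure = 1) : nrmC f = 1 := by
  rw [angularMeasure_eq, eLpNorm_eq_nrm hf] at h
  exact ENNReal.ofReal_eq_one.1 h

/-- A positive lower bound for the exact eigenvalues. -/
lemma IsSLEigenpair.le_sq (hpmin : 0 < pmin) (T : TrialMesh φ) (hq : IsSectorCoeff pmin pmax q)
    {Lam : ℝ} {vth : ℝ → ℝ} (h : IsSLEigenpair q Lam vth) :
    pmin ≤ max pmin pmax * (2 * Real.pi) ^ 2 * Lam ^ 2 := by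
  obtain ⟨⟨hL0, hL1⟩, hH, hn, heq⟩ := h
  have hpi : (0 : ℝ) < 2 * Real.pi := by positivity
  have hn1 := nrmC_eq_one hH.memLp hn
  have h1 : MemH1Per fun _ => (1 : ℝ) :=
    memH1Per_of_contDiff contDiff_const fun _ => rfl
  -- Testing with the constant `1` and dividing by `Λ² ≠ 0` shows that `ϑ` has weighted mean zero.
  have z1 : ∫ θ in (0 : ℝ)..(2 * Real.pi), q θ * vth θ = 0 := by
    have := (circleForm_eq_sub hpmin T hq hH h1 Lam).symm.trans (heq _ h1)
    simpa [hL0.ne'] using this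
  have z2 : (∫ θ in (0 : ℝ)..(2 * Real.pi), q θ * (deriv vth θ * deriv vth θ))
      = Lam ^ 2 * ∫ θ in (0 : ℝ)..(2 * Real.pi), q θ * (vth θ * vth θ) := by
    have := (circleForm_eq_sub hpmin T hq hH hH Lam).symm.trans (heq _ hH)
    linarith
  have hD := weighted_integral_sq_bounds hpmin T hq hH.memLp_deriv
  have hU : (∫ θ in (0 : ℝ)..(2 * Real.pi), q θ * (vth θ * vth θ)) ≤ max pmin pmax := by
    have := (le_abs_self _).trans (abs_integral_weight_le hpmin T hq hH.memLp hH.memLp).2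
    rwa [hn1, mul_one, mul_one] at this
  set N := nrmC (deriv vth) with hN
  -- Cauchy–Schwarz for `ϑ x - ϑ y = ∫ ϑ'` on an interval of length at most `2π`.
  have hosc : ∀ x ∈ Icc 0 (2 * Real.pi), ∀ y ∈ Icc 0 (2 * Real.pi),
      |vth x - vth y| ≤ √(2 * Real.pi) * N := by
    have key : ∀ x y, 0 ≤ x → x ≤ y → y ≤ 2 * Real.pi →
        |vth x - vth y| ≤ √(2 * Real.pi) * N := by
      intro x y hx hxy hy
      have hac : AbsolutelyContinuousOnInterval vth x y := by
        refine hH.2.1.mono ?_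
        rw [uIcc_of_le hxy, uIcc_of_le hpi.le]
        exact Icc_subset_Icc hx hy
      have hs : Ioc x y ⊆ Ioc 0 (2 * Real.pi) := Ioc_subset_Ioc hx hy
      have e1 := abs_intervalIntegral_mul_le (f := fun _ => (1 : ℝ)) hxy
        (memLp_const _) (hH.memLp_deriv.mono_measure (Measure.restrict_mono hs le_rfl))
      simp only [one_mul] at e1
      rw [hac.integral_deriv_eq_sub] at e1
      rw [abs_sub_comm]
      refine e1.trans (mul_le_mul ?_ (nrmI_le_nrmC hx hy hH.memLp_deriv) nrm_nonneg
        (Real.sqrt_nonneg _))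
      simp only [nrmI, nrm]
      refine Real.sqrt_le_sqrt ?_
      simp [hxy]
      linarith
    intro x hx y hy
    rcases le_total x y with h | h
    · exact key x y hx.1 h hy.2
    · rw [abs_sub_comm]; exact key y x hy.1 h hx.2
  have hq1 : IntervalIntegrable q volume 0 (2 * Real.pi) := (hq.pwCont T).intervalIntegrable
  have hqv : IntervalIntegrable (fun θ => q θ * vth θ) volume 0 (2 * Real.pi) := by
    simpa using (abs_integral_weight_le hpmin T hq hH.memLp h1.memLp).1
  have hqpos : 0 < ∫ θ in (0 : ℝ)..(2 * Real.pi), q θ := by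
    have := weighted_integral_sq_bounds hpmin T hq h1.memLp
    simp only [mul_one] at this
    refine lt_of_lt_of_le ?_ this
    have e : nrmC (fun _ => (1 : ℝ)) ^ 2 = 2 * Real.pi := by
      rw [nrmC, nrm_sq]
      simp [hpi.le]
    rw [e]
    positivity
  -- Since the weighted mean vanishes, `ϑ x` is a weighted average of the differences `ϑ x - ϑ θ`,
  -- so the bound on the oscillation bounds `ϑ` itself.
  have hsup : ∀ x ∈ Ioc 0 (2 * Real.pi), |vth x| ≤ √(2 * Real.pi) * N := by
    intro x hx
    have e1 : vth x * (∫ θ in (0 : ℝ)..(2 * Real.pi), q θ)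
        = ∫ θ in (0 : ℝ)..(2 * Real.pi), q θ * (vth x - vth θ) := by
      simp only [mul_sub]
      rw [intervalIntegral.integral_sub (hq1.mul_const _) hqv, z1, sub_zero,
        intervalIntegral.integral_mul_const, mul_comm]
    have e2 : |∫ θ in (0 : ℝ)..(2 * Real.pi), q θ * (vth x - vth θ)|
        ≤ ∫ θ in (0 : ℝ)..(2 * Real.pi), q θ * (√(2 * Real.pi) * N) := by
      have hb := hq1.mul_const (√(2 * Real.pi) * N)
      rw [intervalIntegral.integral_of_le hpi.le, intervalIntegral.integral_of_le hpi.le]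
      rw [intervalIntegrable_iff_integrableOn_Ioc_of_le hpi.le] at hb
      rw [← Real.norm_eq_abs]
      refine norm_integral_le_of_norm_le hb ?_
      filter_upwards [hq.ae_mem T, ae_restrict_mem measurableSet_Ioc] with θ h h'
      rw [norm_mul, Real.norm_of_nonneg (hpmin.le.trans h.1), Real.norm_eq_abs]
      exact mul_le_mul_of_nonneg_left (hosc x (Ioc_subset_Icc_self hx) θ
        (Ioc_subset_Icc_self h')) (hpmin.le.trans h.1)
    rw [← e1, intervalIntegral.integral_mul_const, abs_mul, abs_of_pos hqpos, mul_comm] at e2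
    exact le_of_mul_le_mul_left e2 hqpos
  -- The sup bound contributes `√(2π)` and passing to the `L²` norm another one. The left side is
  -- the normalization of `ϑ`, so `N = ‖ϑ'‖` is bounded below; by `z2` so is `Λ`.
  have hfin : (1 : ℝ) ≤ 2 * Real.pi * N := by
    rw [← hn1]
    have hN0 : 0 ≤ N := nrm_nonneg
    have e1 : nrmC vth ≤ nrmC fun _ => √(2 * Real.pi) * N := by
      refine nrm_mono (memLp_const _) ((ae_restrict_iff' measurableSet_Ioc).2
        (ae_of_all _ fun x hx => ?_))
      rw [abs_of_nonneg (mul_nonneg (Real.sqrt_nonneg _) hN0)]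
      exact hsup x hx
    refine e1.trans (le_of_eq ?_)
    rw [nrmC, nrmI, nrm]
    simp only [integral_const, MeasurableSet.univ, measureReal_restrict_apply, univ_inter,
      Real.volume_real_Ioc, sub_zero, smul_eq_mul]
    rw [max_eq_left hpi.le, mul_pow, Real.sq_sqrt hpi.le, ← mul_assoc, ← pow_two, ← mul_pow,
      Real.sqrt_sq (by positivity)]
  have h3 : (1 : ℝ) ≤ (2 * Real.pi) ^ 2 * N ^ 2 := by
    rw [← mul_pow]; exact one_le_pow₀ hfin
  have h4 : pmin * N ^ 2 ≤ Lam ^ 2 * max pmin pmax :=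
    hD.trans (z2.le.trans (mul_le_mul_of_nonneg_left hU (sq_nonneg _)))
  calc pmin = pmin * 1 := (mul_one _).symm
    _ ≤ pmin * ((2 * Real.pi) ^ 2 * N ^ 2) := mul_le_mul_of_nonneg_left h3 hpmin.le
    _ = (2 * Real.pi) ^ 2 * (pmin * N ^ 2) := by ring
    _ ≤ (2 * Real.pi) ^ 2 * (Lam ^ 2 * max pmin pmax) :=
        mul_le_mul_of_nonneg_left h4 (sq_nonneg _)
    _ = _ := by ring

/-- The discrete eigenfunction is an approximate solution of the eigenvalue problem: its residual
is controlled by the error of the eigenpair, with the weights `λ` and `λ²`. -/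
theorem exists_circleForm_residual_le (hφ : ∀ k, IsPeriodicPiecewisePolynomial (φ k))
    (hpmin : 0 < pmin) (pmax : ℝ) :
    ∃ C : ℝ, 0 < C ∧ ∀ q, IsSectorCoeff pmin pmax q → ∀ (Lam lam : ℝ) (vth mu : ℝ → ℝ),
      IsSLEigenpair q Lam vth → IsFEEigenpair φ q lam mu →
      ∃ A B : ℝ, 0 ≤ A ∧ 0 ≤ B ∧
        A ≤ C * lam * (nrmC (fun θ => mu θ - vth θ) + |lam - Lam|) ∧
        B ≤ C * lam ^ 2 * (nrmC (fun θ => mu θ - vth θ) + |lam - Lam|) ∧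
        ∀ ψ, ContDiff ℝ 1 ψ → Function.Periodic ψ (2 * Real.pi) →
          |circleForm q lam mu ψ| ≤ A * nrmC (deriv ψ) + B * nrmC ψ := by
  obtain ⟨T⟩ := exists_trialMesh hφ
  have hper := fun k => (hφ k).1
  obtain ⟨K, hK0, hK⟩ := T.exists_circleForm_le hper hpmin pmax
  set m := max pmin pmax with hm
  have hm0 : 0 < m := hpmin.trans_le (le_max_left _ _)
  have hpi : (0 : ℝ) < 2 * Real.pi := by positivity
  -- The lower bound for the exact `Λ` provided by `IsSLEigenpair.le_sq`.
  set L0 := √(pmin / m) / (2 * Real.pi) with hL0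
  have hL0p : 0 < L0 := by positivity
  set κ := √(m / pmin) with hκ
  have hκ0 : 0 ≤ κ := Real.sqrt_nonneg _
  -- The four summands serve the weights `λ` and `λ²` in the two cases below, in this order.
  set C := (K + 2 * m) * (2 / L0) + (K + 2 * m) * (2 / L0) ^ 2 + m * κ * (2 / L0) + m * (2 / L0)
    with hC
  have c1 : 0 ≤ (K + 2 * m) * (2 / L0) := by positivity
  have c2 : 0 ≤ (K + 2 * m) * (2 / L0) ^ 2 := by positivity
  have c3 : 0 ≤ m * κ * (2 / L0) := by positivity
  have c4 : 0 < m * (2 / L0) := by positivity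
  refine ⟨C, by rw [hC]; linarith, ?_⟩
  intro q hq Lam lam vth mu hSL hFE
  have hLge : L0 ≤ Lam := by
    have h1 := hSL.le_sq hpmin T hq
    have h2 : L0 ^ 2 ≤ Lam ^ 2 := by
      rw [hL0, div_pow, Real.sq_sqrt (by positivity), div_div, div_le_iff₀ (by positivity)]
      linarith
    exact (pow_le_pow_iff_left₀ hL0p.le hSL.1.1.le two_ne_zero).1 h2
  obtain ⟨⟨hl0, hl1⟩, hmu1, ρ, hρ, rfl⟩ := hFE
  obtain ⟨⟨hLam0, hLam1⟩, hvH, hv1, hveq⟩ := hSL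
  set mu : ℝ → ℝ := fun θ => ∑ k, ρ k * φ k θ with hmu
  have hmuH : MemH1Per mu := T.memH1Per_combination hper ρ
  have hmun := nrmC_eq_one hmuH.memLp hmu1
  set δ := nrmC (fun θ => mu θ - vth θ) with hδ
  have hδ0 : 0 ≤ δ := nrm_nonneg
  set ε := δ + |lam - Lam| with hε
  have hε0 : 0 ≤ ε := add_nonneg hδ0 (abs_nonneg _)
  -- If `λ ≥ L0 / 2`, the inverse estimate applies and the weights cost only powers of `2 / L0`. If
  -- `λ < L0 / 2 ≤ Λ / 2`, the eigenvalue error is at least `L0 / 2`, so a bound by powers of `λ`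
  -- alone suffices and no comparison with `ϑ` is made.
  rcases le_or_gt (L0 / 2) lam with hcase | hcase
  · have hone : 1 ≤ 2 / L0 * lam := by
      rw [div_mul_eq_mul_div, le_div_iff₀ hL0p]; linarith
    refine ⟨(K + 2 * m) * ε, (K + 2 * m) * ε, by positivity, by positivity, ?_, ?_, ?_⟩
    · calc (K + 2 * m) * ε = (K + 2 * m) * 1 * ε := by ring
        _ ≤ (K + 2 * m) * (2 / L0 * lam) * ε := by gcongr
        _ = ((K + 2 * m) * (2 / L0)) * lam * ε := by ring
        _ ≤ C * lam * ε := by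
          have : (K + 2 * m) * (2 / L0) ≤ C := by rw [hC]; linarith
          gcongr
    · calc (K + 2 * m) * ε = (K + 2 * m) * 1 ^ 2 * ε := by ring
        _ ≤ (K + 2 * m) * (2 / L0 * lam) ^ 2 * ε := by gcongr
        _ = ((K + 2 * m) * (2 / L0) ^ 2) * lam ^ 2 * ε := by ring
        _ ≤ C * lam ^ 2 * ε := by
          have : (K + 2 * m) * (2 / L0) ^ 2 ≤ C := by rw [hC]; linarith
          gcongr
    · intro ψ hψ hψp
      have hψH := memH1Per_of_contDiff hψ hψp
      have k1 := hK q hq Lam vth ⟨hLam0.le, hLam1.le⟩ hvH hveq ρ ψ hψ hψp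
      have k2 := (abs_integral_weight_le hpmin T hq hmuH.memLp hψH.memLp).2
      rw [hmun, mul_one] at k2
      -- The inverse estimate concerns the form with parameter `Λ`. Changing it to `λ` costs `|Λ² -
      -- λ²| ≤ 2 |λ - Λ|`, since both parameters are below `1`.
      have e : circleForm q lam mu ψ = circleForm q Lam mu ψ
          + (Lam ^ 2 - lam ^ 2) * ∫ θ in (0 : ℝ)..(2 * Real.pi), q θ * (mu θ * ψ θ) := by
        rw [circleForm_eq_sub hpmin T hq hmuH hψH, circleForm_eq_sub hpmin T hq hmuH hψH]
        ring
      have k3 : |Lam ^ 2 - lam ^ 2| ≤ 2 * |lam - Lam| := by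
        rw [show Lam ^ 2 - lam ^ 2 = (Lam + lam) * (Lam - lam) by ring, abs_mul,
          abs_sub_comm Lam lam, abs_of_pos (by linarith : 0 < Lam + lam)]
        gcongr
        linarith
      have n1 : 0 ≤ nrmC ψ := nrm_nonneg
      have n2 : 0 ≤ nrmC (deriv ψ) := nrm_nonneg
      rw [e]
      have k4 : |(Lam ^ 2 - lam ^ 2) * ∫ θ in (0 : ℝ)..(2 * Real.pi), q θ * (mu θ * ψ θ)|
          ≤ 2 * |lam - Lam| * (m * nrmC ψ) := by
        rw [abs_mul]
        exact mul_le_mul k3 k2 (abs_nonneg _) (by positivity)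
      refine (abs_add_le _ _).trans ((add_le_add k1 k4).trans ?_)
      have d1 : K * δ * (nrmC ψ + nrmC (deriv ψ)) ≤ K * ε * (nrmC ψ + nrmC (deriv ψ)) := by
        have : δ ≤ ε := by rw [hε]; linarith [abs_nonneg (lam - Lam)]
        gcongr
      have d2 : 2 * |lam - Lam| * (m * nrmC ψ) ≤ 2 * ε * (m * nrmC ψ) := by
        have : |lam - Lam| ≤ ε := by rw [hε]; linarith
        gcongr
      have d3 : 0 ≤ 2 * m * ε * nrmC (deriv ψ) := by positivity
      calc K * δ * (nrmC ψ + nrmC (deriv ψ)) + 2 * |lam - Lam| * (m * nrmC ψ)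
          ≤ K * ε * (nrmC ψ + nrmC (deriv ψ)) + 2 * ε * (m * nrmC ψ) := add_le_add d1 d2
        _ ≤ _ := by linarith
  · have hεL : L0 / 2 ≤ ε := by
      have : L0 / 2 ≤ |lam - Lam| := by
        rw [abs_sub_comm]
        refine le_trans ?_ (le_abs_self _)
        linarith
      rw [hε]; linarith
    have hone : 1 ≤ 2 / L0 * ε := by
      rw [div_mul_eq_mul_div, le_div_iff₀ hL0p]; linarith
    have hray := IsFEEigenpair.rayleigh hpmin T hper hq hρ
    rw [circleForm_eq_sub hpmin T hq hmuH hmuH] at hray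
    have r1 := weighted_integral_sq_bounds hpmin T hq hmuH.memLp_deriv
    have r2 := (le_abs_self _).trans (abs_integral_weight_le hpmin T hq hmuH.memLp hmuH.memLp).2
    rw [hmun, mul_one, mul_one] at r2
    -- The Rayleigh identity `∫ q μ'² = λ² ∫ q μ²` makes the derivative as small as `λ`, which
    -- supplies the weights directly.
    have r3 : nrmC (deriv mu) ≤ κ * lam := by
      have h1 : pmin * nrmC (deriv mu) ^ 2 ≤ lam ^ 2 * m := by
        have := mul_le_mul_of_nonneg_left r2 (sq_nonneg lam)
        linarith
      have h2 : nrmC (deriv mu) ^ 2 ≤ (κ * lam) ^ 2 := by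
        rw [mul_pow, hκ, Real.sq_sqrt (by positivity), div_mul_eq_mul_div, le_div_iff₀ hpmin]
        linarith
      exact (pow_le_pow_iff_left₀ nrm_nonneg (by positivity) two_ne_zero).1 h2
    refine ⟨m * (κ * lam), m * lam ^ 2, by positivity, by positivity, ?_, ?_, ?_⟩
    · calc m * (κ * lam) = m * (κ * lam) * 1 := by ring
        _ ≤ m * (κ * lam) * (2 / L0 * ε) := by gcongr
        _ = (m * κ * (2 / L0)) * lam * ε := by ring
        _ ≤ C * lam * ε := by
          have : m * κ * (2 / L0) ≤ C := by rw [hC]; linarith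
          gcongr
    · calc m * lam ^ 2 = m * lam ^ 2 * 1 := by ring
        _ ≤ m * lam ^ 2 * (2 / L0 * ε) := by gcongr
        _ = (m * (2 / L0)) * lam ^ 2 * ε := by ring
        _ ≤ C * lam ^ 2 * ε := by
          have : m * (2 / L0) ≤ C := by rw [hC]; linarith
          gcongr
    · intro ψ hψ hψp
      have hψH := memH1Per_of_contDiff hψ hψp
      have k1 := (abs_integral_weight_le hpmin T hq hmuH.memLp_deriv hψH.memLp_deriv).2
      have k2 := (abs_integral_weight_le hpmin T hq hmuH.memLp hψH.memLp).2
      rw [hmun, mul_one] at k2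
      rw [circleForm_eq_sub hpmin T hq hmuH hψH]
      refine (abs_sub _ _).trans (add_le_add (k1.trans ?_) ?_)
      · have n2 : 0 ≤ nrmC (deriv ψ) := nrm_nonneg
        gcongr
      · rw [abs_mul, abs_of_nonneg (sq_nonneg lam)]
        calc _ ≤ lam ^ 2 * (m * nrmC ψ) := mul_le_mul_of_nonneg_left k2 (sq_nonneg _)
          _ = _ := by ring

end Circle


/-! ### Polar coordinates -/

section Polar

variable {x₀ : E 2}

/-- The position relative to `x₀` as a complex number. -/
def relC (x₀ x : E 2) : ℂ := ⟨x 0 - x₀ 0, x 1 - x₀ 1⟩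

lemma polarAngle_eq (x : E 2) : polarAngle x₀ x = (relC x₀ x).arg := rfl

lemma dist_eq_sqrt (x y : E 2) : dist x y = √((x 0 - y 0) ^ 2 + (x 1 - y 1) ^ 2) := by
  rw [EuclideanSpace.dist_eq, Fin.sum_univ_two, Real.dist_eq, Real.dist_eq, sq_abs, sq_abs]

lemma norm_relC_sub (x y : E 2) : ‖relC x₀ x - relC x₀ y‖ = dist x y := by
  rw [Complex.norm_eq_sqrt_sq_add_sq, dist_eq_sqrt]
  simp [relC]

lemma norm_relC (x : E 2) : ‖relC x₀ x‖ = dist x x₀ := by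
  rw [Complex.norm_eq_sqrt_sq_add_sq, dist_eq_sqrt]
  rfl

lemma continuous_relC : Continuous (relC x₀) := by
  have : relC x₀ = fun x => ((x 0 - x₀ 0 : ℝ) : ℂ) + ((x 1 - x₀ 1 : ℝ) : ℂ) * Complex.I := by
    funext x
    apply Complex.ext <;> simp [relC]
  rw [this]
  fun_prop

lemma measurable_polarAngle : Measurable (polarAngle x₀) :=
  Complex.measurable_arg.comp continuous_relC.measurable

@[simp] lemma polarPoint_zero (r θ : ℝ) : polarPoint x₀ r θ 0 = x₀ 0 + r * Real.cos θ := rfl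

@[simp] lemma polarPoint_one (r θ : ℝ) : polarPoint x₀ r θ 1 = x₀ 1 + r * Real.sin θ := rfl

lemma relC_polarPoint (r θ : ℝ) :
    relC x₀ (polarPoint x₀ r θ) = r * (Complex.cos θ + Complex.sin θ * Complex.I) := by
  rw [← Complex.ofReal_cos, ← Complex.ofReal_sin]
  apply Complex.ext <;> simp [relC, -Complex.ofReal_cos, -Complex.ofReal_sin]

lemma dist_polarPoint {r : ℝ} (hr : 0 ≤ r) (θ : ℝ) : dist (polarPoint x₀ r θ) x₀ = r := by
  rw [dist_eq_sqrt, polarPoint_zero, polarPoint_one]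
  rw [show (x₀ 0 + r * Real.cos θ - x₀ 0) ^ 2 + (x₀ 1 + r * Real.sin θ - x₀ 1) ^ 2
    = r ^ 2 * (Real.cos θ ^ 2 + Real.sin θ ^ 2) by ring, Real.cos_sq_add_sin_sq, mul_one,
    Real.sqrt_sq hr]

lemma polarAngle_polarPoint {r : ℝ} (hr : 0 < r) {θ : ℝ} (hθ : θ ∈ Ioc (-Real.pi) Real.pi) :
    polarAngle x₀ (polarPoint x₀ r θ) = θ := by
  rw [polarAngle_eq, relC_polarPoint]
  exact Complex.arg_mul_cos_add_sin_mul_I hr hθ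

lemma polarPoint_dist_polarAngle (x : E 2) :
    polarPoint x₀ (dist x x₀) (polarAngle x₀ x) = x := by
  have h := Complex.norm_mul_cos_add_sin_mul_I (relC x₀ x)
  rw [norm_relC, ← polarAngle_eq] at h
  rw [← Complex.ofReal_cos, ← Complex.ofReal_sin] at h
  have h1 := congrArg Complex.re h
  have h2 := congrArg Complex.im h
  simp [relC, -Complex.ofReal_cos, -Complex.ofReal_sin] at h1 h2
  ext k
  fin_cases k
  · simp only [Fin.zero_eta, polarPoint_zero]
    linarith
  · simp only [Fin.mk_one, polarPoint_one]
    linarith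

lemma continuous_polarPoint : Continuous fun p : ℝ × ℝ => polarPoint x₀ p.1 p.2 := by
  refine (PiLp.continuous_toLp 2 _).comp (continuous_pi fun k => ?_)
  fin_cases k
  · simp only [Fin.zero_eta, Matrix.cons_val_zero]
    fun_prop
  · simp only [Fin.mk_one, Matrix.cons_val_one]
    fun_prop

lemma measurePreserving_add_repr :
    MeasurePreserving (fun z : ℂ => x₀ + Complex.orthonormalBasisOneI.repr z) :=
  (measurePreserving_add_left volume x₀).comp
    (LinearIsometryEquiv.measurePreserving Complex.orthonormalBasisOneI.repr)

lemma measurableEmbedding_add_repr :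
    MeasurableEmbedding (fun z : ℂ => x₀ + Complex.orthonormalBasisOneI.repr z) :=
  (MeasurableEquiv.addLeft x₀).measurableEmbedding.comp
    (Complex.orthonormalBasisOneI.repr.toHomeomorph.measurableEmbedding)

lemma add_repr_polarCoord_symm (p : ℝ × ℝ) :
    x₀ + Complex.orthonormalBasisOneI.repr (Complex.polarCoord.symm p)
      = polarPoint x₀ p.1 p.2 := by
  rw [Complex.polarCoord_symm_apply]
  ext k
  fin_cases k <;> simp [polarPoint, -Complex.ofReal_cos, -Complex.ofReal_sin]

lemma polarCoord_target_eq :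
    polarCoord.target = Ioi (0 : ℝ) ×ˢ Ioo (-Real.pi) Real.pi := rfl

/-- Integration in polar coordinates. -/
lemma integral_polar (x₀ : E 2) (g : E 2 → ℝ) :
    ∫ x, g x = ∫ p in Ioi (0 : ℝ) ×ˢ Ioo (-Real.pi) Real.pi, p.1 * g (polarPoint x₀ p.1 p.2) := by
  rw [← (measurePreserving_add_repr (x₀ := x₀)).integral_comp measurableEmbedding_add_repr,
    ← Complex.integral_comp_polarCoord_symm, polarCoord_target_eq]
  simp only [add_repr_polarCoord_symm, smul_eq_mul]

lemma lintegral_polar (x₀ : E 2) (g : E 2 → ℝ≥0∞) :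
    ∫⁻ x, g x = ∫⁻ p in Ioi (0 : ℝ) ×ˢ Ioo (-Real.pi) Real.pi,
      ENNReal.ofReal p.1 * g (polarPoint x₀ p.1 p.2) := by
  rw [← (measurePreserving_add_repr (x₀ := x₀)).lintegral_comp_emb measurableEmbedding_add_repr,
    ← Complex.lintegral_comp_polarCoord_symm, polarCoord_target_eq]
  simp only [add_repr_polarCoord_symm, smul_eq_mul]

/-- In polar coordinates the exceptional set becomes a product of the radii with the null set `N`.
This discards the branch cut and the rays where an angular factor is not differentiable. -/
lemma ae_polarAngle_notMem (x₀ : E 2) {N : Set ℝ} (hN : MeasurableSet N) (h0 : volume N = 0) :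
    ∀ᵐ x, polarAngle x₀ x ∉ N := by
  have hm : MeasurableSet (polarAngle x₀ ⁻¹' N) := measurable_polarAngle hN
  have hkey : volume (polarAngle x₀ ⁻¹' N) = 0 → ∀ᵐ x, polarAngle x₀ x ∉ N := fun h =>
    measure_eq_zero_iff_ae_notMem.1 h
  refine hkey ?_
  rw [← lintegral_indicator_one hm, lintegral_polar x₀]
  refine lintegral_eq_zero_of_ae_eq_zero ?_
  have h1 : ∀ᵐ p : ℝ × ℝ, p.2 ∉ N := by
    have : (volume : Measure (ℝ × ℝ)) (univ ×ˢ N) = 0 := by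
      rw [Measure.volume_eq_prod, Measure.prod_prod, h0, mul_zero]
    filter_upwards [measure_eq_zero_iff_ae_notMem.1 this] with p hp h
    exact hp ⟨mem_univ _, h⟩
  refine (ae_restrict_iff' (measurableSet_Ioi.prod measurableSet_Ioo)).2 ?_
  filter_upwards [h1] with p hp hpt
  have : polarPoint x₀ p.1 p.2 ∉ polarAngle x₀ ⁻¹' N := by
    rw [mem_preimage, polarAngle_polarPoint hpt.1 ⟨hpt.2.1, hpt.2.2.le⟩]
    exact hp
  rw [indicator_of_notMem this, mul_zero]
  rfl

/-- The measure `dr dθ` on `(0, R) × (-π, π)`. -/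
def polarMeasure (R : ℝ) : Measure (ℝ × ℝ) :=
  (volume.restrict (Ioo 0 R)).prod (volume.restrict (Ioo (-Real.pi) Real.pi))

lemma polarMeasure_eq (R : ℝ) :
    polarMeasure R = volume.restrict (Ioo 0 R ×ˢ Ioo (-Real.pi) Real.pi) := by
  rw [polarMeasure, Measure.prod_restrict, Measure.volume_eq_prod]

/-- Integration in polar coordinates of a function supported in a disc. -/
lemma integral_polar_of_support {R : ℝ} {g : E 2 → ℝ} (hg : ∀ x, R ≤ dist x x₀ → g x = 0) :
    ∫ x, g x = ∫ p, p.1 * g (polarPoint x₀ p.1 p.2) ∂polarMeasure R := by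
  rw [integral_polar x₀, polarMeasure_eq]
  refine setIntegral_eq_of_subset_of_forall_sdiff_eq_zero
    (measurableSet_Ioi.prod measurableSet_Ioo) (prod_mono Ioo_subset_Ioi_self subset_rfl) ?_
  rintro p ⟨⟨hp1, hp2⟩, hp3⟩
  have : R ≤ p.1 := by
    by_contra! h
    exact hp3 ⟨⟨hp1, h⟩, hp2⟩
  rw [hg _ (by rwa [dist_polarPoint (le_of_lt hp1)]), mul_zero]

lemma ae_polarMeasure (R : ℝ) :
    ∀ᵐ p ∂polarMeasure R, p.1 ∈ Ioo 0 R ∧ p.2 ∈ Ioo (-Real.pi) Real.pi := by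
  rw [polarMeasure_eq]
  filter_upwards [ae_restrict_mem (measurableSet_Ioo.prod measurableSet_Ioo)] with p hp using hp

lemma ae_polarMeasure_snd {R : ℝ} {Q : ℝ → Prop}
    (h : ∀ᵐ θ ∂volume.restrict (Ioo (-Real.pi) Real.pi), Q θ) : ∀ᵐ p ∂polarMeasure R, Q p.2 :=
  Measure.quasiMeasurePreserving_snd.ae h

/-- Bounded multiples of `r ^ (λ - 1)` are integrable. -/
lemma integrable_rpow_mul_polarMeasure {R lam M : ℝ} (hlam : 0 < lam) {B : ℝ × ℝ → ℝ}
    (hB : AEStronglyMeasurable B (polarMeasure R)) (hM : ∀ᵐ p ∂polarMeasure R, |B p| ≤ M) :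
    Integrable (fun p => B p * p.1 ^ (lam - 1)) (polarMeasure R) := by
  refine Integrable.bdd_mul (c := M) ?_ hB hM
  have h1 : Integrable (fun r : ℝ => r ^ (lam - 1)) (volume.restrict (Ioo 0 R)) := by
    rcases le_or_gt R 0 with h | h
    · simp [Ioo_eq_empty_of_le h]
    · have := intervalIntegral.intervalIntegrable_rpow' (a := 0) (b := R) (r := lam - 1)
        (by linarith)
      rw [intervalIntegrable_iff_integrableOn_Ioo_of_le h.le] at this
      exact this
  have h2 := h1.mul_prod (integrable_const (μ := volume.restrict (Ioo (-Real.pi) Real.pi)) (1 : ℝ))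
  simp only [mul_one] at h2
  exact h2

/-- One period of a periodic function. -/
lemma integral_Ioo_neg_pi_pi {f : ℝ → ℝ} (hf : Function.Periodic f (2 * Real.pi)) :
    ∫ θ in Ioo (-Real.pi) Real.pi, f θ = ∫ θ in (0 : ℝ)..(2 * Real.pi), f θ := by
  have h := hf.intervalIntegral_add_eq (-Real.pi) 0
  rw [← integral_Ioc_eq_integral_Ioo, ← intervalIntegral.integral_of_le (by linarith [Real.pi_pos])]
  rw [show -Real.pi + 2 * Real.pi = Real.pi by ring, zero_add] at h
  exact h

/-- The singular weight `r ^ (λ - 1)` is square integrable on discs. -/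
lemma memLp_rpow_dist (x₀ : E 2) {lam R : ℝ} (hlam : 0 < lam) :
    MemLp (fun x => (Metric.ball x₀ R).indicator (fun x => dist x x₀ ^ (lam - 1)) x) 2 volume := by
  have hm : Measurable fun x => (Metric.ball x₀ R).indicator
      (fun x => dist x x₀ ^ (lam - 1)) x := by
    refine Measurable.indicator ?_ measurableSet_ball
    exact (measurable_id.dist measurable_const).pow_const _
  refine (memLp_two_iff_integrable_sq hm.aestronglyMeasurable).2 ?_
  refine ⟨(hm.pow_const 2).aestronglyMeasurable, ?_⟩
  rw [HasFiniteIntegral, lintegral_polar x₀]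
  -- Together with the Jacobian `r`, the square of `r ^ (λ - 1)` is `r ^ (2λ - 1)`, whence the
  -- exponent `2 * lam`.
  have h1 := integrable_rpow_mul_polarMeasure (R := R) (lam := 2 * lam) (M := 1) (B := fun _ => 1)
    (by linarith) aestronglyMeasurable_const (ae_of_all _ fun _ => by simp)
  simp only [one_mul] at h1
  refine lt_of_le_of_lt ?_ h1.2
  rw [polarMeasure_eq, ← lintegral_indicator (measurableSet_Ioi.prod measurableSet_Ioo),
    ← lintegral_indicator (measurableSet_Ioo.prod measurableSet_Ioo)]
  refine lintegral_mono fun p => ?_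
  by_cases hp : p ∈ Ioi (0 : ℝ) ×ˢ Ioo (-Real.pi) Real.pi
  · rw [indicator_of_mem hp]
    have hp0 : 0 < p.1 := hp.1
    by_cases hpR : p.1 < R
    · rw [indicator_of_mem (show p ∈ Ioo 0 R ×ˢ Ioo (-Real.pi) Real.pi from ⟨⟨hp.1, hpR⟩, hp.2⟩),
        indicator_of_mem (by rwa [Metric.mem_ball, dist_polarPoint hp0.le]),
        dist_polarPoint hp0.le, ← ofReal_norm, ← ofReal_norm, ← ENNReal.ofReal_mul hp0.le,
        Real.norm_of_nonneg (sq_nonneg _), Real.norm_of_nonneg (Real.rpow_nonneg hp0.le _)]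
      refine ENNReal.ofReal_le_ofReal (le_of_eq ?_)
      rw [← Real.rpow_natCast, ← Real.rpow_mul hp0.le]
      nth_rewrite 1 [← Real.rpow_one p.1]
      rw [← Real.rpow_add hp0]
      congr 1
      push_cast
      ring
    · rw [indicator_of_notMem (by rwa [Metric.mem_ball, dist_polarPoint hp0.le])]
      simp
  · rw [indicator_of_notMem hp]
    exact zero_le

end Polar


/-! ### The coefficient near a singular point -/

namespace SingularPoints

variable {I Ns : ℕ} {D : BoxPartition 2 I} (V : SingularPoints D Ns)

lemma δ₂_pos : 0 < V.δ₂ := V.δ₁_pos.trans V.δ₁_lt_δ₂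

/-- The open rectangle spanned by the singular point and a nearby point off the axes lies in one
subdomain. -/
lemma exists_rectangle_subset_sub (i : Fin Ns) {y : E 2} (hy : dist y (V.pt i) < V.δ₂) :
    ∃ k, ∀ w : E 2, (∀ l, 0 < (w l - V.pt i l) * (y l - V.pt i l) ∧
      |w l - V.pt i l| ≤ |y l - V.pt i l|) → w ∈ D.sub k := by
  set z := V.pt i with hz
  -- There is room to push `y` slightly outwards within the disc. The rectangle up to `y` then lies
  -- strictly inside the one up to the pushed point `y'`, which turns weak inequalities into strict
  -- ones.
  obtain ⟨t, ht0, ht⟩ : ∃ t : ℝ, 0 < t ∧ (1 + t) * dist y z < V.δ₂ := by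
    rcases dist_nonneg (x := y) (y := z) |>.eq_or_lt with h | h
    · exact ⟨1, one_pos, by rw [← h, mul_zero]; exact V.δ₂_pos⟩
    · refine ⟨(V.δ₂ - dist y z) / (2 * dist y z), by
        have := sub_pos.2 hy
        positivity, ?_⟩
      have : (1 + (V.δ₂ - dist y z) / (2 * dist y z)) * dist y z
          = dist y z + (V.δ₂ - dist y z) / 2 := by
        field_simp
      rw [this]
      linarith
  set y' : E 2 := z + (1 + t) • (y - z) with hy'
  have hd : dist y' z < V.δ₂ := by
    rw [dist_eq_norm, hy', add_sub_cancel_left, norm_smul, Real.norm_of_nonneg (by linarith),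
      ← dist_eq_norm]
    exact ht
  -- `y'` lies in the closure of some subdomain `k`, which therefore meets the disc and so has the
  -- centre in its closure as well. A box whose closure contains both points contains the open
  -- rectangle spanned by them.
  have h1 : y' ∈ closure (openBox D.lo D.hi) :=
    subset_closure (V.ball_subset i (Metric.mem_closedBall.2 hd.le))
  rw [← D.cover] at h1
  obtain ⟨k, hk⟩ := mem_iUnion.1 h1
  obtain ⟨x, hxb, hxk⟩ := mem_closure_iff.1 hk _ Metric.isOpen_ball (Metric.mem_ball.2 hd)
  have hzk := V.ball_incident i k ⟨x, Metric.ball_subset_closedBall hxb, hxk⟩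
  have b1 := closure_openBox_subset hk
  have b2 := closure_openBox_subset hzk
  refine ⟨k, fun w hw l => ?_⟩
  obtain ⟨hw1, hw2⟩ := hw l
  have e : y' l = z l + (1 + t) * (y l - z l) := by simp [hy']
  have c1 := b1 l
  have c2 : D.subLo k l ≤ z l ∧ z l ≤ D.subHi k l := b2 l
  rw [e] at c1
  rcases lt_trichotomy (y l - z l) 0 with h | h | h
  · have hw3 : w l - z l < 0 := by
      by_contra! h'
      exact absurd (mul_nonpos_of_nonneg_of_nonpos h' h.le) (not_le.2 hw1)
    rw [abs_of_neg hw3, abs_of_neg h] at hw2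
    constructor
    · nlinarith [c1.1, mul_pos ht0 (neg_pos.2 h)]
    · linarith [c2.2]
  · rw [h, mul_zero] at hw1
    exact absurd hw1 (lt_irrefl _)
  · have hw3 : 0 < w l - z l := by
      by_contra! h'
      exact absurd (mul_nonpos_of_nonpos_of_nonneg h' h.le) (not_le.2 hw1)
    rw [abs_of_pos hw3, abs_of_pos h] at hw2
    constructor
    · linarith [c2.1]
    · nlinarith [c1.2, mul_pos ht0 h]

/-- Points of the disc in the same open quadrant lie in the same subdomain. -/
lemma exists_mem_sub_of_same_quadrant (i : Fin Ns) {y y' : E 2} (hy : dist y (V.pt i) < V.δ₂)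
    (hy' : dist y' (V.pt i) < V.δ₂) (h : ∀ l, 0 < (y l - V.pt i l) * (y' l - V.pt i l)) :
    ∃ k, y ∈ D.sub k ∧ y' ∈ D.sub k := by
  obtain ⟨k, hk⟩ := V.exists_rectangle_subset_sub i hy
  obtain ⟨k', hk'⟩ := V.exists_rectangle_subset_sub i hy'
  have hsq : ∀ l, 0 < (y l - V.pt i l) * (y l - V.pt i l) := fun l =>
    mul_self_pos.2 fun h0 => by simpa [h0] using h l
  have hsq' : ∀ l, 0 < (y' l - V.pt i l) * (y' l - V.pt i l) := fun l =>
    mul_self_pos.2 fun h0 => by simpa [h0] using h l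
  -- In each coordinate `w` takes whichever of `y`, `y'` is closer to the centre, so it lies in both
  -- rectangles. Disjointness of the subdomains then forces `k = k'`.
  set w : E 2 := WithLp.toLp 2 fun l =>
    if |y l - V.pt i l| ≤ |y' l - V.pt i l| then y l else y' l with hw
  have hwl : ∀ l, w l = if |y l - V.pt i l| ≤ |y' l - V.pt i l| then y l else y' l := fun _ => rfl
  have m1 : w ∈ D.sub k := hk w fun l => by
    rw [hwl]
    split_ifs with hc
    · exact ⟨hsq l, le_rfl⟩
    · exact ⟨by rw [mul_comm]; exact h l, (not_le.1 hc).le⟩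
  have m2 : w ∈ D.sub k' := hk' w fun l => by
    rw [hwl]
    split_ifs with hc
    · exact ⟨h l, hc⟩
    · exact ⟨hsq' l, le_rfl⟩
  have hkk : k = k' := by
    by_contra hne
    exact disjoint_left.1 (D.disjoint k k' hne) m1 m2
  exact ⟨k, hk y fun l => ⟨hsq l, le_rfl⟩, hkk ▸ hk' y' fun l => ⟨hsq' l, le_rfl⟩⟩

lemma exists_polarPoint_mem_sub (i : Fin Ns) {r r' θ θ' : ℝ} (hr : r ∈ Ioo 0 V.δ₂)
    (hr' : r' ∈ Ioo 0 V.δ₂) (hc : 0 < Real.cos θ * Real.cos θ')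
    (hs : 0 < Real.sin θ * Real.sin θ') :
    ∃ k, polarPoint (V.pt i) r θ ∈ D.sub k ∧ polarPoint (V.pt i) r' θ' ∈ D.sub k := by
  refine V.exists_mem_sub_of_same_quadrant i (by rw [dist_polarPoint hr.1.le]; exact hr.2)
    (by rw [dist_polarPoint hr'.1.le]; exact hr'.2) fun l => ?_
  have hrr := mul_pos hr.1 hr'.1
  fin_cases l
  · simp only [Fin.zero_eta, polarPoint_zero, add_sub_cancel_left]
    rw [show r * Real.cos θ * (r' * Real.cos θ') = r * r' * (Real.cos θ * Real.cos θ') by ring]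
    exact mul_pos hrr hc
  · simp only [Fin.mk_one, polarPoint_one, add_sub_cancel_left]
    rw [show r * Real.sin θ * (r' * Real.sin θ') = r * r' * (Real.sin θ * Real.sin θ') by ring]
    exact mul_pos hrr hs

/-- In the disc the coefficient depends on the angle only. -/
lemma coeff_polarPoint (p : Fin I → ℝ) (i : Fin Ns) {r θ : ℝ} (hr : r ∈ Ioo 0 V.δ₂)
    (hc : Real.cos θ ≠ 0) (hs : Real.sin θ ≠ 0) :
    D.coeff p (polarPoint (V.pt i) r θ) = V.angularCoeff p i θ := by
  obtain ⟨k, h1, h2⟩ := V.exists_polarPoint_mem_sub i hr ⟨V.δ₁_pos, V.δ₁_lt_δ₂⟩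
    (mul_self_pos.2 hc) (mul_self_pos.2 hs)
  rw [angularCoeff, D.coeff_eq p h1, D.coeff_eq p h2]

lemma periodic_angularCoeff (p : Fin I → ℝ) (i : Fin Ns) :
    Function.Periodic (V.angularCoeff p i) (2 * Real.pi) := fun θ => by
  simp only [angularCoeff, polarPoint, Real.cos_add_two_pi, Real.sin_add_two_pi]

lemma measurable_angularCoeff (p : Fin I → ℝ) (i : Fin Ns) :
    Measurable (V.angularCoeff p i) :=
  (D.measurable_coeff p).comp
    (continuous_polarPoint.comp (Continuous.prodMk_right V.δ₁)).measurable

/-- The signs of cosine and sine are constant in each open quadrant. -/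
lemma cos_mul_cos_pos_sin_mul_sin_pos (j : Fin 4) {θ θ' : ℝ}
    (h : θ ∈ Ioo (j * (Real.pi / 2)) ((j + 1) * (Real.pi / 2)))
    (h' : θ' ∈ Ioo (j * (Real.pi / 2)) ((j + 1) * (Real.pi / 2))) :
    0 < Real.cos θ * Real.cos θ' ∧ 0 < Real.sin θ * Real.sin θ' := by
  have key : ∀ t, t ∈ Ioo (j * (Real.pi / 2)) ((j + 1) * (Real.pi / 2)) →
      0 < Real.cos (t - j * (Real.pi / 2)) ∧ 0 < Real.sin (t - j * (Real.pi / 2)) := by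
    intro t ht
    have h0 : 0 < t - j * (Real.pi / 2) := sub_pos.2 ht.1
    have h1 : t - j * (Real.pi / 2) < Real.pi / 2 := by linarith [ht.2]
    exact ⟨Real.cos_pos_of_mem_Ioo ⟨by linarith, h1⟩,
      Real.sin_pos_of_pos_of_lt_pi h0 (by linarith)⟩
  have k := key θ h
  have k' := key θ' h'
  fin_cases j
  · simp at k k'
    exact ⟨mul_pos k.1 k'.1, mul_pos k.2 k'.2⟩
  · simp [Real.cos_sub_pi_div_two, Real.sin_sub_pi_div_two] at k k'
    exact ⟨mul_pos_of_neg_of_neg k.2 k'.2, mul_pos k.1 k'.1⟩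
  · have e : ((2 : ℕ) : ℝ) * (Real.pi / 2) = Real.pi := by push_cast; ring
    simp only [e, Real.cos_sub_pi, Real.sin_sub_pi] at k k'
    exact ⟨mul_pos_of_neg_of_neg (neg_pos.1 k.1) (neg_pos.1 k'.1),
      mul_pos_of_neg_of_neg (neg_pos.1 k.2) (neg_pos.1 k'.2)⟩
  · have e : ∀ t : ℝ, t - ((3 : ℕ) : ℝ) * (Real.pi / 2) = t - Real.pi - Real.pi / 2 := fun t => by
      push_cast; ring
    simp only [e, Real.cos_sub_pi_div_two, Real.sin_sub_pi_div_two, Real.cos_sub_pi,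
      Real.sin_sub_pi, neg_neg] at k k'
    exact ⟨mul_pos k.2 k'.2, mul_pos_of_neg_of_neg (neg_pos.1 k.1) (neg_pos.1 k'.1)⟩

/-- Any two angles in an open quadrant give points of one subdomain. The value is read off at the
midpoint of the quadrant. -/
lemma isSectorCoeff_angularCoeff {p : Fin I → ℝ} {pmin pmax : ℝ}
    (hp : ∀ k, pmin ≤ p k ∧ p k ≤ pmax) (i : Fin Ns) :
    IsSectorCoeff pmin pmax (V.angularCoeff p i) := by
  intro j
  have hr : V.δ₁ ∈ Ioo 0 V.δ₂ := ⟨V.δ₁_pos, V.δ₁_lt_δ₂⟩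
  have hm : (j : ℝ) * (Real.pi / 2) + Real.pi / 4
      ∈ Ioo ((j : ℝ) * (Real.pi / 2)) (((j : ℝ) + 1) * (Real.pi / 2)) :=
    ⟨by linarith [Real.pi_pos], by linarith [Real.pi_pos]⟩
  refine ⟨V.angularCoeff p i (j * (Real.pi / 2) + Real.pi / 4), ?_, fun θ hθ => ?_⟩
  · obtain ⟨hc, hs⟩ := cos_mul_cos_pos_sin_mul_sin_pos j hm hm
    obtain ⟨k, h1, -⟩ := V.exists_polarPoint_mem_sub i hr hr hc hs
    rw [angularCoeff, D.coeff_eq p h1]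
    exact hp k
  · obtain ⟨hc, hs⟩ := cos_mul_cos_pos_sin_mul_sin_pos j hθ hm
    obtain ⟨k, h1, h2⟩ := V.exists_polarPoint_mem_sub i hr hr hc hs
    rw [angularCoeff, angularCoeff, D.coeff_eq p h1, D.coeff_eq p h2]

/-- Almost all angles avoid the axes. -/
lemma ae_cos_ne_zero_sin_ne_zero : ∀ᵐ θ : ℝ, Real.cos θ ≠ 0 ∧ Real.sin θ ≠ 0 := by
  have h : ({θ : ℝ | ¬(Real.cos θ ≠ 0 ∧ Real.sin θ ≠ 0)} : Set ℝ)
      ⊆ range (fun n : ℤ => (2 * (n : ℝ) + 1) * Real.pi / 2) ∪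
        range (fun n : ℤ => (n : ℝ) * Real.pi) := by
    intro θ hθ
    rcases not_and_or.1 hθ with h | h
    · obtain ⟨n, hn⟩ := Real.cos_eq_zero_iff.1 (not_not.1 h)
      exact Or.inl ⟨n, hn.symm⟩
    · obtain ⟨n, hn⟩ := Real.sin_eq_zero_iff.1 (not_not.1 h)
      exact Or.inr ⟨n, hn⟩
  exact measure_mono_null h (((countable_range _).union (countable_range _)).measure_zero _)

end SingularPoints


/-! ### Singular functions belong to `H¹₀` -/

section Singular

variable {x₀ : E 2}

/-- The radial unit vector. -/
def radialVec (θ : ℝ) (k : Fin 2) : ℝ := ![Real.cos θ, Real.sin θ] k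

/-- The angular unit vector. -/
def angularVec (θ : ℝ) (k : Fin 2) : ℝ := ![-Real.sin θ, Real.cos θ] k

lemma abs_radialVec_le (θ : ℝ) (k : Fin 2) : |radialVec θ k| ≤ 1 := by
  fin_cases k
  · exact Real.abs_cos_le_one θ
  · exact Real.abs_sin_le_one θ

lemma abs_angularVec_le (θ : ℝ) (k : Fin 2) : |angularVec θ k| ≤ 1 := by
  fin_cases k
  · simpa [angularVec] using Real.abs_sin_le_one θ
  · exact Real.abs_cos_le_one θ

lemma measurable_radialVec (k : Fin 2) : Measurable fun θ => radialVec θ k := by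
  fin_cases k
  · exact Real.measurable_cos
  · exact Real.measurable_sin

lemma measurable_angularVec (k : Fin 2) : Measurable fun θ => angularVec θ k := by
  fin_cases k
  · exact Real.measurable_sin.neg
  · exact Real.measurable_cos

/-- The singular function `r ^ λ μ(θ) η(r)`. -/
def polarSing (x₀ : E 2) (lam : ℝ) (mu η : ℝ → ℝ) (x : E 2) : ℝ :=
  dist x x₀ ^ lam * mu (polarAngle x₀ x) * η (dist x x₀)

/-- The gradient of the singular function, in polar coordinates. -/
def polarGrad (x₀ : E 2) (lam : ℝ) (mu η : ℝ → ℝ) (k : Fin 2) (x : E 2) : ℝ :=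
  (lam * dist x x₀ ^ (lam - 1) * η (dist x x₀) + dist x x₀ ^ lam * deriv η (dist x x₀))
      * mu (polarAngle x₀ x) * radialVec (polarAngle x₀ x) k
    + dist x x₀ ^ (lam - 1) * η (dist x x₀) * deriv mu (polarAngle x₀ x)
      * angularVec (polarAngle x₀ x) k

lemma hasDerivAt_relC (x : E 2) (k : Fin 2) :
    HasDerivAt (fun t : ℝ => relC x₀ (x + t • EuclideanSpace.single k 1))
      (![1, Complex.I] k) 0 := by
  have e : (fun t : ℝ => relC x₀ (x + t • EuclideanSpace.single k 1))
      = fun t : ℝ => relC x₀ x + (t : ℂ) * ![1, Complex.I] k := by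
    funext t
    fin_cases k <;> apply Complex.ext <;> simp [relC] <;> ring
  rw [e]
  simpa using ((Complex.ofRealCLM.hasDerivAt (x := (0 : ℝ))).mul_const
    (![1, Complex.I] k)).const_add (relC x₀ x)

lemma inv_relC {x : E 2} (hx : x ≠ x₀) :
    (relC x₀ x)⁻¹ = ((dist x x₀)⁻¹ : ℝ) * (Real.cos (polarAngle x₀ x)
      - Real.sin (polarAngle x₀ x) * Complex.I) := by
  have h := relC_polarPoint (x₀ := x₀) (dist x x₀) (polarAngle x₀ x)
  rw [polarPoint_dist_polarAngle, ← Complex.ofReal_cos, ← Complex.ofReal_sin] at h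
  have hr : ((dist x x₀ : ℝ) : ℂ) ≠ 0 := by exact_mod_cast (dist_pos.2 hx).ne'
  rw [h]
  refine inv_eq_of_mul_eq_one_right ?_
  have hcs : (Real.cos (polarAngle x₀ x) : ℂ) ^ 2 + (Real.sin (polarAngle x₀ x) : ℂ) ^ 2 = 1 := by
    exact_mod_cast Real.cos_sq_add_sin_sq (polarAngle x₀ x)
  push_cast at hcs ⊢
  field_simp
  linear_combination hcs - (Complex.sin (polarAngle x₀ x : ℂ)) ^ 2 * Complex.I_sq

/-- Since `log z = log r + iθ`, the partial derivatives of the complex logarithm contain those of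
`r` and of `θ` in their real and imaginary parts. -/
lemma direction_div_relC {x : E 2} (hx : x ≠ x₀) (k : Fin 2) :
    (![1, Complex.I] k / relC x₀ x).re = radialVec (polarAngle x₀ x) k / dist x x₀ ∧
      (![1, Complex.I] k / relC x₀ x).im = angularVec (polarAngle x₀ x) k / dist x x₀ := by
  rw [div_eq_mul_inv, inv_relC hx]
  fin_cases k <;> constructor <;>
    simp [radialVec, angularVec, -Complex.ofReal_cos, -Complex.ofReal_sin] <;> field_simp

lemma hasDerivAt_log_relC {x : E 2} (hx : relC x₀ x ∈ Complex.slitPlane) (k : Fin 2) :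
    HasDerivAt (fun t : ℝ => Complex.log (relC x₀ (x + t • EuclideanSpace.single k 1)))
      (![1, Complex.I] k / relC x₀ x) 0 := by
  have := (hasDerivAt_relC (x₀ := x₀) x k).clog_real (by simpa using hx)
  simpa using this

lemma hasDerivAt_polarAngle {x : E 2} (hx : relC x₀ x ∈ Complex.slitPlane) (k : Fin 2) :
    HasDerivAt (fun t : ℝ => polarAngle x₀ (x + t • EuclideanSpace.single k 1))
      (angularVec (polarAngle x₀ x) k / dist x x₀) 0 := by
  have hne : x ≠ x₀ := by
    rintro rfl
    exact Complex.slitPlane_ne_zero hx (by apply Complex.ext <;> simp [relC])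
  rw [← (direction_div_relC hne k).2]
  have := Complex.imCLM.hasFDerivAt.comp_hasDerivAt (0 : ℝ) (hasDerivAt_log_relC hx k)
  simp only [Function.comp_def, Complex.imCLM_apply, Complex.log_im] at this
  exact this

/-- `r` is recovered as the exponential of the real part of the logarithm. -/
lemma hasDerivAt_dist {x : E 2} (hx : relC x₀ x ∈ Complex.slitPlane) (k : Fin 2) :
    HasDerivAt (fun t : ℝ => dist (x + t • EuclideanSpace.single k 1) x₀)
      (radialVec (polarAngle x₀ x) k) 0 := by
  have hne : x ≠ x₀ := by
    rintro rfl
    exact Complex.slitPlane_ne_zero hx (by apply Complex.ext <;> simp [relC])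
  have hr := dist_pos.2 hne
  have h1 := (Complex.reCLM.hasFDerivAt.comp_hasDerivAt (0 : ℝ) (hasDerivAt_log_relC hx k)).exp
  have e : (![1, Complex.I] k / relC x₀ x).re = radialVec (polarAngle x₀ x) k / dist x x₀ :=
    (direction_div_relC hne k).1
  simp only [Function.comp_def, Complex.reCLM_apply, Complex.log_re, zero_smul, add_zero, e,
    norm_relC, Real.exp_log hr] at h1
  rw [mul_div_cancel₀ _ hr.ne'] at h1
  refine h1.congr_of_eventuallyEq ?_
  have hc : Continuous fun t : ℝ => dist (x + t • EuclideanSpace.single k (1 : ℝ)) x₀ := by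
    fun_prop
  filter_upwards [hc.continuousAt.eventually_ne (show dist (x + (0 : ℝ) •
    EuclideanSpace.single k (1 : ℝ)) x₀ ≠ 0 by simpa using hne)] with t ht
  rw [Real.exp_log (lt_of_le_of_ne dist_nonneg ht.symm)]

lemma hasLineDerivAt_polarSing {lam : ℝ} {mu η : ℝ → ℝ} {x : E 2}
    (hx : relC x₀ x ∈ Complex.slitPlane) (hη : Differentiable ℝ η)
    (hmu : DifferentiableAt ℝ mu (polarAngle x₀ x)) (k : Fin 2) :
    HasLineDerivAt ℝ (polarSing x₀ lam mu η) (polarGrad x₀ lam mu η k x) x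
      (EuclideanSpace.single k 1) := by
  have hne : x ≠ x₀ := by
    rintro rfl
    exact Complex.slitPlane_ne_zero hx (by apply Complex.ext <;> simp [relC])
  have hr := dist_pos.2 hne
  have h1 := hasDerivAt_dist hx k
  have h2 := hasDerivAt_polarAngle hx k
  have h3 : HasDerivAt (fun t : ℝ => dist (x + t • EuclideanSpace.single k 1) x₀ ^ lam)
      (radialVec (polarAngle x₀ x) k * lam * dist x x₀ ^ (lam - 1)) 0 := by
    have := h1.rpow_const (p := lam) (Or.inl (by simpa using hne))
    simpa using this
  have h4 : HasDerivAt (fun t : ℝ => mu (polarAngle x₀ (x + t • EuclideanSpace.single k 1)))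
      (deriv mu (polarAngle x₀ x) * (angularVec (polarAngle x₀ x) k / dist x x₀)) 0 := by
    refine HasDerivAt.comp (0 : ℝ) ?_ h2
    simpa using hmu.hasDerivAt
  have h5 : HasDerivAt (fun t : ℝ => η (dist (x + t • EuclideanSpace.single k 1) x₀))
      (deriv η (dist x x₀) * radialVec (polarAngle x₀ x) k) 0 := by
    refine HasDerivAt.comp (0 : ℝ) ?_ h1
    simpa using (hη (dist x x₀)).hasDerivAt
  have h6 := (h3.mul h4).mul h5
  refine HasDerivAt.congr_deriv h6 ?_
  have e : dist x x₀ ^ lam = dist x x₀ ^ (lam - 1) * dist x x₀ := by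
    rw [Real.rpow_sub_one hr.ne', div_mul_cancel₀ _ hr.ne']
  simp only [zero_smul, add_zero, Pi.mul_apply, polarGrad, e]
  field_simp
  ring

/-- On the unit circle an arc is at most `π / 2` times its chord. Normalizing `w` moves it by `|‖w‖
- 1| ≤ ‖w - 1‖`, which doubles the constant. -/
lemma abs_arg_le (w : ℂ) (hw : w ≠ 0) : |w.arg| ≤ Real.pi * ‖w - 1‖ := by
  have hn : 0 < ‖w‖ := norm_pos_iff.2 hw
  set u : ℂ := ((‖w‖⁻¹ : ℝ) : ℂ) * w with hu
  have hun : ‖u‖ = 1 := by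
    rw [hu, norm_mul, Complex.norm_real, norm_inv, norm_norm, inv_mul_cancel₀ hn.ne']
  have hu0 : u ≠ 0 := norm_ne_zero_iff.1 (by rw [hun]; exact one_ne_zero)
  have h1 := Complex.angle_le_mul_norm_sub hun (norm_one (α := ℂ))
  rw [Complex.angle_eq_abs_arg hu0 one_ne_zero, div_one, hu,
    Complex.arg_real_mul _ (inv_pos.2 hn), ← hu] at h1
  have h2 : ‖u - w‖ ≤ ‖w - 1‖ := by
    have e : u - w = ((‖w‖⁻¹ * (1 - ‖w‖) : ℝ) : ℂ) * w := by
      rw [hu, mul_sub, mul_one, inv_mul_cancel₀ hn.ne']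
      push_cast
      ring
    rw [e, norm_mul, Complex.norm_real, norm_mul, norm_inv, norm_norm, mul_comm, ← mul_assoc,
      mul_inv_cancel₀ hn.ne', one_mul, Real.norm_eq_abs, abs_sub_comm]
    have := abs_norm_sub_norm_le w 1
    rwa [norm_one] at this
  have h3 : ‖u - 1‖ ≤ 2 * ‖w - 1‖ := by
    have := norm_sub_le_norm_sub_add_norm_sub u w 1
    linarith
  calc _ ≤ Real.pi / 2 * ‖u - 1‖ := h1
    _ ≤ Real.pi / 2 * (2 * ‖w - 1‖) := by gcongr
    _ = _ := by ring

/-- The arguments of `z` and `w` differ by that of `z / w` modulo `2π`. Periodicity absorbs the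
multiple of `2π`, so the branch cut does no harm. -/
lemma abs_sub_comp_arg_le {mu : ℝ → ℝ} {K : NNReal} (hK : LipschitzWith K mu)
    (hp : Function.Periodic mu (2 * Real.pi)) {z w : ℂ} (hz : z ≠ 0) (hw : w ≠ 0) :
    |mu z.arg - mu w.arg| ≤ K * |(z / w).arg| := by
  have h := Complex.arg_div_coe_angle hz hw
  rw [← Real.Angle.coe_sub, Real.Angle.angle_eq_iff_two_pi_dvd_sub] at h
  obtain ⟨n, hn⟩ := h
  have e : z.arg = w.arg + (z / w).arg - n * (2 * Real.pi) := by linarith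
  rw [e, hp.sub_int_mul_eq]
  have := hK.dist_le_mul (w.arg + (z / w).arg) w.arg
  rw [Real.dist_eq, Real.dist_eq, add_sub_cancel_left] at this
  exact this

lemma exists_bound_of_periodic {mu : ℝ → ℝ} (hc : Continuous mu)
    (hp : Function.Periodic mu (2 * Real.pi)) : ∃ M : ℝ, 0 ≤ M ∧ ∀ θ, |mu θ| ≤ M := by
  obtain ⟨M, hM⟩ := isCompact_Icc.exists_bound_of_continuousOn
    (s := Icc 0 (2 * Real.pi)) hc.continuousOn
  refine ⟨M, (norm_nonneg _).trans (hM 0 ⟨le_rfl, by positivity⟩), fun θ => ?_⟩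
  obtain ⟨θ', hθ', e⟩ := hp.exists_mem_Ico₀ (by positivity) θ
  rw [e]
  exact hM θ' (Ico_subset_Icc_self hθ')

/-- The homogeneous extension `r μ(θ)` is Lipschitz continuous. -/
lemma exists_lipschitz_homogeneous (x₀ : E 2) {mu : ℝ → ℝ} {K : NNReal} (hK : LipschitzWith K mu)
    (hp : Function.Periodic mu (2 * Real.pi)) :
    ∃ L : NNReal, LipschitzWith L fun x => dist x x₀ * mu (polarAngle x₀ x) := by
  obtain ⟨M, hM0, hM⟩ := exists_bound_of_periodic hK.continuous hp
  refine ⟨⟨M + K * Real.pi, by positivity⟩, LipschitzWith.of_dist_le_mul fun x y => ?_⟩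
  rw [Real.dist_eq]
  change _ ≤ (M + K * Real.pi) * dist x y
  -- The difference is split into a change of radius and a change of angle. The latter is of order
  -- `dist x y / dist y x₀`, and the factor `dist y x₀` compensates the denominator. At the centre
  -- the angle carries no information, hence the alternative `x = x₀` in `h2`.
  have h1 : |(dist x x₀ - dist y x₀) * mu (polarAngle x₀ x)| ≤ M * dist x y := by
    rw [abs_mul, mul_comm]
    exact mul_le_mul (hM _) (abs_dist_sub_le x y x₀) (abs_nonneg _) hM0
  have h2 : |dist y x₀ * (mu (polarAngle x₀ x) - mu (polarAngle x₀ y))|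
      ≤ K * Real.pi * dist x y ∨ x = x₀ := by
    rcases eq_or_ne x x₀ with hx | hx
    · exact Or.inr hx
    refine Or.inl ?_
    rcases eq_or_ne y x₀ with rfl | hy
    · rw [dist_self, zero_mul, abs_zero]; positivity
    have hy0 := dist_pos.2 hy
    have hzx : relC x₀ x ≠ 0 := norm_pos_iff.1 (by rw [norm_relC]; exact dist_pos.2 hx)
    have hzy : relC x₀ y ≠ 0 := norm_pos_iff.1 (by rw [norm_relC]; exact hy0)
    have a1 := abs_sub_comp_arg_le hK hp hzx hzy
    have a2 := abs_arg_le (relC x₀ x / relC x₀ y) (div_ne_zero hzx hzy)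
    have a3 : ‖relC x₀ x / relC x₀ y - 1‖ = dist x y / dist y x₀ := by
      rw [div_sub_one hzy, norm_div, norm_relC_sub, norm_relC]
    rw [a3] at a2
    rw [abs_mul, abs_of_pos hy0]
    calc _ ≤ dist y x₀ * (K * (Real.pi * (dist x y / dist y x₀))) := by
          refine mul_le_mul_of_nonneg_left (a1.trans ?_) hy0.le
          exact mul_le_mul_of_nonneg_left a2 K.2
      _ = _ := by field_simp
  rcases h2 with h2 | rfl
  · have e : dist x x₀ * mu (polarAngle x₀ x) - dist y x₀ * mu (polarAngle x₀ y)
        = (dist x x₀ - dist y x₀) * mu (polarAngle x₀ x)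
          + dist y x₀ * (mu (polarAngle x₀ x) - mu (polarAngle x₀ y)) := by ring
    rw [e, add_mul]
    exact (abs_add_le _ _).trans (add_le_add h1 h2)
  · rw [dist_self, zero_mul, zero_sub, abs_neg, abs_mul, abs_of_nonneg dist_nonneg, dist_comm y x,
      mul_comm]
    refine mul_le_mul_of_nonneg_right ((hM _).trans ?_) dist_nonneg
    have : 0 ≤ K * Real.pi := by positivity
    linarith

/-- Boundedness of `g` is asked only where `f ≠ 0`: the homogeneous function `r μ(θ)` is unbounded,
but the cutoff it is multiplied with has bounded support. In the product rule the point with `f ≠ 0`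
must therefore be the one where `g` is evaluated. -/
lemma exists_lipschitz_mul {α : Type*} [PseudoMetricSpace α] {f g : α → ℝ} {Kf Kg : NNReal}
    (hf : LipschitzWith Kf f) (hg : LipschitzWith Kg g) {A B : ℝ} (hA : ∀ x, |f x| ≤ A)
    (hB : ∀ x, f x ≠ 0 → |g x| ≤ B) : ∃ K : NNReal, LipschitzWith K fun x => f x * g x := by
  have hf' : ∀ x y, |f x - f y| ≤ Kf * dist x y := fun x y => by
    have := hf.dist_le_mul x y
    rwa [Real.dist_eq] at this
  have hg' : ∀ x y, |g x - g y| ≤ Kg * dist x y := fun x y => by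
    have := hg.dist_le_mul x y
    rwa [Real.dist_eq] at this
  set L : ℝ := |A| * Kg + Kf * |B| with hL
  have hL0 : 0 ≤ L := by positivity
  have key : ∀ x y, f x ≠ 0 → |f x * g x - f y * g y| ≤ L * dist x y := by
    intro x y hx
    have e : f x * g x - f y * g y = f y * (g x - g y) + (f x - f y) * g x := by ring
    rw [e, hL, add_mul]
    refine (abs_add_le _ _).trans (add_le_add ?_ ?_)
    · rw [abs_mul, mul_assoc]
      exact mul_le_mul ((hA y).trans (le_abs_self A)) (hg' x y) (abs_nonneg _) (abs_nonneg _)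
    · rw [abs_mul, mul_right_comm]
      exact mul_le_mul (hf' x y) ((hB x hx).trans (le_abs_self B)) (abs_nonneg _) (by positivity)
  refine ⟨⟨L, hL0⟩, LipschitzWith.of_dist_le_mul fun x y => ?_⟩
  rw [Real.dist_eq]
  change _ ≤ L * dist x y
  by_cases hx : f x = 0
  · by_cases hy : f y = 0
    · rw [hx, hy]; simp; positivity
    · rw [abs_sub_comm, dist_comm]
      exact key y x hy
  · exact key x y hx

end Singular


/-! ### Truncation of the singularity and `H¹₀` regularity -/

section Singular

variable {x₀ : E 2}

open Filter Topology in
-- The integrals of an integrable function over balls shrinking to the null set `{x₀}` tend to zero.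
lemma exists_nrm_rpow_ball_lt (x₀ : E 2) {lam κ : ℝ} (hlam : 0 < lam) (hκ : 0 < κ) {R : ℝ}
    (hR : 0 < R) : ∃ ε, 0 < ε ∧ ε < R ∧
      nrm volume (fun x => (Metric.ball x₀ ε).indicator (fun x => dist x x₀ ^ (lam - 1)) x)
        < κ := by
  set f : E 2 → ℝ := fun x => (Metric.ball x₀ R).indicator (fun x => dist x x₀ ^ (lam - 1)) x
    with hf
  have hfi : Integrable fun x => f x ^ 2 := (memLp_rpow_dist x₀ hlam).integrable_sq
  set s : ℕ → Set (E 2) := fun n => Metric.ball x₀ (R / (n + 2)) with hs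
  have hanti : Antitone s := by
    intro m n hmn
    refine Metric.ball_subset_ball ?_
    have : (m : ℝ) ≤ n := by exact_mod_cast hmn
    gcongr
  have hlim := tendsto_setIntegral_of_antitone (μ := volume) (f := fun x => f x ^ 2) (s := s)
    (fun _ => measurableSet_ball) hanti ⟨0, hfi.integrableOn⟩
  have h0 : ∫ x in ⋂ n, s n, f x ^ 2 = 0 := by
    have hsub : ⋂ n, s n ⊆ {x₀} := by
      intro x hx
      rw [mem_singleton_iff]
      by_contra hne
      have hd := dist_pos.2 hne
      obtain ⟨n, hn⟩ := exists_nat_gt (R / dist x x₀)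
      have := Metric.mem_ball.1 (mem_iInter.1 hx n)
      rw [lt_div_iff₀ (by positivity)] at this
      rw [div_lt_iff₀ hd] at hn
      nlinarith
    exact setIntegral_measure_zero _ (measure_mono_null hsub (measure_singleton _))
  rw [h0] at hlim
  obtain ⟨n, hn⟩ := (hlim.eventually (gt_mem_nhds (show 0 < κ ^ 2 by positivity))).exists
  have hle : R / ((n : ℝ) + 2) < R := div_lt_self hR (by
    have : (0 : ℝ) ≤ n := Nat.cast_nonneg n
    linarith)
  refine ⟨R / (n + 2), by positivity, hle, ?_⟩
  rw [nrm, Real.sqrt_lt' hκ]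
  refine lt_of_eq_of_lt ?_ hn
  rw [← integral_indicator measurableSet_ball]
  refine integral_congr_ae (ae_of_all _ fun x => ?_)
  by_cases hx : x ∈ s n
  · have hx' : x ∈ Metric.ball x₀ R := Metric.ball_subset_ball hle.le hx
    simp only
    rw [indicator_of_mem hx, indicator_of_mem hx, hf]
    simp only
    rw [indicator_of_mem hx']
  · simp only
    rw [indicator_of_notMem hx, indicator_of_notMem hx]
    simp

/-- The singular function with the singularity cut off at the radius `ε`. -/
def truncSing (x₀ : E 2) (lam : ℝ) (mu η : ℝ → ℝ) (ε : ℝ) (x : E 2) : ℝ :=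
  max (dist x x₀) ε ^ (lam - 1) * (η (dist x x₀) * (dist x x₀ * mu (polarAngle x₀ x)))

/-- A smooth radial cutoff function. -/
structure IsCutoff (δ₁ δ₂ : ℝ) (η : ℝ → ℝ) : Prop where
  pos : 0 < δ₁
  lt : δ₁ < δ₂
  contDiff : ContDiff ℝ ∞ η
  eq_one : ∀ r, r < δ₁ → η r = 1
  eq_zero : ∀ r, δ₂ < r → η r = 0

namespace IsCutoff

variable {δ₁ δ₂ : ℝ} {η : ℝ → ℝ}

lemma deriv_eq_zero (h : IsCutoff δ₁ δ₂ η) {r : ℝ} (hr : δ₂ < r) : deriv η r = 0 := by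
  have : η =ᶠ[nhds r] fun _ => 0 := by
    filter_upwards [Ioi_mem_nhds hr] with s hs using h.eq_zero s hs
  rw [this.deriv_eq, deriv_const]

lemma exists_bound_of_continuous (h : IsCutoff δ₁ δ₂ η) {f : ℝ → ℝ} (hf : Continuous f)
    (h0 : ∀ r, δ₂ < r → f r = 0) : ∃ M : ℝ, 0 ≤ M ∧ ∀ r, 0 ≤ r → |f r| ≤ M := by
  obtain ⟨M, hM⟩ := isCompact_Icc.exists_bound_of_continuousOn (s := Icc 0 δ₂) hf.continuousOn
  have hM0 : 0 ≤ M := (norm_nonneg _).trans (hM 0 ⟨le_rfl, (h.pos.trans h.lt).le⟩)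
  refine ⟨M, hM0, fun r hr => ?_⟩
  rcases le_or_gt r δ₂ with h' | h'
  · exact hM r ⟨hr, h'⟩
  · rw [h0 r h', abs_zero]
    exact hM0

lemma exists_bound (h : IsCutoff δ₁ δ₂ η) :
    ∃ M : ℝ, 0 ≤ M ∧ ∀ r, 0 ≤ r → |η r| ≤ M ∧ |deriv η r| ≤ M := by
  obtain ⟨M₁, h1, h1'⟩ := h.exists_bound_of_continuous h.contDiff.continuous h.eq_zero
  obtain ⟨M₂, h2, h2'⟩ := h.exists_bound_of_continuous (h.contDiff.continuous_deriv (by simp))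
    fun r hr => h.deriv_eq_zero hr
  exact ⟨max M₁ M₂, h1.trans (le_max_left _ _), fun r hr =>
    ⟨(h1' r hr).trans (le_max_left _ _), (h2' r hr).trans (le_max_right _ _)⟩⟩

/-- A product of three Lipschitz factors: the cutoff, the homogeneous function `r μ(θ)`, and the
truncated power, whose base stays away from zero. -/
lemma exists_lipschitz_truncSing (h : IsCutoff δ₁ δ₂ η) (x₀ : E 2) {lam : ℝ} {mu : ℝ → ℝ}
    {K : NNReal} (hK : LipschitzWith K mu) (hp : Function.Periodic mu (2 * Real.pi)) {ε : ℝ}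
    (hε : 0 < ε) : ∃ C : NNReal, LipschitzWith C (truncSing x₀ lam mu η ε) := by
  obtain ⟨L, hL⟩ := exists_lipschitz_homogeneous x₀ hK hp
  obtain ⟨Mη, hMη0, hMη⟩ := h.exists_bound
  obtain ⟨M, hM0, hM⟩ := exists_bound_of_periodic hK.continuous hp
  set R := δ₂ + 1 with hR
  have hδ : 0 < δ₂ := h.pos.trans h.lt
  have hR0 : 0 < R := by positivity
  -- The radius is clamped at `R > δ₂`, where the cutoff already vanishes. The radial functions then
  -- need to be Lipschitz on compact intervals only.
  have hclamp : LipschitzWith 1 fun x : E 2 => min (dist x x₀) R :=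
    (LipschitzWith.dist_left x₀).min_const R
  have hηR : ∀ x : E 2, η (dist x x₀) = η (min (dist x x₀) R) := by
    intro x
    rcases le_or_gt (dist x x₀) R with h' | h'
    · rw [min_eq_left h']
    · rw [min_eq_right h'.le, h.eq_zero _ (by linarith), h.eq_zero _ (by linarith)]
  have hlt : ∀ x : E 2, η (dist x x₀) ≠ 0 → dist x x₀ ≤ δ₂ := fun x hx =>
    not_lt.1 fun h' => hx (h.eq_zero _ h')
  obtain ⟨C₁, hC₁⟩ := ((h.contDiff.of_le (m := 1) (by simp)).contDiffOn
    (s := Icc 0 R)).exists_lipschitzOnWith (by simp) (convex_Icc _ _) isCompact_Icc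
  have hf2 : LipschitzWith (C₁ * 1) fun x : E 2 => η (dist x x₀) := by
    have := hC₁.comp (hclamp.lipschitzOnWith (s := univ))
      (fun x _ => ⟨le_min dist_nonneg hR0.le, min_le_right _ _⟩)
    rw [lipschitzOnWith_univ] at this
    simpa only [Function.comp_def, ← hηR] using this
  obtain ⟨C₂, hC₂⟩ := exists_lipschitz_mul hf2 hL (A := Mη) (B := δ₂ * M)
    (fun x => (hMη _ dist_nonneg).1) fun x hx => by
      rw [abs_mul, abs_of_nonneg dist_nonneg]
      exact mul_le_mul (hlt x hx) (hM _) (abs_nonneg _) hδ.le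
  have hpow : ContDiffOn ℝ 1 (fun t : ℝ => t ^ (lam - 1)) (Icc ε (max R ε)) := fun t ht =>
    (Real.contDiffAt_rpow_const_of_ne (hε.trans_le ht.1).ne').contDiffWithinAt
  obtain ⟨C₃, hC₃⟩ := hpow.exists_lipschitzOnWith (by simp) (convex_Icc _ _) isCompact_Icc
  have hmem : ∀ x : E 2, max (min (dist x x₀) R) ε ∈ Icc ε (max R ε) := fun x =>
    ⟨le_max_right _ _, max_le_max_right _ (min_le_right _ _)⟩
  have hf1 : LipschitzWith (C₃ * 1) fun x : E 2 => max (min (dist x x₀) R) ε ^ (lam - 1) := by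
    have := hC₃.comp ((hclamp.max_const ε).lipschitzOnWith (s := univ)) (fun x _ => hmem x)
    rw [lipschitzOnWith_univ] at this
    exact this
  obtain ⟨B, hB⟩ := isCompact_Icc.exists_bound_of_continuousOn hpow.continuousOn
  obtain ⟨C₄, hC₄⟩ := exists_lipschitz_mul hC₂ hf1 (A := Mη * (δ₂ * M)) (B := B) (fun x => by
      rw [abs_mul]
      by_cases hx : η (dist x x₀) = 0
      · rw [hx, abs_zero, zero_mul]; positivity
      · refine mul_le_mul (hMη _ dist_nonneg).1 ?_ (abs_nonneg _) hMη0
        rw [abs_mul, abs_of_nonneg dist_nonneg]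
        exact mul_le_mul (hlt x hx) (hM _) (abs_nonneg _) hδ.le)
    fun x _ => hB _ (hmem x)
  refine ⟨C₄, ?_⟩
  have e : truncSing x₀ lam mu η ε = fun x : E 2 => η (dist x x₀) *
      (dist x x₀ * mu (polarAngle x₀ x)) * max (min (dist x x₀) R) ε ^ (lam - 1) := by
    funext x
    rw [truncSing, mul_comm]
    by_cases hx : η (dist x x₀) = 0
    · rw [hx]; simp
    · rw [min_eq_left ((hlt x hx).trans (by linarith))]
  rw [e]
  exact hC₄

/-- As `r ^ λ = r · r ^ (λ - 1)`, every term is `r ^ (λ - 1)` times a factor bounded on the support.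
This weight is square integrable in the plane because `λ > 0`. -/
lemma abs_polarGrad_le (h : IsCutoff δ₁ δ₂ η) (x₀ : E 2) {lam : ℝ} (hlam : lam ∈ Ioo (0 : ℝ) 1)
    {mu : ℝ → ℝ} {K : NNReal} (hK : LipschitzWith K mu)
    (hp : Function.Periodic mu (2 * Real.pi)) :
    ∃ C : ℝ, 0 ≤ C ∧ ∀ k x, |polarGrad x₀ lam mu η k x| ≤ C * dist x x₀ ^ (lam - 1) ∧
      (δ₂ < dist x x₀ → polarGrad x₀ lam mu η k x = 0) := by
  obtain ⟨Mη, hMη0, hMη⟩ := h.exists_bound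
  obtain ⟨M, hM0, hM⟩ := exists_bound_of_periodic hK.continuous hp
  have hδ : 0 < δ₂ := h.pos.trans h.lt
  have hz : ∀ k (x : E 2), δ₂ < dist x x₀ → polarGrad x₀ lam mu η k x = 0 := by
    intro k x hx
    rw [polarGrad, h.eq_zero _ hx, h.deriv_eq_zero hx]
    ring
  refine ⟨(Mη + δ₂ * Mη) * M + Mη * K, by positivity, fun k x => ⟨?_, hz k x⟩⟩
  have hr0 : 0 ≤ dist x x₀ := dist_nonneg
  set r := dist x x₀ with hr
  have hw : 0 ≤ r ^ (lam - 1) := Real.rpow_nonneg hr0 _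
  rcases le_or_gt r δ₂ with hle | hgt
  · have e : r ^ lam = r * r ^ (lam - 1) := by
      rcases hr0.eq_or_lt with h0 | h0
      · rw [← h0, Real.zero_rpow hlam.1.ne', zero_mul]
      · rw [Real.rpow_sub_one h0.ne', mul_div_cancel₀ _ h0.ne']
    have b1 := (hMη r hr0).1
    have b2 := (hMη r hr0).2
    have b3 := hM (polarAngle x₀ x)
    have b4 : |deriv mu (polarAngle x₀ x)| ≤ K := norm_deriv_le_of_lipschitz hK
    have b5 := abs_radialVec_le (polarAngle x₀ x) k
    have b6 := abs_angularVec_le (polarAngle x₀ x) k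
    have e2 : polarGrad x₀ lam mu η k x = ((lam * η r + r * deriv η r) * mu (polarAngle x₀ x)
        * radialVec (polarAngle x₀ x) k + η r * deriv mu (polarAngle x₀ x)
        * angularVec (polarAngle x₀ x) k) * r ^ (lam - 1) := by
      rw [polarGrad, ← hr, e]
      ring
    rw [e2, abs_mul, abs_of_nonneg hw]
    refine mul_le_mul_of_nonneg_right ?_ hw
    have c1 : |lam * η r + r * deriv η r| ≤ Mη + δ₂ * Mη := by
      refine (abs_add_le _ _).trans (add_le_add ?_ ?_)
      · rw [abs_mul, abs_of_pos hlam.1]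
        exact (mul_le_of_le_one_left (abs_nonneg _) hlam.2.le).trans b1
      · rw [abs_mul, abs_of_nonneg hr0]
        exact mul_le_mul hle b2 (abs_nonneg _) hδ.le
    refine (abs_add_le _ _).trans (add_le_add ?_ ?_)
    · rw [abs_mul, abs_mul]
      refine (mul_le_of_le_one_right (by positivity) b5).trans ?_
      exact mul_le_mul c1 b3 (abs_nonneg _) (by positivity)
    · rw [abs_mul, abs_mul]
      refine (mul_le_of_le_one_right (by positivity) b6).trans ?_
      exact mul_le_mul b1 b4 (abs_nonneg _) hMη0
  · rw [hz k x hgt, abs_zero]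
    positivity

lemma measurable_polarGrad (h : IsCutoff δ₁ δ₂ η) (x₀ : E 2) {lam : ℝ} {mu : ℝ → ℝ}
    (hmu : Continuous mu) (k : Fin 2) : Measurable (polarGrad x₀ lam mu η k) := by
  have m1 : Measurable fun x : E 2 => dist x x₀ := measurable_id.dist measurable_const
  have m2 : Measurable (polarAngle x₀) := measurable_polarAngle
  have m3 := h.contDiff.continuous.measurable.comp m1
  have m4 := (measurable_deriv η).comp m1
  have m5 := hmu.measurable.comp m2
  have m6 := (measurable_deriv mu).comp m2
  have m7 := (measurable_radialVec k).comp m2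
  have m8 := (measurable_angularVec k).comp m2
  exact ((((((m1.pow_const _).const_mul _).mul m3).add ((m1.pow_const _).mul m4)).mul m5).mul
    m7).add ((((m1.pow_const _).mul m3).mul m6).mul m8)

lemma measurable_polarSing (h : IsCutoff δ₁ δ₂ η) (x₀ : E 2) {lam : ℝ} {mu : ℝ → ℝ}
    (hmu : Continuous mu) : Measurable (polarSing x₀ lam mu η) := by
  have m1 : Measurable fun x : E 2 => dist x x₀ := measurable_id.dist measurable_const
  exact ((m1.pow_const _).mul (hmu.measurable.comp measurable_polarAngle)).mul
    (h.contDiff.continuous.measurable.comp m1)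

lemma memLp_polarGrad (h : IsCutoff δ₁ δ₂ η) (x₀ : E 2) {lam : ℝ} (hlam : lam ∈ Ioo (0 : ℝ) 1)
    {mu : ℝ → ℝ} {K : NNReal} (hK : LipschitzWith K mu)
    (hp : Function.Periodic mu (2 * Real.pi)) (k : Fin 2) :
    MemLp (polarGrad x₀ lam mu η k) 2 volume := by
  obtain ⟨C, hC0, hC⟩ := h.abs_polarGrad_le x₀ hlam hK hp
  refine (memLp_rpow_dist x₀ (R := δ₂ + 1) hlam.1).of_le_mul (c := C)
    (h.measurable_polarGrad x₀ hK.continuous k).aestronglyMeasurable (ae_of_all _ fun x => ?_)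
  rw [Real.norm_eq_abs, Real.norm_eq_abs]
  by_cases hx : x ∈ Metric.ball x₀ (δ₂ + 1)
  · rw [indicator_of_mem hx, abs_of_nonneg (Real.rpow_nonneg dist_nonneg _)]
    exact (hC k x).1
  · rw [(hC k x).2 (by
      rw [Metric.mem_ball, not_lt] at hx
      linarith), abs_zero]
    positivity

lemma memLp_polarSing (h : IsCutoff δ₁ δ₂ η) (x₀ : E 2) {lam : ℝ} (hlam : lam ∈ Ioo (0 : ℝ) 1)
    {mu : ℝ → ℝ} {K : NNReal} (hK : LipschitzWith K mu)
    (hp : Function.Periodic mu (2 * Real.pi)) : MemLp (polarSing x₀ lam mu η) 2 volume := by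
  obtain ⟨Mη, hMη0, hMη⟩ := h.exists_bound
  obtain ⟨M, hM0, hM⟩ := exists_bound_of_periodic hK.continuous hp
  have hδ : 0 < δ₂ := h.pos.trans h.lt
  refine memLp_of_bounded_compact (h.measurable_polarSing x₀ hK.continuous)
    (M := δ₂ ^ lam * M * Mη) (fun x => ?_) (isCompact_closedBall x₀ δ₂) fun x hx => ?_
  · by_cases hx : δ₂ < dist x x₀
    · rw [polarSing, h.eq_zero _ hx, mul_zero, abs_zero]
      have : 0 ≤ δ₂ ^ lam := Real.rpow_nonneg hδ.le _
      positivity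
    · rw [polarSing, abs_mul, abs_mul, abs_of_nonneg (Real.rpow_nonneg dist_nonneg _)]
      have : dist x x₀ ^ lam ≤ δ₂ ^ lam :=
        Real.rpow_le_rpow dist_nonneg (not_lt.1 hx) hlam.1.le
      have b1 := (hMη (dist x x₀) dist_nonneg).1
      have b2 := hM (polarAngle x₀ x)
      have b3 : 0 ≤ dist x x₀ ^ lam := Real.rpow_nonneg dist_nonneg _
      gcongr
  · rw [Metric.mem_closedBall, not_le] at hx
    rw [polarSing, h.eq_zero _ hx, mul_zero]

lemma nrmOn_le_nrm {d : ℕ} {U : Set (E d)} {f : E d → ℝ} (hf : MemLp f 2 volume) :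
    nrmOn U f ≤ nrm volume f :=
  Real.sqrt_le_sqrt (setIntegral_le_integral hf.integrable_sq (ae_of_all _ fun _ => sq_nonneg _))

/-- Singular functions belong to `H¹₀`. -/
theorem inH10_polarSing (h : IsCutoff δ₁ δ₂ η) {U : Set (E 2)} (hU : IsOpen U) {x₀ : E 2}
    (hball : Metric.closedBall x₀ δ₂ ⊆ U) {lam : ℝ} (hlam : lam ∈ Ioo (0 : ℝ) 1) {mu : ℝ → ℝ}
    {K : NNReal} (hK : LipschitzWith K mu) (hp : Function.Periodic mu (2 * Real.pi)) :
    InH10 U (polarSing x₀ lam mu η) (polarGrad x₀ lam mu η) := by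
  refine inH10_of_approx ((h.memLp_polarSing x₀ hlam hK hp).restrict U)
    (fun k => (h.memLp_polarGrad x₀ hlam hK hp k).restrict U) fun κ hκ => ?_
  obtain ⟨L, hL⟩ := exists_lipschitz_homogeneous x₀ hK hp
  obtain ⟨M, hM0, hM⟩ := exists_bound_of_periodic hK.continuous hp
  obtain ⟨C, hC0, hC⟩ := h.abs_polarGrad_le x₀ hlam hK hp
  -- On the ball of radius `ε` the difference to the truncated function is at most `A r ^ (λ - 1)`:
  -- the last summand covers the values, `C` the gradient of the singular function and `L` that of
  -- its truncation.
  set A := C + L + 2 * M * δ₁ with hA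
  have hA0 : 0 ≤ A := by have := h.pos; positivity
  -- Outside the ball of radius `ε` the truncation changes nothing, so it suffices that `A r ^ (λ -
  -- 1)` has small norm on the ball. Taking `ε < δ₁` keeps the cutoff equal to `1` there.
  obtain ⟨ε, hε, hεδ, hεn⟩ := exists_nrm_rpow_ball_lt x₀ hlam.1
    (show 0 < κ / (A + 1) by positivity) h.pos
  set W : E 2 → ℝ := fun x => (Metric.ball x₀ ε).indicator (fun x => dist x x₀ ^ (lam - 1)) x
    with hW
  have hWm : MemLp W 2 volume := memLp_rpow_dist x₀ hlam.1
  have hAW : nrm volume (fun x => A * W x) < κ := by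
    rw [nrm_const_mul, abs_of_nonneg hA0]
    calc A * nrm volume W ≤ (A + 1) * nrm volume W :=
          mul_le_mul_of_nonneg_right (by linarith) nrm_nonneg
      _ < (A + 1) * (κ / (A + 1)) := mul_lt_mul_of_pos_left hεn (by positivity)
      _ = κ := by field_simp
  obtain ⟨Kt, hKt⟩ := h.exists_lipschitz_truncSing x₀ (lam := lam) hK hp hε
  have hzero : ∀ x, x ∉ Metric.closedBall x₀ δ₂ → truncSing x₀ lam mu η ε x = 0 := by
    intro x hx
    rw [Metric.mem_closedBall, not_le] at hx
    rw [truncSing, h.eq_zero _ hx]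
    ring
  have hcs : HasCompactSupport (truncSing x₀ lam mu η ε) :=
    HasCompactSupport.intro (isCompact_closedBall x₀ δ₂) hzero
  have hts : tsupport (truncSing x₀ lam mu η ε) ⊆ Metric.closedBall x₀ δ₂ :=
    closure_minimal (fun x hx => by_contra fun h' => hx (hzero x h')) Metric.isClosed_closedBall
  have hH := inH10_of_lipschitz hU hKt hcs (hts.trans hball)
  refine ⟨_, _, hH, ?_, fun k => ?_⟩
  · have hfar : ∀ x, ε ≤ dist x x₀ → truncSing x₀ lam mu η ε x = polarSing x₀ lam mu η x := by
      intro x hx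
      have hr : 0 < dist x x₀ := hε.trans_le hx
      rw [truncSing, polarSing, max_eq_left hx, Real.rpow_sub_one hr.ne']
      field_simp
    have hb : ∀ x, |polarSing x₀ lam mu η x - truncSing x₀ lam mu η ε x| ≤ |A * W x| := by
      intro x
      by_cases hx : x ∈ Metric.ball x₀ ε
      · have hx' := Metric.mem_ball.1 hx
        rw [hW]
        simp only
        rw [indicator_of_mem hx, abs_mul, abs_of_nonneg hA0,
          abs_of_nonneg (Real.rpow_nonneg dist_nonneg _)]
        rcases (dist_nonneg (x := x) (y := x₀)).eq_or_lt with h0 | h0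
        · rw [polarSing, truncSing, ← h0, Real.zero_rpow hlam.1.ne']
          simp only [zero_mul, mul_zero, sub_zero, abs_zero]
          exact mul_nonneg hA0 (Real.rpow_nonneg le_rfl _)
        · have e1 : polarSing x₀ lam mu η x = dist x x₀ ^ (lam - 1)
              * (dist x x₀ * mu (polarAngle x₀ x)) := by
            rw [polarSing, h.eq_one _ (hx'.trans hεδ), Real.rpow_sub_one h0.ne']
            field_simp
          have e2 : truncSing x₀ lam mu η ε x = ε ^ (lam - 1)
              * (dist x x₀ * mu (polarAngle x₀ x)) := by
            rw [truncSing, h.eq_one _ (hx'.trans hεδ), max_eq_right hx'.le, one_mul]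
          have e3 : ε ^ (lam - 1) ≤ dist x x₀ ^ (lam - 1) :=
            Real.rpow_le_rpow_of_nonpos h0 hx'.le (by linarith [hlam.2])
          have e4 : 0 ≤ ε ^ (lam - 1) := Real.rpow_nonneg hε.le _
          have e5 : 0 ≤ dist x x₀ ^ (lam - 1) := Real.rpow_nonneg h0.le _
          rw [e1, e2, ← sub_mul, abs_mul, abs_mul, abs_of_pos h0, mul_comm]
          refine mul_le_mul ?_ ?_ (abs_nonneg _) hA0
          · calc dist x x₀ * |mu (polarAngle x₀ x)| ≤ δ₁ * M :=
                  mul_le_mul (hx'.le.trans hεδ.le) (hM _) (abs_nonneg _) h.pos.le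
              _ ≤ A := by
                have : 0 ≤ (L : ℝ) := L.2
                have : 0 ≤ M * δ₁ := mul_nonneg hM0 h.pos.le
                rw [hA]; linarith
          · rw [abs_of_nonneg (by linarith)]; linarith
      · rw [hfar x (by rwa [Metric.mem_ball, not_lt] at hx), sub_self, abs_zero]
        exact abs_nonneg _
    have hm : MemLp (fun x => polarSing x₀ lam mu η x - truncSing x₀ lam mu η ε x) 2 volume :=
      (hWm.const_mul A).mono ((h.measurable_polarSing x₀ hK.continuous).sub
        hKt.continuous.measurable).aestronglyMeasurable (ae_of_all _ hb)
    exact (nrmOn_le_nrm hm).trans_lt ((nrm_mono (hWm.const_mul A) (ae_of_all _ hb)).trans_lt hAW)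
  · have hb : ∀ᵐ x, |polarGrad x₀ lam mu η k x
        - lineDeriv ℝ (truncSing x₀ lam mu η ε) x (EuclideanSpace.single k 1)| ≤ |A * W x| := by
      -- Angles at which `μ` is not differentiable, together with the branch cut `π` of the
      -- argument. The classical gradient formula holds on all other rays.
      set N : Set ℝ := {θ | ¬DifferentiableAt ℝ mu θ} ∪ {Real.pi} with hN
      have hN0 : volume N = 0 := by
        refine measure_union_null ?_ (measure_singleton _)
        exact hK.ae_differentiableAt
      have hNm : MeasurableSet N :=
        (measurableSet_of_differentiableAt ℝ mu).compl.union (measurableSet_singleton _)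
      have hsph : ∀ᵐ x : E 2, x ∉ Metric.sphere x₀ ε :=
        measure_eq_zero_iff_ae_notMem.1 (Measure.addHaar_sphere volume x₀ ε)
      have hx0 : ∀ᵐ x : E 2, x ∉ ({x₀} : Set (E 2)) :=
        measure_eq_zero_iff_ae_notMem.1 (measure_singleton _)
      filter_upwards [ae_polarAngle_notMem x₀ hNm hN0, hsph, hx0] with x hxN hxs hx0
      have hr : 0 < dist x x₀ := dist_pos.2 hx0
      rcases lt_trichotomy (dist x x₀) ε with hlt | heq | hgt
      · have hx : x ∈ Metric.ball x₀ ε := hlt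
        have hw : 0 ≤ dist x x₀ ^ (lam - 1) := Real.rpow_nonneg dist_nonneg _
        have e3 : ε ^ (lam - 1) ≤ dist x x₀ ^ (lam - 1) :=
          Real.rpow_le_rpow_of_nonpos hr hlt.le (by linarith [hlam.2])
        -- Inside the ball the truncated function is `ε ^ (λ - 1)` times the Lipschitz function `r
        -- μ(θ)`, and `ε ^ (λ - 1) ≤ r ^ (λ - 1)` because the exponent is negative.
        have hlip : LipschitzOnWith (Real.toNNReal (ε ^ (lam - 1)) * L)
            (truncSing x₀ lam mu η ε) (Metric.ball x₀ ε) := by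
          refine LipschitzOnWith.of_dist_le_mul fun y hy z hz => ?_
          have hy' := Metric.mem_ball.1 hy
          have hz' := Metric.mem_ball.1 hz
          have := hL.dist_le_mul y z
          rw [Real.dist_eq] at this ⊢
          rw [truncSing, truncSing, h.eq_one _ (hy'.trans hεδ), h.eq_one _ (hz'.trans hεδ),
            max_eq_right hy'.le, max_eq_right hz'.le, one_mul, one_mul, ← mul_sub, abs_mul,
            abs_of_nonneg (Real.rpow_nonneg hε.le _), NNReal.coe_mul,
            Real.coe_toNNReal _ (Real.rpow_nonneg hε.le _), mul_assoc]
          exact mul_le_mul_of_nonneg_left this (Real.rpow_nonneg hε.le _)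
        have b1 := norm_lineDeriv_le_of_lipschitzOn ℝ (v := EuclideanSpace.single k (1 : ℝ))
          (Metric.isOpen_ball.mem_nhds hx) hlip
        rw [show ‖EuclideanSpace.single k (1 : ℝ)‖ = 1 by simp, mul_one, NNReal.coe_mul,
          Real.coe_toNNReal _ (Real.rpow_nonneg hε.le _), Real.norm_eq_abs] at b1
        rw [hW]
        simp only
        rw [indicator_of_mem hx, abs_mul, abs_of_nonneg hA0, abs_of_nonneg hw]
        have b2 : ε ^ (lam - 1) * L ≤ dist x x₀ ^ (lam - 1) * L :=
          mul_le_mul_of_nonneg_right e3 L.2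
        have b3 : 0 ≤ 2 * M * δ₁ * dist x x₀ ^ (lam - 1) := by
          have := h.pos
          positivity
        calc _ ≤ C * dist x x₀ ^ (lam - 1) + dist x x₀ ^ (lam - 1) * L :=
              (abs_sub _ _).trans (add_le_add (hC k x).1 (b1.trans b2))
          _ ≤ _ := by rw [hA]; linarith
      · exact absurd (Metric.mem_sphere.2 heq) hxs
      · have hslit : relC x₀ x ∈ Complex.slitPlane := by
          rw [Complex.mem_slitPlane_iff_arg]
          refine ⟨fun h' => hxN (Or.inr h'), ?_⟩
          exact norm_pos_iff.1 (by rwa [norm_relC])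
        have hd : DifferentiableAt ℝ mu (polarAngle x₀ x) :=
          not_not.1 fun h' => hxN (Or.inl h')
        have e : truncSing x₀ lam mu η ε =ᶠ[nhds x] polarSing x₀ lam mu η := by
          have ho : IsOpen {y : E 2 | ε < dist y x₀} :=
            isOpen_lt continuous_const (continuous_id.dist continuous_const)
          filter_upwards [ho.mem_nhds hgt] with y hy
          have hy' : ε < dist y x₀ := hy
          have hr : 0 < dist y x₀ := hε.trans hy'
          rw [truncSing, polarSing, max_eq_left hy'.le, Real.rpow_sub_one hr.ne']
          field_simp
        rw [e.lineDeriv_eq, (hasLineDerivAt_polarSing hslit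
          (h.contDiff.differentiable (by simp)) hd k).lineDeriv, sub_self, abs_zero]
        exact abs_nonneg _
    have hm : MemLp (fun x => polarGrad x₀ lam mu η k x
        - lineDeriv ℝ (truncSing x₀ lam mu η ε) x (EuclideanSpace.single k 1)) 2 volume :=
      (hWm.const_mul A).mono ((h.measurable_polarGrad x₀ hK.continuous k).sub
        (measurable_lineDeriv hKt.continuous)).aestronglyMeasurable hb
    exact (nrmOn_le_nrm hm).trans_lt ((nrm_mono (hWm.const_mul A) hb).trans_lt hAW)

end IsCutoff

end Singular


/-! ### The residual of a singular function -/

section PolarTest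

variable {x₀ : E 2} {φ : E 2 → ℝ}

/-- The radial derivative of `φ` in polar coordinates. -/
def polarDr (x₀ : E 2) (φ : E 2 → ℝ) (p : ℝ × ℝ) : ℝ :=
  ∑ k, radialVec p.2 k * partialDeriv k φ (polarPoint x₀ p.1 p.2)

/-- The angular derivative of `φ` in polar coordinates, divided by the radius. -/
def polarDa (x₀ : E 2) (φ : E 2 → ℝ) (p : ℝ × ℝ) : ℝ :=
  ∑ k, angularVec p.2 k * partialDeriv k φ (polarPoint x₀ p.1 p.2)

lemma fderiv_apply_eq_sum (x v : E 2) :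
    fderiv ℝ φ x v = ∑ k, v k * partialDeriv k φ x := by
  have e : v = ∑ k, v k • EuclideanSpace.single k (1 : ℝ) := by
    ext j
    fin_cases j <;> simp [Fin.sum_univ_two]
  conv_lhs => rw [e]
  simp only [map_sum, map_smul, smul_eq_mul, partialDeriv]

lemma hasDerivAt_polarPoint_radius (r θ : ℝ) :
    HasDerivAt (fun s => polarPoint x₀ s θ) (WithLp.toLp 2 (radialVec θ)) r := by
  have h : HasDerivAt (fun s => (![x₀ 0 + s * Real.cos θ, x₀ 1 + s * Real.sin θ] : Fin 2 → ℝ))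
      (radialVec θ) r := by
    rw [hasDerivAt_pi]
    intro k
    fin_cases k
    · simpa [radialVec] using ((hasDerivAt_id r).mul_const (Real.cos θ)).const_add (x₀ 0)
    · simpa [radialVec] using ((hasDerivAt_id r).mul_const (Real.sin θ)).const_add (x₀ 1)
  exact (PiLp.continuousLinearEquiv 2 ℝ (fun _ : Fin 2 => ℝ)).symm.hasFDerivAt.comp_hasDerivAt r h

lemma hasDerivAt_polarPoint_angle (r θ : ℝ) :
    HasDerivAt (fun s => polarPoint x₀ r s) (r • WithLp.toLp 2 (angularVec θ)) θ := by
  have h : HasDerivAt (fun s => (![x₀ 0 + r * Real.cos s, x₀ 1 + r * Real.sin s] : Fin 2 → ℝ))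
      (r • angularVec θ) θ := by
    rw [hasDerivAt_pi]
    intro k
    fin_cases k
    · simpa [angularVec] using ((Real.hasDerivAt_cos θ).const_mul r).const_add (x₀ 0)
    · simpa [angularVec] using ((Real.hasDerivAt_sin θ).const_mul r).const_add (x₀ 1)
  exact (PiLp.continuousLinearEquiv 2 ℝ (fun _ : Fin 2 => ℝ)).symm.hasFDerivAt.comp_hasDerivAt θ h

lemma hasDerivAt_comp_polarPoint_radius (hφ : Differentiable ℝ φ) (r θ : ℝ) :
    HasDerivAt (fun s => φ (polarPoint x₀ s θ)) (polarDr x₀ φ (r, θ)) r := by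
  have := (hφ (polarPoint x₀ r θ)).hasFDerivAt.comp_hasDerivAt r
    (hasDerivAt_polarPoint_radius (x₀ := x₀) r θ)
  rwa [fderiv_apply_eq_sum] at this

lemma hasDerivAt_comp_polarPoint_angle (hφ : Differentiable ℝ φ) (r θ : ℝ) :
    HasDerivAt (fun s => φ (polarPoint x₀ r s)) (r * polarDa x₀ φ (r, θ)) θ := by
  have := (hφ (polarPoint x₀ r θ)).hasFDerivAt.comp_hasDerivAt θ
    (hasDerivAt_polarPoint_angle (x₀ := x₀) r θ)
  rwa [map_smul, fderiv_apply_eq_sum] at this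

lemma continuous_radialVec (k : Fin 2) : Continuous fun θ => radialVec θ k := by
  fin_cases k
  · exact Real.continuous_cos
  · exact Real.continuous_sin

lemma continuous_angularVec (k : Fin 2) : Continuous fun θ => angularVec θ k := by
  fin_cases k
  · exact Real.continuous_sin.neg
  · exact Real.continuous_cos

lemma continuous_partialDeriv_of_contDiff (hφ : ContDiff ℝ 1 φ) (k : Fin 2) :
    Continuous (partialDeriv k φ) :=
  (hφ.continuous_fderiv (by simp)).clm_apply continuous_const

lemma continuous_polarDr (hφ : ContDiff ℝ 1 φ) : Continuous (polarDr x₀ φ) :=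
  continuous_finsetSum _ fun k _ => ((continuous_radialVec k).comp continuous_snd).mul
    ((continuous_partialDeriv_of_contDiff hφ k).comp continuous_polarPoint)

lemma continuous_polarDa (hφ : ContDiff ℝ 1 φ) : Continuous (polarDa x₀ φ) :=
  continuous_finsetSum _ fun k _ => ((continuous_angularVec k).comp continuous_snd).mul
    ((continuous_partialDeriv_of_contDiff hφ k).comp continuous_polarPoint)

lemma polarPoint_add_two_pi (r θ : ℝ) :
    polarPoint x₀ r (θ + 2 * Real.pi) = polarPoint x₀ r θ := by
  simp only [polarPoint, Real.cos_add_two_pi, Real.sin_add_two_pi]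

lemma polarDr_sq_add_polarDa_sq (p : ℝ × ℝ) :
    polarDr x₀ φ p ^ 2 + polarDa x₀ φ p ^ 2
      = ∑ k, partialDeriv k φ (polarPoint x₀ p.1 p.2) ^ 2 := by
  simp only [polarDr, polarDa, Fin.sum_univ_two, radialVec, angularVec, Matrix.cons_val_zero,
    Matrix.cons_val_one]
  linear_combination (partialDeriv 0 φ (polarPoint x₀ p.1 p.2) ^ 2
    + partialDeriv 1 φ (polarPoint x₀ p.1 p.2) ^ 2) * Real.cos_sq_add_sin_sq p.2

lemma contDiff_comp_polarPoint_angle (hφ : ContDiff ℝ 1 φ) (r : ℝ) :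
    ContDiff ℝ 1 fun θ => φ (polarPoint x₀ r θ) := by
  rw [contDiff_one_iff_deriv]
  have hd := fun θ => hasDerivAt_comp_polarPoint_angle (x₀ := x₀) (hφ.differentiable (by simp)) r θ
  refine ⟨fun θ => (hd θ).differentiableAt, ?_⟩
  rw [show (deriv fun θ => φ (polarPoint x₀ r θ)) = fun θ => r * polarDa x₀ φ (r, θ) from
    funext fun θ => (hd θ).deriv]
  exact continuous_const.mul ((continuous_polarDa hφ).comp (Continuous.prodMk_right r))

/-- Measurable and essentially bounded functions on the polar rectangle. -/
def PolarBdd (R : ℝ) (f : ℝ × ℝ → ℝ) : Prop :=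
  AEStronglyMeasurable f (polarMeasure R) ∧ ∃ M : ℝ, ∀ᵐ p ∂polarMeasure R, |f p| ≤ M

namespace PolarBdd

variable {R : ℝ} {f g : ℝ × ℝ → ℝ}

lemma sub (hf : PolarBdd R f) (hg : PolarBdd R g) : PolarBdd R fun p => f p - g p := by
  obtain ⟨h1, M, hM⟩ := hf
  obtain ⟨h2, N, hN⟩ := hg
  refine ⟨h1.sub h2, M + N, ?_⟩
  filter_upwards [hM, hN] with p a b using (abs_sub _ _).trans (add_le_add a b)

lemma mul (hf : PolarBdd R f) (hg : PolarBdd R g) : PolarBdd R fun p => f p * g p := by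
  obtain ⟨h1, M, hM⟩ := hf
  obtain ⟨h2, N, hN⟩ := hg
  refine ⟨h1.mul h2, M * N, ?_⟩
  filter_upwards [hM, hN] with p a b
  rw [abs_mul]
  exact mul_le_mul a b (abs_nonneg _) ((abs_nonneg _).trans a)

lemma _root_.Continuous.polarBdd (hf : Continuous f) : PolarBdd R f := by
  refine ⟨hf.aestronglyMeasurable, ?_⟩
  obtain ⟨M, hM⟩ := (isCompact_Icc (a := (0 : ℝ)) (b := R)).prod
    (isCompact_Icc (a := -Real.pi) (b := Real.pi)) |>.exists_bound_of_continuousOn hf.continuousOn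
  refine ⟨M, ?_⟩
  filter_upwards [ae_polarMeasure R] with p hp
  exact hM p ⟨Ioo_subset_Icc_self hp.1, Ioo_subset_Icc_self hp.2⟩

lemma of_snd {u : ℝ → ℝ} (hu : Measurable u) {M : ℝ}
    (hM : ∀ᵐ θ ∂volume.restrict (Ioo (-Real.pi) Real.pi), |u θ| ≤ M) :
    PolarBdd R fun p => u p.2 :=
  ⟨(hu.comp measurable_snd).aestronglyMeasurable, M, ae_polarMeasure_snd hM⟩

lemma integrable (hf : PolarBdd R f) {lam : ℝ} (hlam : 0 < lam) :
    Integrable (fun p => f p * p.1 ^ (lam - 1)) (polarMeasure R) := by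
  obtain ⟨h1, M, hM⟩ := hf
  exact integrable_rpow_mul_polarMeasure hlam h1 hM

end PolarBdd

namespace IsCutoff

variable {δ₁ δ₂ : ℝ} {η : ℝ → ℝ}

lemma eq_zero_of_le (h : IsCutoff δ₁ δ₂ η) {r : ℝ} (hr : δ₂ ≤ r) : η r = 0 := by
  have hc : IsClosed {r | η r = 0} := isClosed_eq h.contDiff.continuous continuous_const
  have hsub : closure (Ioi δ₂) ⊆ {r | η r = 0} := closure_minimal (fun s hs => h.eq_zero s hs) hc
  rw [closure_Ioi] at hsub
  exact hsub hr

lemma deriv_eq_zero_of_le (h : IsCutoff δ₁ δ₂ η) {r : ℝ} (hr : δ₂ ≤ r) : deriv η r = 0 := by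
  have hc : IsClosed {r | deriv η r = 0} :=
    isClosed_eq (h.contDiff.continuous_deriv (by simp)) continuous_const
  have hsub : closure (Ioi δ₂) ⊆ {r | deriv η r = 0} :=
    closure_minimal (fun s hs => h.deriv_eq_zero hs) hc
  rw [closure_Ioi] at hsub
  exact hsub hr

lemma deriv_eq_zero_of_lt (h : IsCutoff δ₁ δ₂ η) {r : ℝ} (hr : r < δ₁) :
    deriv η r = 0 ∧ deriv (deriv η) r = 0 := by
  have h1 : ∀ s < δ₁, deriv η s = 0 := fun s hs => by
    have : η =ᶠ[nhds s] fun _ => 1 := by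
      filter_upwards [Iio_mem_nhds hs] with t ht using h.eq_one t ht
    rw [this.deriv_eq, deriv_const]
  refine ⟨h1 r hr, ?_⟩
  have : deriv η =ᶠ[nhds r] fun _ => 0 := by
    filter_upwards [Iio_mem_nhds hr] with t ht using h1 t ht
  rw [this.deriv_eq, deriv_const]

end IsCutoff

open Classical in
/-- The source of the singular function. -/
def polarSource (x₀ : E 2) (δ₁ δ₂ lam : ℝ) (mu η : ℝ → ℝ) (x : E 2) : ℝ :=
  if dist x x₀ ∈ Ioo δ₁ δ₂ then
    2 * deriv (fun s : ℝ => s ^ lam * mu (polarAngle x₀ x)) (dist x x₀) * deriv η (dist x x₀)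
      + dist x x₀ ^ lam * mu (polarAngle x₀ x)
        * (deriv (deriv η) (dist x x₀) + 1 / dist x x₀ * deriv η (dist x x₀))
  else 0

variable {δ₁ δ₂ : ℝ} {η : ℝ → ℝ}

lemma polarSource_eq (h : IsCutoff δ₁ δ₂ η) {lam : ℝ} {mu : ℝ → ℝ} {x : E 2}
    (hx : dist x x₀ ∈ Ioo δ₁ δ₂) :
    polarSource x₀ δ₁ δ₂ lam mu η x = mu (polarAngle x₀ x) * (2 * lam * dist x x₀ ^ (lam - 1)
        * deriv η (dist x x₀) + dist x x₀ ^ lam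
        * (deriv (deriv η) (dist x x₀) + 1 / dist x x₀ * deriv η (dist x x₀))) := by
  have hr : dist x x₀ ≠ 0 := (h.pos.trans hx.1).ne'
  rw [polarSource, if_pos hx, deriv_mul_const_field,
    (Real.hasDerivAt_rpow_const (Or.inl hr)).deriv]
  ring

/-- The residual of the singular function, written in polar coordinates. -/
lemma polar_residual_integrand (h : IsCutoff δ₁ δ₂ η) {lam : ℝ} {mu q : ℝ → ℝ} {κ : E 2 → ℝ}
    {r θ : ℝ} (hr : r ∈ Ioo 0 δ₂) (hr1 : r ≠ δ₁) (hθ : θ ∈ Ioo (-Real.pi) Real.pi)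
    (hκ : κ (polarPoint x₀ r θ) = q θ) :
    r * (κ (polarPoint x₀ r θ) * (∑ k, polarGrad x₀ lam mu η k (polarPoint x₀ r θ)
          * partialDeriv k φ (polarPoint x₀ r θ))
        + κ (polarPoint x₀ r θ) * polarSource x₀ δ₁ δ₂ lam mu η (polarPoint x₀ r θ)
          * φ (polarPoint x₀ r θ))
      = q θ * (η r * (deriv mu θ * (r * polarDa x₀ φ (r, θ))
            - lam ^ 2 * (mu θ * φ (polarPoint x₀ r θ)))) * r ^ (lam - 1)
        + q θ * mu θ * ((lam ^ 2 * η r + (2 * lam + 1) * (r * deriv η r)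
            + r ^ 2 * deriv (deriv η) r) * φ (polarPoint x₀ r θ)
          + (lam * r * η r + r ^ 2 * deriv η r) * polarDr x₀ φ (r, θ)) * r ^ (lam - 1) := by
  have hd : dist (polarPoint x₀ r θ) x₀ = r := dist_polarPoint hr.1.le θ
  have ha : polarAngle x₀ (polarPoint x₀ r θ) = θ :=
    polarAngle_polarPoint hr.1 ⟨hθ.1, hθ.2.le⟩
  have e : r ^ lam = r * r ^ (lam - 1) := by
    rw [Real.rpow_sub_one hr.1.ne', mul_div_cancel₀ _ hr.1.ne']
  -- For `r < δ₁` the source is zero by definition and `η'`, `η''` vanish, so one formula serves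
  -- both sides of `δ₁`.
  have hS : r * polarSource x₀ δ₁ δ₂ lam mu η (polarPoint x₀ r θ)
      = mu θ * (2 * lam * (r * deriv η r) + r ^ 2 * deriv (deriv η) r + r * deriv η r)
        * r ^ (lam - 1) := by
    rcases lt_or_gt_of_ne hr1 with h1 | h1
    · have hn : dist (polarPoint x₀ r θ) x₀ ∉ Ioo δ₁ δ₂ := by
        rw [hd]; exact fun h' => absurd h'.1 (not_lt.2 h1.le)
      rw [polarSource, if_neg hn, (h.deriv_eq_zero_of_lt h1).1, (h.deriv_eq_zero_of_lt h1).2]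
      ring
    · rw [polarSource_eq h (by rw [hd]; exact ⟨h1, hr.2⟩), hd, ha, e]
      have := hr.1.ne'
      field_simp
      ring
  have hG : r * (∑ k, polarGrad x₀ lam mu η k (polarPoint x₀ r θ)
        * partialDeriv k φ (polarPoint x₀ r θ))
      = ((lam * r * η r + r ^ 2 * deriv η r) * mu θ * polarDr x₀ φ (r, θ)
        + r * η r * deriv mu θ * polarDa x₀ φ (r, θ)) * r ^ (lam - 1) := by
    simp only [polarGrad, polarDr, polarDa, hd, ha, Fin.sum_univ_two, e]
    ring
  rw [hκ]
  calc _ = q θ * (r * ∑ k, polarGrad x₀ lam mu η k (polarPoint x₀ r θ)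
          * partialDeriv k φ (polarPoint x₀ r θ))
        + q θ * (r * polarSource x₀ δ₁ δ₂ lam mu η (polarPoint x₀ r θ))
          * φ (polarPoint x₀ r θ) := by ring
    _ = _ := by
      rw [hG, hS]
      ring

/-- The radial part of the residual is a total derivative. -/
lemma integral_radial_eq_zero (h : IsCutoff δ₁ δ₂ η) {lam : ℝ} (hlam : 0 < lam) {f f' : ℝ → ℝ}
    (hf : ∀ r, HasDerivAt f (f' r) r) (hf' : Continuous f') :
    ∫ r in Ioo 0 δ₂, ((lam ^ 2 * η r + (2 * lam + 1) * (r * deriv η r)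
        + r ^ 2 * deriv (deriv η) r) * f r + (lam * r * η r + r ^ 2 * deriv η r) * f' r)
          * r ^ (lam - 1) = 0 := by
  have hδ : 0 ≤ δ₂ := (h.pos.trans h.lt).le
  have hfc : Continuous f := continuous_iff_continuousAt.2 fun r => (hf r).continuousAt
  have hη' : ContDiff ℝ ∞ (deriv η) := by
    have := h.contDiff
    rw [contDiff_infty_iff_deriv] at this
    exact this.2
  have hc0 := h.contDiff.continuous
  have hc1 := hη'.continuous
  have hc2 := hη'.continuous_deriv (by simp)
  rw [← integral_Ioc_eq_integral_Ioo, ← intervalIntegral.integral_of_le hδ]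
  -- The primitive is `r ∂ᵣ(r ^ λ η) f`. It vanishes at `0` because `λ > 0`, and at `δ₂` because `η`
  -- and `η'` do.
  have key := intervalIntegral.integral_eq_sub_of_hasDerivAt_of_le (a := 0) (b := δ₂)
    (f := fun r => (lam * η r + r * deriv η r) * r ^ lam * f r)
    (f' := fun r => ((lam ^ 2 * η r + (2 * lam + 1) * (r * deriv η r)
        + r ^ 2 * deriv (deriv η) r) * f r + (lam * r * η r + r ^ 2 * deriv η r) * f' r)
          * r ^ (lam - 1)) hδ ?_ ?_ ?_
  · rw [key, h.eq_zero_of_le le_rfl, h.deriv_eq_zero_of_le le_rfl, Real.zero_rpow hlam.ne']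
    ring
  · exact ((((continuous_const.mul hc0).add (continuous_id.mul hc1)).mul
      (Real.continuous_rpow_const hlam.le)).mul hfc).continuousOn
  · intro r hr
    have d0 := ((h.contDiff.differentiable (by simp)) r).hasDerivAt
    have d1 := ((hη'.differentiable (by simp)) r).hasDerivAt
    have d2 := Real.hasDerivAt_rpow_const (x := r) (p := lam) (Or.inl hr.1.ne')
    have := (((d0.const_mul lam).add ((hasDerivAt_id r).mul d1)).mul d2).mul (hf r)
    refine HasDerivAt.congr_deriv this ?_
    have e : r ^ lam = r * r ^ (lam - 1) := by
      rw [Real.rpow_sub_one hr.1.ne', mul_div_cancel₀ _ hr.1.ne']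
    simp only [Pi.mul_apply, Pi.add_apply, id_eq, e]
    ring
  · refine (intervalIntegral.intervalIntegrable_rpow' (by linarith)).continuousOn_mul
      (Continuous.continuousOn ?_)
    fun_prop

/-- The residual of a singular function is an integral of residuals of the angular eigenvalue
problem. -/
lemma residual_polarSing_eq (h : IsCutoff δ₁ δ₂ η) {lam : ℝ} (hlam : lam ∈ Ioo (0 : ℝ) 1)
    {mu q : ℝ → ℝ} {K : NNReal} (hK : LipschitzWith K mu)
    (hp : Function.Periodic mu (2 * Real.pi)) (hqm : Measurable q)
    (hqp : Function.Periodic q (2 * Real.pi)) {Q : ℝ} (hQ : ∀ θ, |q θ| ≤ Q) {κ : E 2 → ℝ}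
    (hκ : ∀ r ∈ Ioo 0 δ₂, ∀ θ, Real.cos θ ≠ 0 → Real.sin θ ≠ 0 → κ (polarPoint x₀ r θ) = q θ)
    (hφ : ContDiff ℝ 1 φ) :
    ∫ x, (κ x * (∑ k, polarGrad x₀ lam mu η k x * partialDeriv k φ x)
        + κ x * polarSource x₀ δ₁ δ₂ lam mu η x * φ x)
      = ∫ r in Ioo 0 δ₂, η r * r ^ (lam - 1)
          * circleForm q lam mu fun θ => φ (polarPoint x₀ r θ) := by
  obtain ⟨M, hM0, hM⟩ := exists_bound_of_periodic hK.continuous hp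
  have hη' : ContDiff ℝ ∞ (deriv η) := by
    have := h.contDiff
    rw [contDiff_infty_iff_deriv] at this
    exact this.2
  have hc0 := h.contDiff.continuous
  have hc1 := hη'.continuous
  have hc2 := hη'.continuous_deriv (by simp)
  have hΦ : Continuous fun p : ℝ × ℝ => φ (polarPoint x₀ p.1 p.2) :=
    hφ.continuous.comp continuous_polarPoint
  have hΦr : Continuous (polarDr x₀ φ) := continuous_polarDr hφ
  have hΦa : Continuous (polarDa x₀ φ) := continuous_polarDa hφ
  have bq : PolarBdd δ₂ fun p => q p.2 := PolarBdd.of_snd hqm (ae_of_all _ hQ)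
  have bmu : PolarBdd δ₂ fun p => mu p.2 :=
    PolarBdd.of_snd hK.continuous.measurable (ae_of_all _ hM)
  have bmu' : PolarBdd δ₂ fun p => deriv mu p.2 :=
    PolarBdd.of_snd (measurable_deriv mu) (ae_of_all _ fun θ => norm_deriv_le_of_lipschitz hK)
  have b1 : PolarBdd δ₂ fun p => q p.2 * (η p.1 * (deriv mu p.2 * (p.1 * polarDa x₀ φ p)
      - lam ^ 2 * (mu p.2 * φ (polarPoint x₀ p.1 p.2)))) :=
    bq.mul ((hc0.comp continuous_fst).polarBdd.mul ((bmu'.mul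
      (continuous_fst.mul hΦa).polarBdd).sub (continuous_const.polarBdd.mul
        (bmu.mul hΦ.polarBdd))))
  have b2 : PolarBdd δ₂ fun p => q p.2 * mu p.2 * ((lam ^ 2 * η p.1
      + (2 * lam + 1) * (p.1 * deriv η p.1) + p.1 ^ 2 * deriv (deriv η) p.1)
        * φ (polarPoint x₀ p.1 p.2)
      + (lam * p.1 * η p.1 + p.1 ^ 2 * deriv η p.1) * polarDr x₀ φ p) := by
    have c0 : Continuous fun p : ℝ × ℝ => η p.1 := hc0.comp continuous_fst
    have c1 : Continuous fun p : ℝ × ℝ => deriv η p.1 := hc1.comp continuous_fst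
    have c2 : Continuous fun p : ℝ × ℝ => deriv (deriv η) p.1 := hc2.comp continuous_fst
    exact (bq.mul bmu).mul (Continuous.polarBdd (((((continuous_const.mul c0).add
      (continuous_const.mul (continuous_fst.mul c1))).add ((continuous_fst.pow 2).mul c2)).mul
      hΦ).add ((((continuous_const.mul continuous_fst).mul c0).add
      ((continuous_fst.pow 2).mul c1)).mul hΦr)))
  have i1 := b1.integrable hlam.1
  have i2 := b2.integrable hlam.1
  rw [integral_polar_of_support (x₀ := x₀) (R := δ₂)]
  swap
  · intro x hx
    have e1 : ∀ k, polarGrad x₀ lam mu η k x = 0 := fun k => by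
      rw [polarGrad, h.eq_zero_of_le hx, h.deriv_eq_zero_of_le hx]
      ring
    rw [polarSource, if_neg fun h' => absurd h'.2 (not_lt.2 hx)]
    simp [e1]
  -- The term `λ² μ φ η` is added and subtracted. This splits the integrand into the angular
  -- eigenvalue form and a radial part which is an exact derivative in `r`.
  have hae : ∀ᵐ p ∂polarMeasure δ₂, p.1 * (κ (polarPoint x₀ p.1 p.2)
        * (∑ k, polarGrad x₀ lam mu η k (polarPoint x₀ p.1 p.2)
          * partialDeriv k φ (polarPoint x₀ p.1 p.2))
        + κ (polarPoint x₀ p.1 p.2) * polarSource x₀ δ₁ δ₂ lam mu η (polarPoint x₀ p.1 p.2)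
          * φ (polarPoint x₀ p.1 p.2))
      = q p.2 * (η p.1 * (deriv mu p.2 * (p.1 * polarDa x₀ φ p)
            - lam ^ 2 * (mu p.2 * φ (polarPoint x₀ p.1 p.2)))) * p.1 ^ (lam - 1)
        + q p.2 * mu p.2 * ((lam ^ 2 * η p.1 + (2 * lam + 1) * (p.1 * deriv η p.1)
            + p.1 ^ 2 * deriv (deriv η) p.1) * φ (polarPoint x₀ p.1 p.2)
          + (lam * p.1 * η p.1 + p.1 ^ 2 * deriv η p.1) * polarDr x₀ φ p)
            * p.1 ^ (lam - 1) := by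
    have h1 : ∀ᵐ p ∂polarMeasure δ₂, p.1 ≠ δ₁ := by
      have : ∀ᵐ r ∂volume.restrict (Ioo 0 δ₂), r ≠ δ₁ :=
        ae_restrict_of_ae (by simp [ae_iff])
      exact Measure.quasiMeasurePreserving_fst.ae this
    have h2 : ∀ᵐ p ∂polarMeasure δ₂, Real.cos p.2 ≠ 0 ∧ Real.sin p.2 ≠ 0 :=
      ae_polarMeasure_snd (Q := fun θ => Real.cos θ ≠ 0 ∧ Real.sin θ ≠ 0)
        (ae_restrict_of_ae SingularPoints.ae_cos_ne_zero_sin_ne_zero)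
    filter_upwards [h1, h2, ae_polarMeasure δ₂] with p hp1 hp2 hp3
    exact polar_residual_integrand h hp3.1 hp1 hp3.2 (hκ p.1 hp3.1 p.2 hp2.1 hp2.2)
  rw [integral_congr_ae hae, integral_add i1 i2]
  -- The order of integration is chosen so that `r` is innermost: `q μ` depends on the angle only
  -- and factors out of a vanishing integral.
  have z2 : ∫ p, q p.2 * mu p.2 * ((lam ^ 2 * η p.1 + (2 * lam + 1) * (p.1 * deriv η p.1)
            + p.1 ^ 2 * deriv (deriv η) p.1) * φ (polarPoint x₀ p.1 p.2)
          + (lam * p.1 * η p.1 + p.1 ^ 2 * deriv η p.1) * polarDr x₀ φ p)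
            * p.1 ^ (lam - 1) ∂polarMeasure δ₂ = 0 := by
    rw [polarMeasure, integral_prod_symm _ i2]
    refine integral_eq_zero_of_ae (ae_of_all _ fun θ => ?_)
    simp only [mul_assoc, Pi.zero_apply]
    rw [integral_const_mul, integral_const_mul]
    have := integral_radial_eq_zero h hlam.1
      (fun r => hasDerivAt_comp_polarPoint_radius (x₀ := x₀) (hφ.differentiable (by simp)) r θ)
      (hΦr.comp (Continuous.prodMk_left θ))
    simp only [mul_assoc] at this
    rw [this]
    simp
  rw [z2, add_zero, polarMeasure, integral_prod _ i1]
  refine integral_congr_ae (ae_of_all _ fun r => ?_)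
  simp only
  -- Here the angle is innermost. The polar angle runs over `(-π, π)` and `circleForm` over `(0,
  -- 2π)`; periodicity identifies the two.
  rw [circleForm, ← integral_Ioo_neg_pi_pi, ← integral_const_mul]
  · refine integral_congr_ae (ae_of_all _ fun θ => ?_)
    simp only
    rw [(hasDerivAt_comp_polarPoint_angle (x₀ := x₀) (hφ.differentiable (by simp)) r θ).deriv]
    ring
  · intro θ
    have hper : Function.Periodic (fun θ => φ (polarPoint x₀ r θ)) (2 * Real.pi) := fun θ => by
      simp only [polarPoint_add_two_pi]
    simp only
    rw [hqp θ, hp θ, periodic_deriv hp θ, periodic_deriv hper θ, polarPoint_add_two_pi]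

end PolarTest


/-! ### Weighted radial inequalities and the bound of the singular residual -/

section PolarBounds

variable {x₀ : E 2} {φ : E 2 → ℝ}

lemma integrableOn_rpow_mul {a R : ℝ} (ha : 0 < a) {u : ℝ → ℝ} (hu : Continuous u) :
    IntegrableOn (fun r => r ^ (a - 1) * u r) (Ioo 0 R) := by
  rcases le_or_gt R 0 with h | h
  · rw [Ioo_eq_empty_of_le h]
    exact integrableOn_empty
  · have := (intervalIntegral.intervalIntegrable_rpow' (a := 0) (b := R) (r := a - 1)
      (by linarith)).mul_continuousOn hu.continuousOn
    rwa [intervalIntegrable_iff_integrableOn_Ioo_of_le h.le] at this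

lemma integral_Ioo_rpow {a R : ℝ} (ha : 0 < a) (hR : 0 ≤ R) :
    ∫ r in Ioo 0 R, r ^ (a - 1) = R ^ a / a := by
  rw [← integral_Ioc_eq_integral_Ioo, ← intervalIntegral.integral_of_le hR,
    integral_rpow (Or.inl (by linarith)), sub_add_cancel, Real.zero_rpow ha.ne', sub_zero]

lemma memLp_rpow_half_mul {a R : ℝ} (ha : 0 < a) {u : ℝ → ℝ} (hu : Continuous u) :
    MemLp (fun r => r ^ ((a - 1) / 2) * u r) 2 (volume.restrict (Ioo 0 R)) ∧
      nrm (volume.restrict (Ioo 0 R)) (fun r => r ^ ((a - 1) / 2) * u r)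
        = √(∫ r in Ioo 0 R, r ^ (a - 1) * u r ^ 2) := by
  have e : ∀ r ∈ Ioo 0 R, (r ^ ((a - 1) / 2) * u r) ^ 2 = r ^ (a - 1) * u r ^ 2 := by
    intro r hr
    rw [mul_pow, ← Real.rpow_natCast (r ^ ((a - 1) / 2)), ← Real.rpow_mul hr.1.le]
    congr 2
    push_cast
    ring
  constructor
  · have hm : Measurable fun r : ℝ => r ^ ((a - 1) / 2) * u r :=
      (measurable_id.pow_const _).mul hu.measurable
    refine (memLp_two_iff_integrable_sq hm.aestronglyMeasurable).2 ?_
    refine (integrableOn_rpow_mul ha (hu.pow 2)).congr ?_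
    filter_upwards [ae_restrict_mem measurableSet_Ioo] with r hr using (e r hr).symm
  · rw [nrm]
    congr 1
    exact setIntegral_congr_fun measurableSet_Ioo e

/-- A weighted Cauchy–Schwarz inequality. -/
lemma integral_rpow_mul_le {a b c R : ℝ} (ha : 0 < a) (hb : 0 < b)
    (habc : c - 1 = (a - 1) / 2 + (b - 1) / 2) {u : ℝ → ℝ} (hu : Continuous u) :
    ∫ r in Ioo 0 R, r ^ (c - 1) * u r
      ≤ √(∫ r in Ioo 0 R, r ^ (a - 1)) * √(∫ r in Ioo 0 R, r ^ (b - 1) * u r ^ 2) := by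
  obtain ⟨f1, f2⟩ := memLp_rpow_half_mul (R := R) ha (continuous_const (y := (1 : ℝ)))
  obtain ⟨g1, g2⟩ := memLp_rpow_half_mul (R := R) hb hu
  have h := (le_abs_self _).trans (abs_integral_mul_le f1 g1)
  rw [f2, g2] at h
  simp only [one_pow, mul_one] at h
  refine le_of_eq_of_le (setIntegral_congr_fun measurableSet_Ioo fun r hr => ?_) h
  rw [habc, Real.rpow_add hr.1]
  ring

/-- A Hardy inequality with the weight `r ^ (λ - 1)`. -/
lemma hardy_rpow {lam R : ℝ} (hlam : 0 < lam) (hR : 0 ≤ R) {f f' : ℝ → ℝ}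
    (hf : ∀ r, HasDerivAt f (f' r) r) (hf' : Continuous f') (h0 : f R = 0) :
    ∫ r in Ioo 0 R, r ^ (lam - 1) * f r ^ 2
      ≤ 4 / lam ^ 2 * R ^ lam * ∫ r in Ioo 0 R, r * f' r ^ 2 := by
  have hfc : Continuous f := continuous_iff_continuousAt.2 fun r => (hf r).continuousAt
  have hi : IntegrableOn (fun r => r ^ (lam - 1) * (lam * f r ^ 2 + 2 * r * f r * f' r))
      (Ioo 0 R) := integrableOn_rpow_mul hlam (by fun_prop)
  -- The integrand is the derivative of `r ^ λ f²`, which vanishes at both ends.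
  have key : ∫ r in Ioo 0 R, r ^ (lam - 1) * (lam * f r ^ 2 + 2 * r * f r * f' r) = 0 := by
    rw [← integral_Ioc_eq_integral_Ioo, ← intervalIntegral.integral_of_le hR]
    rw [intervalIntegral.integral_eq_sub_of_hasDerivAt_of_le (f := fun r => r ^ lam * f r ^ 2) hR]
    · rw [h0, Real.zero_rpow hlam.ne']
      ring
    · exact ((Real.continuous_rpow_const hlam.le).mul (hfc.pow 2)).continuousOn
    · intro r hr
      have := (Real.hasDerivAt_rpow_const (x := r) (p := lam) (Or.inl hr.1.ne')).mul ((hf r).pow 2)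
      refine HasDerivAt.congr_deriv this ?_
      have e : r ^ lam = r * r ^ (lam - 1) := by
        rw [Real.rpow_sub_one hr.1.ne', mul_div_cancel₀ _ hr.1.ne']
      simp only [Pi.pow_apply, e]
      push_cast
      ring
    · rwa [intervalIntegrable_iff_integrableOn_Ioo_of_le hR]
  have hj : IntegrableOn (fun r => r * f' r ^ 2) (Ioo 0 R) :=
    (Continuous.integrableOn_Icc (by fun_prop)).mono_set Ioo_subset_Icc_self
  have hl : IntegrableOn (fun r => r ^ (lam - 1) * f r ^ 2) (Ioo 0 R) :=
    integrableOn_rpow_mul hlam (hfc.pow 2)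
  have hmono : ∫ r in Ioo 0 R, lam / 2 * (r ^ (lam - 1) * f r ^ 2)
      ≤ ∫ r in Ioo 0 R, (r ^ (lam - 1) * (lam * f r ^ 2 + 2 * r * f r * f' r)
        + 2 / lam * R ^ lam * (r * f' r ^ 2)) := by
    refine setIntegral_mono_on (hl.const_mul _) (hi.add (hj.const_mul _)) measurableSet_Ioo
      fun r hr => ?_
    have hw : 0 ≤ r ^ (lam - 1) := Real.rpow_nonneg hr.1.le _
    have e1 : r ^ lam ≤ R ^ lam := Real.rpow_le_rpow hr.1.le hr.2.le hlam.le
    have e2 : r ^ lam = r * r ^ (lam - 1) := by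
      rw [Real.rpow_sub_one hr.1.ne', mul_div_cancel₀ _ hr.1.ne']
    have e3 : 2 / lam * r ^ lam * (r * f' r ^ 2) ≤ 2 / lam * R ^ lam * (r * f' r ^ 2) := by
      have := hr.1.le
      gcongr
    have e4 : 0 ≤ r ^ (lam - 1) * (2 / lam) * (lam / 2 * f r + r * f' r) ^ 2 := by positivity
    -- Completing the square absorbs the mixed term and leaves half of `λ r ^ (λ - 1) f²` on the
    -- left side.
    have e5 : r ^ (lam - 1) * (lam * f r ^ 2 + 2 * r * f r * f' r)
        + 2 / lam * r ^ lam * (r * f' r ^ 2) - lam / 2 * (r ^ (lam - 1) * f r ^ 2)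
        = r ^ (lam - 1) * (2 / lam) * (lam / 2 * f r + r * f' r) ^ 2 := by
      rw [e2]
      field_simp
      ring
    linarith
  rw [integral_const_mul, integral_add hi (hj.const_mul _), key, integral_const_mul,
    zero_add] at hmono
  have e : 4 / lam ^ 2 * R ^ lam * ∫ r in Ioo 0 R, r * f' r ^ 2
      = 2 / lam * (2 / lam * R ^ lam * ∫ r in Ioo 0 R, r * f' r ^ 2) := by
    field_simp
    ring
  rw [e]
  calc _ = 2 / lam * (lam / 2 * ∫ r in Ioo 0 R, r ^ (lam - 1) * f r ^ 2) := by
        field_simp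
    _ ≤ _ := mul_le_mul_of_nonneg_left hmono (by positivity)

lemma nrmC_sq_eq {f : ℝ → ℝ} (hf : Function.Periodic f (2 * Real.pi)) :
    nrmC f ^ 2 = ∫ θ in Ioo (-Real.pi) Real.pi, f θ ^ 2 := by
  rw [nrmC, nrm_sq, integral_Ioo_neg_pi_pi (f := fun θ => f θ ^ 2)
    (fun θ => by simp only [hf θ]), intervalIntegral.integral_of_le (by positivity)]

lemma continuous_nrmC {f : ℝ × ℝ → ℝ} (hf : Continuous f) :
    Continuous fun r => nrmC fun θ => f (r, θ) := by
  have h := intervalIntegral.continuous_parametric_intervalIntegral_of_continuous'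
    (μ := volume) (f := fun r θ => f (r, θ) ^ 2)
    (show Continuous (Function.uncurry fun r θ => f (r, θ) ^ 2) from hf.pow 2) 0 (2 * Real.pi)
  refine (Real.continuous_sqrt.comp h).congr fun r => ?_
  simp only [Function.comp_apply, nrmC, nrm]
  rw [intervalIntegral.integral_of_le (by positivity)]

lemma periodic_polarDa (r : ℝ) :
    Function.Periodic (fun θ => polarDa x₀ φ (r, θ)) (2 * Real.pi) := fun θ => by
  simp only [polarDa, polarPoint_add_two_pi, Fin.sum_univ_two, angularVec, Matrix.cons_val_zero,
    Matrix.cons_val_one, Real.sin_add_two_pi, Real.cos_add_two_pi]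

/-- The Dirichlet integral in polar coordinates. -/
lemma integral_polar_gradient {U : Set (E 2)} {R : ℝ} (hφ : IsTestFunction U φ)
    (hU : U ⊆ Metric.ball x₀ R) :
    ∫ p, p.1 * (polarDr x₀ φ p ^ 2 + polarDa x₀ φ p ^ 2) ∂polarMeasure R = gradNorm φ ^ 2 := by
  rw [gradNorm_sq]
  simp only [nrm_sq, polarDr_sq_add_polarDa_sq]
  rw [← integral_finsetSum _ fun k _ => (hφ.memLp_partialDeriv k 2).integrable_sq,
    integral_polar_of_support (x₀ := x₀) (R := R)]
  intro x hx
  refine Finset.sum_eq_zero fun k _ => ?_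
  rw [hφ.partialDeriv_eq_zero_of_notMem k fun h => absurd (Metric.mem_ball.1 (hU h)) (not_lt.2 hx)]
  ring

/-- The angular part of the Dirichlet integral; the radial part is nonnegative and dropped. -/
lemma integral_angular_le {U : Set (E 2)} {R : ℝ} (hφ : IsTestFunction U φ)
    (hU : U ⊆ Metric.ball x₀ R) :
    ∫ r in Ioo 0 R, r * nrmC (fun θ => polarDa x₀ φ (r, θ)) ^ 2 ≤ gradNorm φ ^ 2 := by
  have hφ1 : ContDiff ℝ 1 φ := hφ.1.of_le (by simp)
  have hca : Continuous (polarDa x₀ φ) := continuous_polarDa hφ1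
  have hcr : Continuous (polarDr x₀ φ) := continuous_polarDr hφ1
  have hb : PolarBdd R fun p => polarDa x₀ φ p ^ 2 := (hca.pow 2).polarBdd
  have hi : Integrable (fun p : ℝ × ℝ => p.1 * polarDa x₀ φ p ^ 2) (polarMeasure R) := by
    have := (hb.integrable (lam := 2) two_pos)
    refine this.congr (ae_of_all _ fun p => ?_)
    simp only
    rw [show (2 : ℝ) - 1 = 1 by norm_num, Real.rpow_one, mul_comm]
  have hi' : Integrable (fun p : ℝ × ℝ => p.1 * (polarDr x₀ φ p ^ 2 + polarDa x₀ φ p ^ 2))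
      (polarMeasure R) := by
    have hb : PolarBdd R fun p => polarDr x₀ φ p ^ 2 + polarDa x₀ φ p ^ 2 :=
      ((hcr.pow 2).add (hca.pow 2)).polarBdd
    have := (hb.integrable (lam := 2) two_pos)
    refine this.congr (ae_of_all _ fun p => ?_)
    simp only
    rw [show (2 : ℝ) - 1 = 1 by norm_num, Real.rpow_one, mul_comm]
  have e : ∫ r in Ioo 0 R, r * nrmC (fun θ => polarDa x₀ φ (r, θ)) ^ 2
      = ∫ p, p.1 * polarDa x₀ φ p ^ 2 ∂polarMeasure R := by
    rw [polarMeasure, integral_prod _ hi]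
    refine integral_congr_ae (ae_of_all _ fun r => ?_)
    simp only
    rw [nrmC_sq_eq (periodic_polarDa r), integral_const_mul]
  rw [e, ← integral_polar_gradient hφ hU]
  refine integral_mono_ae hi hi' ?_
  filter_upwards [ae_polarMeasure R] with p hp
  have := hp.1.1
  have := sq_nonneg (polarDr x₀ φ p)
  nlinarith [mul_nonneg hp.1.1.le this]

/-- The one-dimensional Hardy inequality on each ray, available because `φ` vanishes at radius `R`,
integrated over the angles. Only the radial part of the Dirichlet integral is used. -/
lemma integral_hardy_le {U : Set (E 2)} {R lam : ℝ} (hR : 0 ≤ R) (hlam : 0 < lam)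
    (hφ : IsTestFunction U φ) (hU : U ⊆ Metric.ball x₀ R) :
    ∫ r in Ioo 0 R, r ^ (lam - 1) * nrmC (fun θ => φ (polarPoint x₀ r θ)) ^ 2
      ≤ 4 / lam ^ 2 * R ^ lam * gradNorm φ ^ 2 := by
  have hφ1 : ContDiff ℝ 1 φ := hφ.1.of_le (by simp)
  have hca : Continuous (polarDa x₀ φ) := continuous_polarDa hφ1
  have hcr : Continuous (polarDr x₀ φ) := continuous_polarDr hφ1
  have hc : Continuous fun p : ℝ × ℝ => φ (polarPoint x₀ p.1 p.2) :=
    hφ1.continuous.comp continuous_polarPoint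
  have hb : PolarBdd R fun p => φ (polarPoint x₀ p.1 p.2) ^ 2 := (hc.pow 2).polarBdd
  have hi := hb.integrable hlam
  have hir : Integrable (fun p : ℝ × ℝ => p.1 * polarDr x₀ φ p ^ 2) (polarMeasure R) := by
    have hb : PolarBdd R fun p => polarDr x₀ φ p ^ 2 := (hcr.pow 2).polarBdd
    have := hb.integrable (lam := 2) two_pos
    refine this.congr (ae_of_all _ fun p => ?_)
    simp only
    rw [show (2 : ℝ) - 1 = 1 by norm_num, Real.rpow_one, mul_comm]
  have hi' : Integrable (fun p : ℝ × ℝ => p.1 * (polarDr x₀ φ p ^ 2 + polarDa x₀ φ p ^ 2))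
      (polarMeasure R) := by
    have hb : PolarBdd R fun p => polarDr x₀ φ p ^ 2 + polarDa x₀ φ p ^ 2 :=
      ((hcr.pow 2).add (hca.pow 2)).polarBdd
    have := (hb.integrable (lam := 2) two_pos)
    refine this.congr (ae_of_all _ fun p => ?_)
    simp only
    rw [show (2 : ℝ) - 1 = 1 by norm_num, Real.rpow_one, mul_comm]
  have e : ∫ r in Ioo 0 R, r ^ (lam - 1) * nrmC (fun θ => φ (polarPoint x₀ r θ)) ^ 2
      = ∫ p, φ (polarPoint x₀ p.1 p.2) ^ 2 * p.1 ^ (lam - 1) ∂polarMeasure R := by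
    rw [polarMeasure, integral_prod _ hi]
    refine integral_congr_ae (ae_of_all _ fun r => ?_)
    simp only
    rw [nrmC_sq_eq (fun θ => by simp only [polarPoint_add_two_pi]), integral_mul_const, mul_comm]
  have hzero : ∀ θ, φ (polarPoint x₀ R θ) = 0 := fun θ =>
    hφ.eq_zero_of_notMem fun h => by
      have := Metric.mem_ball.1 (hU h)
      rw [dist_polarPoint hR] at this
      exact lt_irrefl _ this
  rw [e]
  calc ∫ p, φ (polarPoint x₀ p.1 p.2) ^ 2 * p.1 ^ (lam - 1) ∂polarMeasure R
      ≤ 4 / lam ^ 2 * R ^ lam * ∫ p, p.1 * polarDr x₀ φ p ^ 2 ∂polarMeasure R := by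
        rw [polarMeasure, integral_prod_symm _ hi, integral_prod_symm _ hir, ← integral_const_mul]
        refine integral_mono hi.integral_prod_right (hir.integral_prod_right.const_mul _) fun θ => ?_
        have := hardy_rpow hlam hR
          (fun r => hasDerivAt_comp_polarPoint_radius (x₀ := x₀) (hφ1.differentiable (by simp)) r θ)
          (hcr.comp (Continuous.prodMk_left θ)) (hzero θ)
        simp only [mul_comm (_ ^ 2) (_ ^ (lam - 1))]
        exact this
    _ ≤ 4 / lam ^ 2 * R ^ lam * gradNorm φ ^ 2 := by
        refine mul_le_mul_of_nonneg_left ?_ (by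
          have := Real.rpow_nonneg hR lam
          positivity)
        rw [← integral_polar_gradient hφ hU]
        refine integral_mono_ae hir hi' ?_
        filter_upwards [ae_polarMeasure R] with p hp
        have := sq_nonneg (polarDa x₀ φ p)
        nlinarith [mul_nonneg hp.1.1.le this]

/-- The residual of a singular function is bounded by the residual of the angular eigenvalue
problem. -/
lemma abs_integral_circleForm_le {δ₁ δ₂ : ℝ} {η : ℝ → ℝ} (h : IsCutoff δ₁ δ₂ η) {Mη R : ℝ}
    (hMη : ∀ r, 0 ≤ r → |η r| ≤ Mη) (hδR : δ₂ ≤ R) (hR : 1 ≤ R) {lam : ℝ}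
    (hlam : lam ∈ Ioo (0 : ℝ) 1) {mu q : ℝ → ℝ} {A B : ℝ} (hA : 0 ≤ A) (hB : 0 ≤ B)
    (hAB : ∀ ψ, ContDiff ℝ 1 ψ → Function.Periodic ψ (2 * Real.pi) →
      |circleForm q lam mu ψ| ≤ A * nrmC (deriv ψ) + B * nrmC ψ)
    {U : Set (E 2)} (hφ : IsTestFunction U φ) (hU : U ⊆ Metric.ball x₀ R) :
    |∫ r in Ioo 0 δ₂, η r * r ^ (lam - 1) * circleForm q lam mu fun θ => φ (polarPoint x₀ r θ)|
      ≤ Mη * R * (A / lam + 2 * B / lam ^ 2) * gradNorm φ := by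
  have hφ1 : ContDiff ℝ 1 φ := hφ.1.of_le (by simp)
  have hR0 : 0 ≤ R := by linarith
  have hM0 : 0 ≤ Mη := (abs_nonneg _).trans (hMη 0 le_rfl)
  obtain ⟨hl0, hl1⟩ := hlam
  have hca : Continuous (polarDa x₀ φ) := continuous_polarDa hφ1
  have hc : Continuous fun p : ℝ × ℝ => φ (polarPoint x₀ p.1 p.2) :=
    hφ1.continuous.comp continuous_polarPoint
  set α : ℝ → ℝ := fun r => nrmC fun θ => polarDa x₀ φ (r, θ) with hα
  set β : ℝ → ℝ := fun r => nrmC fun θ => φ (polarPoint x₀ r θ) with hβ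
  have hαc : Continuous α := continuous_nrmC hca
  have hβc : Continuous β := continuous_nrmC hc
  have hα0 : ∀ r, 0 ≤ α r := fun r => nrm_nonneg
  have hβ0 : ∀ r, 0 ≤ β r := fun r => nrm_nonneg
  set N := gradNorm φ with hN
  have hN0 : 0 ≤ N := gradNorm_nonneg
  have iα : IntegrableOn (fun r => r ^ (lam + 1 - 1) * α r) (Ioo 0 R) :=
    integrableOn_rpow_mul (by linarith) hαc
  have iβ : IntegrableOn (fun r => r ^ (lam - 1) * β r) (Ioo 0 R) :=
    integrableOn_rpow_mul hl0 hβc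
  -- The normalization `R ≥ 1` makes powers of `R` uniformly bounded for `λ` in `(0, 1)`.
  have hRl : R ^ lam ≤ R := by
    have := Real.rpow_le_rpow_of_exponent_le hR hl1.le
    rwa [Real.rpow_one] at this
  have hRl0 : 0 ≤ R ^ lam := Real.rpow_nonneg hR0 _
  -- The weight `r ^ λ` is split as `r ^ (λ - 1/2) · r ^ (1/2)`, so that the second factor meets the
  -- Dirichlet integral. The price is `1 / λ`.
  have Iα : ∫ r in Ioo 0 R, r ^ (lam + 1 - 1) * α r ≤ R / lam * N := by
    refine (integral_rpow_mul_le (a := 2 * lam) (b := 2) (by linarith) two_pos (by ring) hαc).trans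
      (mul_le_mul ?_ ?_ (Real.sqrt_nonneg _) (by positivity))
    · rw [integral_Ioo_rpow (by linarith) hR0]
      refine Real.sqrt_le_iff.2 ⟨by positivity, ?_⟩
      have e1 : R ^ (2 * lam) ≤ R ^ 2 := by
        have := Real.rpow_le_rpow_of_exponent_le hR (show 2 * lam ≤ 2 by linarith)
        rwa [Real.rpow_two] at this
      rw [div_pow]
      refine div_le_div₀ (by positivity) e1 (by positivity) ?_
      nlinarith
    · refine Real.sqrt_le_iff.2 ⟨hN0, ?_⟩
      refine le_of_eq_of_le ?_ (integral_angular_le hφ hU)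
      refine setIntegral_congr_fun measurableSet_Ioo fun r _ => ?_
      rw [show (2 : ℝ) - 1 = 1 by norm_num, Real.rpow_one]
  -- The weight is split evenly. One half integrates to `R ^ λ / λ`, the other is handled by Hardy's
  -- inequality, and together they cost `1 / λ²`.
  have Iβ : ∫ r in Ioo 0 R, r ^ (lam - 1) * β r ≤ 2 * R / lam ^ 2 * N := by
    refine (integral_rpow_mul_le (a := lam) (b := lam) hl0 hl0 (by ring) hβc).trans ?_
    rw [integral_Ioo_rpow hl0 hR0, ← Real.sqrt_mul (by positivity)]
    refine Real.sqrt_le_iff.2 ⟨by positivity, ?_⟩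
    calc R ^ lam / lam * ∫ r in Ioo 0 R, r ^ (lam - 1) * β r ^ 2
        ≤ R ^ lam / lam * (4 / lam ^ 2 * R ^ lam * N ^ 2) :=
          mul_le_mul_of_nonneg_left (integral_hardy_le hR0 hl0 hφ hU) (by positivity)
      _ ≤ R / lam ^ 2 * (4 / lam ^ 2 * R * N ^ 2) := by
          have e1 : R ^ lam / lam ≤ R / lam ^ 2 :=
            div_le_div₀ hR0 hRl (by positivity) (by nlinarith)
          gcongr
      _ = _ := by
          field_simp
          ring
  -- The test function need not vanish at radius `δ₂`, so the integral is extended to `R`, where it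
  -- does.
  have e0 : ∫ r in Ioo 0 δ₂, η r * r ^ (lam - 1)
        * circleForm q lam mu (fun θ => φ (polarPoint x₀ r θ))
      = ∫ r in Ioo 0 R, η r * r ^ (lam - 1)
        * circleForm q lam mu (fun θ => φ (polarPoint x₀ r θ)) := by
    refine (setIntegral_eq_of_subset_of_forall_sdiff_eq_zero measurableSet_Ioo
      (Ioo_subset_Ioo_right hδR) ?_).symm
    rintro r ⟨hr1, hr2⟩
    have : δ₂ ≤ r := by
      by_contra! h'
      exact hr2 ⟨hr1.1, h'⟩
    rw [h.eq_zero_of_le this]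
    ring
  rw [e0, ← Real.norm_eq_abs]
  refine (norm_integral_le_of_norm_le
    (((iα.const_mul A).add (iβ.const_mul B)).const_mul Mη) ?_).trans ?_
  · filter_upwards [ae_restrict_mem measurableSet_Ioo] with r hr
    -- The angular derivative carries a factor `r`, which raises the weight of the `A` term from `r
    -- ^ (λ - 1)` to `r ^ λ`.
    have hd : deriv (fun θ => φ (polarPoint x₀ r θ)) = fun θ => r * polarDa x₀ φ (r, θ) :=
      funext fun θ => (hasDerivAt_comp_polarPoint_angle (x₀ := x₀)
        (hφ1.differentiable (by simp)) r θ).deriv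
    have b1 := hAB _ (contDiff_comp_polarPoint_angle (x₀ := x₀) hφ1 r)
      (fun θ => by simp only [polarPoint_add_two_pi])
    have e' : nrmC (fun θ => r * polarDa x₀ φ (r, θ)) = r * α r := by
      simp only [hα, nrmC, nrm_const_mul, abs_of_pos hr.1]
    rw [hd, e'] at b1
    have b2 := hMη r hr.1.le
    have hw : 0 ≤ r ^ (lam - 1) := Real.rpow_nonneg hr.1.le _
    have e : r ^ (lam + 1 - 1) = r ^ (lam - 1) * r := by
      rw [add_sub_cancel_right, Real.rpow_sub_one hr.1.ne', div_mul_cancel₀ _ hr.1.ne']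
    rw [norm_mul, norm_mul, Real.norm_eq_abs, Real.norm_eq_abs, Real.norm_eq_abs,
      abs_of_nonneg hw]
    simp only [Pi.add_apply]
    calc |η r| * r ^ (lam - 1) * |circleForm q lam mu fun θ => φ (polarPoint x₀ r θ)|
        ≤ Mη * r ^ (lam - 1) * (A * (r * α r) + B * β r) :=
          mul_le_mul (mul_le_mul_of_nonneg_right b2 hw) b1 (abs_nonneg _) (by positivity)
      _ = Mη * (A * (r ^ (lam + 1 - 1) * α r) + B * (r ^ (lam - 1) * β r)) := by
          rw [e]
          ring
  · simp only [Pi.add_apply]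
    rw [integral_const_mul, integral_add (iα.const_mul A) (iβ.const_mul B), integral_const_mul,
      integral_const_mul]
    calc _ ≤ Mη * (A * (R / lam * N) + B * (2 * R / lam ^ 2 * N)) := by gcongr
      _ = _ := by ring

end PolarBounds


/-! ### The singular component as a whole -/

lemma isBounded_openBox {d : ℕ} {lo hi : Fin d → ℝ} : Bornology.IsBounded (openBox lo hi) := by
  refine (isCompact_Icc (a := lo) (b := hi)).image (PiLp.continuous_toLp 2 _) |>.isBounded.subset
    fun x hx => ⟨WithLp.ofLp x, ⟨fun k => (hx k).1.le, fun k => (hx k).2.le⟩, rfl⟩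

namespace IsCutoff

variable {δ₁ δ₂ : ℝ} {η : ℝ → ℝ}

/-- The source lives on the annulus between `δ₁` and `δ₂`, away from the singularity, where all
powers of `r` are bounded. -/
lemma memLp_polarSource (h : IsCutoff δ₁ δ₂ η) (x₀ : E 2) (lam : ℝ) {mu : ℝ → ℝ}
    (hc : Continuous mu) (hp : Function.Periodic mu (2 * Real.pi)) :
    MemLp (polarSource x₀ δ₁ δ₂ lam mu η) 2 volume := by
  have hη' : ContDiff ℝ ∞ (deriv η) := by
    have := h.contDiff
    rw [contDiff_infty_iff_deriv] at this
    exact this.2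
  have hc1 := hη'.continuous
  have hc2 := hη'.continuous_deriv (by simp)
  set g : ℝ → ℝ := fun r => 2 * lam * r ^ (lam - 1) * deriv η r
    + r ^ lam * (deriv (deriv η) r + 1 / r * deriv η r) with hg
  have hgc : ContinuousOn g (Icc δ₁ δ₂) := by
    have hne : ∀ r ∈ Icc δ₁ δ₂, r ≠ 0 := fun r hr => (h.pos.trans_le hr.1).ne'
    refine ((continuousOn_const.mul (continuousOn_id.rpow_const fun r hr =>
      Or.inl (hne r hr))).mul hc1.continuousOn).add ((continuousOn_id.rpow_const fun r hr =>
      Or.inl (hne r hr)).mul (hc2.continuousOn.add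
        ((continuousOn_const.div continuousOn_id hne).mul hc1.continuousOn)))
  obtain ⟨N, hN⟩ := isCompact_Icc.exists_bound_of_continuousOn hgc
  obtain ⟨M, hM0, hM⟩ := exists_bound_of_periodic hc hp
  have hN0 : 0 ≤ N := (norm_nonneg _).trans (hN δ₁ ⟨le_rfl, h.lt.le⟩)
  have e : polarSource x₀ δ₁ δ₂ lam mu η = ((fun x => dist x x₀) ⁻¹' Ioo δ₁ δ₂).indicator
      fun x => mu (polarAngle x₀ x) * g (dist x x₀) := by
    funext x
    by_cases hx : dist x x₀ ∈ Ioo δ₁ δ₂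
    · rw [indicator_of_mem (show x ∈ _ from hx), polarSource_eq h hx]
    · rw [indicator_of_notMem (show x ∉ _ from hx), polarSource, if_neg hx]
  have hgm : Measurable g := ((measurable_const.mul (measurable_id.pow_const _)).mul
    hc1.measurable).add ((measurable_id.pow_const _).mul (hc2.measurable.add
      ((measurable_const.div measurable_id).mul hc1.measurable)))
  have m1 : Measurable fun x : E 2 => dist x x₀ := measurable_id.dist measurable_const
  refine memLp_of_bounded_compact (M := M * N) (K := Metric.closedBall x₀ δ₂) ?_ (fun x => ?_)
    (isCompact_closedBall _ _) fun x hx => ?_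
  · rw [e]
    exact ((hc.measurable.comp measurable_polarAngle).mul (hgm.comp m1)).indicator
      (m1 measurableSet_Ioo)
  · rw [e]
    by_cases hx : dist x x₀ ∈ Ioo δ₁ δ₂
    · rw [indicator_of_mem (show x ∈ _ from hx), abs_mul]
      exact mul_le_mul (hM _) (hN _ (Ioo_subset_Icc_self hx)) (abs_nonneg _) hM0
    · rw [indicator_of_notMem (show x ∉ _ from hx), abs_zero]
      positivity
  · rw [polarSource, if_neg fun h' => hx (Metric.mem_closedBall.2 h'.2.le)]

end IsCutoff

lemma BoxPartition.residual_sum {d I : ℕ} (D : BoxPartition d I) {p : Fin I → ℝ}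
    {pmin pmax : ℝ} (hpmin : 0 < pmin) (hpm : pmin ≤ pmax) (hp : ∀ i, pmin ≤ p i ∧ p i ≤ pmax)
    {ι : Type*} [Fintype ι] (c : ι → ℝ) {G : ι → Fin d → E d → ℝ} {S : ι → E d → ℝ}
    (hG : ∀ i k, MemL2 D.dom (G i k)) (hS : ∀ i, MemL2 D.dom (S i)) {φ : E d → ℝ}
    (hφ : IsTestFunction D.dom φ) :
    (∫ x in D.dom, D.coeff p x * ∑ k, (∑ i, c i * G i k x) * partialDeriv k φ x)
        + ∫ x in D.dom, D.coeff p x * (∑ i, c i * S i x) * φ x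
      = ∑ i, c i * ((∫ x in D.dom, D.coeff p x * ∑ k, G i k x * partialDeriv k φ x)
        + ∫ x in D.dom, D.coeff p x * S i x * φ x) := by
  have i1 := fun i => D.integrable_coeff_mul_sum hpmin hpm hp (hG i)
    fun k => hφ.memLp_partialDeriv (μ := volume.restrict D.dom) k 2
  have i2 := fun i => integrable_mul_of_memLp (D.memLp_coeff_mul hpmin hpm hp (hS i))
    (hφ.memLp (μ := volume.restrict D.dom) 2)
  have e1 : ∀ x, D.coeff p x * ∑ k, (∑ i, c i * G i k x) * partialDeriv k φ x
      = ∑ i, c i * (D.coeff p x * ∑ k, G i k x * partialDeriv k φ x) := fun x => by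
    simp only [Finset.sum_mul, Finset.mul_sum]
    rw [Finset.sum_comm]
    exact Finset.sum_congr rfl fun i _ => Finset.sum_congr rfl fun k _ => by ring
  have e2 : ∀ x, D.coeff p x * (∑ i, c i * S i x) * φ x
      = ∑ i, c i * (D.coeff p x * S i x * φ x) := fun x => by
    simp only [Finset.sum_mul, Finset.mul_sum]
    exact Finset.sum_congr rfl fun i _ => by ring
  simp only [e1, e2]
  rw [integral_finsetSum _ fun i _ => (i1 i).const_mul _,
    integral_finsetSum _ fun i _ => (i2 i).const_mul _, ← Finset.sum_add_distrib]
  simp only [integral_const_mul, mul_add]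

namespace SingularPoints

variable {I Ns : ℕ} {D : BoxPartition 2 I} (V : SingularPoints D Ns)

lemma isCutoff : IsCutoff V.δ₁ V.δ₂ V.η :=
  ⟨V.δ₁_pos, V.δ₁_lt_δ₂, V.η_smooth, V.η_one, V.η_zero⟩

/-- One radius for all singular points, large enough that every test function on `Ω` vanishes at
distance `R`. -/
lemma exists_radius : ∃ R, 1 ≤ R ∧ V.δ₂ ≤ R ∧ ∀ i, D.dom ⊆ Metric.ball (V.pt i) R := by
  have h := fun i => (isBounded_openBox (lo := D.lo) (hi := D.hi)).subset_ball_lt 0 (V.pt i)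
  choose r hr0 hr using h
  have hδ := V.δ₂_pos
  have hs : 0 ≤ ∑ i, r i := Finset.sum_nonneg fun i _ => (hr0 i).le
  refine ⟨1 + V.δ₂ + ∑ i, r i, by linarith, by linarith, fun i =>
    (hr i).trans (Metric.ball_subset_ball ?_)⟩
  have := Finset.single_le_sum (f := r) (fun j _ => (hr0 j).le) (Finset.mem_univ i)
  linarith

/-- The residual of a single singular function. -/
lemma abs_residual_polarSing_le {p : Fin I → ℝ} {pmin pmax : ℝ} (hpmin : 0 < pmin)
    (hpm : pmin ≤ pmax) (hp : ∀ i, pmin ≤ p i ∧ p i ≤ pmax) (i : Fin Ns) {Mη R : ℝ}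
    (hMη : ∀ r, 0 ≤ r → |V.η r| ≤ Mη) (hδR : V.δ₂ ≤ R) (hR : 1 ≤ R)
    (hU : D.dom ⊆ Metric.ball (V.pt i) R) {lam : ℝ} (hlam : lam ∈ Ioo (0 : ℝ) 1) {mu : ℝ → ℝ}
    {K : NNReal} (hK : LipschitzWith K mu) (hper : Function.Periodic mu (2 * Real.pi)) {A B : ℝ}
    (hA : 0 ≤ A) (hB : 0 ≤ B)
    (hAB : ∀ ψ, ContDiff ℝ 1 ψ → Function.Periodic ψ (2 * Real.pi) →
      |circleForm (V.angularCoeff p i) lam mu ψ| ≤ A * nrmC (deriv ψ) + B * nrmC ψ)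
    {φ : E 2 → ℝ} (hφ : IsTestFunction D.dom φ) :
    |(∫ x in D.dom, D.coeff p x * ∑ k, polarGrad (V.pt i) lam mu V.η k x * partialDeriv k φ x)
        + ∫ x in D.dom, D.coeff p x * polarSource (V.pt i) V.δ₁ V.δ₂ lam mu V.η x * φ x|
      ≤ Mη * R * (A / lam + 2 * B / lam ^ 2) * gradNorm φ := by
  have h := V.isCutoff
  have hG := fun k => (h.memLp_polarGrad (V.pt i) hlam hK hper k).restrict D.dom
  have hS := (h.memLp_polarSource (V.pt i) lam hK.continuous hper).restrict D.dom
  rw [← integral_add (D.integrable_coeff_mul_sum hpmin hpm hp hG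
      fun k => hφ.memLp_partialDeriv k 2)
    (integrable_mul_of_memLp (D.memLp_coeff_mul hpmin hpm hp hS) (hφ.memLp 2)),
    setIntegral_eq_integral_of_forall_compl_eq_zero,
    residual_polarSing_eq h hlam hK hper (V.measurable_angularCoeff p i)
      (V.periodic_angularCoeff p i) (fun θ => D.abs_coeff_le hpmin hpm hp _)
      (fun r hr θ hc hs => V.coeff_polarPoint p i hr hc hs) (hφ.1.of_le (by simp))]
  · exact abs_integral_circleForm_le h hMη hδR hR hlam hA hB hAB hφ hU
  · intro x hx
    simp only [hφ.eq_zero_of_notMem hx, hφ.partialDeriv_eq_zero_of_notMem _ hx, mul_zero,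
      Finset.sum_const_zero, add_zero]

/-- The residual of the singular component is bounded by the errors of the eigenpairs. -/
theorem exists_residual_singularPart_le {M : ℕ} {φ : Fin M → ℝ → ℝ}
    (hφ : ∀ k, IsPeriodicPiecewisePolynomial (φ k)) {pmin pmax : ℝ} (hpmin : 0 < pmin)
    (hpm : pmin ≤ pmax) :
    ∃ C : ℝ, 0 < C ∧ ∀ p : Fin I → ℝ, (∀ i, pmin ≤ p i ∧ p i ≤ pmax) →
      ∀ (K : Fin Ns → ℕ) (Lam lam : ∀ i, Fin (K i) → ℝ) (vth mu : ∀ i, Fin (K i) → ℝ → ℝ),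
        (∀ i j, IsSLEigenpair (V.angularCoeff p i) (Lam i j) (vth i j)) →
        (∀ i j, IsFEEigenpair φ (V.angularCoeff p i) (lam i j) (mu i j)) →
      ∀ c : ∀ i, Fin (K i) → ℝ, ∃ (G : Fin 2 → E 2 → ℝ) (Es : ℝ), 0 ≤ Es ∧
        InH10 D.dom (V.singularPart lam mu c) G ∧ MemL2 D.dom (V.sourcePart lam mu c) ∧
        (∀ ψ, IsTestFunction D.dom ψ →
          |(∫ x in D.dom, D.coeff p x * ∑ k, G k x * partialDeriv k ψ x)
            + ∫ x in D.dom, D.coeff p x * V.sourcePart lam mu c x * ψ x| ≤ Es * gradNorm ψ) ∧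
        ENNReal.ofReal (Es ^ 2) ≤ ENNReal.ofReal C * eigenError c lam Lam mu vth := by
  obtain ⟨Cc, hCc, hcirc⟩ := exists_circleForm_residual_le hφ hpmin pmax
  obtain ⟨T⟩ := exists_trialMesh hφ
  obtain ⟨R, hR, hδR, hU⟩ := V.exists_radius
  obtain ⟨Mη, hM0, hMη⟩ := V.isCutoff.exists_bound
  have hM1 : 0 < Mη := by
    have := (hMη 0 le_rfl).1
    rw [V.η_one 0 V.δ₁_pos, abs_one] at this
    linarith
  -- The weights `λ` and `λ²` of the angular residual cancel the factors `1 / λ` and `1 / λ²` of the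
  -- radial integration, so `A / λ + 2 B / λ² ≤ 3 Cc ε`.
  set C' := Mη * R * (3 * Cc) with hC'
  have hC'0 : 0 < C' := by positivity
  refine ⟨2 * C' ^ 2, by positivity, fun p hp K Lam lam vth mu hSL hFE c => ?_⟩
  have hq := fun i => V.isSectorCoeff_angularCoeff hp i
  have hper : ∀ i j, Function.Periodic (mu i j) (2 * Real.pi) := fun i j => by
    obtain ⟨-, -, ρ, -, e⟩ := hFE i j
    rw [e]
    exact fun θ => by simp only [(hφ _).1 θ]
  have hLip : ∀ i j, ∃ L : NNReal, LipschitzWith L (mu i j) := fun i j => by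
    obtain ⟨-, -, ρ, -, e⟩ := hFE i j
    rw [e]
    exact T.exists_lipschitz_combination (fun k => (hφ k).1) ρ
  have hmuL : ∀ i j, MemLp (mu i j) 2 (volume.restrict (Ioc 0 (2 * Real.pi))) := fun i j => by
    obtain ⟨-, -, ρ, -, e⟩ := hFE i j
    rw [e]
    exact (T.memH1Per_combination (fun k => (hφ k).1) ρ).memLp
  choose L hL using hLip
  -- All singular functions are indexed by one finite type, which makes Cauchy–Schwarz over all
  -- pairs a single step.
  set ι := (i : Fin Ns) × Fin (K i) with hι
  set δ : ι → ℝ := fun a => nrmC fun θ => mu a.1 a.2 θ - vth a.1 a.2 θ with hδ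
  set ε : ι → ℝ := fun a => δ a + |lam a.1 a.2 - Lam a.1 a.2| with hε
  have hδ0 : ∀ a, 0 ≤ δ a := fun a => nrm_nonneg
  have hε0 : ∀ a, 0 ≤ ε a := fun a => add_nonneg (hδ0 a) (abs_nonneg _)
  set G : ι → Fin 2 → E 2 → ℝ := fun a =>
    polarGrad (V.pt a.1) (lam a.1 a.2) (mu a.1 a.2) V.η with hG
  set S : ι → E 2 → ℝ := fun a =>
    polarSource (V.pt a.1) V.δ₁ V.δ₂ (lam a.1 a.2) (mu a.1 a.2) V.η with hS
  have hH : ∀ a : ι, InH10 D.dom (V.singularFun a.1 (lam a.1 a.2) (mu a.1 a.2)) (G a) := fun a =>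
    V.isCutoff.inH10_polarSing D.isOpen_dom (V.ball_subset a.1) (hFE a.1 a.2).1 (hL a.1 a.2)
      (hper a.1 a.2)
  have hSm : ∀ a, MemL2 D.dom (S a) := fun a =>
    (V.isCutoff.memLp_polarSource _ _ (hL a.1 a.2).continuous (hper a.1 a.2)).restrict D.dom
  have hsing : V.singularPart lam mu c
      = fun x => ∑ a : ι, c a.1 a.2 * V.singularFun a.1 (lam a.1 a.2) (mu a.1 a.2) x := by
    funext x
    rw [Fintype.sum_sigma]
    rfl
  have hsrc : V.sourcePart lam mu c = fun x => ∑ a : ι, c a.1 a.2 * S a x := by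
    funext x
    rw [Fintype.sum_sigma]
    rfl
  have hsum : ∀ ψ, IsTestFunction D.dom ψ → ∀ a : ι,
      |(∫ x in D.dom, D.coeff p x * ∑ k, G a k x * partialDeriv k ψ x)
        + ∫ x in D.dom, D.coeff p x * S a x * ψ x| ≤ C' * ε a * gradNorm ψ := by
    intro ψ hψ a
    obtain ⟨A, B, hA, hB, hA', hB', hAB⟩ := hcirc _ (hq a.1) _ _ _ _ (hSL a.1 a.2) (hFE a.1 a.2)
    have hl := (hFE a.1 a.2).1
    have hl0 := hl.1
    refine (V.abs_residual_polarSing_le hpmin hpm hp a.1 (fun r hr => (hMη r hr).1) hδR hR (hU a.1)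
      hl (hL a.1 a.2) (hper a.1 a.2) hA hB hAB hψ).trans ?_
    refine mul_le_mul_of_nonneg_right ?_ gradNorm_nonneg
    have e1 : A / lam a.1 a.2 ≤ Cc * ε a := by
      rw [div_le_iff₀ hl0]
      exact hA'.trans_eq (by simp only [hε, hδ]; ring)
    have e2 : B / lam a.1 a.2 ^ 2 ≤ Cc * ε a := by
      rw [div_le_iff₀ (by positivity)]
      exact hB'.trans_eq (by simp only [hε, hδ]; ring)
    have e3 : A / lam a.1 a.2 + 2 * B / lam a.1 a.2 ^ 2 ≤ 3 * Cc * ε a := by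
      rw [mul_div_assoc]
      linarith
    calc _ ≤ Mη * R * (3 * Cc * ε a) := by gcongr
      _ = _ := by rw [hC']; ring
  refine ⟨fun k x => ∑ a : ι, c a.1 a.2 * G a k x, C' * ∑ a : ι, |c a.1 a.2| * ε a, ?_, ?_, ?_,
    fun ψ hψ => ?_, ?_⟩
  · exact mul_nonneg hC'0.le (Finset.sum_nonneg fun a _ => mul_nonneg (abs_nonneg _) (hε0 a))
  · rw [hsing]
    exact InH10.sum Finset.univ fun a _ => (hH a).const_mul (c a.1 a.2)
  · rw [hsrc]
    exact memLp_finsetSum _ fun a _ => (hSm a).const_mul _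
  · simp only [hsrc]
    rw [D.residual_sum hpmin hpm hp (fun a : ι => c a.1 a.2) (fun a => (hH a).2.1) hSm hψ]
    refine (Finset.abs_sum_le_sum_abs _ _).trans ?_
    rw [Finset.mul_sum, Finset.sum_mul]
    refine Finset.sum_le_sum fun a _ => ?_
    rw [abs_mul]
    calc _ ≤ |c a.1 a.2| * (C' * ε a * gradNorm ψ) :=
          mul_le_mul_of_nonneg_left (hsum ψ hψ a) (abs_nonneg _)
      _ = _ := by ring
  · have hE : eigenError c lam Lam mu vth = ENNReal.ofReal ((∑ a : ι, |c a.1 a.2| ^ 2)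
        * (∑ a : ι, δ a ^ 2 + ∑ a : ι, (lam a.1 a.2 - Lam a.1 a.2) ^ 2)) := by
      have e1 : ∀ i j, eLpNorm (fun θ => mu i j θ - vth i j θ) 2 angularMeasure ^ 2
          = ENNReal.ofReal (δ ⟨i, j⟩ ^ 2) := fun i j => by
        rw [angularMeasure_eq, eLpNorm_sq_eq (memLp_sub (hmuL i j) (hSL i j).2.1.memLp)]
      have n1 : ∀ a : ι, 0 ≤ δ a ^ 2 := fun a => sq_nonneg _
      rw [eigenError, ENNReal.ofReal_mul (by positivity), ENNReal.ofReal_add (by positivity)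
        (by positivity), ENNReal.ofReal_sum_of_nonneg fun a _ => n1 a]
      simp only [sq_abs, e1]
      rw [Fintype.sum_sigma, Fintype.sum_sigma, Fintype.sum_sigma]
    rw [hE, ← ENNReal.ofReal_mul (by positivity)]
    refine ENNReal.ofReal_le_ofReal ?_
    -- Cauchy–Schwarz separates the coefficients from the errors, so the number of pairs does not
    -- enter the constant. The factor `2` comes from squaring `δ + |λ - Λ|`.
    have h1 := Finset.sum_mul_sq_le_sq_mul_sq Finset.univ (fun a : ι => |c a.1 a.2|) ε
    have h2 : ∑ a, ε a ^ 2 ≤ 2 * (∑ a : ι, δ a ^ 2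
        + ∑ a : ι, (lam a.1 a.2 - Lam a.1 a.2) ^ 2) := by
      rw [← Finset.sum_add_distrib, Finset.mul_sum]
      refine Finset.sum_le_sum fun a _ => ?_
      simp only [hε]
      rw [← sq_abs (lam a.1 a.2 - Lam a.1 a.2)]
      exact add_sq_le
    calc _ = C' ^ 2 * (∑ a : ι, |c a.1 a.2| * ε a) ^ 2 := by ring
      _ ≤ C' ^ 2 * ((∑ a : ι, |c a.1 a.2| ^ 2) * (2 * (∑ a : ι, δ a ^ 2
          + ∑ a : ι, (lam a.1 a.2 - Lam a.1 a.2) ^ 2))) := by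
          refine mul_le_mul_of_nonneg_left (h1.trans ?_) (by positivity)
          exact mul_le_mul_of_nonneg_left h2 (by positivity)
      _ = _ := by ring

end SingularPoints

/-- For each `p` the energy estimate is fed with the residual bound of the singular component. All
constants are fixed before `p`, so the inequality can be integrated. -/
theorem estimate_dim_two {I Ns M : ℕ} {D : BoxPartition 2 I} (V : SingularPoints D Ns)
    {φ : Fin M → ℝ → ℝ} (hφ : ∀ k, IsPeriodicPiecewisePolynomial (φ k)) {Θ pmin pmax : ℝ}
    (hΘ : 0 < Θ) (hpmin : 0 < pmin) :
      ∃ C : ℝ, 0 < C ∧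
      ∀ (N₁ N₂ : ℕ) (w : Fin N₁ → E 2 → ℝ) (v : Fin N₂ → E 2 → ℝ),
        (∀ n, D.MemSmooth (w n)) → (∀ m, D.MemJump (v m)) →
      ∀ (P : Set (Fin I → ℝ)) (μ : Measure (Fin I → ℝ)),
        MeasurableSet P → (∀ p ∈ P, ∀ i, pmin ≤ p i ∧ p i ≤ pmax) →
      ∀ (l u : (Fin I → ℝ) → E 2 → ℝ),
        (∀ p ∈ P, MemL2 D.dom (l p)) → (∀ p ∈ P, D.IsWeakSolution p (l p) (u p)) →
      ∀ (K : (Fin I → ℝ) → Fin Ns → ℕ)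
        (Lam lam : ∀ p i, Fin (K p i) → ℝ) (vth mu : ∀ p i, Fin (K p i) → ℝ → ℝ),
        (∀ p ∈ P, ∀ i j, IsSLEigenpair (V.angularCoeff p i) (Lam p i j) (vth p i j)) →
        (∀ p ∈ P, ∀ i j, IsFEEigenpair φ (V.angularCoeff p i) (lam p i j) (mu p i j)) →
      ∀ (a : (Fin I → ℝ) → Fin N₁ → ℝ) (b : (Fin I → ℝ) → Fin N₂ → ℝ)
        (c : ∀ p i, Fin (K p i) → ℝ),
        (∀ p ∈ P, ∀ a' b' c',
          D.residual Θ p (l p) (principal w v (a p) (b p)) (V.sourcePart (lam p) (mu p) (c p))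
            ≤ D.residual Θ p (l p) (principal w v a' b') (V.sourcePart (lam p) (mu p) c')) →
        AEMeasurable (fun p => eigenError (c p) (lam p) (Lam p) (mu p) (vth p)) (μ.restrict P) →
        ∫⁻ p in P, h10NormSq D.dom
            (fun x => principal w v (a p) (b p) x + V.singularPart (lam p) (mu p) (c p) x
              - u p x) ∂μ
          ≤ ENNReal.ofReal C *
            (∫⁻ p in P, (⨅ (a') (b') (c'), D.residual Θ p (l p) (principal w v a' b')
                (V.sourcePart (lam p) (mu p) c')) ∂μ
              + ∫⁻ p in P, eigenError (c p) (lam p) (Lam p) (mu p) (vth p) ∂μ) := by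
  have hpm := le_max_left pmin pmax
  obtain ⟨Ct, hCt, htr⟩ := D.exists_trace_bound (n := 1) le_rfl
  obtain ⟨C, hC, hest⟩ := D.residual_estimate hpmin hpm hΘ 0 hCt htr
  obtain ⟨C₂, hC₂, hsing⟩ := V.exists_residual_singularPart_le hφ hpmin hpm
  -- A common factor for the loss, which needs only `C`, and for the eigenpair error, which needs `C
  -- C₂`.
  refine ⟨C * (1 + C₂), by positivity, fun N₁ N₂ w v hw hv P μ hP hPp l u hl hu K Lam lam vth mu
    hSL hFE a b c hmin hmeas => ?_⟩
  -- Joining the two lower integrals into one requires measurability of one summand, here the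
  -- eigenpair error; the loss may be arbitrary.
  rw [← lintegral_add_right' _ hmeas, ← lintegral_const_mul' _ _ ENNReal.ofReal_ne_top]
  refine setLIntegral_mono' hP fun p hp => ?_
  have hpb : ∀ i, pmin ≤ p i ∧ p i ≤ max pmin pmax := fun i =>
    ⟨(hPp p hp i).1, (hPp p hp i).2.trans (le_max_right _ _)⟩
  obtain ⟨G, Es, hEs, hs, hS, herr, hE⟩ := hsing p hpb (K p) (Lam p) (lam p) (vth p) (mu p)
    (hSL p hp) (hFE p hp) (c p)
  have h := hest p hpb (l p) (u p) (principal w v (a p) (b p)) _ _ G Es (hl p hp) (hu p hp)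
    (D.memH10_principal hw hv _ _) (D.memH2_principal hw hv _ _) hS hs hEs herr
  refine h.trans ?_
  have hmin' : D.residual Θ p (l p) (principal w v (a p) (b p))
      (V.sourcePart (lam p) (mu p) (c p))
      ≤ ⨅ (a') (b') (c'), D.residual Θ p (l p) (principal w v a' b')
        (V.sourcePart (lam p) (mu p) c') :=
    le_iInf fun a' => le_iInf fun b' => le_iInf fun c' => hmin p hp a' b' c'
  rw [ENNReal.ofReal_mul hC.le, mul_assoc]
  refine mul_le_mul_right ((add_le_add hmin' hE).trans ?_) _
  rw [mul_add]
  have h1 : (1 : ℝ≥0∞) ≤ ENNReal.ofReal (1 + C₂) := by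
    rw [← ENNReal.ofReal_one]
    exact ENNReal.ofReal_le_ofReal (by linarith)
  have h2 : ENNReal.ofReal C₂ ≤ ENNReal.ofReal (1 + C₂) := ENNReal.ofReal_le_ofReal (by linarith)
  refine add_le_add (le_mul_of_one_le_left' h1) ?_
  gcongr

end LSReCoNN

end

theorem mainTheorem3 (Θ pmin pmax : ℝ) (hΘ : 0 < Θ) (hpmin : 0 < pmin) :
    -- one-dimensional problems
    (∀ (I : ℕ) (D : BoxPartition 1 I),
      ∃ C : ℝ, 0 < C ∧
      ∀ (N₁ N₂ : ℕ) (w : Fin N₁ → E 1 → ℝ) (v : Fin N₂ → E 1 → ℝ),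
        (∀ n, D.MemSmooth (w n)) → (∀ m, D.MemJump (v m)) →
      ∀ (P : Set (Fin I → ℝ)) (μ : Measure (Fin I → ℝ)),
        MeasurableSet P → (∀ p ∈ P, ∀ i, pmin ≤ p i ∧ p i ≤ pmax) →
      ∀ (l u : (Fin I → ℝ) → E 1 → ℝ),
        (∀ p ∈ P, MemL2 D.dom (l p)) → (∀ p ∈ P, D.IsWeakSolution p (l p) (u p)) →
      ∀ (a : (Fin I → ℝ) → Fin N₁ → ℝ) (b : (Fin I → ℝ) → Fin N₂ → ℝ),
        (∀ p ∈ P, ∀ a' b', D.residual Θ p (l p) (principal w v (a p) (b p)) 0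
          ≤ D.residual Θ p (l p) (principal w v a' b') 0) →
        ∫⁻ p in P, h10NormSq D.dom (fun x => principal w v (a p) (b p) x - u p x) ∂μ
          ≤ ENNReal.ofReal C *
            ∫⁻ p in P, (⨅ (a') (b'), D.residual Θ p (l p) (principal w v a' b') 0) ∂μ) ∧
    -- two-dimensional problems
    (∀ (I Ns M : ℕ) (D : BoxPartition 2 I) (V : SingularPoints D Ns) (φ : Fin M → ℝ → ℝ),
        (∀ k, IsPeriodicPiecewisePolynomial (φ k)) →
      ∃ C : ℝ, 0 < C ∧
      ∀ (N₁ N₂ : ℕ) (w : Fin N₁ → E 2 → ℝ) (v : Fin N₂ → E 2 → ℝ),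
        (∀ n, D.MemSmooth (w n)) → (∀ m, D.MemJump (v m)) →
      ∀ (P : Set (Fin I → ℝ)) (μ : Measure (Fin I → ℝ)),
        MeasurableSet P → (∀ p ∈ P, ∀ i, pmin ≤ p i ∧ p i ≤ pmax) →
      ∀ (l u : (Fin I → ℝ) → E 2 → ℝ),
        (∀ p ∈ P, MemL2 D.dom (l p)) → (∀ p ∈ P, D.IsWeakSolution p (l p) (u p)) →
      ∀ (K : (Fin I → ℝ) → Fin Ns → ℕ)
        (Lam lam : ∀ p i, Fin (K p i) → ℝ) (vth mu : ∀ p i, Fin (K p i) → ℝ → ℝ),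
        (∀ p ∈ P, ∀ i j, IsSLEigenpair (V.angularCoeff p i) (Lam p i j) (vth p i j)) →
        (∀ p ∈ P, ∀ i j, IsFEEigenpair φ (V.angularCoeff p i) (lam p i j) (mu p i j)) →
      ∀ (a : (Fin I → ℝ) → Fin N₁ → ℝ) (b : (Fin I → ℝ) → Fin N₂ → ℝ)
        (c : ∀ p i, Fin (K p i) → ℝ),
        (∀ p ∈ P, ∀ a' b' c',
          D.residual Θ p (l p) (principal w v (a p) (b p)) (V.sourcePart (lam p) (mu p) (c p))
            ≤ D.residual Θ p (l p) (principal w v a' b') (V.sourcePart (lam p) (mu p) c')) →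
        AEMeasurable (fun p => eigenError (c p) (lam p) (Lam p) (mu p) (vth p)) (μ.restrict P) →
        ∫⁻ p in P, h10NormSq D.dom
            (fun x => principal w v (a p) (b p) x + V.singularPart (lam p) (mu p) (c p) x
              - u p x) ∂μ
          ≤ ENNReal.ofReal C *
            (∫⁻ p in P, (⨅ (a') (b') (c'), D.residual Θ p (l p) (principal w v a' b')
                (V.sourcePart (lam p) (mu p) c')) ∂μ
              + ∫⁻ p in P, eigenError (c p) (lam p) (Lam p) (mu p) (vth p) ∂μ)) := by
  exact ⟨fun I D => estimate_dim_one D hΘ hpmin,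
    fun I Ns M D V φ hφ => estimate_dim_two V hφ hΘ hpmin⟩
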